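/- Let $N\ge 2$ and $k\in\mathbb C$. For $\hbar>0$ consider bosons $\hat\lambda_\mu(t)$ $(1\le\mu\le N)$ and $\hat b_{\mu\nu}(t),\hat c_{\mu\nu}(t)$ $(1\le\mu<\nu\le N)$, $t\in\mathbb R\setminus\{0\}$, with $\sum_\mu e^{(1-\mu)\hbar t}\hat\lambda_\mu(t)=0$ and $$[\hat\lambda_\mu(t),\hat\lambda_\mu(t')]=\frac{\sinh\frac{k+N}{2}\hbar t\,\sinh\frac{N-1}{2}\hbar t\,\sinh\frac{\hbar t}{2}}{\hbar^2t\,\sinh\frac N2\hbar t}\delta(t+t'),\quad [\hat\lambda_\mu(t),\hat\lambda_\nu(t')]=-\frac{\sinh\frac{k+N}{2}\hbar t\,\sinh^2\frac{\hbar t}{2}}{\hbar^2t\,\sinh\frac N2\hbar t}e^{\mathrm{sign}(\mu-\nu)\frac N2\hbar t}\delta(t+t')\ (\mu\ne\nu),$$ $$[\hat c_{\mu\nu}(t),\hat c_{\mu'\nu'}(t')]=-[\hat b_{\mu\nu}(t),\hat b_{\mu'\nu'}(t')]=\frac{\sinh^2\frac{\hbar t}{2}}{\hbar^2t}\delta_{\mu\mu'}\delta_{\nu\nu'}\delta(t+t'),$$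 the other commutators being zero, acting on the Fock space $\mathcal F$ generated by the (smeared) negative modes from a vacuum killed by the positive modes. For $\chi=\lambda_\mu,b_{\mu\nu},c_{\mu\nu}$ put $\chi^+(u)=\exp(2\hbar\int_0^\infty\hat\chi(t)e^{-iut}dt)$, $\chi^-(u)=\exp(-2\hbar\int_{-\infty}^0\hat\chi(t)e^{-iut}dt)$, $\chi(u)=\exp(-\hbar\int_{-\infty}^0\frac{\hat\chi(t)e^{-iut}}{\sinh(\hbar t/2)}dt)\exp(-\hbar\int_0^\infty\frac{\hat\chi(t)e^{-iut}}{\sinh(\hbar t/2)}dt)$, $(b+c)_{\mu\nu}(u)={:}b_{\mu\nu}(u)c_{\mu\nu}(u){:}$; fields $b_{\mu\nu},c_{\mu\nu}$ with $\mu\ge\nu$ are replaced by $1$. Define $$k^+_\mu(u)={:}\lambda^+_\mu(u+\tfrac{k-N}4i\hbar)^{-1}\prod_{\alpha=1}^{\mu-1}b^+_{\alpha\mu}(u+\tfrac{\mu-\alpha}2i\hbar)\prod_{\beta=\mu+1}^Nb^+_{\mu\beta}(u+\tfrac{\mu-\beta}2i\hbar)^{-1}{:},$$ $$k^-_\mu(u)={:}\lambda^-_\mu(u-\tfrac{k-N}4i\hbar)^{-1}\prod_{\rho=1}^{\mu-1}\prod_{\gamma=\mu}^Nb^-_{\rho\gamma}(u+\tfrac{\rho+\gamma}2i\hbar)\prod_{\alpha=1}^{\mu}\prod_{\beta=\mu+1}^Nb^-_{\alpha\beta}(u+\tfrac{\alpha+\beta-2}2i\hbar)^{-1}{:},$$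 $$H^\pm_\mu(u)={:}\frac{\lambda^\pm_\mu}{\lambda^\pm_{\mu+1}}(u\pm\tfrac{k-N}4i\hbar-\tfrac\mu2i\hbar)\prod_{m=1}^\mu\frac{b^\pm_{m,\mu+1}(u\mp\frac{m-1}2i\hbar)}{b^\pm_{m\mu}(u\mp\frac m2i\hbar)}\prod_{n=\mu+1}^N\frac{b^\pm_{\mu n}(u\mp\frac n2i\hbar)}{b^\pm_{\mu+1,n}(u\mp\frac{n-1}2i\hbar)}{:},$$ $$E_\mu(u)=\frac1\hbar\sum_{m=1}^\mu{:}(b+c)_{m\mu}(u-\tfrac{m-1}2i\hbar)\Big\{\frac{b^+_{m,\mu+1}(u-\frac{m-1}2i\hbar)}{(b+c)_{m,\mu+1}(u-\frac m2i\hbar)}-\frac{b^-_{m,\mu+1}(u-\frac{m-1}2i\hbar)}{(b+c)_{m,\mu+1}(u-\frac{m-2}2i\hbar)}\Big\}\prod_{n=1}^{m-1}\frac{b^+_{n,\mu+1}(u-\frac{n-1}2i\hbar)}{b^+_{n\mu}(u-\frac n2i\hbar)}{:},$$ $$\begin{aligned}F_\mu(u)=\frac1\hbar{:}\Big\{&\sum_{m=1}^\mu(b+c)_{m,\mu+1}(u+\tfrac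 m2i\hbar)\frac{\lambda^-_\mu}{\lambda^-_{\mu+1}}(u-\tfrac{k-N}4i\hbar-\tfrac\mu2i\hbar)\Big[\frac{1+\delta_{m\mu}}{b^-_{m\mu}(u+\frac m2i\hbar)(b+c)_{m\mu}(u+\frac{m-1}2i\hbar)}\\&-\frac1{b^+_{m\mu}(u+\frac m2i\hbar)(b+c)_{m\mu}(u+\frac{m+1}2i\hbar)}\Big]\prod_{n=m+1}^\mu\frac{b^-_{n,\mu+1}(u+\frac{n-1}2i\hbar)}{b^-_{n\mu}(u+\frac n2i\hbar)}\prod_{s=\mu+1}^N\frac{b^-_{\mu s}(u+\frac s2i\hbar)}{b^-_{\mu+1,s}(u+\frac{s-1}2i\hbar)}\\-&\sum_{m=\mu+1}^N(b+c)_{\mu m}(u-\tfrac{2k+m-1}2i\hbar)\frac{\lambda^+_\mu}{\lambda^+_{\mu+1}}(u-\tfrac{3k+N}4i\hbar-\tfrac\mu2i\hbar)\Big[\frac{(1+\delta_{m,\mu+1})b^+_{\mu+1,m}(u-\frac{2k+m-1}2i\hbar)}{(b+c)_{\mu+1,m}(u-\frac{2k+m}2i\hbar)}\\&-\frac{b^-_{\mu+1,m}(u-\frac{2k+m-1}2i\hbar)}{(b+c)_{\mu+1,m}(u-\frac{2k+m-2}2i\hbar)}\Big]\prod_{n=m}^N\frac{b^+_{\mu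 n}(u-\frac{2k+n}2i\hbar)}{b^+_{\mu+1,n}(u-\frac{2k+n-1}2i\hbar)}\Big\}{:},\end{aligned}$$ and $X^+_\mu(u)=\hbar E_\mu(u+\frac\mu2i\hbar)$, $X^-_\mu(u)=\hbar F_\mu(u+\frac\mu2i\hbar)$. Put $\eta=-i\hbar$. Relations between products of currents are understood for matrix elements between vectors of $\mathcal F$ and dual coherent states, in the sense of analytic continuation (a product $A(u)B(v)$ converges for $\mathrm{Im}\,u\ll\mathrm{Im}\,v$), with $\delta(u-w)$ the difference of the two determinations of $1/(u-w)$. Then for every $\hbar>0$ these currents represent the Yangian doubles $DY_\eta(gl_N)$ and $DY_\eta(sl_N)$ with the central element $c$ acting as $k$: (1) $k^\pm_\mu$, $\frac1\eta X^+_\nu$ and $X^-_\nu$ satisfy, with $c=k$ and with these two rescaled currents written $X^+_\nu,X^-_\nu$ (and $w=u-v$): $k^\pm_\mu(u)$ is invertible; $[k^\pm_\mu(u),k^\pm_\nu(v)]=0$; $\rho(w-c\eta)r_{\mu\nu}(w-c\eta)k^+_\mu(u)k^-_\nu(v)=k^-_\nu(v)k^+_\mu(u)r_{\mu\nu}(w)\rho(w)$,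 where $r_{\mu\nu}(w)=\frac w{w+\eta},1,\frac{w-\eta}w$ for $\mu<\nu,\mu=\nu,\mu>\nu$ and $\rho(w)=\frac{\Gamma(\frac w{N\eta})\Gamma(1+\frac w{N\eta})}{\Gamma(\frac1N+\frac w{N\eta})\Gamma(1-\frac1N+\frac w{N\eta})}$; $(w+\eta)k^\pm_\mu(u)X^+_\mu(v)=wX^+_\mu(v)k^\pm_\mu(u)$; $(w-\eta)k^\pm_{\mu+1}(u)X^+_\mu(v)=wX^+_\mu(v)k^\pm_{\mu+1}(u)$; $wk^-_\mu(u)X^-_\mu(v)=(w+\eta)X^-_\mu(v)k^-_\mu(u)$; $wk^-_{\mu+1}(u)X^-_\mu(v)=(w-\eta)X^-_\mu(v)k^-_{\mu+1}(u)$; the last two with $k^+$ for $k^-$ and $w-c\eta$ for $w$; $k^\pm_\mu$ commutes with $X^+_\nu$ and $X^-_\nu$ for $\mu-\nu\ge2$ or $\mu-\nu\le-1$; $(w\mp\eta)X^\pm_\mu(u)X^\pm_\mu(v)=(w\pm\eta)X^\pm_\mu(v)X^\pm_\mu(u)$; $(w+\eta)X^+_\mu(u)X^+_{\mu+1}(v)=wX^+_{\mu+1}(v)X^+_\mu(u)$;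 $wX^-_\mu(u)X^-_{\mu+1}(v)=(w+\eta)X^-_{\mu+1}(v)X^-_\mu(u)$; $X^\pm_\mu,X^\pm_\nu$ commute for $|\mu-\nu|\ge2$; the Serre relations $X^\pm_\mu(u_1)X^\pm_\mu(u_2)X^\pm_\nu(v)-2X^\pm_\mu(u_1)X^\pm_\nu(v)X^\pm_\mu(u_2)+X^\pm_\nu(v)X^\pm_\mu(u_1)X^\pm_\mu(u_2)+(u_1\leftrightarrow u_2)=0$ for $|\mu-\nu|=1$; and $[X^+_\mu(u),X^-_\nu(v)]=\delta_{\mu\nu}\big(\delta(w-c\eta)k^+_{\mu+1}(u)k^+_\mu(u)^{-1}-\delta(w)k^-_{\mu+1}(v)k^-_\mu(v)^{-1}\big)$. (2) $H^\pm_\mu$, $iE_\mu$, $iF_\mu$ (written $E_\mu,F_\mu$ below) and $K^\pm(u)=\prod_{\mu=1}^Nk^\pm_\mu(u+(\mu-1)\eta)$ satisfy, with $c=k$ and $B_{\mu\nu}$ half of the Cartan matrix of $sl_N$: $[H^\pm_\mu(u),H^\pm_\nu(v)]=0$; $(w+B_{\mu\nu}\eta\mp c\eta)(w-B_{\mu\nu}\eta)H^\pm_\mu(u)H^\mp_\nu(v)=(w-B_{\mu\nu}\eta\mp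 c\eta)(w+B_{\mu\nu}\eta)H^\mp_\nu(v)H^\pm_\mu(u)$; $(w-B_{\mu\nu}\eta)H^\pm_\mu(u)E_\nu(v)=(w+B_{\mu\nu}\eta)E_\nu(v)H^\pm_\mu(u)$; $(w+B_{\mu\nu}\eta-c\eta)H^+_\mu(u)F_\nu(v)=(w-B_{\mu\nu}\eta-c\eta)F_\nu(v)H^+_\mu(u)$; $(w+B_{\mu\nu}\eta)H^-_\mu(u)F_\nu(v)=(w-B_{\mu\nu}\eta)F_\nu(v)H^-_\mu(u)$; $(w\mp B_{\mu\nu}\eta)Y_\mu(u)Y_\nu(v)=(w\pm B_{\mu\nu}\eta)Y_\nu(v)Y_\mu(u)$ with upper signs for $Y=E$ and lower for $Y=F$; $[E_\mu(u),F_\nu(v)]=\frac{\delta_{\mu\nu}}\eta\big(\delta(w-c\eta)H^+_\mu(u)-\delta(w)H^-_\mu(v)\big)$; $[E_\mu(u),E_\nu(v)]=[F_\mu(u),F_\nu(v)]=0$ for $|\mu-\nu|>1$; the Serre relations for $E$ and for $F$ when $|\mu-\nu|=1$; and $K^\pm$ commute with each other, with themselves and with all $H^\pm_\mu,E_\mu,F_\mu$.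 (3) As $\hbar\to0^+$ the realization becomes the (bosonized) Wakimoto realization of level $k$: on $\mathcal F$, matrix element by matrix element (the creation modes $e^{(\mu-1)\hbar s}\hat\lambda_\mu(-s)$, $\hat b_{\mu\nu}(-s)$, $\hat c_{\mu\nu}(-s)$, $s>0$, being identified for different $\hbar$), $E_\mu$ and $\frac1\hbar X^+_\mu$ tend to $\sum_{m=1}^\mu{:}\gamma_{m\mu}\beta_{m,\mu+1}{:}$; $F_\mu$ and $\frac1\hbar X^-_\mu$ tend to $\sum_{m<\mu}{:}\gamma_{m,\mu+1}\beta_{m\mu}{:}+{:}J_\mu\gamma_{\mu,\mu+1}{:}-\sum_{m\ge\mu+2}{:}\gamma_{\mu m}\beta_{\mu+1,m}{:}$ with $J_\mu=(k+\mu)i\partial\chi_{\mu,\mu+1}-2(\hat\lambda_\mu-\hat\lambda_{\mu+1})-2\sum_{n>\mu}(\hat b_{\mu n}-\hat b_{\mu+1,n})$; $\frac1\hbar(H^+_\mu-H^-_\mu)$ tends to $2(\hat\lambda_\mu-\hat\lambda_{\mu+1})+2\sum_{m\le\mu}(\hat b_{m,\mu+1}-\hat b_{m\mu})+2\sum_{n>\mu}(\hat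 b_{\mu n}-\hat b_{\mu+1,n})$; and $\frac1\hbar(k^+_\mu-k^-_\mu)$ tends to $-2\hat\lambda_\mu+2\sum_{\alpha<\mu}\hat b_{\alpha\mu}-2\sum_{\beta>\mu}\hat b_{\mu\beta}$. Here $\hat\chi(u)=\int_{\mathbb R\setminus0}\hat\chi(t)e^{-iut}dt$, the modes obey the $\hbar\to0$ limits of the commutators above, $\chi_{\mu\nu}(u)=-2\int_{\mathbb R\setminus0}(\hat b_{\mu\nu}+\hat c_{\mu\nu})(t)e^{-iut}\frac{dt}t$, $\gamma_{\mu\nu}={:}e^{\chi_{\mu\nu}}{:}$, $\beta_{\mu\nu}=-2{:}\hat c_{\mu\nu}e^{-\chi_{\mu\nu}}{:}$, $\gamma_{\mu\mu}=1$ and $\hat b_{\mu\mu}=0$. -/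

import Mathlib

open Complex MeasureTheory Filter Topology

noncomputable section

namespace BosonYangian

/-! ### Heisenberg algebra with continuous parameter and its Fock space -/

/-- Labels of the free bosons `λ̂_μ(t)`, `b̂_{μ,ν}(t)`, `ĉ_{μ,ν}(t)`. -/
inductive Mode
  | lam (μ : ℕ)
  | b (μ ν : ℕ)
  | c (μ ν : ℕ)

/-- The bosons that occur for a given `N`: `1 ≤ μ ≤ N` for `λ̂_μ`, and `1 ≤ μ < ν ≤ N` for
`b̂_{μ,ν}` and `ĉ_{μ,ν}`. -/
def Mode.InRange (N : ℕ) : Mode → Prop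
  | .lam μ => 1 ≤ μ ∧ μ ≤ N
  | .b μ ν => 1 ≤ μ ∧ μ < ν ∧ ν ≤ N
  | .c μ ν => 1 ≤ μ ∧ μ < ν ∧ ν ≤ N

/-- A family of functions of the positive continuous parameter, one for each boson. -/
abbrev Profile := Mode → ℝ → ℂ

/-- States in the Bargmann (functional) picture. The vacuum is the constant functional `1`;
the creation operator `a_m(-s)`, `s > 0`, is multiplication by the coordinate `ξ m s`. -/
abbrev State := Profile → ℂ

abbrev Op := State →ₗ[ℂ] State

/-- Commutators: `[λ̂_μ(t), λ̂_ν(-s)] = lam μ ν t · δ(t - s)`,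
`[ĉ_{μ,ν}(t), ĉ_{μ,ν}(-s)] = ghost t · δ(t - s) = -[b̂_{μ,ν}(t), b̂_{μ,ν}(-s)]`
for `t, s > 0`; all other commutators of an annihilation and a creation mode vanish. -/
structure Commutators where
  lam : ℕ → ℕ → ℝ → ℂ
  ghost : ℝ → ℂ

/-- The commutators at deformation parameter `h` and level `k`. -/
def comm (N : ℕ) (h : ℝ) (k : ℂ) : Commutators where
  lam μ ν t :=
    if μ = ν then
      sinh ((k + N) / 2 * h * t) * sinh (((N : ℂ) - 1) / 2 * h * t) * sinh ((h : ℂ) / 2 * t)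
        / ((h : ℂ) ^ 2 * t * sinh ((N : ℂ) / 2 * h * t))
    else
      -(sinh ((k + N) / 2 * h * t) * sinh ((h : ℂ) / 2 * t) ^ 2
        / ((h : ℂ) ^ 2 * t * sinh ((N : ℂ) / 2 * h * t)))
        * exp ((if ν < μ then 1 else -1) * ((N : ℂ) / 2 * h * t))
  ghost t := sinh ((h : ℂ) * t / 2) ^ 2 / ((h : ℂ) ^ 2 * t)

/-- The commutators in the limit `h → 0`. -/
def commClassical (N : ℕ) (k : ℂ) : Commutators where
  lam μ ν t :=
    if μ = ν then (k + N) * ((N : ℂ) - 1) * t / (4 * N) else -((k + N) * t / (4 * N))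
  ghost t := (t : ℂ) / 4

/-- `pairing N f ξ` is `∑_m ∫_0^∞ f m s · ξ m s ds`, the sum over the bosons that occur for `N`;
it is the operator `∑_m ∫_0^∞ f m s · a_m(-s) ds` in the functional picture. -/
def pairing (N : ℕ) (f ξ : Profile) : ℂ :=
  ∫ s in Set.Ioi (0 : ℝ),
    ((∑ μ ∈ Finset.Icc 1 N, f (.lam μ) s * ξ (.lam μ) s)
      + ∑ μ ∈ Finset.Icc 1 N, ∑ ν ∈ Finset.Ioc μ N,
          (f (.b μ ν) s * ξ (.b μ ν) s + f (.c μ ν) s * ξ (.c μ ν) s))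

/-- The operator `∑_m ∫_0^∞ g m t · a_m(t) dt` is the derivation that sends the creation mode
`a_m(-s)` to the number `shift N H g m s`, i.e. the derivative in the direction
`shift N H g`. -/
def shift (N : ℕ) (H : Commutators) (g : Profile) : Profile
  | .lam ν => fun s => ∑ μ ∈ Finset.Icc 1 N, g (.lam μ) s * H.lam μ ν s
  | .b μ ν => fun s => -(g (.b μ ν) s * H.ghost s)
  | .c μ ν => fun s => g (.c μ ν) s * H.ghost s

/-- Smearing functions: continuous with compact support inside `(0, ∞)`. -/
def IsSmearing (f : ℝ → ℂ) : Prop :=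
  Continuous f ∧ HasCompactSupport f ∧ tsupport f ⊆ Set.Ioi 0

/-- The Fock space: everything obtained from the vacuum `1` by sums and products of smeared
negative modes `∫_0^∞ η(s) a_m(-s) ds`. -/
def fockSpace (N : ℕ) : Subalgebra ℂ State :=
  Algebra.adjoin ℂ {Φ : State | ∃ m : Mode, m.InRange N ∧ ∃ η : ℝ → ℂ, IsSmearing η ∧
    Φ = fun ξ => ∫ s in Set.Ioi (0 : ℝ), η s * ξ m s}

/-- The points at which states are evaluated (`Φ ↦ Φ ξ` are the matrix elements with the dual
coherent states). They obey the linear relation `∑_μ e^{(1-μ)ht} λ̂_μ(t) = 0` at `t = -s`;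
states that agree on this set are identified. -/
def fockDual (N : ℕ) (h : ℝ) : Set Profile :=
  {ξ | (∀ m, IsSmearing (ξ m)) ∧
    ∀ s : ℝ, 0 < s → ∑ μ ∈ Finset.Icc 1 N, exp (((μ : ℂ) - 1) * h * s) * ξ (.lam μ) s = 0}

/-! ### Normal ordered exponentials -/

/-- The pair `(f, g)` stands for the linear expression
`∑_m ∫_0^∞ f m s · a_m(-s) ds + ∑_m ∫_0^∞ g m t · a_m(t) dt`. Used as an exponent, sums of
exponents correspond to normal ordered products and negatives to inverses. -/
abbrev Exponent := Profile × Profile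

/-- The normal ordered exponential `:exp X:` (creation part to the left): translation by the
annihilation part followed by multiplication with the exponential of the creation part. -/
def normalExp (N : ℕ) (H : Commutators) (X : Exponent) : Op where
  toFun Φ := fun ξ => exp (pairing N X.1 ξ) * Φ (ξ + shift N H X.2)
  map_add' Φ Ψ := by funext ξ; simp [mul_add]
  map_smul' a Φ := by funext ξ; simp [mul_left_comm]

/-- The normal ordered product `:J exp X:` with the linear expression `J`. -/
def normalLinExp (N : ℕ) (H : Commutators) (J X : Exponent) (Φ : State) : State := fun ξ =>
  exp (pairing N X.1 ξ) *
    (pairing N J.1 ξ * Φ (ξ + shift N H X.2)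
      + deriv (fun ε : ℂ => Φ (ξ + shift N H X.2 + ε • shift N H J.2)) 0)

/-- The profile with `f` in the `λ_μ` component. -/
def onLam (μ : ℕ) (f : ℝ → ℂ) : Profile
  | .lam μ' => if μ' = μ then f else 0
  | _ => 0

/-- The profile with `f` in the `b_{μ,ν}` component; zero for `μ ≥ ν`. -/
def onB (μ ν : ℕ) (f : ℝ → ℂ) : Profile
  | .b μ' ν' => if μ' = μ ∧ ν' = ν ∧ μ < ν then f else 0
  | _ => 0

/-- The profile with `f` in the `c_{μ,ν}` component; zero for `μ ≥ ν`. -/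
def onC (μ ν : ℕ) (f : ℝ → ℂ) : Profile
  | .c μ' ν' => if μ' = μ ∧ ν' = ν ∧ μ < ν then f else 0
  | _ => 0

/-- `λ_μ^+(u) = exp (2h ∫_0^∞ λ̂_μ(t) e^{-iut} dt)`. -/
def lamP (h : ℝ) (μ : ℕ) (u : ℂ) : Exponent :=
  (0, onLam μ fun t => 2 * h * exp (-I * u * t))

/-- `λ_μ^-(u) = exp (-2h ∫_{-∞}^0 λ̂_μ(t) e^{-iut} dt)`. -/
def lamM (h : ℝ) (μ : ℕ) (u : ℂ) : Exponent :=
  (onLam μ fun s => -(2 * h * exp (I * u * s)), 0)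

/-- `b_{μ,ν}^+(u) = exp (2h ∫_0^∞ b̂_{μ,ν}(t) e^{-iut} dt)`. -/
def bP (h : ℝ) (μ ν : ℕ) (u : ℂ) : Exponent :=
  (0, onB μ ν fun t => 2 * h * exp (-I * u * t))

/-- `b_{μ,ν}^-(u) = exp (-2h ∫_{-∞}^0 b̂_{μ,ν}(t) e^{-iut} dt)`. -/
def bM (h : ℝ) (μ ν : ℕ) (u : ℂ) : Exponent :=
  (onB μ ν fun s => -(2 * h * exp (I * u * s)), 0)

/-- `(b+c)_{μ,ν}(u) = :b_{μ,ν}(u) c_{μ,ν}(u):`, where `χ(u)` is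
`exp (-h ∫_{-∞}^0 χ̂(t) e^{-iut} dt / sinh (ht/2)) exp (-h ∫_0^∞ χ̂(t) e^{-iut} dt / sinh (ht/2))`. -/
def bc (h : ℝ) (μ ν : ℕ) (u : ℂ) : Exponent :=
  let f : ℝ → ℂ := fun s => h / sinh ((h : ℂ) * s / 2) * exp (I * u * s)
  let g : ℝ → ℂ := fun t => -(h / sinh ((h : ℂ) * t / 2) * exp (-I * u * t))
  (onB μ ν f + onC μ ν f, onB μ ν g + onC μ ν g)

/-! ### The free field currents

In all formulas `i h` is written `I * h`. -/

/-- `k^+_μ(u)`, `1 ≤ μ ≤ N`. -/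
def kPlus (N : ℕ) (h : ℝ) (k : ℂ) (μ : ℕ) (u : ℂ) : Op :=
  normalExp N (comm N h k)
    (-lamP h μ (u + (k - N) / 4 * (I * h))
      + ∑ α ∈ Finset.Ico 1 μ, bP h α μ (u + ((μ : ℂ) - α) / 2 * (I * h))
      - ∑ β ∈ Finset.Icc (μ + 1) N, bP h μ β (u + ((μ : ℂ) - β) / 2 * (I * h)))

/-- `k^-_μ(u)`, `1 ≤ μ ≤ N`. -/
def kMinus (N : ℕ) (h : ℝ) (k : ℂ) (μ : ℕ) (u : ℂ) : Op :=
  normalExp N (comm N h k)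
    (-lamM h μ (u - (k - N) / 4 * (I * h))
      + ∑ ρ ∈ Finset.Ico 1 μ, ∑ γ ∈ Finset.Icc μ N,
          bM h ρ γ (u + ((ρ : ℂ) + γ) / 2 * (I * h))
      - ∑ α ∈ Finset.Icc 1 μ, ∑ β ∈ Finset.Icc (μ + 1) N,
          bM h α β (u + ((α : ℂ) + β - 2) / 2 * (I * h)))

/-- `H^+_μ(u)`, `1 ≤ μ ≤ N - 1`. -/
def HPlus (N : ℕ) (h : ℝ) (k : ℂ) (μ : ℕ) (u : ℂ) : Op :=
  normalExp N (comm N h k)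
    (lamP h μ (u + (k - N) / 4 * (I * h) - (μ : ℂ) / 2 * (I * h))
      - lamP h (μ + 1) (u + (k - N) / 4 * (I * h) - (μ : ℂ) / 2 * (I * h))
      + ∑ m ∈ Finset.Icc 1 μ,
          (bP h m (μ + 1) (u - ((m : ℂ) - 1) / 2 * (I * h)) - bP h m μ (u - (m : ℂ) / 2 * (I * h)))
      + ∑ n ∈ Finset.Icc (μ + 1) N,
          (bP h μ n (u - (n : ℂ) / 2 * (I * h))
            - bP h (μ + 1) n (u - ((n : ℂ) - 1) / 2 * (I * h))))

/-- `H^-_μ(u)`, `1 ≤ μ ≤ N - 1`. -/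
def HMinus (N : ℕ) (h : ℝ) (k : ℂ) (μ : ℕ) (u : ℂ) : Op :=
  normalExp N (comm N h k)
    (lamM h μ (u - (k - N) / 4 * (I * h) - (μ : ℂ) / 2 * (I * h))
      - lamM h (μ + 1) (u - (k - N) / 4 * (I * h) - (μ : ℂ) / 2 * (I * h))
      + ∑ m ∈ Finset.Icc 1 μ,
          (bM h m (μ + 1) (u + ((m : ℂ) - 1) / 2 * (I * h)) - bM h m μ (u + (m : ℂ) / 2 * (I * h)))
      + ∑ n ∈ Finset.Icc (μ + 1) N,
          (bM h μ n (u + (n : ℂ) / 2 * (I * h))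
            - bM h (μ + 1) n (u + ((n : ℂ) - 1) / 2 * (I * h))))

/-- `h · E_μ(u)`. -/
def eCore (N : ℕ) (h : ℝ) (k : ℂ) (μ : ℕ) (u : ℂ) : Op :=
  ∑ m ∈ Finset.Icc 1 μ,
    let base : Exponent := bc h m μ (u - ((m : ℂ) - 1) / 2 * (I * h))
      + ∑ n ∈ Finset.Ico 1 m,
          (bP h n (μ + 1) (u - ((n : ℂ) - 1) / 2 * (I * h)) - bP h n μ (u - (n : ℂ) / 2 * (I * h)))
    (normalExp N (comm N h k) (base + bP h m (μ + 1) (u - ((m : ℂ) - 1) / 2 * (I * h))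
        - bc h m (μ + 1) (u - (m : ℂ) / 2 * (I * h)))
      - normalExp N (comm N h k) (base + bM h m (μ + 1) (u - ((m : ℂ) - 1) / 2 * (I * h))
        - bc h m (μ + 1) (u - ((m : ℂ) - 2) / 2 * (I * h))))

/-- `h · F_μ(u)`. -/
def fCore (N : ℕ) (h : ℝ) (k : ℂ) (μ : ℕ) (u : ℂ) : Op :=
  (∑ m ∈ Finset.Icc 1 μ,
    let base : Exponent := bc h m (μ + 1) (u + (m : ℂ) / 2 * (I * h))
      + lamM h μ (u - (k - N) / 4 * (I * h) - (μ : ℂ) / 2 * (I * h))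
      - lamM h (μ + 1) (u - (k - N) / 4 * (I * h) - (μ : ℂ) / 2 * (I * h))
      + ∑ n ∈ Finset.Icc (m + 1) μ,
          (bM h n (μ + 1) (u + ((n : ℂ) - 1) / 2 * (I * h)) - bM h n μ (u + (n : ℂ) / 2 * (I * h)))
      + ∑ s ∈ Finset.Icc (μ + 1) N,
          (bM h μ s (u + (s : ℂ) / 2 * (I * h))
            - bM h (μ + 1) s (u + ((s : ℂ) - 1) / 2 * (I * h)))
    ((1 + if m = μ then (1 : ℂ) else 0) • normalExp N (comm N h k)
        (base - bM h m μ (u + (m : ℂ) / 2 * (I * h)) - bc h m μ (u + ((m : ℂ) - 1) / 2 * (I * h)))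
      - normalExp N (comm N h k)
        (base - bP h m μ (u + (m : ℂ) / 2 * (I * h))
          - bc h m μ (u + ((m : ℂ) + 1) / 2 * (I * h)))))
  - ∑ m ∈ Finset.Icc (μ + 1) N,
    let base : Exponent := bc h μ m (u - (2 * k + m - 1) / 2 * (I * h))
      + lamP h μ (u - (3 * k + N) / 4 * (I * h) - (μ : ℂ) / 2 * (I * h))
      - lamP h (μ + 1) (u - (3 * k + N) / 4 * (I * h) - (μ : ℂ) / 2 * (I * h))
      + ∑ n ∈ Finset.Icc m N,
          (bP h μ n (u - (2 * k + n) / 2 * (I * h))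
            - bP h (μ + 1) n (u - (2 * k + n - 1) / 2 * (I * h)))
    ((1 + if m = μ + 1 then (1 : ℂ) else 0) • normalExp N (comm N h k)
        (base + bP h (μ + 1) m (u - (2 * k + m - 1) / 2 * (I * h))
          - bc h (μ + 1) m (u - (2 * k + m) / 2 * (I * h)))
      - normalExp N (comm N h k)
        (base + bM h (μ + 1) m (u - (2 * k + m - 1) / 2 * (I * h))
          - bc h (μ + 1) m (u - (2 * k + m - 2) / 2 * (I * h))))

/-- `X^+_ν(u)`, `1 ≤ ν ≤ N - 1`. -/
def XPlus (N : ℕ) (h : ℝ) (k : ℂ) (ν : ℕ) (u : ℂ) : Op :=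
  eCore N h k ν (u + (ν : ℂ) / 2 * (I * h))

/-- `X^-_ν(u)`, `1 ≤ ν ≤ N - 1`. -/
def XMinus (N : ℕ) (h : ℝ) (k : ℂ) (ν : ℕ) (u : ℂ) : Op :=
  fCore N h k ν (u + (ν : ℂ) / 2 * (I * h))

/-- `E_μ(u)`, `1 ≤ μ ≤ N - 1`. -/
def ECur (N : ℕ) (h : ℝ) (k : ℂ) (μ : ℕ) (u : ℂ) : Op := (1 / (h : ℂ)) • eCore N h k μ u

/-- `F_μ(u)`, `1 ≤ μ ≤ N - 1`. -/
def FCur (N : ℕ) (h : ℝ) (k : ℂ) (μ : ℕ) (u : ℂ) : Op := (1 / (h : ℂ)) • fCore N h k μ u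

/-! ### Relations between currents, in the sense of analytic continuation

The product `A(u) B(v)` is an absolutely convergent expression for `Im u` far below `Im v`, and
`B(v) A(u)` for `Im u` far above `Im v`. A relation between the two products says that
their matrix elements are restrictions of one and the same analytic function. -/

/-- `P(u-v) A(u) B(v) = Q(u-v) B(v) A(u)`, both sides being regular: the matrix elements continue
to one and the same entire function of `u`. -/
def Exchange (Fo : Set State) (Du : Set Profile) (P Q : ℂ → ℂ) (A B : ℂ → Op) : Prop :=
  ∃ C : ℝ, ∀ Φ ∈ Fo, ∀ ξ ∈ Du, ∀ v : ℂ, ∃ G : ℂ → ℂ, Differentiable ℂ G ∧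
    (∀ u : ℂ, u.im < v.im - C → P (u - v) * A u (B v Φ) ξ = G u) ∧
    (∀ u : ℂ, v.im + C < u.im → Q (u - v) * B v (A u Φ) ξ = G u)

/-- `P(u-v) A(u) B(v) = Q(u-v) B(v) A(u)` with meromorphic coefficients `P`, `Q`: the matrix
elements continue to one and the same meromorphic function of `u`. -/
def ExchangeMero (Fo : Set State) (Du : Set Profile) (P Q : ℂ → ℂ) (A B : ℂ → Op) : Prop :=
  ∃ C : ℝ, ∀ Φ ∈ Fo, ∀ ξ ∈ Du, ∀ v : ℂ, ∃ G : ℂ → ℂ, MeromorphicOn G Set.univ ∧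
    (∀ u : ℂ, u.im < v.im - C → P (u - v) * A u (B v Φ) ξ = G u) ∧
    (∀ u : ℂ, v.im + C < u.im → Q (u - v) * B v (A u Φ) ξ = G u)

/-- `[A(u), B(v)] = κ (δ(u - (v + a)) S(u) - δ(u - v) T(v))`. The delta function `δ(u - w)` is the
difference of the two determinations of `1 / (u - w)` that belong to the two regions, so
both products are the sum of one entire function and the polar part
`κ (S(u) / (u - v - a) - T(v) / (u - v))`. -/
def DeltaCommutator (Fo : Set State) (Du : Set Profile) (κ a : ℂ) (A B S T : ℂ → Op) : Prop :=
  ∃ C : ℝ, ∀ Φ ∈ Fo, ∀ ξ ∈ Du, ∀ v : ℂ, ∃ G : ℂ → ℂ, Differentiable ℂ G ∧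
    (∀ u : ℂ, u.im < v.im - C →
      A u (B v Φ) ξ = G u + κ * (S u Φ ξ / (u - v - a) - T v Φ ξ / (u - v))) ∧
    (∀ u : ℂ, v.im + C < u.im →
      B v (A u Φ) ξ = G u + κ * (S u Φ ξ / (u - v - a) - T v Φ ξ / (u - v)))

/-- The meromorphic function `G / D` on `ℂ³` (`D`, `G` entire) continues `f` from the region where
the imaginary parts of `x`, `y`, `z` increase by more than `C` at each step; here `x`, `y`, `z`
are coordinates of the point `p`. -/
def Continues (C : ℝ) (x y z : ℂ × ℂ × ℂ → ℂ) (f D G : ℂ × ℂ × ℂ → ℂ) : Prop :=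
  ∀ p : ℂ × ℂ × ℂ, (x p).im < (y p).im - C → (y p).im < (z p).im - C → D p * f p = G p

/-- The cubic relation
`A(u₁)A(u₂)B(v) - 2 A(u₁)B(v)A(u₂) + B(v)A(u₁)A(u₂) + (u₁ ↔ u₂) = 0`
between the meromorphic continuations of the six products to `(u₁, u₂, v) ∈ ℂ³`, written with
a common denominator `D`. -/
def Serre (Fo : Set State) (Du : Set Profile) (A B : ℂ → Op) : Prop :=
  ∃ (C : ℝ) (D : ℂ × ℂ × ℂ → ℂ), Differentiable ℂ D ∧ D ≠ 0 ∧ ∀ Φ ∈ Fo, ∀ ξ ∈ Du,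
    ∃ G : Fin 6 → ℂ × ℂ × ℂ → ℂ, (∀ j, Differentiable ℂ (G j)) ∧
      Continues C (fun p => p.1) (fun p => p.2.1) (fun p => p.2.2)
        (fun p => A p.1 (A p.2.1 (B p.2.2 Φ)) ξ) D (G 0) ∧
      Continues C (fun p => p.1) (fun p => p.2.2) (fun p => p.2.1)
        (fun p => A p.1 (B p.2.2 (A p.2.1 Φ)) ξ) D (G 1) ∧
      Continues C (fun p => p.2.2) (fun p => p.1) (fun p => p.2.1)
        (fun p => B p.2.2 (A p.1 (A p.2.1 Φ)) ξ) D (G 2) ∧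
      Continues C (fun p => p.2.1) (fun p => p.1) (fun p => p.2.2)
        (fun p => A p.2.1 (A p.1 (B p.2.2 Φ)) ξ) D (G 3) ∧
      Continues C (fun p => p.2.1) (fun p => p.2.2) (fun p => p.1)
        (fun p => A p.2.1 (B p.2.2 (A p.1 Φ)) ξ) D (G 4) ∧
      Continues C (fun p => p.2.2) (fun p => p.2.1) (fun p => p.1)
        (fun p => B p.2.2 (A p.2.1 (A p.1 Φ)) ξ) D (G 5) ∧
      ∀ p, G 0 p - 2 * G 1 p + G 2 p + (G 3 p - 2 * G 4 p + G 5 p) = 0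

/-! ### The Yangian doubles -/

/-- The scalar factor
`ρ(w) = Γ(w/(Nη)) Γ(1 + w/(Nη)) / (Γ(1/N + w/(Nη)) Γ(1 - 1/N + w/(Nη)))`. -/
def rho (N : ℕ) (η w : ℂ) : ℂ :=
  Gamma (w / (N * η)) * Gamma (1 + w / (N * η))
    / (Gamma (1 / N + w / (N * η)) * Gamma (1 - 1 / N + w / (N * η)))

/-- The rational factor in the relation between `k^+_μ` and `k^-_ν`. -/
def ratFactor (η : ℂ) (μ ν : ℕ) (w : ℂ) : ℂ :=
  if μ < ν then w / (w + η) else if ν < μ then (w - η) / w else 1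

/-- `B_{μ,ν}`, half of the Cartan matrix of type `A`. -/
def halfCartan (μ ν : ℕ) : ℂ :=
  if μ = ν then 1 else if μ = ν + 1 ∨ ν = μ + 1 then -1 / 2 else 0

/-- The currents `k^±_μ` (`1 ≤ μ ≤ N`) and `X^±_ν` (`1 ≤ ν ≤ N - 1`) satisfy the defining relations
of the Yangian double `DY_η(gl_N)` with the central element acting as the number `c`. -/
structure IsYangianDoubleGL (N : ℕ) (η c : ℂ) (Fo : Set State) (Du : Set Profile)
    (kP kM XP XM : ℕ → ℂ → Op) : Prop where
  kP_isUnit : ∀ μ u, 1 ≤ μ → μ ≤ N → IsUnit (kP μ u)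
  kM_isUnit : ∀ μ u, 1 ≤ μ → μ ≤ N → IsUnit (kM μ u)
  kP_kP : ∀ μ ν, 1 ≤ μ → μ ≤ N → 1 ≤ ν → ν ≤ N →
    Exchange Fo Du (fun _ => 1) (fun _ => 1) (kP μ) (kP ν)
  kM_kM : ∀ μ ν, 1 ≤ μ → μ ≤ N → 1 ≤ ν → ν ≤ N →
    Exchange Fo Du (fun _ => 1) (fun _ => 1) (kM μ) (kM ν)
  kP_kM : ∀ μ ν, 1 ≤ μ → μ ≤ N → 1 ≤ ν → ν ≤ N →
    ExchangeMero Fo Du (fun w => rho N η (w - c * η) * ratFactor η μ ν (w - c * η))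
      (fun w => ratFactor η μ ν w * rho N η w) (kP μ) (kM ν)
  kP_XP : ∀ μ, 1 ≤ μ → μ < N → Exchange Fo Du (fun w => w + η) (fun w => w) (kP μ) (XP μ)
  kM_XP : ∀ μ, 1 ≤ μ → μ < N → Exchange Fo Du (fun w => w + η) (fun w => w) (kM μ) (XP μ)
  kP_succ_XP : ∀ μ, 1 ≤ μ → μ < N →
    Exchange Fo Du (fun w => w - η) (fun w => w) (kP (μ + 1)) (XP μ)
  kM_succ_XP : ∀ μ, 1 ≤ μ → μ < N →
    Exchange Fo Du (fun w => w - η) (fun w => w) (kM (μ + 1)) (XP μ)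
  kM_XM : ∀ μ, 1 ≤ μ → μ < N → Exchange Fo Du (fun w => w) (fun w => w + η) (kM μ) (XM μ)
  kM_succ_XM : ∀ μ, 1 ≤ μ → μ < N →
    Exchange Fo Du (fun w => w) (fun w => w - η) (kM (μ + 1)) (XM μ)
  kP_XM : ∀ μ, 1 ≤ μ → μ < N →
    Exchange Fo Du (fun w => w - c * η) (fun w => w + η - c * η) (kP μ) (XM μ)
  kP_succ_XM : ∀ μ, 1 ≤ μ → μ < N →
    Exchange Fo Du (fun w => w - c * η) (fun w => w - η - c * η) (kP (μ + 1)) (XM μ)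
  k_X_far : ∀ μ ν, 1 ≤ μ → μ ≤ N → 1 ≤ ν → ν < N → (ν + 2 ≤ μ ∨ μ + 1 ≤ ν) →
    Exchange Fo Du (fun _ => 1) (fun _ => 1) (kP μ) (XP ν) ∧
    Exchange Fo Du (fun _ => 1) (fun _ => 1) (kM μ) (XP ν) ∧
    Exchange Fo Du (fun _ => 1) (fun _ => 1) (kP μ) (XM ν) ∧
    Exchange Fo Du (fun _ => 1) (fun _ => 1) (kM μ) (XM ν)
  XP_XP : ∀ μ, 1 ≤ μ → μ < N → Exchange Fo Du (fun w => w - η) (fun w => w + η) (XP μ) (XP μ)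
  XM_XM : ∀ μ, 1 ≤ μ → μ < N → Exchange Fo Du (fun w => w + η) (fun w => w - η) (XM μ) (XM μ)
  XP_XP_succ : ∀ μ, 1 ≤ μ → μ + 1 < N →
    Exchange Fo Du (fun w => w + η) (fun w => w) (XP μ) (XP (μ + 1))
  XM_XM_succ : ∀ μ, 1 ≤ μ → μ + 1 < N →
    Exchange Fo Du (fun w => w) (fun w => w + η) (XM μ) (XM (μ + 1))
  X_serre : ∀ μ ν, 1 ≤ μ → μ < N → 1 ≤ ν → ν < N → (μ = ν + 1 ∨ ν = μ + 1) →
    Serre Fo Du (XP μ) (XP ν) ∧ Serre Fo Du (XM μ) (XM ν)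
  X_far : ∀ μ ν, 1 ≤ μ → μ < N → 1 ≤ ν → ν < N → (ν + 2 ≤ μ ∨ μ + 2 ≤ ν) →
    Exchange Fo Du (fun _ => 1) (fun _ => 1) (XP μ) (XP ν) ∧
    Exchange Fo Du (fun _ => 1) (fun _ => 1) (XM μ) (XM ν)
  XP_XM_ne : ∀ μ ν, 1 ≤ μ → μ < N → 1 ≤ ν → ν < N → μ ≠ ν →
    Exchange Fo Du (fun _ => 1) (fun _ => 1) (XP μ) (XM ν)
  XP_XM : ∀ μ, 1 ≤ μ → μ < N → DeltaCommutator Fo Du 1 (c * η) (XP μ) (XM μ)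
    (fun u => kP (μ + 1) u * Ring.inverse (kP μ u))
    (fun v => kM (μ + 1) v * Ring.inverse (kM μ v))

/-- The currents `H^±_μ`, `E_μ`, `F_μ` (`1 ≤ μ ≤ N - 1`) and `K^±` satisfy the defining relations of
the Yangian double `DY_η(sl_N)`, and of the currents `K^±` that complement it to
`DY_η(gl_N)`, with the central element acting as the number `c`. -/
structure IsYangianDoubleSL (N : ℕ) (η c : ℂ) (Fo : Set State) (Du : Set Profile)
    (HP HM E F : ℕ → ℂ → Op) (KP KM : ℂ → Op) : Prop where
  HP_HP : ∀ μ ν, 1 ≤ μ → μ < N → 1 ≤ ν → ν < N →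
    Exchange Fo Du (fun _ => 1) (fun _ => 1) (HP μ) (HP ν)
  HM_HM : ∀ μ ν, 1 ≤ μ → μ < N → 1 ≤ ν → ν < N →
    Exchange Fo Du (fun _ => 1) (fun _ => 1) (HM μ) (HM ν)
  HP_HM : ∀ μ ν, 1 ≤ μ → μ < N → 1 ≤ ν → ν < N →
    Exchange Fo Du
      (fun w => (w + halfCartan μ ν * η - c * η) * (w - halfCartan μ ν * η))
      (fun w => (w - halfCartan μ ν * η - c * η) * (w + halfCartan μ ν * η)) (HP μ) (HM ν)
  HM_HP : ∀ μ ν, 1 ≤ μ → μ < N → 1 ≤ ν → ν < N →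
    Exchange Fo Du
      (fun w => (w + halfCartan μ ν * η + c * η) * (w - halfCartan μ ν * η))
      (fun w => (w - halfCartan μ ν * η + c * η) * (w + halfCartan μ ν * η)) (HM μ) (HP ν)
  HP_E : ∀ μ ν, 1 ≤ μ → μ < N → 1 ≤ ν → ν < N →
    Exchange Fo Du (fun w => w - halfCartan μ ν * η) (fun w => w + halfCartan μ ν * η)
      (HP μ) (E ν)
  HM_E : ∀ μ ν, 1 ≤ μ → μ < N → 1 ≤ ν → ν < N →
    Exchange Fo Du (fun w => w - halfCartan μ ν * η) (fun w => w + halfCartan μ ν * η)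
      (HM μ) (E ν)
  HP_F : ∀ μ ν, 1 ≤ μ → μ < N → 1 ≤ ν → ν < N →
    Exchange Fo Du (fun w => w + halfCartan μ ν * η - c * η)
      (fun w => w - halfCartan μ ν * η - c * η) (HP μ) (F ν)
  HM_F : ∀ μ ν, 1 ≤ μ → μ < N → 1 ≤ ν → ν < N →
    Exchange Fo Du (fun w => w + halfCartan μ ν * η) (fun w => w - halfCartan μ ν * η)
      (HM μ) (F ν)
  E_E : ∀ μ ν, 1 ≤ μ → μ < N → 1 ≤ ν → ν < N →
    Exchange Fo Du (fun w => w - halfCartan μ ν * η) (fun w => w + halfCartan μ ν * η)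
      (E μ) (E ν)
  F_F : ∀ μ ν, 1 ≤ μ → μ < N → 1 ≤ ν → ν < N →
    Exchange Fo Du (fun w => w + halfCartan μ ν * η) (fun w => w - halfCartan μ ν * η)
      (F μ) (F ν)
  E_F_ne : ∀ μ ν, 1 ≤ μ → μ < N → 1 ≤ ν → ν < N → μ ≠ ν →
    Exchange Fo Du (fun _ => 1) (fun _ => 1) (E μ) (F ν)
  E_F : ∀ μ, 1 ≤ μ → μ < N →
    DeltaCommutator Fo Du (1 / η) (c * η) (E μ) (F μ) (HP μ) (HM μ)
  serre : ∀ μ ν, 1 ≤ μ → μ < N → 1 ≤ ν → ν < N → (μ = ν + 1 ∨ ν = μ + 1) →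
    Serre Fo Du (E μ) (E ν) ∧ Serre Fo Du (F μ) (F ν)
  far : ∀ μ ν, 1 ≤ μ → μ < N → 1 ≤ ν → ν < N → (ν + 2 ≤ μ ∨ μ + 2 ≤ ν) →
    Exchange Fo Du (fun _ => 1) (fun _ => 1) (E μ) (E ν) ∧
    Exchange Fo Du (fun _ => 1) (fun _ => 1) (F μ) (F ν)
  K_K : Exchange Fo Du (fun _ => 1) (fun _ => 1) KP KP ∧
    Exchange Fo Du (fun _ => 1) (fun _ => 1) KM KM ∧
    Exchange Fo Du (fun _ => 1) (fun _ => 1) KP KM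
  K_central : ∀ K : ℂ → Op, (K = KP ∨ K = KM) → ∀ μ, 1 ≤ μ → μ < N →
    Exchange Fo Du (fun _ => 1) (fun _ => 1) K (HP μ) ∧
    Exchange Fo Du (fun _ => 1) (fun _ => 1) K (HM μ) ∧
    Exchange Fo Du (fun _ => 1) (fun _ => 1) K (E μ) ∧
    Exchange Fo Du (fun _ => 1) (fun _ => 1) K (F μ)

/-- `K(u) = k_1(u) k_2(u + η) ⋯ k_N(u + (N-1)η)`. -/
def quantumDet (N : ℕ) (η : ℂ) (kk : ℕ → ℂ → Op) (u : ℂ) : Op :=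
  ((List.range N).map fun j => kk (j + 1) (u + j * η)).prod

/-! ### The bosonized Wakimoto realization (`h = 0`) -/

/-- `χ_{μ,ν}(u) = -2 ∫_{ℝ∖0} (b̂ + ĉ)_{μ,ν}(t) e^{-iut} dt / t`, so that `γ_{μ,ν} = :exp χ_{μ,ν}:`
and `γ_{μ,μ} = 1`. -/
def chiCl (μ ν : ℕ) (u : ℂ) : Exponent :=
  let f : ℝ → ℂ := fun s => 2 / s * exp (I * u * s)
  let g : ℝ → ℂ := fun t => -(2 / t * exp (-I * u * t))
  (onB μ ν f + onC μ ν f, onB μ ν g + onC μ ν g)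

/-- `λ̂_μ(u) = ∫ λ̂_μ(t) e^{-iut} dt` over `ℝ∖0`. -/
def lamCl (μ : ℕ) (u : ℂ) : Exponent :=
  (onLam μ fun s => exp (I * u * s), onLam μ fun t => exp (-I * u * t))

/-- `b̂_{μ,ν}(u) = ∫ b̂_{μ,ν}(t) e^{-iut} dt` over `ℝ∖0`. -/
def bCl (μ ν : ℕ) (u : ℂ) : Exponent :=
  (onB μ ν fun s => exp (I * u * s), onB μ ν fun t => exp (-I * u * t))

/-- `ĉ_{μ,ν}(u) = ∫ ĉ_{μ,ν}(t) e^{-iut} dt` over `ℝ∖0`. -/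
def cCl (μ ν : ℕ) (u : ℂ) : Exponent :=
  (onC μ ν fun s => exp (I * u * s), onC μ ν fun t => exp (-I * u * t))

/-- `:γ_{p,q}(u) β_{μ,ν}(u):`, where `β_{μ,ν} = -2 :ĉ_{μ,ν} exp (-χ_{μ,ν}):`. -/
def gammaBeta (N : ℕ) (k : ℂ) (p q μ ν : ℕ) (u : ℂ) (Φ : State) : State :=
  normalLinExp N (commClassical N k) ((-2 : ℂ) • cCl μ ν u) (chiCl p q u - chiCl μ ν u) Φ

/-- The Wakimoto current `E_μ = ∑_{m ≤ μ} :γ_{m,μ} β_{m,μ+1}:`. -/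
def wakimotoE (N : ℕ) (k : ℂ) (μ : ℕ) (u : ℂ) (Φ : State) : State :=
  ∑ m ∈ Finset.Icc 1 μ, gammaBeta N k m μ m (μ + 1) u Φ

/-- The Wakimoto current
`F_μ = ∑_{m<μ} :γ_{m,μ+1} β_{m,μ}: + :J_μ γ_{μ,μ+1}: - ∑_{m≥μ+2} :γ_{μ,m} β_{μ+1,m}:` with
`J_μ = (k+μ) i ∂χ_{μ,μ+1} - 2 (λ̂_μ - λ̂_{μ+1}) - 2 ∑_{n>μ} (b̂_{μ,n} - b̂_{μ+1,n})`,
`i ∂χ_{μ,μ+1} = -2 (b̂ + ĉ)_{μ,μ+1}`. -/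
def wakimotoF (N : ℕ) (k : ℂ) (μ : ℕ) (u : ℂ) (Φ : State) : State :=
  ∑ m ∈ Finset.Ico 1 μ, gammaBeta N k m (μ + 1) m μ u Φ
  + normalLinExp N (commClassical N k)
      ((-2 * (k + μ)) • (bCl μ (μ + 1) u + cCl μ (μ + 1) u)
        - (2 : ℂ) • (lamCl μ u - lamCl (μ + 1) u)
        - (2 : ℂ) • ∑ n ∈ Finset.Icc (μ + 1) N, (bCl μ n u - bCl (μ + 1) n u))
      (chiCl μ (μ + 1) u) Φ
  - ∑ m ∈ Finset.Icc (μ + 2) N, gammaBeta N k μ m (μ + 1) m u Φ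

/-- The Wakimoto Cartan current of `sl_N`,
`2 (λ̂_μ - λ̂_{μ+1}) + 2 ∑_{m≤μ} (b̂_{m,μ+1} - b̂_{m,μ}) + 2 ∑_{n>μ} (b̂_{μ,n} - b̂_{μ+1,n})`. -/
def wakimotoH (N : ℕ) (k : ℂ) (μ : ℕ) (u : ℂ) (Φ : State) : State :=
  normalLinExp N (commClassical N k)
    ((2 : ℂ) • (lamCl μ u - lamCl (μ + 1) u)
      + (2 : ℂ) • ∑ m ∈ Finset.Icc 1 μ, (bCl m (μ + 1) u - bCl m μ u)
      + (2 : ℂ) • ∑ n ∈ Finset.Icc (μ + 1) N, (bCl μ n u - bCl (μ + 1) n u)) 0 Φ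

/-- The Wakimoto Cartan current of `gl_N`,
`-2 λ̂_μ + 2 ∑_{α<μ} b̂_{α,μ} - 2 ∑_{β>μ} b̂_{μ,β}`. -/
def wakimotoK (N : ℕ) (k : ℂ) (μ : ℕ) (u : ℂ) (Φ : State) : State :=
  normalLinExp N (commClassical N k)
    ((-2 : ℂ) • lamCl μ u
      + (2 : ℂ) • ∑ α ∈ Finset.Ico 1 μ, bCl α μ u
      - (2 : ℂ) • ∑ β ∈ Finset.Icc (μ + 1) N, bCl μ β u) 0 Φ

/-- Identification of `fockDual N 0` with `fockDual N h`: the creation modes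
`e^{(μ-1)hs} λ̂_μ(-s)` do not depend on `h`. -/
def twist (h : ℝ) (ξ : Profile) : Profile
  | .lam μ => fun s => exp ((1 - (μ : ℂ)) * h * s) * ξ (.lam μ) s
  | .b μ ν => ξ (.b μ ν)
  | .c μ ν => ξ (.c μ ν)

end BosonYangian

end

noncomputable section

namespace BosonYangian

/-! ### Smearing functions -/

theorem IsSmearing.continuousOn_mul {g η : ℝ → ℂ} (hη : IsSmearing η)
    (hg : ContinuousOn g (Set.Ioi 0)) : IsSmearing fun s => g s * η s := by
  obtain ⟨h1, h2, h3⟩ := hη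
  have hsub : tsupport (fun s => g s * η s) ⊆ tsupport η := tsupport_mul_subset_right
  refine ⟨?_, h2.mul_left, hsub.trans h3⟩
  rw [continuous_iff_continuousAt]
  intro s
  by_cases hs : s ∈ tsupport η
  · exact (hg.continuousAt (isOpen_Ioi.mem_nhds (h3 hs))).mul h1.continuousAt
  · have : (fun s => g s * η s) =ᶠ[𝓝 s] fun _ => 0 := by
      filter_upwards [(isClosed_tsupport η).isOpen_compl.mem_nhds hs] with t ht
      rw [image_eq_zero_of_notMem_tsupport ht, mul_zero]
    exact this.continuousAt

theorem IsSmearing.zero : IsSmearing 0 := by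
  refine ⟨continuous_const, HasCompactSupport.zero, ?_⟩
  have h : tsupport (0 : ℝ → ℂ) = ∅ := tsupport_eq_empty_iff.2 rfl
  rw [h]; exact Set.empty_subset _

theorem IsSmearing.add {η θ : ℝ → ℂ} (hη : IsSmearing η) (hθ : IsSmearing θ) :
    IsSmearing (η + θ) := by
  refine ⟨hη.1.add hθ.1, hη.2.1.add hθ.2.1, ?_⟩
  exact (tsupport_add η θ).trans (Set.union_subset hη.2.2 hθ.2.2)

theorem IsSmearing.sum {ι : Type*} (S : Finset ι) {η : ι → ℝ → ℂ}
    (hη : ∀ i ∈ S, IsSmearing (η i)) : IsSmearing (∑ i ∈ S, η i) :=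
  Finset.sum_induction _ IsSmearing (fun _ _ => IsSmearing.add) IsSmearing.zero hη

theorem IsSmearing.integrable {η : ℝ → ℂ} (hη : IsSmearing η) :
    IntegrableOn η (Set.Ioi 0) :=
  (hη.1.integrable_of_hasCompactSupport hη.2.1).integrableOn

theorem IsSmearing.differentiable_integral {η : ℝ → ℂ} (hη : IsSmearing η) (c : ℂ) :
    Differentiable ℂ fun u : ℂ => ∫ s in Set.Ioi (0 : ℝ), exp (c * u * s) * η s := by
  intro u
  let bound : ℝ → ℝ := fun s => Real.exp (‖c‖ * (‖u‖ + 1) * |s|) * (‖c‖ * |s|) * ‖η s‖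
  have hb : Integrable bound (volume.restrict (Set.Ioi 0)) := by
    have h1 : Continuous bound := by
      have := hη.1
      fun_prop
    have h2 : HasCompactSupport bound := hη.2.1.norm.mul_left
    exact (h1.integrable_of_hasCompactSupport h2).integrableOn
  have key := hasDerivAt_integral_of_dominated_loc_of_deriv_le
    (μ := volume.restrict (Set.Ioi (0 : ℝ)))
    (F := fun (u : ℂ) (s : ℝ) => exp (c * u * s) * η s)
    (F' := fun (u : ℂ) (s : ℝ) => exp (c * u * s) * (c * s) * η s) (x₀ := u)
    (bound := bound) (Metric.ball_mem_nhds u one_pos)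
    (by
      refine Eventually.of_forall fun v => ?_
      have := hη.1
      exact Continuous.aestronglyMeasurable (by fun_prop))
    (by
      refine (IsSmearing.continuousOn_mul hη (g := fun s => exp (c * u * s)) ?_).integrable
      fun_prop)
    (by
      have := hη.1
      exact Continuous.aestronglyMeasurable (by fun_prop))
    (by
      refine Eventually.of_forall fun s v hv => ?_
      have hv' : ‖v‖ ≤ ‖u‖ + 1 := by
        have h1 : ‖v - u‖ < 1 := by simpa [dist_eq_norm] using hv
        have h2 : ‖v‖ ≤ ‖v - u‖ + ‖u‖ := by simpa using norm_add_le (v - u) u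
        linarith
      have h3 : (c * v * s).re ≤ ‖c‖ * (‖u‖ + 1) * |s| := by
        refine (re_le_norm _).trans ?_
        rw [norm_mul, norm_mul, norm_real, Real.norm_eq_abs]
        gcongr
      simp only [bound, norm_mul, norm_exp, norm_real, Real.norm_eq_abs]
      gcongr)
    hb
    (by
      refine Eventually.of_forall fun s v _ => ?_
      have h1 : HasDerivAt (fun v : ℂ => c * v * s) (c * s) v := by
        simpa using ((hasDerivAt_id v).const_mul c).mul_const (s : ℂ)
      exact (h1.cexp).mul_const (η s))
  exact key.2.differentiableAt

/-! ### Pairings and contractions -/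

/-- The integrand of `pairing`. -/
def pairAt (N : ℕ) (f ξ : Profile) (s : ℝ) : ℂ :=
  (∑ μ ∈ Finset.Icc 1 N, f (.lam μ) s * ξ (.lam μ) s)
    + ∑ μ ∈ Finset.Icc 1 N, ∑ ν ∈ Finset.Ioc μ N,
        (f (.b μ ν) s * ξ (.b μ ν) s + f (.c μ ν) s * ξ (.c μ ν) s)

theorem pairing_eq (N : ℕ) (f ξ : Profile) :
    pairing N f ξ = ∫ s in Set.Ioi (0 : ℝ), pairAt N f ξ s := rfl

section bilinear

variable (N : ℕ) (H : Commutators)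

theorem pairAt_add_left (f g ξ : Profile) :
    pairAt N (f + g) ξ = pairAt N f ξ + pairAt N g ξ := by
  funext s
  simp only [pairAt, Pi.add_apply, add_mul, Finset.sum_add_distrib]
  ring

theorem pairAt_add_right (f ξ ζ : Profile) :
    pairAt N f (ξ + ζ) = pairAt N f ξ + pairAt N f ζ := by
  funext s
  simp only [pairAt, Pi.add_apply, mul_add, Finset.sum_add_distrib]
  ring

theorem pairAt_smul_left (a : ℂ) (f ξ : Profile) :
    pairAt N (a • f) ξ = a • pairAt N f ξ := by
  funext s
  simp only [pairAt, Pi.smul_apply, smul_eq_mul, mul_add, Finset.mul_sum, mul_assoc]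

theorem pairAt_smul_right (a : ℂ) (f ξ : Profile) :
    pairAt N f (a • ξ) = a • pairAt N f ξ := by
  funext s
  simp only [pairAt, Pi.smul_apply, smul_eq_mul, mul_add, Finset.mul_sum, mul_left_comm _ a]

theorem pairAt_neg_left (f ξ : Profile) : pairAt N (-f) ξ = -pairAt N f ξ := by
  have := pairAt_smul_left N (-1) f ξ
  simpa using this

theorem pairAt_zero_left (ξ : Profile) : pairAt N 0 ξ = 0 := by
  have := pairAt_smul_left N 0 0 ξ
  simpa using this

theorem pairAt_zero_right (f : Profile) : pairAt N f 0 = 0 := by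
  have := pairAt_smul_right N 0 f 0
  simpa using this

theorem shift_add (g g' : Profile) : shift N H (g + g') = shift N H g + shift N H g' := by
  funext m s
  cases m <;> simp [shift, add_mul, Finset.sum_add_distrib]
  ring_nf

theorem shift_smul (a : ℂ) (g : Profile) : shift N H (a • g) = a • shift N H g := by
  funext m s
  cases m <;> simp [shift, Finset.mul_sum, mul_assoc]

theorem shift_neg (g : Profile) : shift N H (-g) = -shift N H g := by
  simpa using shift_smul N H (-1) g

theorem shift_zero : shift N H 0 = 0 := by
  simpa using shift_smul N H 0 0

theorem pairing_zero_left (ξ : Profile) : pairing N 0 ξ = 0 := by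
  simp [pairing_eq, pairAt_zero_left]

theorem pairing_neg_left (f ξ : Profile) : pairing N (-f) ξ = -pairing N f ξ := by
  simp [pairing_eq, pairAt_neg_left, integral_neg]

/-- The contraction of the annihilation part of `X` with the creation part of `Y`, before
integration over the continuous parameter. -/
def con (X Y : Exponent) (s : ℝ) : ℂ := pairAt N Y.1 (shift N H X.2) s

theorem con_add_left (X X' Y : Exponent) : con N H (X + X') Y = con N H X Y + con N H X' Y := by
  funext s; simp [con, shift_add, pairAt_add_right]

theorem con_add_right (X Y Y' : Exponent) : con N H X (Y + Y') = con N H X Y + con N H X Y' := by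
  funext s; simp [con, pairAt_add_left]

theorem con_neg_left (X Y : Exponent) : con N H (-X) Y = -con N H X Y := by
  funext s
  have := congrFun (pairAt_smul_right N (-1) Y.1 (shift N H X.2)) s
  simpa [con, shift_neg] using this

theorem con_neg_right (X Y : Exponent) : con N H X (-Y) = -con N H X Y := by
  funext s; simp [con, pairAt_neg_left]

theorem con_sub_left (X X' Y : Exponent) : con N H (X - X') Y = con N H X Y - con N H X' Y := by
  rw [sub_eq_add_neg, con_add_left, con_neg_left, sub_eq_add_neg]

theorem con_sub_right (X Y Y' : Exponent) : con N H X (Y - Y') = con N H X Y - con N H X Y' := by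
  rw [sub_eq_add_neg, con_add_right, con_neg_right, sub_eq_add_neg]

theorem con_zero_left (Y : Exponent) : con N H 0 Y = 0 := by
  funext s; simp [con, shift_zero, pairAt_zero_right]

theorem con_zero_right (X : Exponent) : con N H X 0 = 0 := by
  funext s; simp [con, pairAt_zero_left]

theorem con_sum_left {ι : Type*} (S : Finset ι) (X : ι → Exponent) (Y : Exponent) :
    con N H (∑ i ∈ S, X i) Y = ∑ i ∈ S, con N H (X i) Y := by
  classical
  induction S using Finset.induction_on with
  | empty => simp [con_zero_left]
  | insert i S hi ih => rw [Finset.sum_insert hi, Finset.sum_insert hi, con_add_left, ih]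

theorem con_sum_right {ι : Type*} (S : Finset ι) (X : Exponent) (Y : ι → Exponent) :
    con N H X (∑ i ∈ S, Y i) = ∑ i ∈ S, con N H X (Y i) := by
  classical
  induction S using Finset.induction_on with
  | empty => simp [con_zero_right]
  | insert i S hi ih => rw [Finset.sum_insert hi, Finset.sum_insert hi, con_add_right, ih]

/-! ### Products of normal ordered exponentials -/

theorem normalExp_apply (X : Exponent) (Φ : State) (ξ : Profile) :
    normalExp N H X Φ ξ = exp (pairing N X.1 ξ) * Φ (ξ + shift N H X.2) := rfl

theorem normalExp_zero : normalExp N H 0 = 1 := by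
  ext Φ ξ
  simp [normalExp_apply, pairing_zero_left, shift_zero]

variable {N H}

theorem pairing_add_right {f ξ ζ : Profile} (hξ : IntegrableOn (pairAt N f ξ) (Set.Ioi 0))
    (hζ : IntegrableOn (pairAt N f ζ) (Set.Ioi 0)) :
    pairing N f (ξ + ζ) = pairing N f ξ + pairing N f ζ := by
  simp only [pairing_eq, pairAt_add_right]
  exact integral_add hξ hζ

theorem pairing_add_left {f g ξ : Profile} (hf : IntegrableOn (pairAt N f ξ) (Set.Ioi 0))
    (hg : IntegrableOn (pairAt N g ξ) (Set.Ioi 0)) :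
    pairing N (f + g) ξ = pairing N f ξ + pairing N g ξ := by
  simp only [pairing_eq, pairAt_add_left]
  exact integral_add hf hg

/-- `:exp X: :exp Y: = exp ⟨X Y⟩ :exp (X + Y):`. -/
theorem normalExp_mul {X Y : Exponent} {ξ : Profile} (Φ : State)
    (hX : IntegrableOn (pairAt N X.1 ξ) (Set.Ioi 0))
    (hY : IntegrableOn (pairAt N Y.1 ξ) (Set.Ioi 0))
    (hXY : IntegrableOn (con N H X Y) (Set.Ioi 0)) :
    normalExp N H X (normalExp N H Y Φ) ξ
      = exp (∫ s in Set.Ioi 0, con N H X Y s) * normalExp N H (X + Y) Φ ξ := by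
  rw [normalExp_apply, normalExp_apply, normalExp_apply, pairing_add_right hY hXY, Prod.fst_add,
    pairing_add_left hX hY, Prod.snd_add, shift_add, ← add_assoc, exp_add, exp_add,
    pairing_eq N Y.1 (shift N H X.2)]
  simp only [con]
  ring

theorem normalExp_mul_mul {X Y Z : Exponent} {ξ : Profile} (Φ : State)
    (hX : IntegrableOn (pairAt N X.1 ξ) (Set.Ioi 0))
    (hY : IntegrableOn (pairAt N Y.1 ξ) (Set.Ioi 0))
    (hZ : IntegrableOn (pairAt N Z.1 ξ) (Set.Ioi 0))
    (hXY : IntegrableOn (con N H X Y) (Set.Ioi 0))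
    (hXZ : IntegrableOn (con N H X Z) (Set.Ioi 0))
    (hYZ : IntegrableOn (con N H Y Z) (Set.Ioi 0)) :
    normalExp N H X (normalExp N H Y (normalExp N H Z Φ)) ξ
      = exp (∫ s in Set.Ioi 0, con N H X Y s) * exp (∫ s in Set.Ioi 0, con N H X Z s)
        * exp (∫ s in Set.Ioi 0, con N H Y Z s) * normalExp N H (X + Y + Z) Φ ξ := by
  have h1 : pairing N Z.1 (ξ + shift N H X.2 + shift N H Y.2)
      = pairing N Z.1 ξ + ∫ s in Set.Ioi 0, con N H X Z s + con N H Y Z s := by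
    rw [pairing_add_right _ hYZ, pairing_add_right hZ hXZ, integral_add hXZ hYZ]
    · simp only [con, pairing_eq, add_assoc]
    · rw [pairAt_add_right]; exact hZ.add hXZ
  have hXY1 : IntegrableOn (pairAt N (X.1 + Y.1) ξ) (Set.Ioi 0) := by
    rw [pairAt_add_left]; exact hX.add hY
  rw [normalExp_apply, normalExp_apply, normalExp_apply, normalExp_apply, h1,
    pairing_add_right hY hXY, Prod.fst_add, Prod.fst_add,
    pairing_add_left hXY1 hZ, pairing_add_left hX hY, Prod.snd_add, Prod.snd_add,
    shift_add, shift_add, integral_add hXZ hYZ,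
    ← add_assoc, ← add_assoc, exp_add, exp_add, exp_add, exp_add, exp_add,
    pairing_eq N Y.1 (shift N H X.2)]
  simp only [con]
  ring_nf

end bilinear

/-! ### Vertex exponents -/

section vertex

variable {N : ℕ} {H : Commutators}

/-- The commutators depend continuously on the positive parameter. -/
structure Commutators.Regular (H : Commutators) : Prop where
  lam : ∀ μ ν, ContinuousOn (H.lam μ ν) (Set.Ioi 0)
  ghost : ContinuousOn H.ghost (Set.Ioi 0)

theorem continuousOn_shift (hH : H.Regular) {g : Profile}
    (hg : ∀ m, ContinuousOn (g m) (Set.Ioi 0)) (m : Mode) :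
    ContinuousOn (shift N H g m) (Set.Ioi 0) := by
  cases m with
  | lam ν => exact continuousOn_finsetSum _ fun μ _ => (hg _).mul (hH.lam μ ν)
  | b μ ν => exact ((hg _).mul hH.ghost).neg
  | c μ ν => exact (hg _).mul hH.ghost

theorem isSmearing_pairAt {f ξ : Profile} (hf : ∀ m, ContinuousOn (f m) (Set.Ioi 0))
    (hξ : ∀ m, IsSmearing (ξ m)) : IsSmearing (pairAt N f ξ) := by
  have : pairAt N f ξ = (∑ μ ∈ Finset.Icc 1 N, fun s => f (.lam μ) s * ξ (.lam μ) s)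
      + ∑ μ ∈ Finset.Icc 1 N, ∑ ν ∈ Finset.Ioc μ N,
        ((fun s => f (.b μ ν) s * ξ (.b μ ν) s) + fun s => f (.c μ ν) s * ξ (.c μ ν) s) := by
    funext s
    simp [pairAt, Finset.sum_apply]
  rw [this]
  refine (IsSmearing.sum _ fun μ _ => (hξ _).continuousOn_mul (hf _)).add
    (IsSmearing.sum _ fun μ _ => IsSmearing.sum _ fun ν _ => ?_)
  exact ((hξ _).continuousOn_mul (hf _)).add ((hξ _).continuousOn_mul (hf _))

/-- The exponent depends on the spectral parameter through `e^{ius}` in the creation part and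
`e^{-iut}` in the annihilation part. -/
def IsVertex (X : ℂ → Exponent) : Prop :=
  ∃ A B : Profile, (∀ m, ContinuousOn (A m) (Set.Ioi 0)) ∧
    (∀ m, ContinuousOn (B m) (Set.Ioi 0)) ∧
    ∀ u : ℂ, X u = (fun m (s : ℝ) => exp (I * u * s) * A m s,
      fun m (s : ℝ) => exp (-I * u * s) * B m s)

theorem IsVertex.zero : IsVertex fun _ => 0 :=
  ⟨0, 0, fun _ => continuousOn_const, fun _ => continuousOn_const, fun u => by
    ext <;> simp⟩

theorem IsVertex.add {X Y : ℂ → Exponent} (hX : IsVertex X) (hY : IsVertex Y) :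
    IsVertex fun u => X u + Y u := by
  obtain ⟨A, B, hA, hB, h⟩ := hX
  obtain ⟨A', B', hA', hB', h'⟩ := hY
  refine ⟨A + A', B + B', fun m => (hA m).add (hA' m), fun m => (hB m).add (hB' m), fun u => ?_⟩
  ext <;> simp [h, h', mul_add]

theorem IsVertex.neg {X : ℂ → Exponent} (hX : IsVertex X) : IsVertex fun u => -X u := by
  obtain ⟨A, B, hA, hB, h⟩ := hX
  refine ⟨-A, -B, fun m => (hA m).neg, fun m => (hB m).neg, fun u => ?_⟩
  ext <;> simp [h]

theorem IsVertex.sub {X Y : ℂ → Exponent} (hX : IsVertex X) (hY : IsVertex Y) :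
    IsVertex fun u => X u - Y u := by
  simpa only [sub_eq_add_neg] using hX.add hY.neg

theorem IsVertex.sum {ι : Type*} (S : Finset ι) {X : ι → ℂ → Exponent}
    (hX : ∀ i ∈ S, IsVertex (X i)) : IsVertex fun u => ∑ i ∈ S, X i u := by
  classical
  induction S using Finset.induction_on with
  | empty => simpa using IsVertex.zero
  | insert i S hi ih =>
    simp only [Finset.sum_insert hi]
    exact (hX i (Finset.mem_insert_self _ _)).add
      (ih fun j hj => hX j (Finset.mem_insert_of_mem hj))

theorem IsVertex.comp_add {X : ℂ → Exponent} (hX : IsVertex X) (a : ℂ) :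
    IsVertex fun u => X (u + a) := by
  obtain ⟨A, B, hA, hB, h⟩ := hX
  refine ⟨fun m (s : ℝ) => exp (I * a * s) * A m s, fun m (s : ℝ) => exp (-I * a * s) * B m s,
    fun m => (ContinuousOn.mul (by fun_prop) (hA m)),
    fun m => (ContinuousOn.mul (by fun_prop) (hB m)), fun u => ?_⟩
  ext <;> simp only [h] <;> rw [← mul_assoc, ← exp_add] <;> ring_nf

theorem continuousOn_onLam (μ : ℕ) {f : ℝ → ℂ} (hf : ContinuousOn f (Set.Ioi 0)) (m : Mode) :
    ContinuousOn (onLam μ f m) (Set.Ioi 0) := by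
  cases m <;> simp only [onLam] <;> (try split_ifs) <;>
    first | exact hf | exact continuousOn_const

theorem continuousOn_onB (μ ν : ℕ) {f : ℝ → ℂ} (hf : ContinuousOn f (Set.Ioi 0)) (m : Mode) :
    ContinuousOn (onB μ ν f m) (Set.Ioi 0) := by
  cases m <;> simp only [onB] <;> (try split_ifs) <;>
    first | exact hf | exact continuousOn_const

theorem continuousOn_onC (μ ν : ℕ) {f : ℝ → ℂ} (hf : ContinuousOn f (Set.Ioi 0)) (m : Mode) :
    ContinuousOn (onC μ ν f m) (Set.Ioi 0) := by
  cases m <;> simp only [onC] <;> (try split_ifs) <;>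
    first | exact hf | exact continuousOn_const

theorem onLam_scale {μ : ℕ} {f g : ℝ → ℂ} {e : ℂ} {s : ℝ} (hf : f s = e * g s) (m : Mode) :
    onLam μ f m s = e * onLam μ g m s := by
  cases m <;> simp only [onLam] <;> (try split_ifs) <;> simp [hf]

theorem onB_scale {μ ν : ℕ} {f g : ℝ → ℂ} {e : ℂ} {s : ℝ} (hf : f s = e * g s) (m : Mode) :
    onB μ ν f m s = e * onB μ ν g m s := by
  cases m <;> simp only [onB] <;> (try split_ifs) <;> simp [hf]

theorem onC_scale {μ ν : ℕ} {f g : ℝ → ℂ} {e : ℂ} {s : ℝ} (hf : f s = e * g s) (m : Mode) :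
    onC μ ν f m s = e * onC μ ν g m s := by
  cases m <;> simp only [onC] <;> (try split_ifs) <;> simp [hf]

theorem sinh_half_ne_zero {h s : ℝ} (hh : 0 < h) (hs : 0 < s) : sinh ((h : ℂ) * s / 2) ≠ 0 := by
  have h1 : ((h : ℂ) * s / 2) = ((h * s / 2 : ℝ) : ℂ) := by push_cast; ring
  rw [h1, ← ofReal_sinh]
  exact_mod_cast (Real.sinh_pos_iff.2 (by positivity)).ne'

variable (h : ℝ)

theorem isVertex_lamP (μ : ℕ) : IsVertex (lamP h μ) := by
  refine ⟨0, onLam μ fun _ => 2 * h, fun m => continuousOn_const,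
    continuousOn_onLam μ continuousOn_const, fun u => ?_⟩
  ext m s
  · simp [lamP]
  · exact onLam_scale (by ring) m

theorem isVertex_lamM (μ : ℕ) : IsVertex (lamM h μ) := by
  refine ⟨onLam μ fun _ => -(2 * h), 0, continuousOn_onLam μ continuousOn_const,
    fun m => continuousOn_const, fun u => ?_⟩
  ext m s
  · exact onLam_scale (by ring) m
  · simp [lamM]

theorem isVertex_bP (μ ν : ℕ) : IsVertex (bP h μ ν) := by
  refine ⟨0, onB μ ν fun _ => 2 * h, fun m => continuousOn_const,
    continuousOn_onB μ ν continuousOn_const, fun u => ?_⟩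
  ext m s
  · simp [bP]
  · exact onB_scale (by ring) m

theorem isVertex_bM (μ ν : ℕ) : IsVertex (bM h μ ν) := by
  refine ⟨onB μ ν fun _ => -(2 * h), 0, continuousOn_onB μ ν continuousOn_const,
    fun m => continuousOn_const, fun u => ?_⟩
  ext m s
  · exact onB_scale (by ring) m
  · simp [bM]

variable {h}

theorem isVertex_bc (hh : 0 < h) (μ ν : ℕ) : IsVertex (bc h μ ν) := by
  have hc : ContinuousOn (fun s : ℝ => (h : ℂ) / sinh ((h : ℂ) * s / 2)) (Set.Ioi 0) :=
    ContinuousOn.div (by fun_prop) (by fun_prop) fun s hs => sinh_half_ne_zero hh hs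
  refine ⟨onB μ ν (fun s => h / sinh ((h : ℂ) * s / 2)) + onC μ ν fun s => h / sinh ((h : ℂ) * s / 2),
    onB μ ν (fun s => -(h / sinh ((h : ℂ) * s / 2)))
      + onC μ ν fun s => -(h / sinh ((h : ℂ) * s / 2)),
    fun m => (continuousOn_onB μ ν hc m).add (continuousOn_onC μ ν hc m),
    fun m => (continuousOn_onB μ ν hc.neg m).add (continuousOn_onC μ ν hc.neg m), fun u => ?_⟩
  ext m s
  · simp only [bc, Pi.add_apply, mul_add]
    exact congrArg₂ _ (onB_scale (by ring) m) (onC_scale (by ring) m)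
  · simp only [bc, Pi.add_apply, mul_add]
    exact congrArg₂ _ (onB_scale (by ring) m) (onC_scale (by ring) m)

/-! ### Holomorphic dependence of normal ordered exponentials -/

variable {E : Type*} [NormedAddCommGroup E] [NormedSpace ℂ E]

/-- Matrix elements of the linear expression `Z p` depend holomorphically on `p`. -/
structure IsHolomorphic (N : ℕ) (H : Commutators) (Z : E → Exponent) : Prop where
  integrable : ∀ ξ : Profile, (∀ m, IsSmearing (ξ m)) → ∀ p,
    IntegrableOn (pairAt N (Z p).1 ξ) (Set.Ioi 0)
  differentiable : ∀ ξ : Profile, (∀ m, IsSmearing (ξ m)) →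
    Differentiable ℂ fun p => pairing N (Z p).1 ξ
  integrable_shift : ∀ m η, IsSmearing η → ∀ p,
    IntegrableOn (fun s => η s * shift N H (Z p).2 m s) (Set.Ioi 0)
  differentiable_shift : ∀ m η, IsSmearing η →
    Differentiable ℂ fun p => ∫ s in Set.Ioi (0 : ℝ), η s * shift N H (Z p).2 m s

theorem IsHolomorphic.add {Z W : E → Exponent} (hZ : IsHolomorphic N H Z)
    (hW : IsHolomorphic N H W) : IsHolomorphic N H fun p => Z p + W p where
  integrable ξ hξ p := by
    rw [Prod.fst_add, pairAt_add_left]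
    exact (hZ.integrable ξ hξ p).add (hW.integrable ξ hξ p)
  differentiable ξ hξ := by
    simp only [Prod.fst_add]
    simp only [fun p => pairing_add_left (hZ.integrable ξ hξ p) (hW.integrable ξ hξ p)]
    exact (hZ.differentiable ξ hξ).add (hW.differentiable ξ hξ)
  integrable_shift m η hη p := by
    simp only [Prod.snd_add, shift_add, Pi.add_apply, mul_add]
    exact (hZ.integrable_shift m η hη p).add (hW.integrable_shift m η hη p)
  differentiable_shift m η hη := by
    simp only [Prod.snd_add, shift_add, Pi.add_apply, mul_add]
    simp only [fun p => integral_add (hZ.integrable_shift m η hη p) (hW.integrable_shift m η hη p)]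
    exact (hZ.differentiable_shift m η hη).add (hW.differentiable_shift m η hη)

theorem IsHolomorphic.comp {F : Type*} [NormedAddCommGroup F] [NormedSpace ℂ F]
    {Z : E → Exponent} (hZ : IsHolomorphic N H Z) {f : F → E} (hf : Differentiable ℂ f) :
    IsHolomorphic N H fun p => Z (f p) where
  integrable ξ hξ p := hZ.integrable ξ hξ (f p)
  differentiable ξ hξ := (hZ.differentiable ξ hξ).comp hf
  integrable_shift m η hη p := hZ.integrable_shift m η hη (f p)
  differentiable_shift m η hη := (hZ.differentiable_shift m η hη).comp hf

theorem shift_mul (e : ℝ → ℂ) (g : Profile) (m : Mode) (s : ℝ) :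
    shift N H (fun m s => e s * g m s) m s = e s * shift N H g m s := by
  cases m <;> simp [shift, Finset.mul_sum, mul_assoc]

theorem pairAt_mul (e : ℝ → ℂ) (g ξ : Profile) (s : ℝ) :
    pairAt N (fun m s => e s * g m s) ξ s = e s * pairAt N g ξ s := by
  simp only [pairAt, Finset.mul_sum, mul_add, mul_assoc]

theorem IsVertex.isHolomorphic (hH : H.Regular) {X : ℂ → Exponent} (hX : IsVertex X) :
    IsHolomorphic N H X := by
  obtain ⟨A, B, hA, hB, h⟩ := hX
  have h1 : ∀ (ξ : Profile) (p : ℂ),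
      pairAt N (X p).1 ξ = fun s : ℝ => exp (I * p * s) * pairAt N A ξ s := by
    intro ξ p
    funext s
    rw [h]
    exact pairAt_mul (fun s : ℝ => exp (I * p * s)) A ξ s
  have h2 : ∀ (m : Mode) (η : ℝ → ℂ) (p : ℂ),
      (fun s => η s * shift N H (X p).2 m s)
        = fun s : ℝ => exp (-I * p * s) * (shift N H B m s * η s) := by
    intro m η p
    funext s
    rw [h]
    have := shift_mul (N := N) (H := H) (fun s : ℝ => exp (-I * p * s)) B m s
    simp only at this ⊢
    rw [this]
    ring
  refine ⟨fun ξ hξ p => ?_, fun ξ hξ => ?_, fun m η hη p => ?_, fun m η hη => ?_⟩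
  · rw [h1]
    exact ((isSmearing_pairAt hA hξ).continuousOn_mul (by fun_prop)).integrable
  · simp only [pairing_eq, h1]
    exact (isSmearing_pairAt hA hξ).differentiable_integral I
  · rw [h2]
    exact ((hη.continuousOn_mul (continuousOn_shift hH hB m)).continuousOn_mul
      (by fun_prop)).integrable
  · simp only [h2]
    exact (hη.continuousOn_mul (continuousOn_shift hH hB m)).differentiable_integral (-I)

theorem IsHolomorphic.normalExp {Z : E → Exponent} (hZ : IsHolomorphic N H Z) {Φ : State}
    (hΦ : Φ ∈ fockSpace N) {ξ : Profile} (hξ : ∀ m, IsSmearing (ξ m)) :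
    Differentiable ℂ fun p => normalExp N H (Z p) Φ ξ := by
  simp only [normalExp_apply]
  refine (hZ.differentiable ξ hξ).cexp.mul ?_
  induction hΦ using Algebra.adjoin_induction with
  | mem Φ h =>
    obtain ⟨m, -, η, hη, rfl⟩ := h
    simp only [Pi.add_apply, mul_add]
    have h1 : IntegrableOn (fun s => η s * ξ m s) (Set.Ioi 0) :=
      ((hξ m).continuousOn_mul hη.1.continuousOn).integrable
    simp only [fun p => integral_add h1 (hZ.integrable_shift m η hη p)]
    exact (differentiable_const _).add (hZ.differentiable_shift m η hη)
  | algebraMap r => exact differentiable_const _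
  | add Φ Ψ _ _ h1 h2 => exact h1.add h2
  | mul Φ Ψ _ _ h1 h2 => exact h1.mul h2

end vertex

/-! ### A complex Frullani integral -/

theorem norm_exp_mul_sub_exp_mul_le {p q : ℂ} {δ s : ℝ} (hp : p.re ≤ -δ) (hq : q.re ≤ -δ)
    (hs : 0 ≤ s) : ‖exp (p * s) - exp (q * s)‖ ≤ Real.exp (-δ * s) * (‖p - q‖ * s) := by
  have hconv : Convex ℝ {z : ℂ | z.re ≤ -δ * s} := convex_halfSpace_re_le _
  have := hconv.norm_image_sub_le_of_norm_deriv_le (f := exp) (C := Real.exp (-δ * s))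
    (fun _ _ => differentiableAt_exp)
    (fun z hz => by
      rw [Complex.deriv_exp, norm_exp]
      exact Real.exp_le_exp.2 hz)
    (x := q * s) (y := p * s)
    (by simpa using mul_le_mul_of_nonneg_right hq hs)
    (by simpa using mul_le_mul_of_nonneg_right hp hs)
  refine this.trans ?_
  rw [← sub_mul, norm_mul, norm_real, Real.norm_of_nonneg hs]

theorem integrableOn_exp_neg_mul_Ioi {δ : ℝ} (hδ : 0 < δ) :
    IntegrableOn (fun s : ℝ => Real.exp (-δ * s)) (Set.Ioi 0) :=
  integrableOn_exp_mul_Ioi (neg_neg_of_pos hδ) 0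

theorem aestronglyMeasurable_exp_sub_exp_div (p q : ℂ) :
    AEStronglyMeasurable (fun s : ℝ => (exp (p * s) - exp (q * s)) / s)
      (volume.restrict (Set.Ioi 0)) := by
  refine ContinuousOn.aestronglyMeasurable ?_ measurableSet_Ioi
  refine ContinuousOn.div (by fun_prop) (by fun_prop) fun s hs => ?_
  exact_mod_cast (ne_of_gt hs : s ≠ 0)

theorem integrableOn_exp_sub_exp_div {p q : ℂ} (hp : p.re < 0) (hq : q.re < 0) :
    IntegrableOn (fun s : ℝ => (exp (p * s) - exp (q * s)) / s) (Set.Ioi 0) := by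
  set δ := min (-p.re) (-q.re) with hδ
  have hδ0 : 0 < δ := lt_min (by linarith) (by linarith)
  refine Integrable.mono' ((integrableOn_exp_neg_mul_Ioi hδ0).mul_const ‖p - q‖)
    (aestronglyMeasurable_exp_sub_exp_div p q) ?_
  refine (ae_restrict_iff' measurableSet_Ioi).2 (Eventually.of_forall fun s hs => ?_)
  have hs' : (0 : ℝ) < s := hs
  have h1 := norm_exp_mul_sub_exp_mul_le (p := p) (q := q) (δ := δ)
    (by linarith [min_le_left (-p.re) (-q.re)]) (by linarith [min_le_right (-p.re) (-q.re)]) hs'.le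
  rw [norm_div, norm_real, Real.norm_of_nonneg hs'.le, div_le_iff₀ hs', mul_assoc]
  exact h1

theorem exp_integral_exp_sub_exp_div {p q : ℂ} (hp : p.re < 0) (hq : q.re < 0) :
    exp (∫ s in Set.Ioi (0 : ℝ), (exp (p * s) - exp (q * s)) / s) = q / p := by
  set F : ℂ → ℂ := fun z => ∫ s in Set.Ioi (0 : ℝ), (exp (z * s) - exp (q * s)) / s with hF
  have hderiv : ∀ z : ℂ, z.re < 0 → HasDerivAt F (-1 / z) z := by
    intro z hz
    have hδ : 0 < -z.re / 2 := by linarith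
    have key := hasDerivAt_integral_of_dominated_loc_of_deriv_le
      (μ := volume.restrict (Set.Ioi (0 : ℝ)))
      (F := fun (z : ℂ) (s : ℝ) => (exp (z * s) - exp (q * s)) / s)
      (F' := fun (z : ℂ) (s : ℝ) => exp (z * s)) (x₀ := z)
      (bound := fun s => Real.exp (-(-z.re / 2) * s)) (Metric.ball_mem_nhds z hδ)
      (Eventually.of_forall fun v => aestronglyMeasurable_exp_sub_exp_div v q)
      (integrableOn_exp_sub_exp_div hz hq)
      (Continuous.aestronglyMeasurable (by fun_prop))
      (by
        refine (ae_restrict_iff' measurableSet_Ioi).2 (Eventually.of_forall fun s hs v hv => ?_)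
        have hs' : (0 : ℝ) < s := hs
        have h1 : ‖v - z‖ < -z.re / 2 := by simpa [dist_eq_norm] using hv
        have h2 : v.re - z.re ≤ ‖v - z‖ := by simpa using re_le_norm (v - z)
        rw [norm_exp]
        refine Real.exp_le_exp.2 ?_
        have : (v * s).re = v.re * s := by simp
        rw [this]
        exact mul_le_mul_of_nonneg_right (by linarith) hs'.le)
      (integrableOn_exp_neg_mul_Ioi hδ)
      (by
        refine (ae_restrict_iff' measurableSet_Ioi).2 (Eventually.of_forall fun s hs v _ => ?_)
        have hs' : (s : ℂ) ≠ 0 := by exact_mod_cast (ne_of_gt hs : s ≠ 0)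
        have h1 : HasDerivAt (fun v : ℂ => v * s) (s : ℂ) v := by
          simpa using (hasDerivAt_id v).mul_const (s : ℂ)
        have h2 := (h1.cexp.sub_const (exp (q * s))).div_const (s : ℂ)
        rwa [mul_div_assoc, div_self hs', mul_one] at h2)
    have h3 := integral_exp_mul_complex_Ioi hz 0
    rw [ofReal_zero, mul_zero, exp_zero] at h3
    rw [← h3]
    exact key.2
  have hconst : ∀ z : ℂ, z.re < 0 → z * exp (F z) = q * exp (F q) := by
    intro z hz
    refine (convex_halfSpace_re_lt 0).is_const_of_fderivWithin_eq_zero (𝕜 := ℂ)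
      (f := fun z => z * exp (F z)) ?_ ?_ hz hq
    · intro y hy
      exact (differentiableAt_id.mul
        (hderiv y hy).differentiableAt.cexp).differentiableWithinAt
    · intro y hy
      have hy0 : y ≠ 0 := by rintro rfl; simp at hy
      have h1 : HasDerivAt (fun z => z * exp (F z))
          (1 * exp (F y) + id y * (exp (F y) * (-1 / y))) y :=
        (hasDerivAt_id y).mul (hderiv y hy).cexp
      have h2 : (1 * exp (F y) + id y * (exp (F y) * (-1 / y))) = 0 := by
        simp only [id]; field_simp; ring
      rw [h2] at h1
      have h3 : fderiv ℂ (fun z => z * exp (F z)) y = 0 := by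
        rw [h1.hasFDerivAt.fderiv]
        ext
        simp
      rw [fderivWithin_of_isOpen (isOpen_lt continuous_re continuous_const) hy, h3]
  have hq0 : F q = 0 := by simp [hF]
  have hp0 : p ≠ 0 := by rintro rfl; simp at hp
  have := hconst p hp
  rw [hq0, exp_zero, mul_one] at this
  rw [eq_div_iff hp0, mul_comm]
  exact this

/-! ### Contractions -/

/-- `Im w → -∞`. -/
def imBot : Filter ℂ := comap Complex.im atBot

theorem eventually_imBot {p : ℂ → Prop} :
    (∀ᶠ w in imBot, p w) ↔ ∃ C : ℝ, ∀ w : ℂ, w.im < -C → p w := by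
  rw [imBot, eventually_comap, eventually_atBot]
  constructor
  · rintro ⟨a, ha⟩
    exact ⟨-a, fun w hw => ha w.im (by linarith) w rfl⟩
  · rintro ⟨C, hC⟩
    exact ⟨-C - 1, fun b hb w hw => hC w (by rw [hw]; linarith)⟩

theorem eventually_imBot_add {p : ℂ → Prop} (a : ℂ) (h : ∀ᶠ w in imBot, p w) :
    ∀ᶠ w in imBot, p (w + a) := by
  rw [eventually_imBot] at *
  obtain ⟨C, hC⟩ := h
  exact ⟨C + |a.im|, fun w hw => hC _ (by rw [add_im]; linarith [le_abs_self a.im])⟩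

theorem eventually_imBot_lt (C : ℝ) : ∀ᶠ w in imBot, w.im < C :=
  eventually_imBot.2 ⟨-C, fun w hw => by linarith⟩

theorem eventually_imBot_ne (a : ℂ) : ∀ᶠ w in imBot, w + a ≠ 0 := by
  filter_upwards [eventually_imBot_lt (-a.im)] with w hw h0
  have := congrArg Complex.im h0
  simp at this
  linarith

theorem eventually_imBot_neg_ne (a : ℂ) : ∀ᶠ w in imBot, -w + a ≠ 0 := by
  filter_upwards [eventually_imBot_ne (-a)] with w hw h0
  exact hw (by linear_combination -h0)

/-- The exponentials `e^{ahs} e^{-iws} / s` out of which contractions are built. -/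
def expKernel (h : ℝ) (a w : ℂ) (s : ℝ) : ℂ := exp ((-I * w + a * h) * s) / s

/-- `exp ∫_0^∞ f w s ds = R w` as `Im w → -∞`. -/
def IntegratesTo (f : ℂ → ℝ → ℂ) (R : ℂ → ℂ) : Prop :=
  ∀ᶠ w in imBot, IntegrableOn (f w) (Set.Ioi 0) ∧ exp (∫ s in Set.Ioi 0, f w s) = R w

theorem IntegratesTo.zero : IntegratesTo (fun _ _ => 0) fun _ => 1 :=
  Eventually.of_forall fun w => ⟨integrableOn_zero, by simp⟩

theorem IntegratesTo.add {f g : ℂ → ℝ → ℂ} {R S : ℂ → ℂ} (hf : IntegratesTo f R)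
    (hg : IntegratesTo g S) : IntegratesTo (fun w s => f w s + g w s) fun w => R w * S w := by
  filter_upwards [hf, hg] with w h1 h2
  refine ⟨h1.1.add h2.1, ?_⟩
  rw [integral_add h1.1 h2.1, exp_add, h1.2, h2.2]

theorem IntegratesTo.comp_add {f : ℂ → ℝ → ℂ} {R : ℂ → ℂ} (hf : IntegratesTo f R) (a : ℂ) :
    IntegratesTo (fun w => f (w + a)) fun w => R (w + a) :=
  eventually_imBot_add a hf

theorem integratesTo_expKernel (h : ℝ) (a b : ℂ) :
    IntegratesTo (fun w s => expKernel h a w s - expKernel h b w s)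
      fun w => (w + b * (I * h)) / (w + a * (I * h)) := by
  filter_upwards [eventually_imBot_lt (-(a * h).re), eventually_imBot_lt (-(b * h).re),
    eventually_imBot_ne (a * (I * h))] with w h1 h2 h3
  have ha : (-I * w + a * h).re < 0 := by
    have : (-I * w).re = w.im := by simp
    rw [add_re, this]; linarith
  have hb : (-I * w + b * h).re < 0 := by
    have : (-I * w).re = w.im := by simp
    rw [add_re, this]; linarith
  have h4 : (fun s : ℝ => expKernel h a w s - expKernel h b w s)
      = fun s : ℝ => (exp ((-I * w + a * h) * s) - exp ((-I * w + b * h) * s)) / s := by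
    funext s; simp only [expKernel, sub_div]
  refine ⟨by rw [h4]; exact integrableOn_exp_sub_exp_div ha hb, ?_⟩
  rw [h4, exp_integral_exp_sub_exp_div ha hb]
  have e1 : -I * w + a * h = -I * (w + a * (I * h)) := by
    linear_combination (a * h) * I_sq
  have e2 : -I * w + b * h = -I * (w + b * (I * h)) := by
    linear_combination (b * h) * I_sq
  rw [e1, e2, mul_div_mul_left _ _ (neg_ne_zero.2 I_ne_zero)]

/-- The exponential of the contraction of `X u` with `Y v` is `R (u - v)` for `Im u` far below
`Im v`. -/
def HasContraction (N : ℕ) (H : Commutators) (X Y : ℂ → Exponent) (R : ℂ → ℂ) : Prop :=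
  ∃ f : ℂ → ℝ → ℂ, IntegratesTo f R ∧ ∀ u v s, 0 < s → con N H (X u) (Y v) s = f (u - v) s

theorem HasContraction.exists_bound {N : ℕ} {H : Commutators} {X Y : ℂ → Exponent} {R : ℂ → ℂ}
    (hXY : HasContraction N H X Y R) : ∀ᶠ w in imBot, ∀ u v, u - v = w →
      IntegrableOn (con N H (X u) (Y v)) (Set.Ioi 0) ∧
        exp (∫ s in Set.Ioi 0, con N H (X u) (Y v) s) = R w := by
  obtain ⟨f, hf, h⟩ := hXY
  filter_upwards [hf] with w hw u v huv
  have h1 : Set.EqOn (con N H (X u) (Y v)) (f w) (Set.Ioi 0) := fun s hs => by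
    rw [h u v s hs, huv]
  refine ⟨hw.1.congr_fun h1.symm measurableSet_Ioi, ?_⟩
  rw [setIntegral_congr_fun measurableSet_Ioi h1, hw.2]

/-! ### Exchange relations -/

section exchange

variable {N : ℕ} {H : Commutators} {ι κ : Type*}

/-- The current `∑ i ∈ S, a i :exp (X i u):`. -/
def current (N : ℕ) (H : Commutators) (S : Finset ι) (a : ι → ℂ) (X : ι → ℂ → Exponent) (u : ℂ) :
    Op :=
  ∑ i ∈ S, a i • normalExp N H (X i u)

theorem current_apply (S : Finset ι) (a : ι → ℂ) (X : ι → ℂ → Exponent) (u : ℂ) (Φ : State)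
    (ξ : Profile) :
    current N H S a X u Φ ξ = ∑ i ∈ S, a i * normalExp N H (X i u) Φ ξ := by
  simp [current, LinearMap.sum_apply, Finset.sum_apply]

theorem normalExp_current (S : Finset ι) (a : ι → ℂ) (X : ι → ℂ → Exponent) (u : ℂ) (Φ : State)
    (Y : Exponent) (ξ : Profile) :
    normalExp N H Y (current N H S a X u Φ) ξ
      = ∑ i ∈ S, a i * normalExp N H Y (normalExp N H (X i u) Φ) ξ := by
  simp [current, LinearMap.sum_apply, Finset.sum_apply]

theorem current_current (S : Finset ι) (T : Finset κ) (a : ι → ℂ) (b : κ → ℂ)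
    (X : ι → ℂ → Exponent) (Y : κ → ℂ → Exponent) (u v : ℂ) (Φ : State) (ξ : Profile) :
    current N H S a X u (current N H T b Y v Φ) ξ
      = ∑ i ∈ S, ∑ j ∈ T, a i * b j * normalExp N H (X i u) (normalExp N H (Y j v) Φ) ξ := by
  simp only [current_apply, normalExp_current, Finset.mul_sum, mul_assoc]

variable {S : Finset ι} {T : Finset κ} {a : ι → ℂ} {b : κ → ℂ}
  {X : ι → ℂ → Exponent} {Y : κ → ℂ → Exponent}

theorem normalExp_mul_of_integrable (hH : H.Regular) {X Y : ℂ → Exponent} (hX : IsVertex X)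
    (hY : IsVertex Y) {u v : ℂ} (hc : IntegrableOn (con N H (X u) (Y v)) (Set.Ioi 0))
    (Φ : State) {ξ : Profile} (hξ : ∀ m, IsSmearing (ξ m)) :
    normalExp N H (X u) (normalExp N H (Y v) Φ) ξ
      = exp (∫ s in Set.Ioi 0, con N H (X u) (Y v) s) * normalExp N H (X u + Y v) Φ ξ :=
  normalExp_mul Φ ((hX.isHolomorphic hH).integrable ξ hξ u)
    ((hY.isHolomorphic hH).integrable ξ hξ v) hc

/-- Two products of currents whose contractions have, after multiplication with `P` and `Q`,
the same form `n + c / (w - p)`, agree with one entire function up to polar parts. -/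
theorem exists_entire_add_polar (hH : H.Regular) {P Q : ℂ → ℂ}
    (hX : ∀ i ∈ S, IsVertex (X i)) (hY : ∀ j ∈ T, IsVertex (Y j))
    {R R' : ι → κ → ℂ → ℂ}
    (hR : ∀ i ∈ S, ∀ j ∈ T, HasContraction N H (X i) (Y j) (R i j))
    (hR' : ∀ i ∈ S, ∀ j ∈ T, HasContraction N H (Y j) (X i) (R' i j))
    {n : ι → κ → ℂ → ℂ} (hn : ∀ i ∈ S, ∀ j ∈ T, Differentiable ℂ (n i j)) (c p : ι → κ → ℂ)
    (hP : ∀ i ∈ S, ∀ j ∈ T, ∀ᶠ w in imBot, P w * R i j w = n i j w + c i j / (w - p i j))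
    (hQ : ∀ i ∈ S, ∀ j ∈ T, ∀ᶠ w in imBot,
      Q (-w) * R' i j w = n i j (-w) + c i j / (-w - p i j)) :
    ∃ C : ℝ, ∀ Φ ∈ fockSpace N, ∀ ξ : Profile, (∀ m, IsSmearing (ξ m)) → ∀ v : ℂ,
      ∃ G : ℂ → ℂ, Differentiable ℂ G ∧
      (∀ u : ℂ, u.im < v.im - C →
        P (u - v) * current N H S a X u (current N H T b Y v Φ) ξ
          = G u + ∑ i ∈ S, ∑ j ∈ T, a i * b j * (c i j / (u - v - p i j))
            * normalExp N H (X i (v + p i j) + Y j v) Φ ξ) ∧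
      (∀ u : ℂ, v.im + C < u.im →
        Q (u - v) * current N H T b Y v (current N H S a X u Φ) ξ
          = G u + ∑ i ∈ S, ∑ j ∈ T, a i * b j * (c i j / (u - v - p i j))
            * normalExp N H (X i (v + p i j) + Y j v) Φ ξ) := by
  have ev1 : ∀ᶠ w in imBot, ∀ i ∈ S, ∀ j ∈ T,
      (∀ u v, u - v = w → IntegrableOn (con N H (X i u) (Y j v)) (Set.Ioi 0) ∧
        exp (∫ s in Set.Ioi 0, con N H (X i u) (Y j v) s) = R i j w) ∧
      P w * R i j w = n i j w + c i j / (w - p i j) ∧ w - p i j ≠ 0 := by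
    rw [Finset.eventually_all]
    intro i hi
    rw [Finset.eventually_all]
    intro j hj
    filter_upwards [(hR i hi j hj).exists_bound, hP i hi j hj, eventually_imBot_ne (-p i j)]
      with w h1 h2 h3
    exact ⟨h1, h2, by rwa [sub_eq_add_neg]⟩
  have ev2 : ∀ᶠ w in imBot, ∀ i ∈ S, ∀ j ∈ T,
      (∀ u v, u - v = w → IntegrableOn (con N H (Y j u) (X i v)) (Set.Ioi 0) ∧
        exp (∫ s in Set.Ioi 0, con N H (Y j u) (X i v) s) = R' i j w) ∧
      Q (-w) * R' i j w = n i j (-w) + c i j / (-w - p i j) ∧ -w - p i j ≠ 0 := by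
    rw [Finset.eventually_all]
    intro i hi
    rw [Finset.eventually_all]
    intro j hj
    filter_upwards [(hR' i hi j hj).exists_bound, hQ i hi j hj, eventually_imBot_neg_ne (-p i j)]
      with w h1 h2 h3
    exact ⟨h1, h2, by rwa [sub_eq_add_neg]⟩
  obtain ⟨C1, hC1⟩ := eventually_imBot.1 ev1
  obtain ⟨C2, hC2⟩ := eventually_imBot.1 ev2
  refine ⟨max C1 C2, fun Φ hΦ ξ hξ v => ?_⟩
  set F : ι → κ → ℂ → ℂ := fun i j u => normalExp N H (X i u + Y j v) Φ ξ with hF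
  have hFd : ∀ i ∈ S, ∀ j ∈ T, Differentiable ℂ (F i j) := fun i hi j hj =>
    IsHolomorphic.normalExp (((hX i hi).isHolomorphic hH).add
      (((hY j hj).isHolomorphic hH).comp (differentiable_const v))) hΦ hξ
  refine ⟨fun u => ∑ i ∈ S, ∑ j ∈ T, a i * b j *
    (n i j (u - v) * F i j u + c i j * dslope (F i j) (v + p i j) u), ?_, ?_, ?_⟩
  · refine Differentiable.fun_sum fun i hi => Differentiable.fun_sum fun j hj => ?_
    refine (Differentiable.add ?_ ?_).const_mul _
    · exact ((hn i hi j hj).comp (differentiable_id.sub_const v)).mul (hFd i hi j hj)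
    · refine Differentiable.const_mul ?_ _
      rw [← differentiableOn_univ, Complex.differentiableOn_dslope univ_mem]
      exact (hFd i hi j hj).differentiableOn
  · intro u hu
    rw [current_current, Finset.mul_sum, ← Finset.sum_add_distrib]
    refine Finset.sum_congr rfl fun i hi => ?_
    rw [Finset.mul_sum, ← Finset.sum_add_distrib]
    refine Finset.sum_congr rfl fun j hj => ?_
    obtain ⟨h1, h2, h3⟩ := hC1 (u - v) (by rw [sub_im]; linarith [le_max_left C1 C2]) i hi j hj
    obtain ⟨h4, h5⟩ := h1 u v rfl
    have h6 : u ≠ v + p i j := fun h => h3 (by rw [h]; ring)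
    rw [normalExp_mul_of_integrable hH (hX i hi) (hY j hj) h4 Φ hξ, h5, dslope_of_ne _ h6,
      slope_def_field]
    have h7 : u - (v + p i j) = u - v - p i j := by ring
    rw [h7]
    simp only [hF]
    generalize normalExp N H (X i u + Y j v) Φ ξ = f at *
    generalize normalExp N H (X i (v + p i j) + Y j v) Φ ξ = f' at *
    have h8 : P (u - v) * (a i * b j * (R i j (u - v) * f))
      = a i * b j * (P (u - v) * R i j (u - v)) * f := by ring
    rw [h8, h2]
    field_simp
    ring
  · intro u hu
    rw [current_current, Finset.sum_comm, Finset.mul_sum, ← Finset.sum_add_distrib]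
    refine Finset.sum_congr rfl fun i hi => ?_
    rw [Finset.mul_sum, ← Finset.sum_add_distrib]
    refine Finset.sum_congr rfl fun j hj => ?_
    obtain ⟨h1, h2, h3⟩ := hC2 (v - u) (by rw [sub_im]; linarith [le_max_right C1 C2]) i hi j hj
    obtain ⟨h4, h5⟩ := h1 v u rfl
    rw [neg_sub] at h2 h3
    have h6 : u ≠ v + p i j := fun h => h3 (by rw [h]; ring)
    rw [normalExp_mul_of_integrable hH (hY j hj) (hX i hi) h4 Φ hξ, h5, dslope_of_ne _ h6,
      slope_def_field, add_comm (Y j v)]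
    have h7 : u - (v + p i j) = u - v - p i j := by ring
    rw [h7]
    simp only [hF]
    generalize normalExp N H (X i u + Y j v) Φ ξ = f at *
    generalize normalExp N H (X i (v + p i j) + Y j v) Φ ξ = f' at *
    have h8 : Q (u - v) * (b j * a i * (R' i j (v - u) * f))
      = a i * b j * (Q (u - v) * R' i j (v - u)) * f := by ring
    rw [h8, h2]
    field_simp
    ring

end exchange

section relations

variable {N : ℕ} {H : Commutators} {ι κ : Type*} {S : Finset ι} {T : Finset κ}
  {a : ι → ℂ} {b : κ → ℂ} {X : ι → ℂ → Exponent} {Y : κ → ℂ → Exponent} {Du : Set Profile}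

theorem exchange_of_polar_eq_zero (hH : H.Regular) (hDu : ∀ ξ ∈ Du, ∀ m, IsSmearing (ξ m))
    {P Q : ℂ → ℂ}
    (hX : ∀ i ∈ S, IsVertex (X i)) (hY : ∀ j ∈ T, IsVertex (Y j))
    {R R' : ι → κ → ℂ → ℂ}
    (hR : ∀ i ∈ S, ∀ j ∈ T, HasContraction N H (X i) (Y j) (R i j))
    (hR' : ∀ i ∈ S, ∀ j ∈ T, HasContraction N H (Y j) (X i) (R' i j))
    {n : ι → κ → ℂ → ℂ} (hn : ∀ i ∈ S, ∀ j ∈ T, Differentiable ℂ (n i j)) (c p : ι → κ → ℂ)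
    (hP : ∀ i ∈ S, ∀ j ∈ T, ∀ᶠ w in imBot, P w * R i j w = n i j w + c i j / (w - p i j))
    (hQ : ∀ i ∈ S, ∀ j ∈ T, ∀ᶠ w in imBot,
      Q (-w) * R' i j w = n i j (-w) + c i j / (-w - p i j))
    (hpol : ∀ Φ ξ v w, ∑ i ∈ S, ∑ j ∈ T, a i * b j * (c i j / (w - p i j))
      * normalExp N H (X i (v + p i j) + Y j v) Φ ξ = 0) :
    Exchange (fockSpace N) Du P Q (current N H S a X) (current N H T b Y) := by
  obtain ⟨C, hC⟩ := exists_entire_add_polar (a := a) (b := b) hH hX hY hR hR' hn c p hP hQ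
  refine ⟨C, fun Φ hΦ ξ hξ v => ?_⟩
  obtain ⟨G, hG, h1, h2⟩ := hC Φ hΦ ξ (hDu ξ hξ) v
  simp only [hpol, add_zero] at h1 h2
  exact ⟨G, hG, h1, h2⟩

theorem exchange_of_entire (hH : H.Regular) (hDu : ∀ ξ ∈ Du, ∀ m, IsSmearing (ξ m))
    {P Q : ℂ → ℂ}
    (hX : ∀ i ∈ S, IsVertex (X i)) (hY : ∀ j ∈ T, IsVertex (Y j))
    {R R' : ι → κ → ℂ → ℂ}
    (hR : ∀ i ∈ S, ∀ j ∈ T, HasContraction N H (X i) (Y j) (R i j))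
    (hR' : ∀ i ∈ S, ∀ j ∈ T, HasContraction N H (Y j) (X i) (R' i j))
    {n : ι → κ → ℂ → ℂ} (hn : ∀ i ∈ S, ∀ j ∈ T, Differentiable ℂ (n i j))
    (hP : ∀ i ∈ S, ∀ j ∈ T, ∀ᶠ w in imBot, P w * R i j w = n i j w)
    (hQ : ∀ i ∈ S, ∀ j ∈ T, ∀ᶠ w in imBot, Q (-w) * R' i j w = n i j (-w)) :
    Exchange (fockSpace N) Du P Q (current N H S a X) (current N H T b Y) :=
  exchange_of_polar_eq_zero hH hDu hX hY hR hR' hn (fun _ _ => 0) (fun _ _ => 0)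
    (by simpa using hP) (by simpa using hQ) (by simp)

theorem deltaCommutator_of_polar_eq (hH : H.Regular) (hDu : ∀ ξ ∈ Du, ∀ m, IsSmearing (ξ m))
    (hX : ∀ i ∈ S, IsVertex (X i)) (hY : ∀ j ∈ T, IsVertex (Y j))
    {R R' : ι → κ → ℂ → ℂ}
    (hR : ∀ i ∈ S, ∀ j ∈ T, HasContraction N H (X i) (Y j) (R i j))
    (hR' : ∀ i ∈ S, ∀ j ∈ T, HasContraction N H (Y j) (X i) (R' i j))
    (c p : ι → κ → ℂ)
    (hP : ∀ i ∈ S, ∀ j ∈ T, ∀ᶠ w in imBot, R i j w = 1 + c i j / (w - p i j))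
    (hQ : ∀ i ∈ S, ∀ j ∈ T, ∀ᶠ w in imBot, R' i j w = 1 + c i j / (-w - p i j))
    {Z W : ℂ → Exponent} (hZ : IsVertex Z) {r d : ℂ}
    (hpol : ∀ Φ ξ v w, ∑ i ∈ S, ∑ j ∈ T, a i * b j * (c i j / (w - p i j))
      * normalExp N H (X i (v + p i j) + Y j v) Φ ξ
      = r * (normalExp N H (Z (v + d)) Φ ξ / (w - d) - normalExp N H (W v) Φ ξ / w)) :
    DeltaCommutator (fockSpace N) Du r d (current N H S a X) (current N H T b Y)
      (fun u => normalExp N H (Z u)) (fun v => normalExp N H (W v)) := by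
  obtain ⟨C, hC⟩ := exists_entire_add_polar (a := a) (b := b) (P := fun _ => 1) (Q := fun _ => 1)
    hH hX hY hR hR' (n := fun _ _ _ => 1) (fun _ _ _ _ => differentiable_const _) c p
    (by simpa using hP) (by simpa using hQ)
  refine ⟨max C |d.im|, fun Φ hΦ ξ hξ v => ?_⟩
  obtain ⟨G, hG, h1, h2⟩ := hC Φ hΦ ξ (hDu ξ hξ) v
  simp only [hpol, one_mul] at h1 h2
  have hF : Differentiable ℂ fun u => normalExp N H (Z u) Φ ξ :=
    (hZ.isHolomorphic hH).normalExp hΦ (hDu ξ hξ)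
  have key : ∀ u, u ≠ v + d →
      r * (normalExp N H (Z (v + d)) Φ ξ / (u - v - d) - normalExp N H (W v) Φ ξ / (u - v))
      = -r * dslope (fun u => normalExp N H (Z u) Φ ξ) (v + d) u
        + r * (normalExp N H (Z u) Φ ξ / (u - v - d) - normalExp N H (W v) Φ ξ / (u - v)) := by
    intro u hu
    rw [dslope_of_ne _ hu, slope_def_field, ← sub_sub]
    ring
  refine ⟨fun u => G u + -r * dslope (fun u => normalExp N H (Z u) Φ ξ) (v + d) u,
    hG.add (Differentiable.const_mul ?_ _), fun u hu => ?_, fun u hu => ?_⟩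
  · rw [← differentiableOn_univ, Complex.differentiableOn_dslope univ_mem]
    exact hF.differentiableOn
  · rw [h1 u (by linarith [le_max_left C |d.im|]), key, add_assoc]
    rintro rfl
    rw [add_im] at hu
    linarith [le_max_right C |d.im|, neg_abs_le d.im]
  · rw [h2 u (by linarith [le_max_left C |d.im|]), key, add_assoc]
    rintro rfl
    rw [add_im] at hu
    linarith [le_max_right C |d.im|, le_abs_self d.im]

/-! ### Change of normalization -/

variable {Fo : Set State} {P Q : ℂ → ℂ} {A B : ℂ → Op}

theorem Exchange.smul (hAB : Exchange Fo Du P Q A B) (c d : ℂ) :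
    Exchange Fo Du P Q (fun u => c • A u) fun v => d • B v := by
  obtain ⟨C, hC⟩ := hAB
  refine ⟨C, fun Φ hΦ ξ hξ v => ?_⟩
  obtain ⟨G, hG, h1, h2⟩ := hC Φ hΦ ξ hξ v
  refine ⟨fun u => c * d * G u, hG.const_mul _, fun u hu => ?_, fun u hu => ?_⟩
  · beta_reduce
    rw [← h1 u hu]
    simp only [LinearMap.smul_apply, map_smul, Pi.smul_apply, smul_eq_mul]
    ring
  · beta_reduce
    rw [← h2 u hu]
    simp only [LinearMap.smul_apply, map_smul, Pi.smul_apply, smul_eq_mul]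
    ring

theorem Exchange.mul_coeff (hAB : Exchange Fo Du P Q A B) {p : ℂ → ℂ}
    (hp : Differentiable ℂ p) :
    Exchange Fo Du (fun w => p w * P w) (fun w => p w * Q w) A B := by
  obtain ⟨C, hC⟩ := hAB
  refine ⟨C, fun Φ hΦ ξ hξ v => ?_⟩
  obtain ⟨G, hG, h1, h2⟩ := hC Φ hΦ ξ hξ v
  refine ⟨fun u => p (u - v) * G u, (hp.comp (differentiable_id.sub_const v)).mul hG,
    fun u hu => ?_, fun u hu => ?_⟩
  · beta_reduce
    rw [← h1 u hu, mul_assoc]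
  · beta_reduce
    rw [← h2 u hu, mul_assoc]

theorem Exchange.comp_add (hAB : Exchange Fo Du P Q A B) (a b : ℂ) {P' Q' : ℂ → ℂ}
    (hP : ∀ w, P' w = P (w + a - b)) (hQ : ∀ w, Q' w = Q (w + a - b)) :
    Exchange Fo Du P' Q' (fun u => A (u + a)) fun v => B (v + b) := by
  obtain ⟨C, hC⟩ := hAB
  refine ⟨C + |(a - b).im|, fun Φ hΦ ξ hξ v => ?_⟩
  obtain ⟨G, hG, h1, h2⟩ := hC Φ hΦ ξ hξ (v + b)
  have e : ∀ u, u - v + a - b = u + a - (v + b) := fun u => by ring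
  refine ⟨fun u => G (u + a), hG.comp (differentiable_id.add_const a), fun u hu => ?_,
    fun u hu => ?_⟩
  · beta_reduce
    rw [← h1 (u + a), hP, e]
    rw [add_im, add_im]
    linarith [le_abs_self (a - b).im, sub_im a b]
  · beta_reduce
    rw [← h2 (u + a), hQ, e]
    rw [add_im, add_im]
    linarith [neg_abs_le (a - b).im, sub_im a b]

theorem DeltaCommutator.rescale {r d : ℂ} {Z W : ℂ → Op}
    (hAB : DeltaCommutator Fo Du r d A B Z W) (c c' a r' : ℂ) {Z' W' : ℂ → Op}
    (hr : r' = c * c' * r) (hZ : ∀ u, Z' u = Z (u + a)) (hW : ∀ u, W' u = W (u + a)) :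
    DeltaCommutator Fo Du r' d (fun u => c • A (u + a)) (fun v => c' • B (v + a)) Z' W' := by
  obtain ⟨C, hC⟩ := hAB
  refine ⟨C, fun Φ hΦ ξ hξ v => ?_⟩
  obtain ⟨G, hG, h1, h2⟩ := hC Φ hΦ ξ hξ (v + a)
  have e : ∀ u, u + a - (v + a) = u - v := fun u => by ring
  refine ⟨fun u => c * c' * G (u + a), (hG.comp (differentiable_id.add_const a)).const_mul _,
    fun u hu => ?_, fun u hu => ?_⟩
  · have := h1 (u + a) (by rw [add_im, add_im]; linarith)
    rw [e] at this
    simp only [LinearMap.smul_apply, map_smul, Pi.smul_apply, smul_eq_mul, this, hr, hZ, hW]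
    ring
  · have := h2 (u + a) (by rw [add_im, add_im]; linarith)
    rw [e] at this
    simp only [LinearMap.smul_apply, map_smul, Pi.smul_apply, smul_eq_mul, this, hr, hZ, hW]
    ring

theorem Continues.rescale {C : ℝ} {x y z : ℂ × ℂ × ℂ → ℂ} {f D G : ℂ × ℂ × ℂ → ℂ}
    (h : Continues C x y z f D G) {τ : ℂ × ℂ × ℂ → ℂ × ℂ × ℂ} {C' : ℝ} {r : ℂ}
    {x' y' z' : ℂ × ℂ × ℂ → ℂ} {f' : ℂ × ℂ × ℂ → ℂ}
    (hxy : ∀ p, (x' p).im < (y' p).im - C' → (x (τ p)).im < (y (τ p)).im - C)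
    (hyz : ∀ p, (y' p).im < (z' p).im - C' → (y (τ p)).im < (z (τ p)).im - C)
    (hf : ∀ p, f' p = r * f (τ p)) :
    Continues C' x' y' z' f' (fun p => D (τ p)) fun p => r * G (τ p) := by
  intro p h1 h2
  beta_reduce
  rw [hf, ← h (τ p) (hxy p h1) (hyz p h2)]
  ring

theorem Serre.rescale (hAB : Serre Fo Du A B) (c d a b : ℂ) :
    Serre Fo Du (fun u => c • A (u + a)) fun v => d • B (v + b) := by
  obtain ⟨C, D, hD, hD0, h⟩ := hAB
  set τ : ℂ × ℂ × ℂ → ℂ × ℂ × ℂ := fun p => (p.1 + a, p.2.1 + a, p.2.2 + b) with hτ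
  have hτd : Differentiable ℂ τ := by fun_prop
  refine ⟨C + |(a - b).im|, fun p => D (τ p), hD.comp hτd, fun h0 => hD0 ?_,
    fun Φ hΦ ξ hξ => ?_⟩
  · funext p
    have := congrFun h0 (p.1 - a, p.2.1 - a, p.2.2 - b)
    simpa [hτ] using this
  obtain ⟨G, hG, c0, c1, c2, c3, c4, c5, hsum⟩ := h Φ hΦ ξ hξ
  have i1 := le_abs_self (a - b).im
  have i2 := neg_abs_le (a - b).im
  have i3 := sub_im a b
  have i4 := abs_nonneg (a - b).im
  refine ⟨fun j p => c * c * d * G j (τ p), fun j => ((hG j).comp hτd).const_mul _,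
    c0.rescale (fun p hp => ?_) (fun p hp => ?_) (fun p => ?_),
    c1.rescale (fun p hp => ?_) (fun p hp => ?_) (fun p => ?_),
    c2.rescale (fun p hp => ?_) (fun p hp => ?_) (fun p => ?_),
    c3.rescale (fun p hp => ?_) (fun p hp => ?_) (fun p => ?_),
    c4.rescale (fun p hp => ?_) (fun p hp => ?_) (fun p => ?_),
    c5.rescale (fun p hp => ?_) (fun p hp => ?_) (fun p => ?_), fun p => ?_⟩
  all_goals try (simp only [hτ, add_im] at hp ⊢; linarith)
  all_goals try (simp only [hτ, LinearMap.smul_apply, map_smul, Pi.smul_apply, smul_eq_mul]; ring1)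
  beta_reduce
  have := hsum (τ p)
  linear_combination (c * c * d) * this

/-! ### Serre relations -/

theorem eq_zero_of_affine_mul_eq_zero {Z : ℂ × ℂ × ℂ → ℂ} (hZ : Continuous Z)
    {l : ℂ × ℂ × ℂ → ℂ} (d : ℂ × ℂ × ℂ) (hl : ∀ p (t : ℂ), l (p + t • d) = l p + t)
    (h : ∀ p, l p * Z p = 0) (p : ℂ × ℂ × ℂ) : Z p = 0 := by
  have h1 : Set.EqOn (fun t : ℂ => Z (p + t • d)) (fun _ => 0) {-l p}ᶜ := by
    intro t ht
    have h2 := h (p + t • d)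
    rw [hl] at h2
    rcases mul_eq_zero.1 h2 with h3 | h3
    · exact absurd (Set.mem_singleton_iff.2 (by linear_combination h3)) ht
    · exact h3
  have h2 := Continuous.ext_on (dense_compl_singleton (-l p)) (by fun_prop) (by fun_prop) h1
  simpa using congrFun h2 0

theorem current_current_current {α β γ : Type*} (S₁ : Finset α) (S₂ : Finset β) (S₃ : Finset γ)
    (a₁ : α → ℂ) (a₂ : β → ℂ) (a₃ : γ → ℂ) (X₁ : α → ℂ → Exponent) (X₂ : β → ℂ → Exponent)
    (X₃ : γ → ℂ → Exponent) (x y z : ℂ) (Φ : State) (ξ : Profile) :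
    current N H S₁ a₁ X₁ x (current N H S₂ a₂ X₂ y (current N H S₃ a₃ X₃ z Φ)) ξ
      = ∑ i ∈ S₁, ∑ j ∈ S₂, ∑ l ∈ S₃, a₁ i * a₂ j * a₃ l *
        normalExp N H (X₁ i x) (normalExp N H (X₂ j y) (normalExp N H (X₃ l z) Φ)) ξ := by
  rw [current_current]
  refine Finset.sum_congr rfl fun i _ => Finset.sum_congr rfl fun j _ => ?_
  have : normalExp N H (X₁ i x) (normalExp N H (X₂ j y) (current N H S₃ a₃ X₃ z Φ)) ξ
      = ∑ l ∈ S₃, a₃ l *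
        normalExp N H (X₁ i x) (normalExp N H (X₂ j y) (normalExp N H (X₃ l z) Φ)) ξ := by
    simp [current, LinearMap.sum_apply, Finset.sum_apply]
  rw [this, Finset.mul_sum]
  exact Finset.sum_congr rfl fun l _ => by ring

theorem exists_contraction_bound {R : ι → κ → ℂ → ℂ} {D : ℂ → ℂ} {n : ι → κ → ℂ → ℂ}
    (hR : ∀ i ∈ S, ∀ j ∈ T, HasContraction N H (X i) (Y j) (R i j))
    (hDR : ∀ i ∈ S, ∀ j ∈ T, ∀ᶠ w in imBot, D w * R i j w = n i j w) :
    ∃ C : ℝ, ∀ i ∈ S, ∀ j ∈ T, ∀ u v : ℂ, u.im < v.im - C →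
      IntegrableOn (con N H (X i u) (Y j v)) (Set.Ioi 0) ∧
        D (u - v) * exp (∫ s in Set.Ioi 0, con N H (X i u) (Y j v) s) = n i j (u - v) := by
  have ev : ∀ᶠ w in imBot, ∀ i ∈ S, ∀ j ∈ T, ∀ u v, u - v = w →
      IntegrableOn (con N H (X i u) (Y j v)) (Set.Ioi 0) ∧
        D w * exp (∫ s in Set.Ioi 0, con N H (X i u) (Y j v) s) = n i j w := by
    rw [Finset.eventually_all]
    intro i hi
    rw [Finset.eventually_all]
    intro j hj
    filter_upwards [(hR i hi j hj).exists_bound, hDR i hi j hj] with w h1 h2 u v huv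
    obtain ⟨h3, h4⟩ := h1 u v huv
    exact ⟨h3, by rw [h4, h2]⟩
  obtain ⟨C, hC⟩ := eventually_imBot.1 ev
  exact ⟨C, fun i hi j hj u v huv => hC (u - v) (by rw [sub_im]; linarith) i hi j hj u v rfl⟩

theorem normalExp_mul_mul_of_integrable (hH : H.Regular) {X Y Z : ℂ → Exponent}
    (hX : IsVertex X) (hY : IsVertex Y) (hZ : IsVertex Z) {x y z : ℂ}
    (hxy : IntegrableOn (con N H (X x) (Y y)) (Set.Ioi 0))
    (hxz : IntegrableOn (con N H (X x) (Z z)) (Set.Ioi 0))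
    (hyz : IntegrableOn (con N H (Y y) (Z z)) (Set.Ioi 0))
    (Φ : State) {ξ : Profile} (hξ : ∀ m, IsSmearing (ξ m)) :
    normalExp N H (X x) (normalExp N H (Y y) (normalExp N H (Z z) Φ)) ξ
      = exp (∫ s in Set.Ioi 0, con N H (X x) (Y y) s) * exp (∫ s in Set.Ioi 0, con N H (X x) (Z z) s)
        * exp (∫ s in Set.Ioi 0, con N H (Y y) (Z z) s)
        * normalExp N H (X x + Y y + Z z) Φ ξ :=
  normalExp_mul_mul Φ ((hX.isHolomorphic hH).integrable ξ hξ x)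
    ((hY.isHolomorphic hH).integrable ξ hξ y) ((hZ.isHolomorphic hH).integrable ξ hξ z) hxy hxz hyz

/-- The Serre relations follow from the exchange relations
`(w + ε) A(u₁) A(u₂) = (w - ε) A(u₂) A(u₁)` and `(w + σ - ε) A(u) B(v) = (w + σ) B(v) A(u)`
between the terms of two currents with rational contractions. -/
theorem serre_current (hH : H.Regular) (hDu : ∀ ξ ∈ Du, ∀ m, IsSmearing (ξ m))
    (hX : ∀ i ∈ S, IsVertex (X i)) (hY : ∀ j ∈ T, IsVertex (Y j))
    {R : ι → ι → ℂ → ℂ} {R₁ : ι → κ → ℂ → ℂ} {R₂ : κ → ι → ℂ → ℂ}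
    (hR : ∀ i ∈ S, ∀ j ∈ S, HasContraction N H (X i) (X j) (R i j))
    (hR₁ : ∀ i ∈ S, ∀ l ∈ T, HasContraction N H (X i) (Y l) (R₁ i l))
    (hR₂ : ∀ l ∈ T, ∀ i ∈ S, HasContraction N H (Y l) (X i) (R₂ l i))
    {D D₁ D₂ : ℂ → ℂ} {n : ι → ι → ℂ → ℂ} {n₁ : ι → κ → ℂ → ℂ} {n₂ : κ → ι → ℂ → ℂ}
    (hD : Differentiable ℂ D) (hD₁ : Differentiable ℂ D₁) (hD₂ : Differentiable ℂ D₂)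
    (hn : ∀ i ∈ S, ∀ j ∈ S, Differentiable ℂ (n i j))
    (hn₁ : ∀ i ∈ S, ∀ l ∈ T, Differentiable ℂ (n₁ i l))
    (hn₂ : ∀ l ∈ T, ∀ i ∈ S, Differentiable ℂ (n₂ l i))
    (h0 : ∃ w₁ w₂ : ℂ, D (w₁ - w₂) ≠ 0 ∧ D (-(w₁ - w₂)) ≠ 0 ∧ D₁ w₁ ≠ 0 ∧ D₁ w₂ ≠ 0 ∧
      D₂ (-w₁) ≠ 0 ∧ D₂ (-w₂) ≠ 0)
    (hDR : ∀ i ∈ S, ∀ j ∈ S, ∀ᶠ w in imBot, D w * R i j w = n i j w)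
    (hDR₁ : ∀ i ∈ S, ∀ l ∈ T, ∀ᶠ w in imBot, D₁ w * R₁ i l w = n₁ i l w)
    (hDR₂ : ∀ l ∈ T, ∀ i ∈ S, ∀ᶠ w in imBot, D₂ w * R₂ l i w = n₂ l i w)
    {ε σ : ℂ}
    (hex : ∀ i ∈ S, ∀ j ∈ S, ∀ w, (w + ε) * (n i j w * D (-w)) = (w - ε) * (n j i (-w) * D w))
    (hex' : ∀ i ∈ S, ∀ l ∈ T, ∀ w,
      (w + σ - ε) * (n₁ i l w * D₂ (-w)) = (w + σ) * (n₂ l i (-w) * D₁ w)) :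
    Serre (fockSpace N) Du (current N H S a X) (current N H T b Y) := by
  obtain ⟨C, hC⟩ := exists_contraction_bound hR hDR
  obtain ⟨C₁, hC₁⟩ := exists_contraction_bound hR₁ hDR₁
  obtain ⟨C₂, hC₂⟩ := exists_contraction_bound hR₂ hDR₂
  set C₀ := max (max C C₁) (max C₂ 0) with hC₀
  have l1 : C ≤ C₀ := (le_max_left _ _).trans (le_max_left _ _)
  have l2 : C₁ ≤ C₀ := (le_max_right _ _).trans (le_max_left _ _)
  have l3 : C₂ ≤ C₀ := (le_max_left _ _).trans (le_max_right _ _)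
  have l4 : 0 ≤ C₀ := (le_max_right _ _).trans (le_max_right _ _)
  set x : ι → κ → ℂ → ℂ := fun i l w => n₁ i l w * D₂ (-w) with hx
  set y : ι → κ → ℂ → ℂ := fun i l w => n₂ l i (-w) * D₁ w with hy
  set z : ι → ι → ℂ → ℂ := fun i j w => n i j w * D (-w) with hz
  have hxd : ∀ i ∈ S, ∀ l ∈ T, Differentiable ℂ (x i l) := fun i hi l hl =>
    (hn₁ i hi l hl).mul (hD₂.comp differentiable_neg)
  have hyd : ∀ i ∈ S, ∀ l ∈ T, Differentiable ℂ (y i l) := fun i hi l hl =>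
    ((hn₂ l hl i hi).comp differentiable_neg).mul hD₁
  have hzd : ∀ i ∈ S, ∀ j ∈ S, Differentiable ℂ (z i j) := fun i hi j hj =>
    (hn i hi j hj).mul (hD.comp differentiable_neg)
  set D₀ : ℂ × ℂ × ℂ → ℂ := fun p => D (p.1 - p.2.1) * D (-(p.1 - p.2.1)) * (D₁ (p.1 - p.2.2)
    * D₁ (p.2.1 - p.2.2)) * (D₂ (-(p.1 - p.2.2)) * D₂ (-(p.2.1 - p.2.2))) with hD₀
  let cf : Fin 6 → ι → ι → κ → ℂ × ℂ × ℂ → ℂ := fun r i j l p =>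
    (![z i j (p.1 - p.2.1) * x i l (p.1 - p.2.2) * x j l (p.2.1 - p.2.2),
      z i j (p.1 - p.2.1) * x i l (p.1 - p.2.2) * y j l (p.2.1 - p.2.2),
      z i j (p.1 - p.2.1) * y i l (p.1 - p.2.2) * y j l (p.2.1 - p.2.2),
      z j i (-(p.1 - p.2.1)) * x i l (p.1 - p.2.2) * x j l (p.2.1 - p.2.2),
      z j i (-(p.1 - p.2.1)) * y i l (p.1 - p.2.2) * x j l (p.2.1 - p.2.2),
      z j i (-(p.1 - p.2.1)) * y i l (p.1 - p.2.2) * y j l (p.2.1 - p.2.2)] : Fin 6 → ℂ) r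
  refine ⟨C₀, D₀, by fun_prop, ?_, fun Φ hΦ ξ hξ => ?_⟩
  · obtain ⟨w₁, w₂, e1, e2, e3, e4, e5, e6⟩ := h0
    intro h
    have := congrFun h (w₁, w₂, 0)
    simp only [hD₀, sub_zero, Pi.zero_apply, mul_eq_zero, e1, e2, e3, e4, e5, e6, or_self] at this
  have hξ' := hDu ξ hξ
  set F : ι → ι → κ → ℂ × ℂ × ℂ → ℂ := fun i j l p =>
    normalExp N H (X i p.1 + X j p.2.1 + Y l p.2.2) Φ ξ with hF
  have hFd : ∀ i ∈ S, ∀ j ∈ S, ∀ l ∈ T, Differentiable ℂ (F i j l) := fun i hi j hj l hl =>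
    IsHolomorphic.normalExp (((((hX i hi).isHolomorphic hH).comp differentiable_fst).add
      (((hX j hj).isHolomorphic hH).comp (differentiable_fst.comp differentiable_snd))).add
      (((hY l hl).isHolomorphic hH).comp (differentiable_snd.comp differentiable_snd))) hΦ hξ'
  have hcf : ∀ i ∈ S, ∀ j ∈ S, ∀ l ∈ T, ∀ r, Differentiable ℂ (cf r i j l) := by
    intro i hi j hj l hl r
    have d1 := hzd i hi j hj
    have d2 := hzd j hj i hi
    have d3 := hxd i hi l hl
    have d4 := hxd j hj l hl
    have d5 := hyd i hi l hl
    have d6 := hyd j hj l hl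
    fin_cases r <;>
    · simp only [cf, Fin.zero_eta, Fin.mk_one, Fin.reduceFinMk, Matrix.cons_val]
      fun_prop
  refine ⟨fun r p => ∑ i ∈ S, ∑ j ∈ S, ∑ l ∈ T, a i * a j * b l * (cf r i j l p * F i j l p),
    fun r => ?_, ?_, ?_, ?_, ?_, ?_, ?_, fun p => ?_⟩
  · exact Differentiable.fun_sum fun i hi => Differentiable.fun_sum fun j hj =>
      Differentiable.fun_sum fun l hl =>
        ((hcf i hi j hj l hl r).mul (hFd i hi j hj l hl)).const_mul _
  · intro p hp1 hp2
    beta_reduce at hp1 hp2 ⊢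
    rw [current_current_current]
    simp only [Finset.mul_sum]
    refine Finset.sum_congr rfl fun i hi => Finset.sum_congr rfl fun j hj =>
      Finset.sum_congr rfl fun l hl => ?_
    obtain ⟨i1, e1⟩ := hC i hi j hj p.1 p.2.1 (by linarith)
    obtain ⟨i2, e2⟩ := hC₁ i hi l hl p.1 p.2.2 (by linarith)
    obtain ⟨i3, e3⟩ := hC₁ j hj l hl p.2.1 p.2.2 (by linarith)
    rw [normalExp_mul_mul_of_integrable hH (hX i hi) (hX j hj) (hY l hl) i1 i2 i3 Φ hξ']
    simp only [hD₀, cf, Matrix.cons_val, hx, hy, hz, hF, ← e1, ← e2, ← e3]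
    ring
  · intro p hp1 hp2
    beta_reduce at hp1 hp2 ⊢
    rw [current_current_current]
    simp only [Finset.mul_sum]
    refine Finset.sum_congr rfl fun i hi => ?_
    rw [Finset.sum_comm]
    refine Finset.sum_congr rfl fun j hj => Finset.sum_congr rfl fun l hl => ?_
    obtain ⟨i1, e1⟩ := hC i hi j hj p.1 p.2.1 (by linarith)
    obtain ⟨i2, e2⟩ := hC₁ i hi l hl p.1 p.2.2 (by linarith)
    obtain ⟨i3, e3⟩ := hC₂ l hl j hj p.2.2 p.2.1 (by linarith)
    rw [normalExp_mul_mul_of_integrable hH (hX i hi) (hY l hl) (hX j hj) i2 i1 i3 Φ hξ',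
      add_right_comm]
    simp only [hD₀, cf, Matrix.cons_val, hx, hy, hz, hF, neg_sub, ← e1, ← e2, ← e3]
    ring
  · intro p hp1 hp2
    beta_reduce at hp1 hp2 ⊢
    rw [current_current_current]
    simp only [Finset.mul_sum]
    rw [Finset.sum_comm]
    refine Finset.sum_congr rfl fun i hi => ?_
    rw [Finset.sum_comm]
    refine Finset.sum_congr rfl fun j hj => Finset.sum_congr rfl fun l hl => ?_
    obtain ⟨i1, e1⟩ := hC i hi j hj p.1 p.2.1 (by linarith)
    obtain ⟨i2, e2⟩ := hC₂ l hl i hi p.2.2 p.1 (by linarith)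
    obtain ⟨i3, e3⟩ := hC₂ l hl j hj p.2.2 p.2.1 (by linarith)
    rw [normalExp_mul_mul_of_integrable hH (hY l hl) (hX i hi) (hX j hj) i2 i3 i1 Φ hξ',
      add_assoc, add_comm (Y l p.2.2)]
    simp only [hD₀, cf, Matrix.cons_val, hx, hy, hz, hF, neg_sub, ← e1, ← e2, ← e3]
    ring
  · intro p hp1 hp2
    beta_reduce at hp1 hp2 ⊢
    rw [current_current_current]
    simp only [Finset.mul_sum]
    rw [Finset.sum_comm]
    refine Finset.sum_congr rfl fun i hi => Finset.sum_congr rfl fun j hj =>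
      Finset.sum_congr rfl fun l hl => ?_
    obtain ⟨i1, e1⟩ := hC j hj i hi p.2.1 p.1 (by linarith)
    obtain ⟨i2, e2⟩ := hC₁ i hi l hl p.1 p.2.2 (by linarith)
    obtain ⟨i3, e3⟩ := hC₁ j hj l hl p.2.1 p.2.2 (by linarith)
    rw [normalExp_mul_mul_of_integrable hH (hX j hj) (hX i hi) (hY l hl) i1 i3 i2 Φ hξ',
      add_comm (X j p.2.1)]
    simp only [hD₀, cf, Matrix.cons_val, hx, hy, hz, hF, neg_sub, ← e1, ← e2, ← e3]
    ring
  · intro p hp1 hp2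
    beta_reduce at hp1 hp2 ⊢
    rw [current_current_current]
    simp only [Finset.mul_sum]
    rw [Finset.sum_congr rfl fun j _ => Finset.sum_comm]
    rw [Finset.sum_comm]
    refine Finset.sum_congr rfl fun i hi => Finset.sum_congr rfl fun j hj =>
      Finset.sum_congr rfl fun l hl => ?_
    obtain ⟨i1, e1⟩ := hC j hj i hi p.2.1 p.1 (by linarith)
    obtain ⟨i2, e2⟩ := hC₂ l hl i hi p.2.2 p.1 (by linarith)
    obtain ⟨i3, e3⟩ := hC₁ j hj l hl p.2.1 p.2.2 (by linarith)
    rw [normalExp_mul_mul_of_integrable hH (hX j hj) (hY l hl) (hX i hi) i3 i1 i2 Φ hξ',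
      show X j p.2.1 + Y l p.2.2 + X i p.1 = X i p.1 + X j p.2.1 + Y l p.2.2 by abel]
    simp only [hD₀, cf, Matrix.cons_val, hx, hy, hz, hF, neg_sub, ← e1, ← e2, ← e3]
    ring
  · intro p hp1 hp2
    beta_reduce at hp1 hp2 ⊢
    rw [current_current_current]
    simp only [Finset.mul_sum]
    rw [Finset.sum_congr rfl fun j _ => Finset.sum_comm]
    rw [Finset.sum_comm]
    rw [Finset.sum_congr rfl fun j _ => Finset.sum_comm]
    refine Finset.sum_congr rfl fun i hi => Finset.sum_congr rfl fun j hj =>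
      Finset.sum_congr rfl fun l hl => ?_
    obtain ⟨i1, e1⟩ := hC j hj i hi p.2.1 p.1 (by linarith)
    obtain ⟨i2, e2⟩ := hC₂ l hl i hi p.2.2 p.1 (by linarith)
    obtain ⟨i3, e3⟩ := hC₂ l hl j hj p.2.2 p.2.1 (by linarith)
    rw [normalExp_mul_mul_of_integrable hH (hY l hl) (hX j hj) (hX i hi) i3 i2 i1 Φ hξ',
      show Y l p.2.2 + X j p.2.1 + X i p.1 = X i p.1 + X j p.2.1 + Y l p.2.2 by abel]
    simp only [hD₀, cf, Matrix.cons_val, hx, hy, hz, hF, neg_sub, ← e1, ← e2, ← e3]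
    ring
  · simp only [Finset.mul_sum, ← Finset.sum_add_distrib, ← Finset.sum_sub_distrib]
    refine Finset.sum_eq_zero fun i hi => Finset.sum_eq_zero fun j hj =>
      Finset.sum_eq_zero fun l hl => ?_
    set Z : ℂ × ℂ × ℂ → ℂ := fun p => cf 0 i j l p - 2 * cf 1 i j l p + cf 2 i j l p
      + (cf 3 i j l p - 2 * cf 4 i j l p + cf 5 i j l p) with hZ
    have hZc : Continuous Z := by
      have := fun r => (hcf i hi j hj l hl r).continuous
      fun_prop
    have hZ0 : Z p = 0 := by
      refine eq_zero_of_affine_mul_eq_zero hZc (l := fun p => p.1 - p.2.1 + ε) (1, 0, 0)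
        (by intro p t; simp; ring) ?_ p
      refine eq_zero_of_affine_mul_eq_zero (by fun_prop) (l := fun p => p.1 - p.2.2 + σ - ε)
        (1, 0, 0) (by intro p t; simp; ring) ?_
      refine eq_zero_of_affine_mul_eq_zero (by fun_prop) (l := fun p => p.2.1 - p.2.2 + σ - ε)
        (0, 1, 0) (by intro p t; simp; ring) ?_
      intro p
      have h1 := hex i hi j hj (p.1 - p.2.1)
      have h2 := hex' i hi l hl (p.1 - p.2.2)
      have h3 := hex' j hj l hl (p.2.1 - p.2.2)
      have h4 : n j i (-(p.1 - p.2.1)) * D (p.1 - p.2.1) = z j i (-(p.1 - p.2.1)) := by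
        simp only [hz, neg_neg]
      rw [h4] at h1
      simp only [hZ, cf, Matrix.cons_val]
      change _ * z i j (p.1 - p.2.1) = _ at h1
      change _ * x i l (p.1 - p.2.2) = _ * y i l (p.1 - p.2.2) at h2
      change _ * x j l (p.2.1 - p.2.2) = _ * y j l (p.2.1 - p.2.2) at h3
      generalize z i j (p.1 - p.2.1) = A at *
      generalize z j i (-(p.1 - p.2.1)) = A' at *
      generalize x i l (p.1 - p.2.2) = x1 at *
      generalize x j l (p.2.1 - p.2.2) = x2 at *
      generalize y i l (p.1 - p.2.2) = y1 at *
      generalize y j l (p.2.1 - p.2.2) = y2 at *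
      linear_combination
        ((p.1 - p.2.2 + σ - ε) * (p.2.1 - p.2.2 + σ - ε) * (x1 * x2 - 2 * x1 * y2 + y1 * y2)) * h1
        + (A' * (p.2.1 - p.2.2 + σ - ε) * ((p.1 - p.2.1 - ε) * (x2 - 2 * y2)
          + (p.1 - p.2.1 + ε) * x2)) * h2
        + (A' * y1 * ((p.1 - p.2.1 - ε) * (p.1 - p.2.2 + σ)
          + (p.1 - p.2.1 + ε) * (p.1 - p.2.2 + σ - 2 * (p.1 - p.2.2 + σ - ε)))) * h3
    linear_combination (a i * a j * b l * F i j l p) * hZ0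

end relations

/-! ### Elementary contractions -/

section tables

theorem pairAt_ghost {N : ℕ} (H : Commutators) {α β α' β' : ℕ} (hα : 1 ≤ α) (hβ : β ≤ N)
    (f g : ℝ → ℂ) (s : ℝ) :
    pairAt N (onB α' β' f) (shift N H (onB α β g)) s
        = (if α = α' ∧ β = β' ∧ α < β then -(f s * g s * H.ghost s) else 0)
    ∧ pairAt N (onC α' β' f) (shift N H (onC α β g)) s
        = if α = α' ∧ β = β' ∧ α < β then f s * g s * H.ghost s else 0 := by
  constructor <;>
  · simp only [pairAt, onB, onC, shift]
    split_ifs with h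
    · obtain ⟨rfl, rfl, h⟩ := h
      rw [Finset.sum_eq_zero (by simp), zero_add, Finset.sum_eq_single_of_mem α
        (Finset.mem_Icc.2 ⟨hα, by omega⟩), Finset.sum_eq_single_of_mem β (Finset.mem_Ioc.2 ⟨h, hβ⟩)]
      · simp [h]; ring
      · intro ν _ hν; simp [hν]
      · intro μ _ hμ
        exact Finset.sum_eq_zero fun ν _ => by simp [hμ]
    · rw [Finset.sum_eq_zero (by simp), zero_add]
      refine Finset.sum_eq_zero fun μ _ => Finset.sum_eq_zero fun ν _ => ?_
      split_ifs with h1 h2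
      · exact absurd ⟨h2.1.symm.trans h1.1, h2.2.1.symm.trans h1.2.1, h2.2.2⟩ h
      all_goals simp

theorem pairAt_onLam_onLam {N : ℕ} (H : Commutators) {μ ν : ℕ} (hμ : 1 ≤ μ) (hμN : μ ≤ N)
    (hν : 1 ≤ ν) (hνN : ν ≤ N) (f g : ℝ → ℂ) (s : ℝ) :
    pairAt N (onLam ν f) (shift N H (onLam μ g)) s = f s * g s * H.lam μ ν s := by
  simp only [pairAt, onLam, shift]
  rw [Finset.sum_eq_single_of_mem ν (Finset.mem_Icc.2 ⟨hν, hνN⟩),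
    Finset.sum_eq_single_of_mem μ (Finset.mem_Icc.2 ⟨hμ, hμN⟩)]
  · simp; ring
  · intro ν _ hν; simp [hν]
  · intro μ _ hμ; simp [hμ]

theorem pairAt_onB_onC {N : ℕ} (H : Commutators) (α β α' β' : ℕ) (f g : ℝ → ℂ) :
    pairAt N (onB α' β' f) (shift N H (onC α β g)) = 0 := by
  funext s; simp [pairAt, onB, onC, shift]

theorem pairAt_onC_onB {N : ℕ} (H : Commutators) (α β α' β' : ℕ) (f g : ℝ → ℂ) :
    pairAt N (onC α' β' f) (shift N H (onB α β g)) = 0 := by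
  funext s; simp [pairAt, onB, onC, shift]

theorem pairAt_onB_onLam {N : ℕ} (H : Commutators) (μ α' β' : ℕ) (f g : ℝ → ℂ) :
    pairAt N (onB α' β' f) (shift N H (onLam μ g)) = 0 := by
  funext s; simp [pairAt, onB, onLam, shift]

theorem pairAt_onC_onLam {N : ℕ} (H : Commutators) (μ α' β' : ℕ) (f g : ℝ → ℂ) :
    pairAt N (onC α' β' f) (shift N H (onLam μ g)) = 0 := by
  funext s; simp [pairAt, onC, onLam, shift]

theorem pairAt_onLam_onB {N : ℕ} (H : Commutators) (μ α β : ℕ) (f g : ℝ → ℂ) :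
    pairAt N (onLam μ f) (shift N H (onB α β g)) = 0 := by
  funext s; simp [pairAt, onB, onLam, shift]

theorem pairAt_onLam_onC {N : ℕ} (H : Commutators) (μ α β : ℕ) (f g : ℝ → ℂ) :
    pairAt N (onLam μ f) (shift N H (onC α β g)) = 0 := by
  funext s; simp [pairAt, onC, onLam, shift]

variable {N : ℕ} {h : ℝ} {k : ℂ} {s : ℝ} {x y : ℂ}

theorem con_of_fst_eq_zero (H : Commutators) (X Y : Exponent) (hY : Y.1 = 0) (s : ℝ) :
    con N H X Y s = 0 := by
  simp [con, hY, pairAt_zero_left]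

theorem con_of_snd_eq_zero (H : Commutators) (X Y : Exponent) (hX : X.2 = 0) (s : ℝ) :
    con N H X Y s = 0 := by
  simp [con, hX, shift_zero, pairAt_zero_right]

theorem expKernel_add_left (h : ℝ) (c u v a : ℂ) (s : ℝ) :
    expKernel h c (u + a * (I * h) - v) s = expKernel h (c + a) (u - v) s := by
  simp only [expKernel]
  congr 3
  linear_combination -(a * h) * I_sq

theorem expKernel_add_right (h : ℝ) (c u v b : ℂ) (s : ℝ) :
    expKernel h c (u - (v + b * (I * h))) s = expKernel h (c - b) (u - v) s := by
  simp only [expKernel]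
  congr 3
  linear_combination (b * h) * I_sq

theorem two_sinh_half (h s : ℝ) :
    2 * sinh ((h : ℂ) * s / 2) = exp ((h : ℂ) * s / 2) - exp (-((h : ℂ) * s / 2)) := by
  rw [sinh]; ring

theorem expKernel_sub_expKernel (h : ℝ) (w : ℂ) (s : ℝ) :
    expKernel h (-1 / 2) w s - expKernel h (1 / 2) w s
      = -(exp (-I * w * s) * (2 * sinh ((h : ℂ) * s / 2))) / s := by
  have e1 : (-I * w + -1 / 2 * h) * s = -I * w * s + -((h : ℂ) * s / 2) := by ring
  have e2 : (-I * w + 1 / 2 * h) * s = -I * w * s + (h : ℂ) * s / 2 := by ring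
  simp only [expKernel]
  rw [e1, e2, exp_add, exp_add, two_sinh_half]
  ring

theorem expKernel_second_difference (h : ℝ) (w : ℂ) (s : ℝ) :
    expKernel h 1 w s - 2 * expKernel h 0 w s + expKernel h (-1) w s
      = exp (-I * w * s) * (2 * sinh ((h : ℂ) * s / 2)) ^ 2 / s := by
  have e1 : (-I * w + 1 * h) * s = -I * w * s + ((h : ℂ) * s / 2 + (h : ℂ) * s / 2) := by ring
  have e2 : (-I * w + -1 * h) * s = -I * w * s + (-((h : ℂ) * s / 2) + -((h : ℂ) * s / 2)) := by
    ring
  have e3 : (-I * w + 0 * h) * s = -I * w * s := by ring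
  have e4 : exp ((h : ℂ) * s / 2) * exp (-((h : ℂ) * s / 2)) = 1 := by rw [← exp_add]; simp
  simp only [expKernel]
  rw [e1, e2, e3, exp_add, exp_add, exp_add, exp_add, two_sinh_half]
  linear_combination (2 * exp (-I * w * s) / s) * e4

theorem exp_mul_exp_sub (x y : ℂ) (s : ℝ) :
    exp (I * y * s) * exp (-I * x * s) = exp (-I * (x - y) * s) := by
  rw [← exp_add]; ring_nf

theorem con_bc_bc (α β α' β' : ℕ) (hα : 1 ≤ α) (hβ : β ≤ N) :
    con N (comm N h k) (bc h α β x) (bc h α' β' y) s = 0 := by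
  simp only [con, bc, shift_add, pairAt_add_left, pairAt_add_right, Pi.add_apply,
    pairAt_onB_onC, pairAt_onC_onB, Pi.zero_apply, (pairAt_ghost _ hα hβ _ _ _).1, (pairAt_ghost _ hα hβ _ _ _).2]
  split_ifs <;> ring

theorem con_bP_bc_and_con_bc_bM (hh : 0 < h) (hs : 0 < s) (α β α' β' : ℕ) (hα : 1 ≤ α) (hβ : β ≤ N) :
    con N (comm N h k) (bP h α β x) (bc h α' β' y) s = (if α = α' ∧ β = β' ∧ α < β then
      expKernel h (-1 / 2) (x - y) s - expKernel h (1 / 2) (x - y) s else 0)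
    ∧ con N (comm N h k) (bc h α β x) (bM h α' β' y) s = if α = α' ∧ β = β' ∧ α < β then
      expKernel h (-1 / 2) (x - y) s - expKernel h (1 / 2) (x - y) s else 0 := by
  simp only [con, bc, bP, bM, shift_add, pairAt_add_left, pairAt_add_right, Pi.add_apply,
    pairAt_onC_onB, pairAt_onB_onC, Pi.zero_apply, (pairAt_ghost _ hα hβ _ _ _).1, add_zero]
  rw [expKernel_sub_expKernel, ← exp_mul_exp_sub]
  have h1 := sinh_half_ne_zero hh hs
  have h2 : (h : ℂ) ≠ 0 := by exact_mod_cast hh.ne'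
  have h3 : (s : ℂ) ≠ 0 := by exact_mod_cast hs.ne'
  constructor <;>
  · refine if_congr Iff.rfl ?_ rfl
    simp only [comm]
    field_simp

theorem con_bP_bM (hh : 0 < h) (hs : 0 < s) (α β α' β' : ℕ) (hα : 1 ≤ α) (hβ : β ≤ N) :
    con N (comm N h k) (bP h α β x) (bM h α' β' y) s = if α = α' ∧ β = β' ∧ α < β then
      expKernel h 1 (x - y) s - 2 * expKernel h 0 (x - y) s + expKernel h (-1) (x - y) s
      else 0 := by
  simp only [con, bP, bM, (pairAt_ghost _ hα hβ _ _ _).1]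
  refine if_congr Iff.rfl ?_ rfl
  rw [expKernel_second_difference, ← exp_mul_exp_sub]
  have h1 := sinh_half_ne_zero hh hs
  have h2 : (h : ℂ) ≠ 0 := by exact_mod_cast hh.ne'
  have h3 : (s : ℂ) ≠ 0 := by exact_mod_cast hs.ne'
  simp only [comm]
  field_simp

theorem con_lamP_bc (H : Commutators) (μ α β : ℕ) : con N H (lamP h μ x) (bc h α β y) s = 0 := by
  simp only [con, bc, lamP, pairAt_add_left, Pi.add_apply, pairAt_onB_onLam, pairAt_onC_onLam,
    Pi.zero_apply, add_zero]

theorem con_lamP_bM (H : Commutators) (μ α β : ℕ) : con N H (lamP h μ x) (bM h α β y) s = 0 := by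
  simp only [con, bM, lamP, pairAt_onB_onLam, Pi.zero_apply]

theorem con_bc_lamM (H : Commutators) (μ α β : ℕ) : con N H (bc h α β x) (lamM h μ y) s = 0 := by
  simp only [con, bc, lamM, shift_add, pairAt_add_right, Pi.add_apply, pairAt_onLam_onB,
    pairAt_onLam_onC, Pi.zero_apply, add_zero]

theorem con_bP_lamM (H : Commutators) (μ α β : ℕ) : con N H (bP h α β x) (lamM h μ y) s = 0 := by
  simp only [con, bP, lamM, pairAt_onLam_onB, Pi.zero_apply]

theorem con_lamP_lamM (H : Commutators) {μ ν : ℕ} (hμ : 1 ≤ μ) (hμN : μ ≤ N)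
    (hν : 1 ≤ ν) (hνN : ν ≤ N) :
    con N H (lamP h μ x) (lamM h ν y) s
      = -(4 * h ^ 2 * H.lam μ ν s * exp (-I * (x - y) * s)) := by
  simp only [con, lamP, lamM, pairAt_onLam_onLam H hμ hμN hν hνN]
  rw [← exp_mul_exp_sub]
  ring

theorem con_bM_left (H : Commutators) (α β : ℕ) (Y : Exponent) :
    con N H (bM h α β x) Y s = 0 := con_of_snd_eq_zero H _ _ rfl s

theorem con_bP_right (H : Commutators) (α β : ℕ) (X : Exponent) :
    con N H X (bP h α β x) s = 0 := con_of_fst_eq_zero H _ _ rfl s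

/-! ### The commutators of the `λ` bosons -/

theorem sinh_mul_ne_zero_of_ne (hN : 0 < N) (hh : 0 < h) (hs : s ≠ 0) :
    sinh ((N : ℂ) / 2 * h * s) ≠ 0 := by
  have h1 : ((N : ℂ) / 2 * h * s) = ((N / 2 * h * s : ℝ) : ℂ) := by push_cast; ring
  have h2 : (N : ℝ) ≠ 0 := by exact_mod_cast hN.ne'
  rw [h1, ← ofReal_sinh]
  exact_mod_cast Real.sinh_ne_zero.2 (by positivity)

theorem sinh_mul_ne_zero (hN : 0 < N) (hh : 0 < h) (hs : 0 < s) :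
    sinh ((N : ℂ) / 2 * h * s) ≠ 0 := sinh_mul_ne_zero_of_ne hN hh hs.ne'

theorem comm_regular (hN : 0 < N) (hh : 0 < h) : (comm N h k).Regular := by
  have h2 : (h : ℂ) ≠ 0 := by exact_mod_cast hh.ne'
  have hne : ∀ s ∈ Set.Ioi (0 : ℝ), (h : ℂ) ^ 2 * s * sinh ((N : ℂ) / 2 * h * s) ≠ 0 :=
    fun s hs => mul_ne_zero (mul_ne_zero (pow_ne_zero 2 h2) (by exact_mod_cast (ne_of_gt hs)))
      (sinh_mul_ne_zero hN hh hs)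
  refine ⟨fun μ ν => ?_, ?_⟩
  · simp only [comm]
    by_cases hμν : μ = ν
    · simp only [hμν, if_true]
      exact ContinuousOn.div (by fun_prop) (by fun_prop) hne
    · simp only [hμν, if_false]
      exact (ContinuousOn.div (by fun_prop) (by fun_prop) hne).neg.mul (by fun_prop)
  · refine ContinuousOn.div (by fun_prop) (by fun_prop) fun s hs => ?_
    exact mul_ne_zero (pow_ne_zero 2 h2) (by exact_mod_cast (ne_of_gt hs))

/-- `λ_μ^+(x) / λ_{μ+1}^+(x)`. -/
def lamRatio (h : ℝ) (μ : ℕ) (x : ℂ) : Exponent := lamP h μ x - lamP h (μ + 1) x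

theorem con_lamRatio_bc (H : Commutators) (μ α β : ℕ) :
    con N H (lamRatio h μ x) (bc h α β y) s = 0 := by
  rw [lamRatio, con_sub_left, Pi.sub_apply, con_lamP_bc, con_lamP_bc, sub_zero]

theorem con_lamRatio_bM (H : Commutators) (μ α β : ℕ) :
    con N H (lamRatio h μ x) (bM h α β y) s = 0 := by
  rw [lamRatio, con_sub_left, Pi.sub_apply, con_lamP_bM, con_lamP_bM, sub_zero]

theorem lam_sub_lam_succ (hh : 0 < h) (hs : s ≠ 0) (hN : 0 < N) (μ ν : ℕ) :
    4 * h ^ 2 * s * ((comm N h k).lam μ ν s - (comm N h k).lam (μ + 1) ν s)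
      = (exp ((k + N) / 2 * h * s) - exp (-((k + N) / 2 * h * s)))
        * ((if ν = μ then exp (h * s) - 1 else 0) + if ν = μ + 1 then exp (-(h * s)) - 1 else 0) := by
  have h1 := sinh_mul_ne_zero_of_ne hN hh hs
  have h2 : (h : ℂ) ≠ 0 := by exact_mod_cast hh.ne'
  have h3 : (s : ℂ) ≠ 0 := by exact_mod_cast hs
  have e1 : ((N : ℂ) - 1) / 2 * h * s = N / 2 * h * s - (h : ℂ) / 2 * s := by ring
  have e2 : sinh ((k + N) / 2 * h * s)
      = (exp ((k + N) / 2 * h * s) - exp (-((k + N) / 2 * h * s))) / 2 := rfl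
  have e3 : exp ((h : ℂ) * s) - 1
      = 2 * sinh ((h : ℂ) / 2 * s) * (cosh ((h : ℂ) / 2 * s) + sinh ((h : ℂ) / 2 * s)) := by
    rw [cosh_add_sinh, sinh, mul_div_cancel₀ _ two_ne_zero, sub_mul, ← exp_add, ← exp_add,
      neg_add_cancel, exp_zero]
    ring_nf
  have e4 : exp (-((h : ℂ) * s)) - 1
      = -(2 * sinh ((h : ℂ) / 2 * s) * (cosh ((h : ℂ) / 2 * s) - sinh ((h : ℂ) / 2 * s))) := by
    rw [cosh_sub_sinh, sinh, mul_div_cancel₀ _ two_ne_zero, sub_mul, ← exp_add, ← exp_add,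
      add_neg_cancel, exp_zero]
    ring_nf
  have e5 := cosh_add_sinh ((N : ℂ) / 2 * h * s)
  have e6 := cosh_sub_sinh ((N : ℂ) / 2 * h * s)
  rcases (by omega : ν < μ ∨ ν = μ ∨ ν = μ + 1 ∨ μ + 1 < ν) with h4 | rfl | rfl | h4 <;>
    simp (disch := omega) only [comm, if_pos, if_neg, if_true]
  on_goal 2 => rw [e1, sinh_sub, one_mul, ← e5, ← mul_div_cancel₀ (exp ((k + N) / 2 * h * s) -
    exp (-((k + N) / 2 * h * s))) (two_ne_zero' ℂ), ← e2, e3]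
  on_goal 3 => rw [e1, sinh_sub, neg_one_mul, ← e6, ← mul_div_cancel₀ (exp ((k + N) / 2 * h * s) -
    exp (-((k + N) / 2 * h * s))) (two_ne_zero' ℂ), ← e2, e4]
  all_goals
    generalize sinh ((N : ℂ) / 2 * h * s) = S at *
    field_simp
    ring

theorem con_lamRatio_lamM (hh : 0 < h) (hs : 0 < s) {μ ν : ℕ} (hμ : 1 ≤ μ) (hμN : μ < N)
    (hν : 1 ≤ ν) (hνN : ν ≤ N) :
    con N (comm N h k) (lamRatio h μ x) (lamM h ν y) s
      = (if ν = μ then expKernel h ((k + N) / 2) (x - y) s - expKernel h ((k + N) / 2 + 1) (x - y) s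
          - expKernel h (-(k + N) / 2) (x - y) s + expKernel h (-(k + N) / 2 + 1) (x - y) s else 0)
        + if ν = μ + 1 then
          expKernel h ((k + N) / 2) (x - y) s - expKernel h ((k + N) / 2 - 1) (x - y) s
          - expKernel h (-(k + N) / 2) (x - y) s + expKernel h (-(k + N) / 2 - 1) (x - y) s
          else 0 := by
  rw [lamRatio, con_sub_left, Pi.sub_apply, con_lamP_lamM _ hμ hμN.le hν hνN,
    con_lamP_lamM _ (by omega) (by omega) hν hνN]
  have h3 : (s : ℂ) ≠ 0 := by exact_mod_cast hs.ne'
  have key : ∀ a : ℂ, expKernel h a (x - y) s = exp (-I * (x - y) * s) * exp (a * h * s) / s := by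
    intro a
    rw [expKernel, ← exp_add]
    ring_nf
  have h4 := lam_sub_lam_succ (k := k) hh hs.ne' (show 0 < N by omega) μ ν
  have e1 : ((k + N) / 2 + 1) * h * s = (k + N) / 2 * h * s + h * s := by ring
  have e2 : (-(k + N) / 2 + 1) * h * s = -((k + N) / 2 * h * s) + h * s := by ring
  have e3 : ((k + N) / 2 - 1) * h * s = (k + N) / 2 * h * s + -(h * s) := by ring
  have e4 : (-(k + N) / 2 - 1) * h * s = -((k + N) / 2 * h * s) + -(h * s) := by ring
  have e5 : -(k + N) / 2 * h * s = -((k + N) / 2 * h * s) := by ring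
  simp only [key, e1, e2, e3, e4, e5, exp_add ((k + N) / 2 * h * s), exp_add (-((k + N) / 2 * h * s))]
  have h5 : ∀ a b c : ℂ, 4 * h ^ 2 * s * (a - b) = c → -(4 * h ^ 2 * a * exp (-I * (x - y) * s))
      - -(4 * h ^ 2 * b * exp (-I * (x - y) * s)) = -(exp (-I * (x - y) * s) * c / s) := by
    rintro a b c rfl
    field_simp
    ring
  rw [h5 _ _ _ h4]
  split_ifs <;> first | omega | ring

/-! ### Differences of kernels -/

/-- The contraction kernel of the field `b^±` with `b + c`. -/
def firstDiff (φ : ℂ → ℂ) (c : ℂ) : ℂ := φ (c - 1 / 2) - φ (c + 1 / 2)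

/-- The contraction kernel of `b^+` with `b^-`. -/
def secondDiff (φ : ℂ → ℂ) (c : ℂ) : ℂ := φ (c + 1) - 2 * φ c + φ (c - 1)

/-- The kernel `expKernel` as a function of the position of the pole. -/
def ker (h : ℝ) (u v : ℂ) (s : ℝ) (a : ℂ) : ℂ := expKernel h a (u - v) s

theorem expKernel_add_sub_add (h : ℝ) (c u v a b : ℂ) (s : ℝ) :
    expKernel h c (u + a * (I * h) - (v + b * (I * h))) s = ker h u v s (c + a - b) := by
  rw [expKernel_add_right, expKernel_add_left, ker]
  ring_nf

variable {u v a b : ℂ}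

theorem con_bP_bc_ker (hh : 0 < h) (hs : 0 < s) (α β α' β' : ℕ) (hα : 1 ≤ α) (hβ : β ≤ N) :
    con N (comm N h k) (bP h α β (u + a * (I * h))) (bc h α' β' (v + b * (I * h))) s
      = if α = α' ∧ β = β' ∧ α < β then firstDiff (ker h u v s) (a - b) else 0 := by
  rw [(con_bP_bc_and_con_bc_bM hh hs α β α' β' hα hβ).1, expKernel_add_sub_add, expKernel_add_sub_add, firstDiff]
  ring_nf

theorem con_bc_bM_ker (hh : 0 < h) (hs : 0 < s) (α β α' β' : ℕ) (hα : 1 ≤ α) (hβ : β ≤ N) :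
    con N (comm N h k) (bc h α β (u + a * (I * h))) (bM h α' β' (v + b * (I * h))) s
      = if α = α' ∧ β = β' ∧ α < β then firstDiff (ker h u v s) (a - b) else 0 := by
  rw [(con_bP_bc_and_con_bc_bM hh hs α β α' β' hα hβ).2, expKernel_add_sub_add, expKernel_add_sub_add, firstDiff]
  ring_nf

theorem con_bP_bM_ker (hh : 0 < h) (hs : 0 < s) (α β α' β' : ℕ) (hα : 1 ≤ α) (hβ : β ≤ N) :
    con N (comm N h k) (bP h α β (u + a * (I * h))) (bM h α' β' (v + b * (I * h))) s
      = if α = α' ∧ β = β' ∧ α < β then secondDiff (ker h u v s) (a - b) else 0 := by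
  rw [con_bP_bM hh hs α β α' β' hα hβ, expKernel_add_sub_add, expKernel_add_sub_add,
    expKernel_add_sub_add, secondDiff]
  ring_nf

theorem con_lamRatio_lamM_ker (hh : 0 < h) (hs : 0 < s) {μ ν : ℕ} (hμ : 1 ≤ μ) (hμN : μ < N)
    (hν : 1 ≤ ν) (hνN : ν ≤ N) (a b : ℂ) :
    con N (comm N h k) (lamRatio h μ (u + (a + (k - N) / 4) * (I * h)))
        (lamM h ν (v + (b - (k - N) / 4) * (I * h))) s
      = (if ν = μ then ker h u v s (a - b + k) - ker h u v s (a - b + k + 1)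
          - ker h u v s (a - b - N) + ker h u v s (a - b - N + 1) else 0)
        + if ν = μ + 1 then ker h u v s (a - b + k) - ker h u v s (a - b + k - 1)
          - ker h u v s (a - b - N) + ker h u v s (a - b - N - 1) else 0 := by
  rw [con_lamRatio_lamM hh hs hμ hμN hν hνN]
  simp only [expKernel_add_sub_add]
  ring_nf

end tables

/-! ### Composite fields -/

section composite

theorem sum_ite_eq_left (S : Finset ℕ) (α : ℕ) (p : Prop) [Decidable p] (q : ℕ → Prop)
    [DecidablePred q] (g : ℕ → ℂ) :
    ∑ n ∈ S, (if n = α ∧ p ∧ q n then g n else 0) = if α ∈ S ∧ p ∧ q α then g α else 0 := by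
  simp only [ite_and, Finset.sum_ite_eq']

theorem sum_ite_eq_left' (S : Finset ℕ) (α : ℕ) (p q : Prop) [Decidable p] [Decidable q]
    (g : ℕ → ℂ) :
    ∑ n ∈ S, (if α = n ∧ p ∧ q then g n else 0) = if α ∈ S ∧ p ∧ q then g α else 0 := by
  simp only [ite_and, Finset.sum_ite_eq]

theorem sum_ite_eq_right (S : Finset ℕ) (β : ℕ) (p : Prop) [Decidable p] (q : ℕ → Prop)
    [DecidablePred q] (g : ℕ → ℂ) :
    ∑ n ∈ S, (if p ∧ n = β ∧ q n then g n else 0) = if p ∧ β ∈ S ∧ q β then g β else 0 := by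
  by_cases hp : p
  · simp only [hp, true_and, ite_and, Finset.sum_ite_eq']
  · simp [hp]

theorem sum_ite_eq_right' (S : Finset ℕ) (β : ℕ) (p : Prop) [Decidable p] (q : ℕ → Prop)
    [DecidablePred q] (g : ℕ → ℂ) :
    ∑ n ∈ S, (if p ∧ β = n ∧ q n then g n else 0) = if p ∧ β ∈ S ∧ q β then g β else 0 := by
  by_cases hp : p
  · simp only [hp, true_and, ite_and, Finset.sum_ite_eq]
  · simp [hp]

theorem sum_Icc_ite_lt_telescope {a m μ : ℕ} (hm : m ≤ μ + 1) (f : ℕ → ℂ) :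
    ∑ n ∈ Finset.Icc a μ, (if n < m then f n - f (n + 1) else 0)
      = if a ≤ m then f a - f m else 0 := by
  rw [← Finset.sum_filter]
  have : (Finset.Icc a μ).filter (fun n => n < m) = Finset.Ico a m := by
    ext n; simp only [Finset.mem_filter, Finset.mem_Icc, Finset.mem_Ico]; omega
  rw [this]
  split_ifs with h
  · rw [← neg_sub (f m), ← Finset.sum_Ico_sub f h, ← Finset.sum_neg_distrib]
    exact Finset.sum_congr rfl fun _ _ => (neg_sub _ _).symm
  · rw [Finset.Ico_eq_empty (by omega), Finset.sum_empty]

theorem sum_Icc_ite_le_telescope {a m N : ℕ} (hm : m ≤ N + 1) (ha : a ≤ m) (f : ℕ → ℂ) :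
    ∑ n ∈ Finset.Icc a N, (if m ≤ n then f n - f (n + 1) else 0) = f m - f (N + 1) := by
  rw [← Finset.sum_filter]
  have : (Finset.Icc a N).filter (fun n => m ≤ n) = Finset.Ico m (N + 1) := by
    ext n; simp only [Finset.mem_filter, Finset.mem_Icc, Finset.mem_Ico]; omega
  rw [this, ← neg_sub (f (N + 1)), ← Finset.sum_Ico_sub f hm, ← Finset.sum_neg_distrib]
  exact Finset.sum_congr rfl fun _ _ => (neg_sub _ _).symm

/-- A first difference, read from above. -/
def stepDiff (φ : ℂ → ℂ) (z : ℂ) : ℂ := φ (1 - z) - φ (-z)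

variable {N : ℕ} {h : ℝ} {k : ℂ} {s : ℝ} {u v a b c : ℂ}

/-- The `b^+` fields in the `m`-th summand of `X_μ^+`. -/
def ladder (h : ℝ) (μ m : ℕ) (u : ℂ) : Exponent :=
  ∑ n ∈ Finset.Ico 1 m, (bP h n (μ + 1) (u + ((μ : ℂ) - n + 1) / 2 * (I * h))
    - bP h n μ (u + ((μ : ℂ) - n) / 2 * (I * h)))

/-- The annihilation fields of `X_μ^-`. -/
def upper (N : ℕ) (h : ℝ) (k c : ℂ) (μ m : ℕ) (u : ℂ) : Exponent :=
  lamRatio h μ (u + (c + (k - N) / 4) * (I * h))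
    + ∑ n ∈ Finset.Icc m N, (bP h μ n (u + (c + ((μ : ℂ) - n) / 2) * (I * h))
      - bP h (μ + 1) n (u + (c + ((μ : ℂ) - n + 1) / 2) * (I * h)))

/-- The creation fields of `X_ν^-`. -/
def lower (N : ℕ) (h : ℝ) (k : ℂ) (ν r : ℕ) (v : ℂ) : Exponent :=
  lamM h ν (v + (0 - (k - N) / 4) * (I * h)) - lamM h (ν + 1) (v + (0 - (k - N) / 4) * (I * h))
    + ∑ n ∈ Finset.Icc r ν, (bM h n (ν + 1) (v + ((n : ℂ) + ν - 1) / 2 * (I * h))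
      - bM h n ν (v + ((n : ℂ) + ν) / 2 * (I * h)))
    + ∑ n ∈ Finset.Icc (ν + 1) N, (bM h ν n (v + ((n : ℂ) + ν) / 2 * (I * h))
      - bM h (ν + 1) n (v + ((n : ℂ) + ν - 1) / 2 * (I * h)))

theorem con_ladder_bc (hh : 0 < h) (hs : 0 < s) {μ m α β : ℕ} (hμ : μ < N) (hα : 1 ≤ α) :
    con N (comm N h k) (ladder h μ m u) (bc h α β (v + b * (I * h))) s
      = (if α < m ∧ β = μ + 1 ∧ α < β then
          firstDiff (ker h u v s) (((μ : ℂ) - α + 1) / 2 - b) else 0)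
        - if α < m ∧ β = μ ∧ α < β then firstDiff (ker h u v s) (((μ : ℂ) - α) / 2 - b) else 0 := by
  rw [ladder, con_sum_left, Finset.sum_apply]
  simp only [con_sub_left, Pi.sub_apply]
  rw [Finset.sum_congr rfl fun n hn => by
    rw [con_bP_bc_ker hh hs n (μ + 1) α β (Finset.mem_Ico.1 hn).1 (by omega),
      con_bP_bc_ker hh hs n μ α β (Finset.mem_Ico.1 hn).1 (by omega)]]
  rw [Finset.sum_sub_distrib, sum_ite_eq_left, sum_ite_eq_left]
  simp only [Finset.mem_Ico, hα, true_and]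
  congr 1
  all_goals exact if_congr (by omega) rfl rfl

theorem con_ladder_bM (hh : 0 < h) (hs : 0 < s) {μ m α β : ℕ} (hμ : μ < N) (hα : 1 ≤ α) :
    con N (comm N h k) (ladder h μ m u) (bM h α β (v + b * (I * h))) s
      = (if α < m ∧ β = μ + 1 ∧ α < β then
          secondDiff (ker h u v s) (((μ : ℂ) - α + 1) / 2 - b) else 0)
        - if α < m ∧ β = μ ∧ α < β then
          secondDiff (ker h u v s) (((μ : ℂ) - α) / 2 - b) else 0 := by
  rw [ladder, con_sum_left, Finset.sum_apply]
  simp only [con_sub_left, Pi.sub_apply]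
  rw [Finset.sum_congr rfl fun n hn => by
    rw [con_bP_bM_ker hh hs n (μ + 1) α β (Finset.mem_Ico.1 hn).1 (by omega),
      con_bP_bM_ker hh hs n μ α β (Finset.mem_Ico.1 hn).1 (by omega)]]
  rw [Finset.sum_sub_distrib, sum_ite_eq_left, sum_ite_eq_left]
  simp only [Finset.mem_Ico, hα, true_and]
  congr 1
  all_goals exact if_congr (by omega) rfl rfl

theorem con_upper_bc (hh : 0 < h) (hs : 0 < s) {μ m α β : ℕ} (hμ : 1 ≤ μ) (hβ : β ≤ N) :
    con N (comm N h k) (upper N h k c μ m u) (bc h α β (v + b * (I * h))) s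
      = (if α = μ ∧ m ≤ β ∧ α < β then
          firstDiff (ker h u v s) (c + ((μ : ℂ) - β) / 2 - b) else 0)
        - if α = μ + 1 ∧ m ≤ β ∧ α < β then
          firstDiff (ker h u v s) (c + ((μ : ℂ) - β + 1) / 2 - b) else 0 := by
  rw [upper, con_add_left, con_sum_left, Pi.add_apply, con_lamRatio_bc, zero_add, Finset.sum_apply]
  simp only [con_sub_left, Pi.sub_apply]
  rw [Finset.sum_congr rfl fun n hn => by
    rw [con_bP_bc_ker hh hs μ n α β hμ (Finset.mem_Icc.1 hn).2,
      con_bP_bc_ker hh hs (μ + 1) n α β (by omega) (Finset.mem_Icc.1 hn).2]]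
  rw [Finset.sum_sub_distrib, sum_ite_eq_right, sum_ite_eq_right]
  simp only [Finset.mem_Icc, hβ, and_true]
  congr 1
  all_goals exact if_congr (by omega) rfl rfl

theorem con_upper_bM (hh : 0 < h) (hs : 0 < s) {μ m α β : ℕ} (hμ : 1 ≤ μ) (hβ : β ≤ N) :
    con N (comm N h k) (upper N h k c μ m u) (bM h α β (v + b * (I * h))) s
      = (if α = μ ∧ m ≤ β ∧ α < β then
          secondDiff (ker h u v s) (c + ((μ : ℂ) - β) / 2 - b) else 0)
        - if α = μ + 1 ∧ m ≤ β ∧ α < β then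
          secondDiff (ker h u v s) (c + ((μ : ℂ) - β + 1) / 2 - b) else 0 := by
  rw [upper, con_add_left, con_sum_left, Pi.add_apply, con_lamRatio_bM, zero_add, Finset.sum_apply]
  simp only [con_sub_left, Pi.sub_apply]
  rw [Finset.sum_congr rfl fun n hn => by
    rw [con_bP_bM_ker hh hs μ n α β hμ (Finset.mem_Icc.1 hn).2,
      con_bP_bM_ker hh hs (μ + 1) n α β (by omega) (Finset.mem_Icc.1 hn).2]]
  rw [Finset.sum_sub_distrib, sum_ite_eq_right, sum_ite_eq_right]
  simp only [Finset.mem_Icc, hβ, and_true]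
  congr 1
  all_goals exact if_congr (by omega) rfl rfl

theorem con_bc_lower (hh : 0 < h) (hs : 0 < s) {ν r α β : ℕ} (hα : 1 ≤ α) (hβ : β ≤ N) :
    con N (comm N h k) (bc h α β (u + a * (I * h))) (lower N h k ν r v) s
      = (if r ≤ α ∧ β = ν + 1 ∧ α < β then
          firstDiff (ker h u v s) (a - ((α : ℂ) + ν - 1) / 2) else 0)
        - (if r ≤ α ∧ β = ν ∧ α < β then firstDiff (ker h u v s) (a - ((α : ℂ) + ν) / 2) else 0)
        + (if α = ν ∧ α < β then firstDiff (ker h u v s) (a - ((β : ℂ) + ν) / 2) else 0)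
        - if α = ν + 1 ∧ α < β then
          firstDiff (ker h u v s) (a - ((β : ℂ) + ν - 1) / 2) else 0 := by
  rw [lower, con_add_right, con_add_right, con_sub_right, con_sum_right, con_sum_right]
  simp only [Pi.add_apply, Pi.sub_apply, con_bc_lamM, Finset.sum_apply, con_sub_right,
    con_bc_bM_ker hh hs α β _ _ hα hβ, Finset.sum_sub_distrib, sum_ite_eq_left', sum_ite_eq_right',
    sub_zero, zero_add]
  simp only [Finset.mem_Icc, add_sub_assoc]
  congr 1
  · congr 1
    all_goals exact if_congr (by omega) rfl rfl
  congr 1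
  all_goals exact if_congr (by omega) rfl rfl

theorem con_bP_lower (hh : 0 < h) (hs : 0 < s) {ν r α β : ℕ} (hα : 1 ≤ α) (hβ : β ≤ N) :
    con N (comm N h k) (bP h α β (u + a * (I * h))) (lower N h k ν r v) s
      = (if r ≤ α ∧ β = ν + 1 ∧ α < β then
          secondDiff (ker h u v s) (a - ((α : ℂ) + ν - 1) / 2) else 0)
        - (if r ≤ α ∧ β = ν ∧ α < β then secondDiff (ker h u v s) (a - ((α : ℂ) + ν) / 2) else 0)
        + (if α = ν ∧ α < β then secondDiff (ker h u v s) (a - ((β : ℂ) + ν) / 2) else 0)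
        - if α = ν + 1 ∧ α < β then
          secondDiff (ker h u v s) (a - ((β : ℂ) + ν - 1) / 2) else 0 := by
  rw [lower, con_add_right, con_add_right, con_sub_right, con_sum_right, con_sum_right]
  simp only [Pi.add_apply, Pi.sub_apply, con_bP_lamM, Finset.sum_apply, con_sub_right,
    con_bP_bM_ker hh hs α β _ _ hα hβ, Finset.sum_sub_distrib, sum_ite_eq_left', sum_ite_eq_right',
    sub_zero, zero_add]
  simp only [Finset.mem_Icc, add_sub_assoc]
  congr 1
  · congr 1
    all_goals exact if_congr (by omega) rfl rfl
  congr 1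
  all_goals exact if_congr (by omega) rfl rfl

theorem con_ladder_lamM (H : Commutators) (μ m ν : ℕ) :
    con N H (ladder h μ m u) (lamM h ν v) s = 0 := by
  rw [ladder, con_sum_left, Finset.sum_apply]
  refine Finset.sum_eq_zero fun n _ => ?_
  rw [con_sub_left, Pi.sub_apply, con_bP_lamM, con_bP_lamM, sub_zero]

theorem con_ladder_lower (hh : 0 < h) (hs : 0 < s) {μ m ν r : ℕ} (hμ : μ < N) (hm : m ≤ μ)
    (hν : 1 ≤ ν) (hνN : ν < N) (hr : 1 ≤ r) :
    con N (comm N h k) (ladder h μ m u) (lower N h k ν r v) s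
      = if r ≤ m then
          (if ν = μ then stepDiff (ker h u v s) (r - 1) + stepDiff (ker h u v s) r
            - stepDiff (ker h u v s) (m - 1) - stepDiff (ker h u v s) m else 0)
          + (if ν + 1 = μ then stepDiff (ker h u v s) (m - 1) - stepDiff (ker h u v s) (r - 1)
            else 0)
          + (if ν = μ + 1 then stepDiff (ker h u v s) m - stepDiff (ker h u v s) r else 0)
        else 0 := by
  rw [lower, con_add_right, con_add_right, con_sub_right, con_sum_right, con_sum_right]
  simp only [Pi.add_apply, Pi.sub_apply, con_ladder_lamM, Finset.sum_apply, con_sub_right,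
    sub_zero, zero_add]
  rw [Finset.sum_congr rfl fun n hn => by
    rw [con_ladder_bM hh hs hμ (hr.trans (Finset.mem_Icc.1 hn).1),
      con_ladder_bM hh hs hμ (hr.trans (Finset.mem_Icc.1 hn).1)],
    Finset.sum_congr (s₁ := Finset.Icc (ν + 1) N) rfl fun n hn => by
    rw [con_ladder_bM hh hs hμ hν, con_ladder_bM hh hs hμ (by omega)]]
  have e : ∑ n ∈ Finset.Icc (ν + 1) N,
      (((if ν < m ∧ n = μ + 1 ∧ ν < n then
        secondDiff (ker h u v s) (((μ : ℂ) - ν + 1) / 2 - ((n : ℂ) + ν) / 2) else 0)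
      - if ν < m ∧ n = μ ∧ ν < n then
        secondDiff (ker h u v s) (((μ : ℂ) - ν) / 2 - ((n : ℂ) + ν) / 2) else 0)
      - ((if ν + 1 < m ∧ n = μ + 1 ∧ ν + 1 < n then
        secondDiff (ker h u v s) (((μ : ℂ) - (ν + 1 : ℕ) + 1) / 2 - ((n : ℂ) + ν - 1) / 2) else 0)
      - if ν + 1 < m ∧ n = μ ∧ ν + 1 < n then
        secondDiff (ker h u v s) (((μ : ℂ) - (ν + 1 : ℕ)) / 2 - ((n : ℂ) + ν - 1) / 2) else 0))
      = 0 := by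
    simp only [Finset.sum_sub_distrib, sum_ite_eq_right, Finset.mem_Icc]
    have e1 : ((μ : ℂ) - ν + 1) / 2 - (((μ + 1 : ℕ) : ℂ) + ν) / 2 = -ν := by push_cast; ring
    have e2 : ((μ : ℂ) - ν) / 2 - ((μ : ℂ) + ν) / 2 = -ν := by push_cast; ring
    have e3 : ((μ : ℂ) - (ν + 1 : ℕ) + 1) / 2 - (((μ + 1 : ℕ) : ℂ) + ν - 1) / 2 = -ν := by
      push_cast; ring
    have e4 : ((μ : ℂ) - (ν + 1 : ℕ)) / 2 - ((μ : ℂ) + ν - 1) / 2 = -ν := by push_cast; ring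
    rw [e1, e2, e3, e4]
    split_ifs <;> first | omega | ring
  rw [e, add_zero]
  by_cases h1 : ν = μ ∨ ν + 1 = μ ∨ ν = μ + 1
  · obtain ⟨f, hf⟩ : ∃ f : ℕ → ℂ, f = fun n : ℕ =>
        if ν = μ then stepDiff (ker h u v s) (n - 1) + stepDiff (ker h u v s) n
        else if ν + 1 = μ then -stepDiff (ker h u v s) (n - 1) else -stepDiff (ker h u v s) n :=
      ⟨_, rfl⟩
    rw [Finset.sum_congr (g := fun n : ℕ => if n < m then f n - f (n + 1) else 0) rfl
      fun n hn => ?_, sum_Icc_ite_lt_telescope (by omega)]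
    · rcases h1 with rfl | rfl | rfl <;> simp (disch := omega) only [hf, if_pos, if_neg, if_true] <;>
        split_ifs <;> ring
    · rcases h1 with rfl | rfl | rfl <;> by_cases h2 : n < m <;>
      · simp (disch := omega) only [hf, if_pos, if_neg, true_and]
        try simp only [secondDiff, stepDiff]
        push_cast
        ring_nf
  · rw [Finset.sum_eq_zero fun n hn => by simp (disch := omega) only [if_neg]; simp]
    simp (disch := omega) only [if_neg]
    simp

end composite

section upper_lower

variable {N : ℕ} {h : ℝ} {k : ℂ} {s : ℝ} {u v c : ℂ}

theorem con_upper_lamM (H : Commutators) (μ m ν : ℕ) {x : ℂ} :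
    con N H (upper N h k c μ m u) (lamM h ν x) s
      = con N H (lamRatio h μ (u + (c + (k - N) / 4) * (I * h))) (lamM h ν x) s := by
  rw [upper, con_add_left, Pi.add_apply, con_sum_left, Finset.sum_apply, Finset.sum_eq_zero,
    add_zero]
  intro n _
  rw [con_sub_left, Pi.sub_apply, con_bP_lamM, con_bP_lamM, sub_zero]

theorem con_upper_lower (hh : 0 < h) (hs : 0 < s) {μ m ν r : ℕ} (hμ : 1 ≤ μ) (hμN : μ < N)
    (hm : μ < m) (hmN : m ≤ N) (hν : 1 ≤ ν) (hνN : ν < N) (hr : 1 ≤ r) (hrν : r ≤ ν + 1)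
    {ψ : ℂ → ℂ} (hψ : ψ = fun z => ker h u v s (c + z)) :
    con N (comm N h k) (upper N h k c μ m u) (lower N h k ν r v) s
      = (if ν = μ then ψ (k - 1) - ψ (k + 1) + stepDiff ψ m
          + (if r = μ + 1 ∧ m = μ + 1 then stepDiff ψ m else stepDiff ψ (m - 1)) else 0)
        + (if ν = μ + 1 then ψ k - ψ (k - 1)
          - (if r ≤ μ ∨ μ + 3 ≤ m then stepDiff ψ m
            else if r = μ + 1 then stepDiff ψ (μ + 1) else stepDiff ψ (μ + 2)) else 0)
        + (if ν + 1 = μ then ψ (k + 1) - ψ k - stepDiff ψ (m - 1) else 0)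
        - if μ + 2 ≤ ν ∧ r = μ + 1 ∧ m = ν + 1 then secondDiff ψ (-ν) else 0 := by
  rw [lower, con_add_right, con_add_right, con_sub_right, con_sum_right, con_sum_right]
  simp only [Pi.add_apply, Pi.sub_apply, con_upper_lamM, Finset.sum_apply, con_sub_right]
  rw [con_lamRatio_lamM_ker hh hs hμ hμN hν hνN.le,
    con_lamRatio_lamM_ker hh hs hμ hμN (by omega) (by omega)]
  rw [Finset.sum_congr rfl fun n hn => by
    rw [con_upper_bM hh hs hμ (by omega), con_upper_bM hh hs hμ (by omega)],
    Finset.sum_congr (s₁ := Finset.Icc (ν + 1) N) rfl fun n hn => by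
    rw [con_upper_bM hh hs hμ (Finset.mem_Icc.1 hn).2,
      con_upper_bM hh hs hμ (Finset.mem_Icc.1 hn).2]]
  rw [Finset.sum_sub_distrib (s := Finset.Icc r ν), Finset.sum_sub_distrib (s := Finset.Icc r ν),
    Finset.sum_sub_distrib (s := Finset.Icc r ν)]
  simp only [sum_ite_eq_left, Finset.mem_Icc]
  subst hψ
  rcases lt_or_ge (ν + 1) μ with h1 | h1
  · rw [Finset.sum_eq_zero fun n hn => by simp (disch := omega) only [if_neg]; simp]
    simp (disch := omega) only [if_neg]
    simp
  rcases eq_or_lt_of_le h1 with h2 | h2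
  · obtain rfl : μ = ν + 1 := h2
    rw [Finset.sum_congr (s₁ := Finset.Icc (ν + 1) N) (g := fun n : ℕ => if m ≤ n then
      (fun n : ℕ => -stepDiff (fun z => ker h u v s (c + z)) (n - 1)) n
      - (fun n : ℕ => -stepDiff (fun z => ker h u v s (c + z)) (n - 1)) (n + 1) else 0)
      rfl fun n hn => ?_, sum_Icc_ite_le_telescope (by omega) (by omega)]
    · simp (disch := omega) only [if_pos, if_neg, if_true]
      simp only [secondDiff, stepDiff]
      push_cast
      ring_nf
    · by_cases h3 : m ≤ n
      · simp (disch := omega) only [if_pos, if_neg, true_and, and_true]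
        simp only [secondDiff, stepDiff]
        push_cast
        ring_nf
      · simp (disch := omega) only [if_neg]
        simp
  rcases eq_or_lt_of_le (Nat.le_of_lt_succ h2) with h3 | h3
  · subst h3
    have e : ∀ n ∈ Finset.Icc (μ + 1) N, ((if μ = μ ∧ m ≤ n ∧ μ < n then
        secondDiff (ker h u v s) (c + ((μ : ℂ) - n) / 2 - ((n : ℂ) + μ) / 2) else 0)
        - (if μ = μ + 1 ∧ m ≤ n ∧ μ < n then
          secondDiff (ker h u v s) (c + ((μ : ℂ) - n + 1) / 2 - ((n : ℂ) + μ) / 2) else 0)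
        - ((if μ + 1 = μ ∧ m ≤ n ∧ μ + 1 < n then
          secondDiff (ker h u v s) (c + ((μ : ℂ) - n) / 2 - ((n : ℂ) + μ - 1) / 2) else 0)
        - if μ + 1 = μ + 1 ∧ m ≤ n ∧ μ + 1 < n then
          secondDiff (ker h u v s) (c + ((μ : ℂ) - n + 1) / 2 - ((n : ℂ) + μ - 1) / 2) else 0))
        = (if m ≤ n then (fun n : ℕ => stepDiff (fun z => ker h u v s (c + z)) n) n
          - (fun n : ℕ => stepDiff (fun z => ker h u v s (c + z)) n) (n + 1) else 0)
          + if max m (μ + 2) ≤ n then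
          (fun n : ℕ => stepDiff (fun z => ker h u v s (c + z)) (n - 1)) n
          - (fun n : ℕ => stepDiff (fun z => ker h u v s (c + z)) (n - 1)) (n + 1) else 0 := by
      intro n hn
      have hn' := Finset.mem_Icc.1 hn
      rcases lt_or_ge n m with h4 | h4
      · simp (disch := omega) only [if_neg]
        simp
      rcases lt_or_ge n (μ + 2) with h5 | h5 <;>
      · simp (disch := omega) only [if_pos, if_neg, true_and, and_true]
        simp only [secondDiff, stepDiff]
        push_cast
        ring_nf
    rw [Finset.sum_congr rfl e, Finset.sum_add_distrib,
      sum_Icc_ite_le_telescope (by omega) (by omega),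
      sum_Icc_ite_le_telescope (by omega) (by omega)]
    rcases (by omega : m = μ + 1 ∨ μ + 1 < m) with rfl | h4 <;>
    rcases (by omega : r = μ + 1 ∨ r ≤ μ) with rfl | h5 <;>
    · first | rw [max_eq_right (by omega)] | rw [max_eq_left (by omega)]
      simp (disch := omega) only [if_pos, if_neg, true_and, and_true]
      simp only [secondDiff, stepDiff]
      push_cast
      ring_nf
  rcases eq_or_lt_of_le (Nat.succ_le_of_lt h3) with h4 | h4
  · obtain rfl : ν = μ + 1 := h4.symm
    rw [Finset.sum_congr (s₁ := Finset.Icc (μ + 1 + 1) N)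
      (g := fun n : ℕ => if max m (μ + 2) ≤ n then
      (fun n : ℕ => -stepDiff (fun z => ker h u v s (c + z)) n) n
      - (fun n : ℕ => -stepDiff (fun z => ker h u v s (c + z)) n) (n + 1) else 0)
      rfl fun n hn => ?_, sum_Icc_ite_le_telescope (by omega) (by omega)]
    · rcases (by omega : m = μ + 1 ∨ m = μ + 2 ∨ μ + 2 < m) with rfl | rfl | h4 <;>
      rcases (by omega : r = μ + 1 ∨ r = μ + 2 ∨ r ≤ μ) with rfl | rfl | h5 <;>
      · first | rw [max_eq_right (by omega)] | rw [max_eq_left (by omega)]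
        simp (disch := omega) only [if_pos, if_neg, true_and, and_true]
        simp only [secondDiff, stepDiff]
        push_cast
        ring_nf
    · have hn' := Finset.mem_Icc.1 hn
      by_cases h3 : m ≤ n
      · simp (disch := omega) only [if_pos, if_neg, true_and, and_true]
        simp only [secondDiff, stepDiff]
        push_cast
        ring_nf
      · simp (disch := omega) only [if_neg]
        simp
  · rw [Finset.sum_eq_zero (s := Finset.Icc (ν + 1) N) fun n hn => by
      simp (disch := omega) only [if_neg]; simp]
    rcases lt_trichotomy r (μ + 1) with h6 | rfl | h6 <;>
    rcases lt_trichotomy m (ν + 1) with h7 | rfl | h7 <;>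
    · simp (disch := omega) only [if_pos, if_neg, true_and, and_true]
      try simp only [secondDiff, stepDiff]
      push_cast
      ring_nf

end upper_lower

/-! ### Contractions of the terms of the currents -/

/-- `b^+` or `b^-`. -/
def bSgn (h : ℝ) : Bool → ℕ → ℕ → ℂ → Exponent
  | true => bP h
  | false => bM h

/-- The sign of a label. -/
def sgn : Bool → ℂ
  | true => 1
  | false => -1

/-- The `(m, ε)`-th term of `X_μ^+`. -/
def raising (h : ℝ) (μ m : ℕ) (ε : Bool) (u : ℂ) : Exponent :=
  bc h m μ (u + ((μ : ℂ) - m + 1) / 2 * (I * h)) + ladder h μ m u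
    + bSgn h ε m (μ + 1) (u + ((μ : ℂ) - m + 1) / 2 * (I * h))
    - bc h m (μ + 1) (u + ((μ : ℂ) - m + 1 - sgn ε) / 2 * (I * h))

/-- The `(m, ε)`-th term of `X_ν^-`, for `m ≤ ν`. -/
def loweringL (N : ℕ) (h : ℝ) (k : ℂ) (ν m : ℕ) (ε : Bool) (v : ℂ) : Exponent :=
  bc h m (ν + 1) (v + ((m : ℂ) + ν) / 2 * (I * h)) + lower N h k ν (m + 1) v
    - bSgn h ε m ν (v + ((m : ℂ) + ν) / 2 * (I * h))
    - bc h m ν (v + ((m : ℂ) + ν + sgn ε) / 2 * (I * h))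

/-- The `(m, ε)`-th term of `X_μ^-`, for `m > μ`. -/
def loweringR (N : ℕ) (h : ℝ) (k : ℂ) (μ m : ℕ) (ε : Bool) (u : ℂ) : Exponent :=
  bc h μ m (u + (-k + ((μ : ℂ) - m + 1) / 2) * (I * h)) + upper N h k (-k) μ m u
    + bSgn h ε (μ + 1) m (u + (-k + ((μ : ℂ) - m + 1) / 2) * (I * h))
    - bc h (μ + 1) m (u + (-k + ((μ : ℂ) - m + 1 - sgn ε) / 2) * (I * h))

section terms

variable {N : ℕ} {h : ℝ} {k : ℂ} {s : ℝ} {u v : ℂ}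

theorem con_ladder_left (H : Commutators) (X : Exponent) (μ m : ℕ) :
    con N H X (ladder h μ m u) s = 0 := by
  refine con_of_fst_eq_zero H _ _ ?_ s
  simp only [ladder, Prod.fst_sum]
  exact Finset.sum_eq_zero fun n _ => by simp [bP]

theorem con_upper_right (H : Commutators) (X : Exponent) (c : ℂ) (μ m : ℕ) :
    con N H X (upper N h k c μ m u) s = 0 := by
  refine con_of_fst_eq_zero H _ _ ?_ s
  simp only [upper, Prod.fst_add, Prod.fst_sum]
  rw [Finset.sum_eq_zero fun n _ => by simp [bP]]
  simp [lamRatio, lamP]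

theorem con_lower_left (H : Commutators) (Y : Exponent) (ν r : ℕ) :
    con N H (lower N h k ν r u) Y s = 0 := by
  refine con_of_snd_eq_zero H _ _ ?_ s
  simp only [lower, Prod.snd_add, Prod.snd_sum]
  rw [Finset.sum_eq_zero fun n _ => by simp [bM], Finset.sum_eq_zero fun n _ => by simp [bM]]
  simp [lamM]

set_option linter.defProp false in
/-- The contraction rules for the constituents of the terms of the currents. -/
def contractionRules (N : ℕ) (k : ℂ) (hh : 0 < h) (hs : 0 < s) :=
  And.intro (@con_sub_left N) <| And.intro (@con_add_left N) <| And.intro (@con_sub_right N) <|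
  And.intro (@con_add_right N) <| And.intro (@con_ladder_left N) <| And.intro (@con_upper_right N) <|
  And.intro (@con_lower_left N) <| And.intro (@con_bP_right N) <| And.intro (@con_bM_left N) <|
  And.intro (@con_bc_bc N h k s) <|
  And.intro (@con_bP_bc_ker N h k s · · · · hh hs) <|
  And.intro (@con_bc_bM_ker N h k s · · · · hh hs) <|
  And.intro (@con_bP_bM_ker N h k s · · · · hh hs) <|
  And.intro (@con_ladder_bc N h k s · · · hh hs) <|
  And.intro (@con_ladder_bM N h k s · · · hh hs) <|
  And.intro (@con_upper_bc N h k s · · · · hh hs) <|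
  And.intro (@con_upper_bM N h k s · · · · hh hs) <|
  And.intro (@con_bc_lower N h k s · · · hh hs) <|
  And.intro (@con_bP_lower N h k s · · · hh hs) <|
  And.intro (@con_ladder_lower N h k s · · hh hs)
    fun u v c μ m ν r h₁ h₂ h₃ h₄ h₅ h₆ h₇ h₈ =>
      @con_upper_lower N h k s u v c hh hs μ m ν r h₁ h₂ h₃ h₄ h₅ h₆ h₇ h₈ _ rfl

theorem con_raising_raising_self (hh : 0 < h) (hs : 0 < s) {μ m m' : ℕ} {ε ε' : Bool}
    (hμN : μ < N) (hm : 1 ≤ m) (hmμ : m ≤ μ) (hm' : 1 ≤ m') (hmμ' : m' ≤ μ) :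
    con N (comm N h k) (raising h μ m ε u) (raising h μ m' ε' v) s
      = ker h u v s 1 - ker h u v s (if m < m' then 1 else if m' < m then -1 else
          (sgn ε' - sgn ε) / 2) := by
  cases ε <;> cases ε' <;>
  (simp (disch := omega) only [raising, bSgn, sgn, Pi.add_apply, Pi.sub_apply,
    contractionRules N k hh hs]
   rcases lt_trichotomy m m' with h1 | h1 | h1)
  all_goals subst_vars
  all_goals first
  | omega
  | try simp (disch := omega) only [if_pos, if_neg, true_and, and_true, or_true, true_or, if_true,
      reduceCtorEq, and_false, or_false, if_false, false_and, false_or, imp_false, true_imp_iff,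
      ne_eq, not_true_eq_false, not_false_eq_true, secondDiff, firstDiff, stepDiff]
    push_cast
    ring_nf

theorem con_raising_raising_succ (hh : 0 < h) (hs : 0 < s) {μ m m' : ℕ} {ε ε' : Bool}
    (hμN : μ + 1 < N) (hm : 1 ≤ m) (hmμ : m ≤ μ) (hm' : 1 ≤ m') (hmμ' : m' ≤ μ + 1) :
    con N (comm N h k) (raising h μ m ε u) (raising h (μ + 1) m' ε' v) s
      = ker h u v s (-1)
        - ker h u v s (if m' < m ∨ m' = m ∧ ε = true then 0 else -1) := by
  cases ε <;> cases ε' <;>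
  (simp (disch := omega) only [raising, bSgn, sgn, Pi.add_apply, Pi.sub_apply,
    contractionRules N k hh hs]
   rcases lt_trichotomy m m' with h1 | h1 | h1)
  all_goals subst_vars
  all_goals first
  | omega
  | try simp (disch := omega) only [if_pos, if_neg, true_and, and_true, or_true, true_or, if_true,
      reduceCtorEq, and_false, or_false, if_false, false_and, false_or, imp_false, true_imp_iff,
      ne_eq, not_true_eq_false, not_false_eq_true, secondDiff, firstDiff, stepDiff]
    push_cast
    ring_nf

theorem con_raising_succ_raising (hh : 0 < h) (hs : 0 < s) {ν m m' : ℕ} {ε ε' : Bool}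
    (hμN : ν + 1 < N) (hm : 1 ≤ m) (hmμ : m ≤ ν + 1) (hm' : 1 ≤ m') (hmμ' : m' ≤ ν) :
    con N (comm N h k) (raising h (ν + 1) m ε u) (raising h ν m' ε' v) s
      = ker h u v s 0
        - ker h u v s (if m < m' ∨ m = m' ∧ ε' = true then 0 else 1) := by
  cases ε <;> cases ε' <;>
  (simp (disch := omega) only [raising, bSgn, sgn, Pi.add_apply, Pi.sub_apply,
    contractionRules N k hh hs]
   rcases lt_trichotomy m m' with h1 | h1 | h1)
  all_goals subst_vars
  all_goals first
  | omega
  | try simp (disch := omega) only [if_pos, if_neg, true_and, and_true, or_true, true_or, if_true,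
      reduceCtorEq, and_false, or_false, if_false, false_and, false_or, imp_false, true_imp_iff,
      ne_eq, not_true_eq_false, not_false_eq_true, secondDiff, firstDiff, stepDiff]
    push_cast
    ring_nf

theorem con_raising_raising_far (hh : 0 < h) (hs : 0 < s) {μ ν m m' : ℕ} {ε ε' : Bool}
    (hμν : μ + 1 < ν ∨ ν + 1 < μ)
    (i0 : μ < N) (hνN : ν < N) (hm : 1 ≤ m) (hmμ : m ≤ μ) (hm' : 1 ≤ m') (hmμ' : m' ≤ ν) :
    con N (comm N h k) (raising h μ m ε u) (raising h ν m' ε' v) s = 0 := by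
  cases ε <;> cases ε' <;>
  (simp (disch := omega) only [raising, bSgn, sgn, Pi.add_apply, Pi.sub_apply,
    contractionRules N k hh hs]
   rcases lt_trichotomy m m' with h1 | h1 | h1)
  all_goals subst_vars
  all_goals first
  | omega
  | try simp (disch := omega) only [if_pos, if_neg, true_and, and_true, or_true, true_or, if_true,
      reduceCtorEq, and_false, or_false, if_false, false_and, false_or, imp_false, true_imp_iff,
      ne_eq, not_true_eq_false, not_false_eq_true, secondDiff, firstDiff, stepDiff]
    push_cast
    ring_nf

end terms

section crossed

variable {N : ℕ} {h : ℝ} {k : ℂ} {s : ℝ} {u v : ℂ}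

theorem con_raising_loweringL_self (hh : 0 < h) (hs : 0 < s) {μ m m' : ℕ} {ε ε' : Bool}
    (hμN : μ < N) (hm : 1 ≤ m) (hmμ : m ≤ μ) (hm' : 1 ≤ m') (hmμ' : m' ≤ μ)
    (hε : ¬(m' = μ ∧ ε' = true)) :
    (con N (comm N h k) (raising h μ m ε u) (loweringL N h k μ m' ε' v) s
      = if m = m' ∧ ε = ε' then ker h u v s (-m + (1 - sgn ε) / 2)
        - ker h u v s (-m + (1 - sgn ε) / 2 + sgn ε) else 0)
    ∧ con N (comm N h k) (loweringL N h k μ m' ε' u) (raising h μ m ε v) s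
      = if m = m' ∧ ε = ε' then ker h u v s (-(-m + (1 - sgn ε) / 2))
        - ker h u v s (-(-m + (1 - sgn ε) / 2) - sgn ε) else 0 := by
  constructor <;> cases ε <;> cases ε' <;>
  (simp (disch := omega) only [raising, loweringL, bSgn, sgn, Pi.add_apply, Pi.sub_apply,
    contractionRules N k hh hs]
   try simp at hε
   rcases lt_trichotomy m m' with h1 | h1 | h1 <;> rcases eq_or_lt_of_le hmμ with h2 | h2)
  all_goals subst_vars
  all_goals first
  | omega
  | try simp (disch := omega) only [if_pos, if_neg, true_and, and_true, or_true, true_or, if_true,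
      reduceCtorEq, and_false, or_false, if_false, false_and, false_or, imp_false, true_imp_iff,
      ne_eq, not_true_eq_false, not_false_eq_true, secondDiff, firstDiff, stepDiff]
    push_cast
    ring_nf

theorem con_raising_loweringL_succ (hh : 0 < h) (hs : 0 < s) {μ m m' : ℕ} {ε ε' : Bool}
    (hμN : μ + 1 < N) (hm : 1 ≤ m) (hmμ : m ≤ μ) (hm' : 1 ≤ m') (hmμ' : m' ≤ μ + 1) :
    (con N (comm N h k) (raising h μ m ε u) (loweringL N h k (μ + 1) m' ε' v) s
      = if m = m' ∧ ε = ε' then ker h u v s (-m) - ker h u v s (-m + -sgn ε) else 0)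
    ∧ con N (comm N h k) (loweringL N h k (μ + 1) m' ε' u) (raising h μ m ε v) s
      = if m = m' ∧ ε = ε' then ker h u v s (-(-m)) - ker h u v s (-(-m) - -sgn ε) else 0 := by
  constructor <;> cases ε <;> cases ε' <;>
  (simp (disch := omega) only [raising, loweringL, bSgn, sgn, Pi.add_apply, Pi.sub_apply,
    contractionRules N k hh hs]
   rcases lt_trichotomy m m' with h1 | h1 | h1 <;> rcases eq_or_lt_of_le hmμ with h2 | h2)
  all_goals subst_vars
  all_goals first
  | omega
  | try simp (disch := omega) only [if_pos, if_neg, true_and, and_true, or_true, true_or, if_true,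
      reduceCtorEq, and_false, or_false, if_false, false_and, false_or, imp_false, true_imp_iff,
      ne_eq, not_true_eq_false, not_false_eq_true, secondDiff, firstDiff, stepDiff]
    push_cast
    ring_nf

theorem con_raising_loweringL_far (hh : 0 < h) (hs : 0 < s) {μ ν m m' : ℕ} {ε ε' : Bool}
    (hμν : ν < μ ∨ μ + 1 < ν) (hμN : μ < N) (hνN : ν < N) (hm : 1 ≤ m) (hmμ : m ≤ μ) (hm' : 1 ≤ m')
    (hmμ' : m' ≤ ν) (hε : ¬(m' = ν ∧ ε' = true)) :
    con N (comm N h k) (raising h μ m ε u) (loweringL N h k ν m' ε' v) s = 0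
    ∧ con N (comm N h k) (loweringL N h k ν m' ε' u) (raising h μ m ε v) s = 0 := by
  constructor <;> cases ε <;> cases ε' <;>
  (simp (disch := omega) only [raising, loweringL, bSgn, sgn, Pi.add_apply, Pi.sub_apply,
    contractionRules N k hh hs]
   try simp at hε
   rcases eq_or_ne μ (ν + 1) with h0 | h0 <;> rcases lt_trichotomy m m' with h1 | h1 | h1 <;>
   rcases (by omega : m < ν ∨ m = ν ∨ m = ν + 1 ∨ ν + 1 < m) with h2 | h2 | h2 | h2)
  all_goals subst_vars
  all_goals first
  | omega
  | try simp (disch := omega) only [if_pos, if_neg, true_and, and_true, or_true, true_or, if_true,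
      reduceCtorEq, and_false, or_false, if_false, false_and, false_or, imp_false, true_imp_iff,
      ne_eq, not_true_eq_false, not_false_eq_true, secondDiff, firstDiff, stepDiff]
    push_cast
    ring_nf

end crossed

section crossed

variable {N : ℕ} {h : ℝ} {k : ℂ} {s : ℝ} {u v : ℂ}

set_option maxHeartbeats 400000 in
theorem con_raising_loweringR_of_lt (hh : 0 < h) (hs : 0 < s) {μ ν m m' : ℕ} {ε ε' : Bool} (hν : 1 ≤ ν)
    (hμν : ν < μ) (hμN : μ < N) (hm : 1 ≤ m) (hmμ : m ≤ μ) (hm' : ν < m') (hmN : m' ≤ N)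
    (hε : ¬(m' = ν + 1 ∧ ε' = false)) :
    (con N (comm N h k) (raising h μ m ε u) (loweringR N h k ν m' ε' v) s
      = ker h u v s (k + (μ - ν)) - ker h u v s (k + (μ - ν)
        + (if m = ν ∧ m' = μ + 1 ∧ ε = true then 1
          else if m = ν + 1 ∧ m' = μ ∧ ε' = true then -1
          else if m = ν + 1 ∧ m' = μ + 1 ∧ ε ≠ ε' then -sgn ε else 0)))
    ∧ con N (comm N h k) (loweringR N h k ν m' ε' u) (raising h μ m ε v) s
      = ker h u v s (-(k + (μ - ν))) - ker h u v s (-(k + (μ - ν))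
        - (if m = ν ∧ m' = μ + 1 ∧ ε = true then 1
          else if m = ν + 1 ∧ m' = μ ∧ ε' = true then -1
          else if m = ν + 1 ∧ m' = μ + 1 ∧ ε ≠ ε' then -sgn ε else 0)) := by
  constructor <;> cases ε <;> cases ε' <;>
  (simp (disch := omega) only [raising, loweringR, bSgn, sgn, Pi.add_apply, Pi.sub_apply,
    contractionRules N k hh hs]
   try simp at hε
   rcases (by omega : m < ν ∨ m = ν ∨ m = ν + 1 ∨ ν + 1 < m) with h1 | h1 | h1 | h1 <;>
   rcases (by omega : m' < μ ∨ m' = μ ∨ m' = μ + 1 ∨ μ + 1 < m') with h2 | h2 | h2 | h2 <;>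
   rcases (by omega : μ = ν + 1 ∨ ν + 1 < μ) with h0 | h0)
  all_goals subst_vars
  all_goals first
  | omega
  | try simp (disch := omega) only [if_pos, if_neg, true_and, and_true, or_true, true_or, if_true,
      reduceCtorEq, and_false, or_false, if_false, false_and, false_or, imp_false, true_imp_iff,
      ne_eq, not_true_eq_false, not_false_eq_true, secondDiff, firstDiff, stepDiff]
    push_cast
    ring_nf

theorem con_raising_loweringR_of_le (hh : 0 < h) (hs : 0 < s) {μ ν m m' : ℕ} {ε ε' : Bool} (hν : 1 ≤ ν)
    (hμν : μ ≤ ν) (hνN : ν < N) (hm : 1 ≤ m) (hmμ : m ≤ μ) (hm' : ν < m') (hmN : m' ≤ N)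
    (hε : ¬(m' = ν + 1 ∧ ε' = false)) :
    (con N (comm N h k) (raising h μ m ε u) (loweringR N h k ν m' ε' v) s
      = if m = ν ∧ m' = ν + 1 ∧ ε = true then ker h u v s k - ker h u v s (k + 1) else 0)
    ∧ con N (comm N h k) (loweringR N h k ν m' ε' u) (raising h μ m ε v) s
      = if m = ν ∧ m' = ν + 1 ∧ ε = true then ker h u v s (-k) - ker h u v s (-k - 1) else 0 := by
  constructor <;> cases ε <;> cases ε' <;>
  (simp (disch := omega) only [raising, loweringR, bSgn, sgn, Pi.add_apply, Pi.sub_apply,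
    contractionRules N k hh hs]
   try simp at hε
   rcases (by omega : m < ν ∨ m = ν) with h1 | h1 <;>
   rcases (by omega : m' = ν + 1 ∨ ν + 1 < m') with h2 | h2 <;>
   rcases (by omega : μ < ν ∨ μ = ν) with h0 | h0)
  all_goals subst_vars
  all_goals first
  | omega
  | try simp (disch := omega) only [if_pos, if_neg, true_and, and_true, or_true, true_or, if_true,
      reduceCtorEq, and_false, or_false, if_false, false_and, false_or, imp_false, true_imp_iff,
      ne_eq, not_true_eq_false, not_false_eq_true, secondDiff, firstDiff, stepDiff]
    push_cast
    ring_nf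

end crossed

section crossed

variable {N : ℕ} {h : ℝ} {k : ℂ} {s : ℝ} {u v : ℂ}

theorem con_loweringL_loweringL_self (hh : 0 < h) (hs : 0 < s) {μ m m' : ℕ} {ε ε' : Bool} (hμN : μ < N)
    (hm : 1 ≤ m) (hmμ : m ≤ μ) (hm' : 1 ≤ m') (hmν : m' ≤ μ)
    (hε : ¬(m = μ ∧ ε = true)) (hε' : ¬(m' = μ ∧ ε' = true)) :
    con N (comm N h k) (loweringL N h k μ m ε u) (loweringL N h k μ m' ε' v) s
      = ker h u v s (-1) - ker h u v s (if m < m' then -1 else if m' < m then 1 else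
          (sgn ε - sgn ε') / 2) := by
  cases ε <;> cases ε' <;>
  (simp (disch := omega) only [loweringL, bSgn, sgn, Pi.add_apply, Pi.sub_apply,
    contractionRules N k hh hs]
   try simp at hε hε'
   rcases lt_trichotomy m m' with h1 | h1 | h1 <;>
   rcases eq_or_lt_of_le hmμ with h2 | h2)
  all_goals subst_vars
  all_goals first
  | omega
  | try simp (disch := omega) only [if_pos, if_neg, true_and, and_true, or_true, true_or, if_true,
      reduceCtorEq, and_false, or_false, if_false, false_and, false_or, imp_false, true_imp_iff,
      ne_eq, not_true_eq_false, not_false_eq_true, secondDiff, firstDiff, stepDiff]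
    push_cast
    ring_nf

theorem con_loweringL_succ_loweringL (hh : 0 < h) (hs : 0 < s) {ν m m' : ℕ} {ε ε' : Bool} (hμN : ν + 1 < N)
    (hm : 1 ≤ m) (hmμ : m ≤ ν + 1) (hm' : 1 ≤ m') (hmν : m' ≤ ν)
    (hε : ¬(m = ν + 1 ∧ ε = true)) (hε' : ¬(m' = ν ∧ ε' = true)) :
    con N (comm N h k) (loweringL N h k (ν + 1) m ε u) (loweringL N h k ν m' ε' v) s
      = ker h u v s 1 - ker h u v s (if m' < m ∨ m' = m ∧ ε = true then 0 else 1) := by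
  cases ε <;> cases ε' <;>
  (simp (disch := omega) only [loweringL, bSgn, sgn, Pi.add_apply, Pi.sub_apply,
    contractionRules N k hh hs]
   try simp at hε hε'
   rcases lt_trichotomy m m' with h1 | h1 | h1 <;>
   rcases (by omega : m = ν + 1 ∨ m = ν ∨ m < ν) with h2 | h2 | h2)
  all_goals subst_vars
  all_goals first
  | omega
  | try simp (disch := omega) only [if_pos, if_neg, true_and, and_true, or_true, true_or, if_true,
      reduceCtorEq, and_false, or_false, if_false, false_and, false_or, imp_false, true_imp_iff,
      ne_eq, not_true_eq_false, not_false_eq_true, secondDiff, firstDiff, stepDiff]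
    push_cast
    ring_nf

theorem con_loweringL_loweringL_succ (hh : 0 < h) (hs : 0 < s) {μ m m' : ℕ} {ε ε' : Bool} (hμN : μ + 1 < N)
    (hm : 1 ≤ m) (hmμ : m ≤ μ) (hm' : 1 ≤ m') (hmν : m' ≤ μ + 1)
    (hε : ¬(m = μ ∧ ε = true)) (hε' : ¬(m' = μ + 1 ∧ ε' = true)) :
    con N (comm N h k) (loweringL N h k μ m ε u) (loweringL N h k (μ + 1) m' ε' v) s
      = ker h u v s 0 - ker h u v s (if m < m' ∨ m = m' ∧ ε' = true then 0 else -1) := by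
  cases ε <;> cases ε' <;>
  (simp (disch := omega) only [loweringL, bSgn, sgn, Pi.add_apply, Pi.sub_apply,
    contractionRules N k hh hs]
   try simp at hε hε'
   rcases lt_trichotomy m m' with h1 | h1 | h1 <;>
   rcases eq_or_lt_of_le hmμ with h2 | h2)
  all_goals subst_vars
  all_goals first
  | omega
  | try simp (disch := omega) only [if_pos, if_neg, true_and, and_true, or_true, true_or, if_true,
      reduceCtorEq, and_false, or_false, if_false, false_and, false_or, imp_false, true_imp_iff,
      ne_eq, not_true_eq_false, not_false_eq_true, secondDiff, firstDiff, stepDiff]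
    push_cast
    ring_nf

theorem con_loweringL_loweringL_far (hh : 0 < h) (hs : 0 < s) {μ ν m m' : ℕ} {ε ε' : Bool}
    (hμν : μ + 1 < ν ∨ ν + 1 < μ) (hμN : μ < N) (hνN : ν < N)
    (hm : 1 ≤ m) (hmμ : m ≤ μ) (hm' : 1 ≤ m') (hmν : m' ≤ ν)
    (hε : ¬(m = μ ∧ ε = true)) (hε' : ¬(m' = ν ∧ ε' = true)) :
    con N (comm N h k) (loweringL N h k μ m ε u) (loweringL N h k ν m' ε' v) s = 0 := by
  cases ε <;> cases ε' <;>
  (simp (disch := omega) only [loweringL, bSgn, sgn, Pi.add_apply, Pi.sub_apply,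
    contractionRules N k hh hs]
   try simp at hε hε'
   rcases lt_trichotomy m m' with h1 | h1 | h1 <;>
   rcases (by omega : m < ν ∨ m = ν ∨ m = ν + 1 ∨ ν + 1 < m) with h2 | h2 | h2 | h2 <;>
   rcases eq_or_lt_of_le hmμ with h0 | h0)
  all_goals subst_vars
  all_goals first
  | omega
  | try simp (disch := omega) only [if_pos, if_neg, true_and, and_true, or_true, true_or, if_true,
      reduceCtorEq, and_false, or_false, if_false, false_and, false_or, imp_false, true_imp_iff,
      ne_eq, not_true_eq_false, not_false_eq_true, secondDiff, firstDiff, stepDiff]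
    push_cast
    ring_nf

end crossed

section crossed

variable {N : ℕ} {h : ℝ} {k : ℂ} {s : ℝ} {u v : ℂ}

theorem con_loweringR_loweringR_self (hh : 0 < h) (hs : 0 < s) {μ m m' : ℕ} {ε ε' : Bool} (hμ : 1 ≤ μ)
    (hm : μ < m) (hmN : m ≤ N) (hm' : μ < m') (hmN' : m' ≤ N)
    (hε : ¬(m = μ + 1 ∧ ε = false)) (hε' : ¬(m' = μ + 1 ∧ ε' = false)) :
    con N (comm N h k) (loweringR N h k μ m ε u) (loweringR N h k μ m' ε' v) s
      = ker h u v s (-1) - ker h u v s (if m' < m then -1 else if m < m' then 1 else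
          (sgn ε' - sgn ε) / 2) := by
  cases ε <;> cases ε' <;>
  (simp (disch := omega) only [loweringR, bSgn, sgn, Pi.add_apply, Pi.sub_apply,
    contractionRules N k hh hs]
   try simp at hε hε'
   rcases lt_trichotomy m m' with h1 | h1 | h1 <;>
   rcases (by omega : m = μ + 1 ∨ μ + 1 < m) with h2 | h2)
  all_goals subst_vars
  all_goals first
  | omega
  | try simp (disch := omega) only [if_pos, if_neg, true_and, and_true, or_true, true_or, if_true,
      reduceCtorEq, and_false, or_false, if_false, false_and, false_or, imp_false, true_imp_iff,
      ne_eq, not_true_eq_false, not_false_eq_true, secondDiff, firstDiff, stepDiff]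
    push_cast
    ring_nf

theorem con_loweringR_succ_loweringR (hh : 0 < h) (hs : 0 < s) {ν m m' : ℕ} {ε ε' : Bool} (hν : 1 ≤ ν)
    (hm : ν + 1 < m) (hmN : m ≤ N) (hm' : ν < m') (hmN' : m' ≤ N)
    (hε : ¬(m = ν + 1 + 1 ∧ ε = false)) (hε' : ¬(m' = ν + 1 ∧ ε' = false)) :
    con N (comm N h k) (loweringR N h k (ν + 1) m ε u) (loweringR N h k ν m' ε' v) s
      = ker h u v s 1 - ker h u v s (if m < m' ∨ m = m' ∧ ε' = true then 0 else 1) := by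
  cases ε <;> cases ε' <;>
  (simp (disch := omega) only [loweringR, bSgn, sgn, Pi.add_apply, Pi.sub_apply,
    contractionRules N k hh hs]
   try simp at hε hε'
   rcases lt_trichotomy m m' with h1 | h1 | h1 <;>
   rcases (by omega : m = ν + 2 ∨ ν + 2 < m) with h2 | h2 <;>
   rcases (by omega : m' = ν + 1 ∨ m' = ν + 2 ∨ ν + 2 < m') with h0 | h0 | h0)
  all_goals subst_vars
  all_goals first
  | omega
  | try simp (disch := omega) only [if_pos, if_neg, true_and, and_true, or_true, true_or, if_true,
      reduceCtorEq, and_false, or_false, if_false, false_and, false_or, imp_false, true_imp_iff,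
      ne_eq, not_true_eq_false, not_false_eq_true, secondDiff, firstDiff, stepDiff]
    push_cast
    ring_nf

theorem con_loweringR_loweringR_succ (hh : 0 < h) (hs : 0 < s) {μ m m' : ℕ} {ε ε' : Bool} (hμ : 1 ≤ μ)
    (hm : μ < m) (hmN : m ≤ N) (hm' : μ + 1 < m') (hmN' : m' ≤ N)
    (hε : ¬(m = μ + 1 ∧ ε = false)) (hε' : ¬(m' = μ + 1 + 1 ∧ ε' = false)) :
    con N (comm N h k) (loweringR N h k μ m ε u) (loweringR N h k (μ + 1) m' ε' v) s
      = ker h u v s 0 - ker h u v s (if m' < m ∨ m' = m ∧ ε = true then 0 else -1) := by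
  cases ε <;> cases ε' <;>
  (simp (disch := omega) only [loweringR, bSgn, sgn, Pi.add_apply, Pi.sub_apply,
    contractionRules N k hh hs]
   try simp at hε hε'
   rcases lt_trichotomy m m' with h1 | h1 | h1 <;>
   rcases (by omega : m' = μ + 2 ∨ μ + 2 < m') with h2 | h2 <;>
   rcases (by omega : m = μ + 1 ∨ m = μ + 2 ∨ μ + 2 < m) with h0 | h0 | h0)
  all_goals subst_vars
  all_goals first
  | omega
  | try simp (disch := omega) only [if_pos, if_neg, true_and, and_true, or_true, true_or, if_true,
      reduceCtorEq, and_false, or_false, if_false, false_and, false_or, imp_false, true_imp_iff,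
      ne_eq, not_true_eq_false, not_false_eq_true, secondDiff, firstDiff, stepDiff]
    push_cast
    ring_nf

theorem con_loweringR_loweringR_far (hh : 0 < h) (hs : 0 < s) {μ ν m m' : ℕ} {ε ε' : Bool}
    (hμν : μ + 1 < ν ∨ ν + 1 < μ) (hμ : 1 ≤ μ) (hν : 1 ≤ ν)
    (hm : μ < m) (hmN : m ≤ N) (hm' : ν < m') (hmN' : m' ≤ N)
    (hε : ¬(m = μ + 1 ∧ ε = false)) (hε' : ¬(m' = ν + 1 ∧ ε' = false)) :
    con N (comm N h k) (loweringR N h k μ m ε u) (loweringR N h k ν m' ε' v) s = 0 := by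
  cases ε <;> cases ε' <;>
  (simp (disch := omega) only [loweringR, bSgn, sgn, Pi.add_apply, Pi.sub_apply,
    contractionRules N k hh hs]
   try simp at hε hε'
   rcases lt_trichotomy m m' with h1 | h1 | h1)
  all_goals subst_vars
  all_goals first
  | omega
  | try simp (disch := omega) only [if_pos, if_neg, true_and, and_true, or_true, true_or, if_true,
      reduceCtorEq, and_false, or_false, if_false, false_and, false_or, imp_false, true_imp_iff,
      ne_eq, not_true_eq_false, not_false_eq_true, secondDiff, firstDiff, stepDiff]
    push_cast
    ring_nf

end crossed

section crossed

variable {N : ℕ} {h : ℝ} {k : ℂ} {s : ℝ} {u v : ℂ}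

theorem con_loweringL_loweringR_of_lt (hh : 0 < h) (hs : 0 < s) {μ ν m m' : ℕ} {ε ε' : Bool} (hν : 1 ≤ ν) (hμν : ν < μ) (hμN : μ < N)
    (hm : 1 ≤ m) (hmμ : m ≤ μ) (hm' : ν < m') (hmN' : m' ≤ N)
    (hε : ¬(m = μ ∧ ε = true)) (hε' : ¬(m' = ν + 1 ∧ ε' = false)) :
    con N (comm N h k) (loweringL N h k μ m ε u) (loweringR N h k ν m' ε' v) s
      = ker h u v s (k + μ) - ker h u v s (k + μ
        + (if m = ν ∧ m' = μ ∧ ε = true then -1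
          else if m = ν + 1 ∧ m' = μ ∧ ε = ε' then sgn ε
          else if m = ν + 1 ∧ m' = μ + 1 ∧ ε' = false then 1 else 0)) := by
  cases ε <;> cases ε' <;>
  (simp (disch := omega) only [loweringL, loweringR, bSgn, sgn, Pi.add_apply, Pi.sub_apply,
    contractionRules N k hh hs]
   try simp at hε hε'
   rcases (by omega : m < ν ∨ m = ν ∨ m = ν + 1 ∨ ν + 1 < m) with h1 | h1 | h1 | h1 <;>
   rcases (by omega : m' < μ ∨ m' = μ ∨ m' = μ + 1 ∨ μ + 1 < m') with h2 | h2 | h2 | h2 <;>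
   rcases (by omega : μ = ν + 1 ∨ ν + 1 < μ) with h0 | h0)
  all_goals subst_vars
  all_goals first
  | omega
  | try simp (disch := omega) only [if_pos, if_neg, true_and, and_true, or_true, true_or, if_true,
      reduceCtorEq, and_false, or_false, if_false, false_and, false_or, imp_false, true_imp_iff,
      ne_eq, not_true_eq_false, not_false_eq_true, secondDiff, firstDiff, stepDiff]
    push_cast
    ring_nf

theorem con_loweringL_loweringR_of_le (hh : 0 < h) (hs : 0 < s) {μ ν m m' : ℕ} {ε ε' : Bool} (hμν : μ ≤ ν) (hνN : ν < N)
    (hm : 1 ≤ m) (hmμ : m ≤ μ) (hm' : ν < m') (hmN' : m' ≤ N)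
    (hε : ¬(m = μ ∧ ε = true)) (hε' : ¬(m' = ν + 1 ∧ ε' = false)) :
    con N (comm N h k) (loweringL N h k μ m ε u) (loweringR N h k ν m' ε' v) s = 0 := by
  cases ε <;> cases ε' <;>
  (simp (disch := omega) only [loweringL, loweringR, bSgn, sgn, Pi.add_apply, Pi.sub_apply,
    contractionRules N k hh hs]
   try simp at hε hε'
   rcases (by omega : m < ν ∨ m = ν) with h1 | h1 <;>
   rcases (by omega : m' = ν + 1 ∨ ν + 1 < m') with h2 | h2 <;>
   rcases (by omega : μ < ν ∨ μ = ν) with h0 | h0)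
  all_goals subst_vars
  all_goals first
  | omega
  | try simp (disch := omega) only [if_pos, if_neg, true_and, and_true, or_true, true_or, if_true,
      reduceCtorEq, and_false, or_false, if_false, false_and, false_or, imp_false, true_imp_iff,
      ne_eq, not_true_eq_false, not_false_eq_true, secondDiff, firstDiff, stepDiff]
    push_cast
    ring_nf

end crossed

section crossed

variable {N : ℕ} {h : ℝ} {k : ℂ} {s : ℝ} {u v : ℂ}

theorem con_loweringR_loweringL_self (hh : 0 < h) (hs : 0 < s) {μ m m' : ℕ} {ε ε' : Bool} (hμN : μ < N)
    (hm : μ < m) (hmN : m ≤ N) (hm' : 1 ≤ m') (hmB : m' ≤ μ)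
    (hε : ¬(m = μ + 1 ∧ ε = false)) (hε' : ¬(m' = μ ∧ ε' = true)) :
    con N (comm N h k) (loweringR N h k μ m ε u) (loweringL N h k μ m' ε' v) s
      = ker h u v s (-1) - ker h u v s 1 := by
  cases ε <;> cases ε' <;>
  (simp (disch := omega) only [loweringL, loweringR, bSgn, sgn, Pi.add_apply, Pi.sub_apply,
    contractionRules N k hh hs]
   try simp at hε hε'
   rcases (by omega : m' = μ ∨ m' < μ) with h1 | h1 <;>
   rcases (by omega : m = μ + 1 ∨ μ + 1 < m) with h2 | h2)
  all_goals subst_vars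
  all_goals first
  | omega
  | try simp (disch := omega) only [if_pos, if_neg, true_and, and_true, or_true, true_or, if_true,
      reduceCtorEq, and_false, or_false, if_false, false_and, false_or, imp_false, true_imp_iff,
      ne_eq, not_true_eq_false, not_false_eq_true, secondDiff, firstDiff, stepDiff]
    push_cast
    ring_nf

theorem con_loweringR_succ_loweringL (hh : 0 < h) (hs : 0 < s) {ν m m' : ℕ} {ε ε' : Bool} (hνN : ν + 1 < N)
    (hm : ν + 1 < m) (hmN : m ≤ N) (hm' : 1 ≤ m') (hmB : m' ≤ ν)
    (hε : ¬(m = ν + 1 + 1 ∧ ε = false)) (hε' : ¬(m' = ν ∧ ε' = true)) :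
    con N (comm N h k) (loweringR N h k (ν + 1) m ε u) (loweringL N h k ν m' ε' v) s
      = ker h u v s 1 - ker h u v s 0 := by
  cases ε <;> cases ε' <;>
  (simp (disch := omega) only [loweringL, loweringR, bSgn, sgn, Pi.add_apply, Pi.sub_apply,
    contractionRules N k hh hs]
   try simp at hε hε'
   rcases (by omega : m' = ν ∨ m' < ν) with h1 | h1 <;>
   rcases (by omega : m = (ν + 1) + 1 ∨ (ν + 1) + 1 < m) with h2 | h2)
  all_goals subst_vars
  all_goals first
  | omega
  | try simp (disch := omega) only [if_pos, if_neg, true_and, and_true, or_true, true_or, if_true,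
      reduceCtorEq, and_false, or_false, if_false, false_and, false_or, imp_false, true_imp_iff,
      ne_eq, not_true_eq_false, not_false_eq_true, secondDiff, firstDiff, stepDiff]
    push_cast
    ring_nf

theorem con_loweringR_loweringL_far (hh : 0 < h) (hs : 0 < s) {μ ν m m' : ℕ} {ε ε' : Bool} (hμν : ν + 1 < μ) (hμN : μ < N)
    (hm : μ < m) (hmN : m ≤ N) (hm' : 1 ≤ m') (hmB : m' ≤ ν)
    (hε : ¬(m = μ + 1 ∧ ε = false)) (hε' : ¬(m' = ν ∧ ε' = true)) :
    con N (comm N h k) (loweringR N h k μ m ε u) (loweringL N h k ν m' ε' v) s = 0 := by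
  cases ε <;> cases ε' <;>
  (simp (disch := omega) only [loweringL, loweringR, bSgn, sgn, Pi.add_apply, Pi.sub_apply,
    contractionRules N k hh hs]
   try simp at hε hε'
   rcases (by omega : m' = ν ∨ m' < ν) with h1 | h1 <;>
   rcases (by omega : m = μ + 1 ∨ μ + 1 < m) with h2 | h2)
  all_goals subst_vars
  all_goals first
  | omega
  | try simp (disch := omega) only [if_pos, if_neg, true_and, and_true, or_true, true_or, if_true,
      reduceCtorEq, and_false, or_false, if_false, false_and, false_or, imp_false, true_imp_iff,
      ne_eq, not_true_eq_false, not_false_eq_true, secondDiff, firstDiff, stepDiff]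
    push_cast
    ring_nf

theorem con_loweringR_loweringL_succ (hh : 0 < h) (hs : 0 < s) {μ m m' : ℕ} {ε ε' : Bool} (hμ : 1 ≤ μ) (hνN : μ + 1 < N)
    (hm : μ < m) (hmN : m ≤ N) (hm' : 1 ≤ m') (hmB : m' ≤ μ + 1)
    (hε : ¬(m = μ + 1 ∧ ε = false)) (hε' : ¬(m' = μ + 1 ∧ ε' = true)) :
    con N (comm N h k) (loweringR N h k μ m ε u) (loweringL N h k (μ + 1) m' ε' v) s
      = ker h u v s 0 - ker h u v s (-1) + (ker h u v s (-(k + (μ + 1))) - ker h u v s (-(k + (μ + 1))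
        - (if m' = μ ∧ m = μ + 1 ∧ ε' = true then -1
          else if m' = μ + 1 ∧ m = μ + 1 ∧ ε' = ε then sgn ε'
          else if m' = μ + 1 ∧ m = μ + 1 + 1 ∧ ε = false then 1 else 0))) := by
  cases ε <;> cases ε' <;>
  (simp (disch := omega) only [loweringL, loweringR, bSgn, sgn, Pi.add_apply, Pi.sub_apply,
    contractionRules N k hh hs]
   try simp at hε hε'
   rcases (by omega : m' < μ ∨ m' = μ ∨ m' = μ + 1 ∨ μ + 1 < m') with h1 | h1 | h1 | h1 <;>
   rcases (by omega : m < (μ + 1) ∨ m = (μ + 1) ∨ m = (μ + 1) + 1 ∨ (μ + 1) + 1 < m) with h2 | h2 | h2 | h2)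
  all_goals subst_vars
  all_goals first
  | omega
  | try simp (disch := omega) only [if_pos, if_neg, true_and, and_true, or_true, true_or, if_true,
      reduceCtorEq, and_false, or_false, if_false, false_and, false_or, imp_false, true_imp_iff,
      ne_eq, not_true_eq_false, not_false_eq_true, secondDiff, firstDiff, stepDiff]
    push_cast
    ring_nf

set_option maxHeartbeats 400000 in
theorem con_loweringR_loweringL_of_lt (hh : 0 < h) (hs : 0 < s) {μ ν m m' : ℕ} {ε ε' : Bool} (hμ : 1 ≤ μ) (hμν : μ + 1 < ν) (hνN : ν < N)
    (hm : μ < m) (hmN : m ≤ N) (hm' : 1 ≤ m') (hmB : m' ≤ ν)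
    (hε : ¬(m = μ + 1 ∧ ε = false)) (hε' : ¬(m' = ν ∧ ε' = true)) :
    con N (comm N h k) (loweringR N h k μ m ε u) (loweringL N h k ν m' ε' v) s
      = ker h u v s (-(k + ν)) - ker h u v s (-(k + ν)
        - (if m' = μ ∧ m = ν ∧ ε' = true then -1
          else if m' = μ + 1 ∧ m = ν ∧ ε' = ε then sgn ε'
          else if m' = μ + 1 ∧ m = ν + 1 ∧ ε = false then 1 else 0)) := by
  cases ε <;> cases ε' <;>
  (simp (disch := omega) only [loweringL, loweringR, bSgn, sgn, Pi.add_apply, Pi.sub_apply,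
    contractionRules N k hh hs]
   try simp at hε hε'
   rcases (by omega : m' < μ ∨ m' = μ ∨ m' = μ + 1 ∨ μ + 1 < m') with h1 | h1 | h1 | h1 <;>
   rcases (by omega : m < ν ∨ m = ν ∨ m = ν + 1 ∨ ν + 1 < m) with h2 | h2 | h2 | h2)
  all_goals subst_vars
  all_goals first
  | omega
  | try simp (disch := omega) only [if_pos, if_neg, true_and, and_true, or_true, true_or, if_true,
      reduceCtorEq, and_false, or_false, if_false, false_and, false_or, imp_false, true_imp_iff,
      ne_eq, not_true_eq_false, not_false_eq_true, secondDiff, firstDiff, stepDiff]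
    push_cast
    ring_nf

end crossed

/-! ### Relations from contraction kernels -/

section kernels

variable {N : ℕ} {H : Commutators} {h : ℝ} {X Y : ℂ → Exponent}

theorem integratesTo_ker_sub (h : ℝ) (a b : ℂ) :
    IntegratesTo (fun w s => expKernel h a w s - expKernel h b w s)
      fun w => (w + b * (I * h)) / (w + a * (I * h)) :=
  integratesTo_expKernel h a b

theorem hasContraction_of_zero (hc : ∀ u v s, 0 < s → con N H (X u) (Y v) s = 0) :
    HasContraction N H X Y fun _ => 1 :=
  ⟨fun _ _ => 0, IntegratesTo.zero, hc⟩

theorem hasContraction_of_ker {a b : ℂ}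
    (hc : ∀ u v s, 0 < s → con N H (X u) (Y v) s = ker h u v s a - ker h u v s b) :
    HasContraction N H X Y fun w => (w + b * (I * h)) / (w + a * (I * h)) :=
  ⟨_, integratesTo_ker_sub h a b, hc⟩

theorem hasContraction_of_ker_add {a b c d : ℂ}
    (hc : ∀ u v s, 0 < s → con N H (X u) (Y v) s
      = ker h u v s a - ker h u v s b + (ker h u v s c - ker h u v s d)) :
    HasContraction N H X Y fun w =>
      (w + b * (I * h)) / (w + a * (I * h)) * ((w + d * (I * h)) / (w + c * (I * h))) :=
  ⟨_, (integratesTo_ker_sub h a b).add (integratesTo_ker_sub h c d), hc⟩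

variable {ι κ : Type*} {S : Finset ι} {T : Finset κ} {a : ι → ℂ} {b : κ → ℂ}
  {Xs : ι → ℂ → Exponent} {Ys : κ → ℂ → Exponent} {Du : Set Profile}

theorem exchange_of_con (hH : H.Regular) (hDu : ∀ ξ ∈ Du, ∀ m, IsSmearing (ξ m))
    (hX : ∀ i ∈ S, IsVertex (Xs i)) (hY : ∀ j ∈ T, IsVertex (Ys j)) {α α' π : ℂ}
    {τ δ : ι → κ → ℂ}
    (hXY : ∀ i ∈ S, ∀ j ∈ T, ∀ u v s, 0 < s → con N H (Xs i u) (Ys j v) s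
      = ker h u v s α - ker h u v s (τ i j) + (ker h u v s π - ker h u v s (π + δ i j)))
    (hYX : ∀ i ∈ S, ∀ j ∈ T, ∀ u v s, 0 < s → con N H (Ys j u) (Xs i v) s
      = ker h u v s α' - ker h u v s (-τ i j) + (ker h u v s (-π) - ker h u v s (-π - δ i j)))
    (hpol : ∀ Φ ξ v, ∑ i ∈ S, ∑ j ∈ T, a i * b j * (δ i j * (τ i j - π))
      * normalExp N H (Xs i (v - π * (I * h)) + Ys j v) Φ ξ = 0) :
    Exchange (fockSpace N) Du (fun w => w + α * (I * h)) (fun w => w - α' * (I * h))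
      (current N H S a Xs) (current N H T b Ys) := by
  refine exchange_of_polar_eq_zero hH hDu hX hY
    (fun i hi j hj => hasContraction_of_ker_add (hXY i hi j hj))
    (fun i hi j hj => hasContraction_of_ker_add (hYX i hi j hj))
    (n := fun i j w => w + (τ i j + δ i j) * (I * h)) (fun i _ j _ => by fun_prop)
    (fun i j => δ i j * (τ i j - π) * (I * h) ^ 2) (fun _ _ => -π * (I * h)) ?_ ?_ ?_
  · intro i _ j _
    filter_upwards [eventually_imBot_ne (α * (I * h)), eventually_imBot_ne (π * (I * h))]
      with w h1 h2
    beta_reduce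
    have h3 : w - -π * (I * h) = w + π * (I * h) := by ring
    rw [h3]
    obtain ⟨A, hA⟩ : ∃ A, A = w + α * (I * h) := ⟨_, rfl⟩
    obtain ⟨B, hB⟩ : ∃ B, B = w + π * (I * h) := ⟨_, rfl⟩
    rw [← hA] at h1 ⊢
    rw [← hB] at h2 ⊢
    rw [← mul_assoc, mul_div_cancel₀ _ h1, add_div' _ _ _ h2, ← mul_div_assoc]
    congr 1
    rw [hB]
    ring
  · intro i _ j _
    filter_upwards [eventually_imBot_ne (α' * (I * h)), eventually_imBot_ne (-π * (I * h))]
      with w h1 h2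
    beta_reduce
    have h3 : -w - -π * (I * h) = -(w + -π * (I * h)) := by ring
    have h4 : -w - α' * (I * h) = -(w + α' * (I * h)) := by ring
    rw [h4, h3, div_neg, ← sub_eq_add_neg]
    obtain ⟨A, hA⟩ : ∃ A, A = w + α' * (I * h) := ⟨_, rfl⟩
    obtain ⟨B, hB⟩ : ∃ B, B = w + -π * (I * h) := ⟨_, rfl⟩
    rw [← hA] at h1 ⊢
    rw [← hB] at h2 ⊢
    rw [← mul_assoc, neg_mul, mul_div_cancel₀ _ h1, sub_div' h2, ← mul_div_assoc]
    congr 1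
    rw [hB]
    ring
  · intro Φ ξ v w
    rw [← zero_mul ((I * h) ^ 2 / (w - -π * (I * h))), ← hpol Φ ξ v, Finset.sum_mul]
    refine Finset.sum_congr rfl fun i _ => ?_
    rw [Finset.sum_mul]
    refine Finset.sum_congr rfl fun j _ => ?_
    have h3 : v + -π * (I * h) = v - π * (I * h) := by ring
    rw [h3]
    ring

theorem exchange_swap_of_con (hH : H.Regular) (hDu : ∀ ξ ∈ Du, ∀ m, IsSmearing (ξ m))
    (hX : ∀ i ∈ S, IsVertex (Xs i)) (hY : ∀ j ∈ T, IsVertex (Ys j)) {α α' π : ℂ}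
    {τ δ : ι → κ → ℂ}
    (hXY : ∀ i ∈ S, ∀ j ∈ T, ∀ u v s, 0 < s → con N H (Xs i u) (Ys j v) s
      = ker h u v s α - ker h u v s (τ i j) + (ker h u v s π - ker h u v s (π + δ i j)))
    (hYX : ∀ i ∈ S, ∀ j ∈ T, ∀ u v s, 0 < s → con N H (Ys j u) (Xs i v) s
      = ker h u v s α' - ker h u v s (-τ i j) + (ker h u v s (-π) - ker h u v s (-π - δ i j)))
    (hpol : ∀ Φ ξ v, ∑ i ∈ S, ∑ j ∈ T, a i * b j * (δ i j * (τ i j - π))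
      * normalExp N H (Xs i (v - π * (I * h)) + Ys j v) Φ ξ = 0) :
    Exchange (fockSpace N) Du (fun w => w + α' * (I * h)) (fun w => w - α * (I * h))
      (current N H T b Ys) (current N H S a Xs) := by
  refine exchange_of_con hH hDu hY hX (π := -π) (τ := fun j i => -τ i j) (δ := fun j i => -δ i j)
    (fun j hj i hi u v s hs => ?_) (fun j hj i hi u v s hs => ?_) fun Φ ξ v => ?_
  · rw [hYX i hi j hj u v s hs, ← sub_eq_add_neg]
  · rw [hXY i hi j hj u v s hs, neg_neg, neg_neg, sub_neg_eq_add]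
  · rw [← hpol Φ ξ (v + π * (I * h)), Finset.sum_comm]
    refine Finset.sum_congr rfl fun i _ => Finset.sum_congr rfl fun j _ => ?_
    have h1 : v - -π * (I * h) = v + π * (I * h) := by ring
    rw [h1, add_sub_cancel_right, add_comm (Ys j _)]
    ring

theorem exchange_one_of_con (hH : H.Regular) (hDu : ∀ ξ ∈ Du, ∀ m, IsSmearing (ξ m))
    (hX : ∀ i ∈ S, IsVertex (Xs i)) (hY : ∀ j ∈ T, IsVertex (Ys j)) {π δ : ι → κ → ℂ}
    (hXY : ∀ i ∈ S, ∀ j ∈ T, ∀ u v s, 0 < s → con N H (Xs i u) (Ys j v) s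
      = ker h u v s (π i j) - ker h u v s (π i j + δ i j))
    (hYX : ∀ i ∈ S, ∀ j ∈ T, ∀ u v s, 0 < s → con N H (Ys j u) (Xs i v) s
      = ker h u v s (-π i j) - ker h u v s (-π i j - δ i j))
    (hpol : ∀ Φ ξ v w, ∑ i ∈ S, ∑ j ∈ T, a i * b j * (δ i j / (w + π i j * (I * h)))
      * normalExp N H (Xs i (v - π i j * (I * h)) + Ys j v) Φ ξ = 0) :
    Exchange (fockSpace N) Du (fun _ => 1) (fun _ => 1)
      (current N H S a Xs) (current N H T b Ys) := by
  refine exchange_of_polar_eq_zero hH hDu hX hY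
    (fun i hi j hj => hasContraction_of_ker (hXY i hi j hj))
    (fun i hi j hj => hasContraction_of_ker (hYX i hi j hj))
    (n := fun i j w => 1) (fun i _ j _ => by fun_prop)
    (fun i j => δ i j * (I * h)) (fun i j => -π i j * (I * h)) ?_ ?_ ?_
  · intro i _ j _
    filter_upwards [eventually_imBot_ne (π i j * (I * h))] with w h2
    beta_reduce
    have h3 : w - -π i j * (I * h) = w + π i j * (I * h) := by ring
    rw [h3, add_div' _ _ _ h2]
    ring
  · intro i _ j _
    filter_upwards [eventually_imBot_ne (-π i j * (I * h))] with w h2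
    beta_reduce
    have h3 : -w - -π i j * (I * h) = -(w + -π i j * (I * h)) := by ring
    rw [h3, div_neg, ← sub_eq_add_neg, sub_div' h2, one_mul]
    ring
  · intro Φ ξ v w
    rw [← zero_mul (I * (h : ℂ)), ← hpol Φ ξ v w, Finset.sum_mul]
    refine Finset.sum_congr rfl fun i _ => ?_
    rw [Finset.sum_mul]
    refine Finset.sum_congr rfl fun j _ => ?_
    have h3 : v + -π i j * (I * h) = v - π i j * (I * h) := by ring
    have h4 : w - -π i j * (I * h) = w + π i j * (I * h) := by ring
    rw [h3, h4]
    ring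

theorem exchange_one_of_con_zero (hH : H.Regular) (hDu : ∀ ξ ∈ Du, ∀ m, IsSmearing (ξ m))
    (hX : ∀ i ∈ S, IsVertex (Xs i)) (hY : ∀ j ∈ T, IsVertex (Ys j))
    (hXY : ∀ i ∈ S, ∀ j ∈ T, ∀ u v s, 0 < s → con N H (Xs i u) (Ys j v) s = 0)
    (hYX : ∀ i ∈ S, ∀ j ∈ T, ∀ u v s, 0 < s → con N H (Ys j u) (Xs i v) s = 0) :
    Exchange (fockSpace N) Du (fun _ => 1) (fun _ => 1)
      (current N H S a Xs) (current N H T b Ys) :=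
  exchange_one_of_con (h := 0) (π := 0) (δ := 0) hH hDu hX hY
    (fun i hi j hj u v s hs => by simp [hXY i hi j hj u v s hs])
    (fun i hi j hj u v s hs => by simp [hYX i hi j hj u v s hs]) (by simp)

/-- The Serre relations, when the contractions have the form of `exchange_of_con`. -/
theorem serre_of_con (hH : H.Regular) (hDu : ∀ ξ ∈ Du, ∀ m, IsSmearing (ξ m))
    (hX : ∀ i ∈ S, IsVertex (Xs i)) (hY : ∀ j ∈ T, IsVertex (Ys j)) {α β β' π : ℂ}
    {σ : ι → ι → ℂ} {τ δ : ι → κ → ℂ}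
    (hXX : ∀ i ∈ S, ∀ j ∈ S, ∀ u v s, 0 < s → con N H (Xs i u) (Xs j v) s
      = ker h u v s α - ker h u v s (σ i j))
    (hσ : ∀ i ∈ S, ∀ j ∈ S, σ j i = -σ i j)
    (hXY : ∀ i ∈ S, ∀ j ∈ T, ∀ u v s, 0 < s → con N H (Xs i u) (Ys j v) s
      = ker h u v s β - ker h u v s (τ i j) + (ker h u v s π - ker h u v s (π + δ i j)))
    (hYX : ∀ i ∈ S, ∀ j ∈ T, ∀ u v s, 0 < s → con N H (Ys j u) (Xs i v) s
      = ker h u v s β' - ker h u v s (-τ i j) + (ker h u v s (-π) - ker h u v s (-π - δ i j)))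
    (hαβ : β + β' = -α) :
    Serre (fockSpace N) Du (current N H S a Xs) (current N H T b Ys) := by
  refine serre_current hH hDu hX hY
    (fun i hi j hj => hasContraction_of_ker (hXX i hi j hj))
    (fun i hi j hj => hasContraction_of_ker_add (hXY i hi j hj))
    (fun j hj i hi => hasContraction_of_ker_add (hYX i hi j hj))
    (D := fun w => w + α * (I * h))
    (D₁ := fun w => (w + β * (I * h)) * (w + π * (I * h)))
    (D₂ := fun w => (w + β' * (I * h)) * (w + -π * (I * h)))
    (n := fun i j w => w + σ i j * (I * h))
    (n₁ := fun i j w => (w + τ i j * (I * h)) * (w + (π + δ i j) * (I * h)))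
    (n₂ := fun j i w => (w + -τ i j * (I * h)) * (w + (-π - δ i j) * (I * h)))
    (by fun_prop) (by fun_prop) (by fun_prop) (fun i _ j _ => by fun_prop)
    (fun i _ j _ => by fun_prop) (fun i _ j _ => by fun_prop) ?_ ?_ ?_ ?_
    (ε := α * (I * h)) (σ := -β' * (I * h)) ?_ ?_
  · have hex : ∀ {p : ℂ → Prop}, (∀ᶠ w in imBot, p w) → ∃ w, p w := fun hp => by
      obtain ⟨C, hC⟩ := eventually_imBot.1 hp
      exact ⟨⟨0, -C - 1⟩, hC _ (by simp)⟩
    have hβ := ((eventually_imBot_ne (β * (I * h))).and (eventually_imBot_ne (π * (I * h)))).and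
      ((eventually_imBot_neg_ne (β' * (I * h))).and (eventually_imBot_neg_ne (-π * (I * h))))
    obtain ⟨w₂, h2⟩ := hex hβ
    obtain ⟨w₁, h1, h3, h4⟩ := hex (hβ.and ((eventually_imBot_ne (-w₂ + α * (I * h))).and
      (eventually_imBot_neg_ne (w₂ + α * (I * h)))))
    refine ⟨w₁, w₂, ?_, ?_, mul_ne_zero h1.1.1 h1.1.2, mul_ne_zero h2.1.1 h2.1.2,
      mul_ne_zero h1.2.1 h1.2.2, mul_ne_zero h2.2.1 h2.2.2⟩
    · intro h0
      exact h3 (by rw [← h0]; ring)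
    · intro h0
      exact h4 (by rw [← h0]; ring)
  · intro i _ j _
    filter_upwards [eventually_imBot_ne (α * (I * h))] with w h1
    rw [mul_div_cancel₀ _ h1]
  · intro i _ j _
    filter_upwards [eventually_imBot_ne (β * (I * h)), eventually_imBot_ne (π * (I * h))]
      with w h1 h2
    rw [div_mul_div_comm, mul_div_cancel₀ _ (mul_ne_zero h1 h2)]
  · intro j _ i _
    filter_upwards [eventually_imBot_ne (β' * (I * h)), eventually_imBot_ne (-π * (I * h))]
      with w h1 h2
    rw [div_mul_div_comm, mul_div_cancel₀ _ (mul_ne_zero h1 h2)]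
  · intro i hi j hj w
    rw [hσ i hi j hj]
    ring
  · intro i _ j _ w
    obtain rfl : α = -(β + β') := by rw [hαβ, neg_neg]
    ring

end kernels

/-! ### The currents `X^±` as sums of normal ordered exponentials -/

section normal_form

variable {N : ℕ} {h : ℝ} {k : ℂ} {μ m : ℕ} {u : ℂ}

theorem onB_eq_zero {μ ν : ℕ} (hμν : ν ≤ μ) (f : ℝ → ℂ) : onB μ ν f = 0 := by
  funext m
  cases m <;> simp [onB, hμν.not_gt]

theorem onC_eq_zero {μ ν : ℕ} (hμν : ν ≤ μ) (f : ℝ → ℂ) : onC μ ν f = 0 := by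
  funext m
  cases m <;> simp [onC, hμν.not_gt]

theorem bP_self (h : ℝ) (μ : ℕ) (u : ℂ) : bP h μ μ u = 0 := by simp [bP, onB_eq_zero]

theorem bM_self (h : ℝ) (μ : ℕ) (u : ℂ) : bM h μ μ u = 0 := by simp [bM, onB_eq_zero]

theorem bSgn_self (h : ℝ) (ε : Bool) (μ : ℕ) (u : ℂ) : bSgn h ε μ μ u = 0 := by
  cases ε
  · exact bM_self h μ u
  · exact bP_self h μ u

theorem bc_self (h : ℝ) (μ : ℕ) (u : ℂ) : bc h μ μ u = 0 := by
  simp [bc, onB_eq_zero, onC_eq_zero]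

theorem op_neg_one_smul (A : Op) : (-1 : ℂ) • A = -A := by
  ext Φ ξ
  simp

/-- The index set of the terms of `X_μ^+`. -/
def raisingSet (μ : ℕ) : Finset (ℕ × Bool) := Finset.Icc 1 μ ×ˢ Finset.univ

/-- The index set of the terms of `X_μ^-`. -/
def loweringSet (N μ : ℕ) : Finset (ℕ × Bool) :=
  (Finset.Icc 1 N ×ˢ Finset.univ).filter
    fun i => ¬(i.1 = μ ∧ i.2 = true) ∧ ¬(i.1 = μ + 1 ∧ i.2 = false)

/-- The terms of `X_μ^-`. -/
def lowering (N : ℕ) (h : ℝ) (k : ℂ) (μ : ℕ) (i : ℕ × Bool) : ℂ → Exponent :=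
  if i.1 ≤ μ then loweringL N h k μ i.1 i.2 else loweringR N h k μ i.1 i.2

theorem mem_raisingSet {i : ℕ × Bool} : i ∈ raisingSet μ ↔ 1 ≤ i.1 ∧ i.1 ≤ μ := by
  simp [raisingSet]

theorem mem_loweringSet {i : ℕ × Bool} : i ∈ loweringSet N μ ↔ 1 ≤ i.1 ∧ i.1 ≤ N ∧
    ¬(i.1 = μ ∧ i.2 = true) ∧ ¬(i.1 = μ + 1 ∧ i.2 = false) := by
  simp [loweringSet, and_assoc]

theorem XPlus_eq_current (N : ℕ) (h : ℝ) (k : ℂ) (μ : ℕ) :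
    XPlus N h k μ = current N (comm N h k) (raisingSet μ) (fun i => sgn i.2)
      fun i => raising h μ i.1 i.2 := by
  funext u
  rw [XPlus, eCore, current, raisingSet, Finset.sum_product]
  refine Finset.sum_congr rfl fun m hm => ?_
  rw [Fintype.sum_bool]
  simp only [sgn, one_smul, neg_smul, ← sub_eq_add_neg, raising, ladder, bSgn]
  have e : ∀ a : ℂ, u + (μ : ℂ) / 2 * (I * h) - a / 2 * (I * h) = u + (μ - a) / 2 * (I * h) :=
    fun a => by ring
  have e1 : (μ : ℂ) - (m - 1) = μ - m + 1 := by ring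
  have e2 : (μ : ℂ) - m + 1 - 1 = μ - m := by ring
  have e3 : (μ : ℂ) - (m - 2) = μ - m + 1 - -1 := by ring
  have e4 : ∀ n : ℂ, (μ : ℂ) - (n - 1) = μ - n + 1 := fun n => by ring
  simp only [e, e4, e2, e3, op_neg_one_smul, ← sub_eq_add_neg]

theorem loweringL_self (N : ℕ) (h : ℝ) (k : ℂ) (μ : ℕ) (ε : Bool) (u : ℂ) :
    loweringL N h k μ μ ε u
      = bc h μ (μ + 1) (u + ((μ : ℂ) + μ) / 2 * (I * h)) + lower N h k μ (μ + 1) u := by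
  rw [loweringL, bSgn_self, bc_self, sub_zero, sub_zero]

theorem loweringR_self (N : ℕ) (h : ℝ) (k : ℂ) (μ : ℕ) (ε : Bool) (u : ℂ) :
    loweringR N h k μ (μ + 1) ε u
      = bc h μ (μ + 1) (u + (-k + ((μ : ℂ) - (μ + 1 : ℕ) + 1) / 2) * (I * h))
        + upper N h k (-k) μ (μ + 1) u := by
  rw [loweringR, bSgn_self, bc_self, sub_zero, add_zero]

theorem XMinus_eq_current (hμN : μ ≤ N) :
    XMinus N h k μ = current N (comm N h k) (loweringSet N μ) (fun i => -sgn i.2)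
      (lowering N h k μ) := by
  funext u
  have hd : Finset.Icc 1 N = Finset.Icc 1 μ ∪ Finset.Icc (μ + 1) N := by
    ext n; simp only [Finset.mem_union, Finset.mem_Icc]; omega
  have hdj : Disjoint (Finset.Icc 1 μ) (Finset.Icc (μ + 1) N) := by
    rw [Finset.disjoint_left]; intro n; simp only [Finset.mem_Icc]; omega
  rw [XMinus, fCore, current, loweringSet, Finset.sum_filter, Finset.sum_product, hd,
    Finset.sum_union hdj, sub_eq_add_neg, ← Finset.sum_neg_distrib]
  congr 1
  · refine Finset.sum_congr rfl fun m hm => ?_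
    have hm' := Finset.mem_Icc.1 hm
    rw [Fintype.sum_bool]
    have hl : ∀ ε, lowering N h k μ (m, ε) = loweringL N h k μ m ε := fun ε => if_pos hm'.2
    have hL : ∀ ε, loweringL N h k μ m ε u = bc h m (μ + 1) (u + (μ : ℂ) / 2 * (I * h) + m / 2 * (I * h))
        + lamM h μ (u + (μ : ℂ) / 2 * (I * h) - (k - N) / 4 * (I * h) - (μ : ℂ) / 2 * (I * h))
        - lamM h (μ + 1) (u + (μ : ℂ) / 2 * (I * h) - (k - N) / 4 * (I * h) - (μ : ℂ) / 2 * (I * h))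
        + ∑ n ∈ Finset.Icc (m + 1) μ, (bM h n (μ + 1) (u + (μ : ℂ) / 2 * (I * h)
          + ((n : ℂ) - 1) / 2 * (I * h)) - bM h n μ (u + (μ : ℂ) / 2 * (I * h) + (n : ℂ) / 2 * (I * h)))
        + ∑ s ∈ Finset.Icc (μ + 1) N, (bM h μ s (u + (μ : ℂ) / 2 * (I * h) + (s : ℂ) / 2 * (I * h))
            - bM h (μ + 1) s (u + (μ : ℂ) / 2 * (I * h) + ((s : ℂ) - 1) / 2 * (I * h)))
        - bSgn h ε m μ (u + (μ : ℂ) / 2 * (I * h) + (m : ℂ) / 2 * (I * h))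
        - bc h m μ (u + (μ : ℂ) / 2 * (I * h) + ((m : ℂ) + sgn ε) / 2 * (I * h)) := by
      intro ε
      have e1 : ∀ a : ℂ, u + (μ : ℂ) / 2 * (I * h) + a / 2 * (I * h) = u + (a + μ) / 2 * (I * h) :=
        fun a => by ring
      have e2 : u + (μ : ℂ) / 2 * (I * h) - (k - N) / 4 * (I * h) - (μ : ℂ) / 2 * (I * h)
        = u + (0 - (k - N) / 4) * (I * h) := by ring
      have e3 : ∀ n : ℂ, n - 1 + μ = n + μ - 1 := fun n => by ring
      have e4 : ∀ n s : ℂ, n + s + μ = n + μ + s := fun n s => by ring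
      simp only [e1, e2, e3, e4, loweringL, lower]
      abel
    have hP := hL true
    have hM := hL false
    simp only [sgn, bSgn, ← sub_eq_add_neg] at hP hM
    dsimp only
    rw [← hP, ← hM, hl, hl]
    by_cases h1 : m = μ
    · have hs : loweringL N h k μ m true u = loweringL N h k μ m false u := by
        rw [h1, loweringL_self, loweringL_self]
      rw [hs, if_pos h1, if_neg (by simp [h1]), if_pos (by simp [h1]), sgn, neg_neg, zero_add,
        one_smul, add_smul, one_smul, add_sub_cancel_right]
    · rw [if_neg h1, if_pos (by simp [h1]), if_pos (by simp [h1]; omega), sgn, sgn, add_zero,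
        neg_neg, op_neg_one_smul, one_smul, sub_eq_neg_add]
  · refine Finset.sum_congr rfl fun m hm => ?_
    have hm' := Finset.mem_Icc.1 hm
    rw [Fintype.sum_bool]
    have hl : ∀ ε, lowering N h k μ (m, ε) = loweringR N h k μ m ε := fun ε => if_neg (by simp; omega)
    have hR : ∀ ε, loweringR N h k μ m ε u
      = bc h μ m (u + (μ : ℂ) / 2 * (I * h) - (2 * k + m - 1) / 2 * (I * h))
        + lamP h μ (u + (μ : ℂ) / 2 * (I * h) - (3 * k + N) / 4 * (I * h) - (μ : ℂ) / 2 * (I * h))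
        - lamP h (μ + 1) (u + (μ : ℂ) / 2 * (I * h) - (3 * k + N) / 4 * (I * h)
          - (μ : ℂ) / 2 * (I * h))
        + ∑ n ∈ Finset.Icc m N,
          (bP h μ n (u + (μ : ℂ) / 2 * (I * h) - (2 * k + n) / 2 * (I * h))
            - bP h (μ + 1) n (u + (μ : ℂ) / 2 * (I * h) - (2 * k + n - 1) / 2 * (I * h)))
        + bSgn h ε (μ + 1) m (u + (μ : ℂ) / 2 * (I * h) - (2 * k + m - 1) / 2 * (I * h))
        - bc h (μ + 1) m (u + (μ : ℂ) / 2 * (I * h) - (2 * k + m - 1 + sgn ε) / 2 * (I * h)) := by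
      intro ε
      have e1 : ∀ a : ℂ, u + (μ : ℂ) / 2 * (I * h) - (2 * k + a) / 2 * (I * h)
        = u + (-k + (μ - a) / 2) * (I * h) := fun a => by ring
      have e2 : u + (μ : ℂ) / 2 * (I * h) - (3 * k + N) / 4 * (I * h) - (μ : ℂ) / 2 * (I * h)
        = u + (-k + (k - N) / 4) * (I * h) := by ring
      have e3 : ∀ a : ℂ, 2 * k + a - 1 = 2 * k + (a - 1) := fun n => by ring
      have e5 : ∀ a : ℂ, 2 * k + a + sgn ε = 2 * k + (a + sgn ε) := fun n => by ring
      have e4 : ∀ a : ℂ, (μ : ℂ) - (a - 1) = μ - a + 1 := fun n => by ring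
      have e6 : ∀ a : ℂ, (μ : ℂ) - (a - 1 + sgn ε) = μ - a + 1 - sgn ε := fun n => by ring
      simp only [e3, e5, e1, e2, e4, e6, loweringR, upper, lamRatio]
      abel
    have hP := hR true
    have hM := hR false
    have e7 : (2 * k + m - 1 + 1 : ℂ) = 2 * k + m := by ring
    have e8 : (2 * k + m - 1 + -1 : ℂ) = 2 * k + m - 2 := by ring
    simp only [sgn, bSgn, e7, e8] at hP hM
    dsimp only
    rw [← hP, ← hM, hl, hl]
    by_cases h1 : m = μ + 1
    · have hs : loweringR N h k μ m false u = loweringR N h k μ m true u := by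
        rw [h1, loweringR_self, loweringR_self]
      rw [hs, if_pos h1, if_pos (by simp [h1]), if_neg (by simp [h1]), sgn, add_zero, op_neg_one_smul,
        add_smul, one_smul, add_sub_cancel_right]
    · rw [if_neg h1, if_pos (by simp [h1]; omega), if_pos (by simp [h1]), sgn, sgn, add_zero,
        neg_neg, op_neg_one_smul, one_smul, one_smul, neg_sub, sub_eq_neg_add]

end normal_form

/-! ### Relations among the `X^+`, and among the `X^-` -/

section vertices

variable {N : ℕ} {h : ℝ} {k : ℂ}

theorem isVertex_bSgn (ε : Bool) (μ ν : ℕ) : IsVertex (bSgn h ε μ ν) := by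
  cases ε
  · exact isVertex_bM _ μ ν
  · exact isVertex_bP _ μ ν

theorem isVertex_ladder (μ m : ℕ) : IsVertex (ladder h μ m) :=
  .sum _ fun n _ => ((isVertex_bP _ n (μ + 1)).comp_add _).sub ((isVertex_bP _ n μ).comp_add _)

theorem isVertex_upper (c : ℂ) (μ m : ℕ) : IsVertex (upper N h k c μ m) :=
  (((isVertex_lamP _ μ).comp_add _).sub ((isVertex_lamP _ (μ + 1)).comp_add _)).add
    (.sum _ fun n _ => ((isVertex_bP _ μ n).comp_add _).sub ((isVertex_bP _ (μ + 1) n).comp_add _))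

theorem isVertex_lower (ν r : ℕ) : IsVertex (lower N h k ν r) :=
  ((((isVertex_lamM _ ν).comp_add _).sub ((isVertex_lamM _ (ν + 1)).comp_add _)).add
    (.sum _ fun n _ => ((isVertex_bM _ n (ν + 1)).comp_add _).sub ((isVertex_bM _ n ν).comp_add _))).add
    (.sum _ fun n _ => ((isVertex_bM _ ν n).comp_add _).sub ((isVertex_bM _ (ν + 1) n).comp_add _))

theorem isVertex_raising (hh : 0 < h) (μ m : ℕ) (ε : Bool) : IsVertex (raising h μ m ε) :=
  ((((isVertex_bc hh m μ).comp_add _).add (isVertex_ladder μ m)).add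
    ((isVertex_bSgn ε m (μ + 1)).comp_add _)).sub ((isVertex_bc hh m (μ + 1)).comp_add _)

theorem isVertex_lowering (hh : 0 < h) (μ : ℕ) (i : ℕ × Bool) :
    IsVertex (lowering N h k μ i) := by
  rw [lowering]
  split_ifs
  · exact ((((isVertex_bc hh i.1 (μ + 1)).comp_add _).add (isVertex_lower μ (i.1 + 1))).sub
      ((isVertex_bSgn i.2 i.1 μ).comp_add _)).sub ((isVertex_bc hh i.1 μ).comp_add _)
  · exact ((((isVertex_bc hh μ i.1).comp_add _).add (isVertex_upper (-k) μ i.1)).add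
      ((isVertex_bSgn i.2 (μ + 1) i.1).comp_add _)).sub ((isVertex_bc hh (μ + 1) i.1).comp_add _)

theorem ladder_succ {μ m : ℕ} (hm : 1 ≤ m) (u : ℂ) : ladder h μ (m + 1) u
    = ladder h μ m u + (bP h m (μ + 1) (u + ((μ : ℂ) - m + 1) / 2 * (I * h))
      - bP h m μ (u + ((μ : ℂ) - m) / 2 * (I * h))) :=
  Finset.sum_Ico_succ_top hm _

theorem upper_eq {c : ℂ} {μ m : ℕ} (hm : m ≤ N) (u : ℂ) : upper N h k c μ m u
    = upper N h k c μ (m + 1) u + (bP h μ m (u + (c + ((μ : ℂ) - m) / 2) * (I * h))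
      - bP h (μ + 1) m (u + (c + ((μ : ℂ) - m + 1) / 2) * (I * h))) := by
  rw [upper, upper, ← Finset.insert_Icc_add_one_left_eq_Icc hm, Finset.sum_insert (by simp)]
  abel

theorem lower_eq {ν r : ℕ} (hr : r ≤ ν) (v : ℂ) : lower N h k ν r v
    = lower N h k ν (r + 1) v + (bM h r (ν + 1) (v + ((r : ℂ) + ν - 1) / 2 * (I * h))
      - bM h r ν (v + ((r : ℂ) + ν) / 2 * (I * h))) := by
  rw [lower, lower, ← Finset.insert_Icc_add_one_left_eq_Icc hr, Finset.sum_insert (by simp)]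
  abel

end vertices

section relations

variable {N : ℕ} {h : ℝ} {k : ℂ}

theorem XPlus_con_self (hh : 0 < h) {μ : ℕ} (hμN : μ < N) :
    ∃ σ : ℕ × Bool → ℕ × Bool → ℂ, (∀ i j, σ j i = -σ i j) ∧
      ∀ i ∈ raisingSet μ, ∀ j ∈ raisingSet μ, ∀ u v s, 0 < s →
        con N (comm N h k) (raising h μ i.1 i.2 u) (raising h μ j.1 j.2 v) s
          = ker h u v s 1 - ker h u v s (σ i j) := by
  refine ⟨fun i j => if i.1 < j.1 then 1 else if j.1 < i.1 then -1 else (sgn j.2 - sgn i.2) / 2,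
    fun i j => ?_, fun i hi j hj u v s hs => ?_⟩
  · rcases lt_trichotomy i.1 j.1 with h1 | h1 | h1
    · simp [h1, h1.not_gt]
    · simp only [h1, lt_irrefl, if_false]
      ring
    · simp [h1, h1.not_gt]
  · rw [mem_raisingSet] at hi hj
    exact con_raising_raising_self hh hs hμN hi.1 hi.2 hj.1 hj.2

theorem exchange_self_of_con {ι : Type*} {S : Finset ι} {a : ι → ℂ} {Xs : ι → ℂ → Exponent}
    (hN : 0 < N) (hh : 0 < h) (hX : ∀ i ∈ S, IsVertex (Xs i)) {α : ℂ} {σ : ι → ι → ℂ}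
    (hσ : ∀ i j, σ j i = -σ i j)
    (hXX : ∀ i ∈ S, ∀ j ∈ S, ∀ u v s, 0 < s → con N (comm N h k) (Xs i u) (Xs j v) s
      = ker h u v s α - ker h u v s (σ i j)) :
    Exchange (fockSpace N) (fockDual N h) (fun w => w + α * (I * h)) (fun w => w - α * (I * h))
      (current N (comm N h k) S a Xs) (current N (comm N h k) S a Xs) :=
  exchange_of_con (comm_regular hN hh) (fun ξ hξ => hξ.1) hX hX (π := 0) (δ := fun _ _ => 0) (τ := σ)
    (fun i hi j hj u v s hs => by rw [hXX i hi j hj u v s hs, add_zero, sub_self, add_zero])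
    (fun i hi j hj u v s hs => by
      rw [hXX j hj i hi u v s hs, neg_zero, sub_zero, sub_self, add_zero, hσ i j]) (by simp)

theorem XPlus_XPlus_self (hN : 0 < N) (hh : 0 < h) {μ : ℕ} (hμN : μ < N) :
    Exchange (fockSpace N) (fockDual N h) (fun w => w + 1 * (I * h)) (fun w => w - 1 * (I * h))
      (XPlus N h k μ) (XPlus N h k μ) := by
  obtain ⟨σ, hσ, h0⟩ := XPlus_con_self (k := k) hh hμN
  simp only [XPlus_eq_current]
  exact exchange_self_of_con hN hh (fun i _ => isVertex_raising hh _ _ _) hσ h0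

theorem XPlus_con_succ (hh : 0 < h) {μ : ℕ} (hμN : μ + 1 < N) :
    ∃ τ : ℕ × Bool → ℕ × Bool → ℂ,
      (∀ i ∈ raisingSet μ, ∀ j ∈ raisingSet (μ + 1), ∀ u v s, 0 < s →
        con N (comm N h k) (raising h μ i.1 i.2 u) (raising h (μ + 1) j.1 j.2 v) s
          = ker h u v s (-1) - ker h u v s (τ i j)
            + (ker h u v s 0 - ker h u v s (0 + (fun _ _ => 0 : ℕ × Bool → ℕ × Bool → ℂ) i j))) ∧
      ∀ i ∈ raisingSet μ, ∀ j ∈ raisingSet (μ + 1), ∀ u v s, 0 < s →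
        con N (comm N h k) (raising h (μ + 1) j.1 j.2 u) (raising h μ i.1 i.2 v) s
          = ker h u v s 0 - ker h u v s (-τ i j)
            + (ker h u v s (-0)
              - ker h u v s (-0 - (fun _ _ => 0 : ℕ × Bool → ℕ × Bool → ℂ) i j)) := by
  refine ⟨fun i j => if j.1 < i.1 ∨ j.1 = i.1 ∧ i.2 = true then 0 else -1, ?_, ?_⟩
  · rintro i hi j hj u v s hs
    rw [mem_raisingSet] at hi hj
    rw [con_raising_raising_succ hh hs hμN hi.1 hi.2 hj.1 hj.2, add_zero, sub_self, add_zero]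
  · rintro i hi j hj u v s hs
    rw [mem_raisingSet] at hi hj
    rw [con_raising_succ_raising hh hs hμN hj.1 hj.2 hi.1 hi.2, neg_zero, sub_zero, sub_self,
      add_zero]
    congr 2
    beta_reduce
    split_ifs with h1
    · rw [neg_zero]
    · rw [neg_neg]

theorem XPlus_XPlus_succ (hN : 0 < N) (hh : 0 < h) {μ : ℕ} (hμN : μ + 1 < N) :
    Exchange (fockSpace N) (fockDual N h) (fun w => w + -1 * (I * h)) (fun w => w - 0 * (I * h))
      (XPlus N h k μ) (XPlus N h k (μ + 1)) := by
  simp only [XPlus_eq_current]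
  obtain ⟨τ, h1, h2⟩ := XPlus_con_succ (k := k) hh hμN
  exact exchange_of_con (comm_regular hN hh) (fun ξ hξ => hξ.1)
    (fun i _ => isVertex_raising hh _ _ _) (fun i _ => isVertex_raising hh _ _ _) h1 h2 (by simp)

theorem XPlus_succ_XPlus (hN : 0 < N) (hh : 0 < h) {μ : ℕ} (hμN : μ + 1 < N) :
    Exchange (fockSpace N) (fockDual N h) (fun w => w + 0 * (I * h)) (fun w => w - -1 * (I * h))
      (XPlus N h k (μ + 1)) (XPlus N h k μ) := by
  simp only [XPlus_eq_current]
  obtain ⟨τ, h1, h2⟩ := XPlus_con_succ (k := k) hh hμN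
  exact exchange_swap_of_con (comm_regular hN hh) (fun ξ hξ => hξ.1)
    (fun i _ => isVertex_raising hh _ _ _) (fun i _ => isVertex_raising hh _ _ _) h1 h2 (by simp)

theorem XPlus_XPlus_far (hN : 0 < N) (hh : 0 < h) {μ ν : ℕ} (hμN : μ < N) (hνN : ν < N)
    (hμν : μ + 1 < ν ∨ ν + 1 < μ) :
    Exchange (fockSpace N) (fockDual N h) (fun _ => 1) (fun _ => 1)
      (XPlus N h k μ) (XPlus N h k ν) := by
  simp only [XPlus_eq_current]
  refine exchange_one_of_con_zero (comm_regular hN hh) (fun ξ hξ => hξ.1)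
    (fun i _ => isVertex_raising hh _ _ _) (fun i _ => isVertex_raising hh _ _ _) ?_ ?_
  · intro i hi j hj u v s hs
    rw [mem_raisingSet] at hi hj
    exact con_raising_raising_far hh hs hμν hμN hνN hi.1 hi.2 hj.1 hj.2
  · intro i hi j hj u v s hs
    rw [mem_raisingSet] at hi hj
    exact con_raising_raising_far hh hs hμν.symm hνN hμN hj.1 hj.2 hi.1 hi.2

theorem XPlus_serre (hN : 0 < N) (hh : 0 < h) {μ ν : ℕ} (hμN : μ < N) (hνN : ν < N)
    (hμν : μ = ν + 1 ∨ ν = μ + 1) :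
    Serre (fockSpace N) (fockDual N h) (XPlus N h k μ) (XPlus N h k ν) := by
  simp only [XPlus_eq_current]
  obtain ⟨σ, hσ, h0⟩ := XPlus_con_self (k := k) hh hμN
  rcases hμν with rfl | rfl
  · obtain ⟨τ, h1, h2⟩ := XPlus_con_succ (k := k) hh hμN
    exact serre_of_con (comm_regular hN hh) (fun ξ hξ => hξ.1)
      (fun i _ => isVertex_raising hh _ _ _) (fun i _ => isVertex_raising hh _ _ _) h0
      (fun i _ j _ => hσ i j) (τ := fun i j => -τ j i) (δ := fun _ _ => 0) (π := 0)
      (fun i hi j hj u v s hs => by simpa using h2 j hj i hi u v s hs)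
      (fun i hi j hj u v s hs => by simpa using h1 j hj i hi u v s hs) (by norm_num)
  · obtain ⟨τ, h1, h2⟩ := XPlus_con_succ (k := k) hh hνN
    exact serre_of_con (comm_regular hN hh) (fun ξ hξ => hξ.1)
      (fun i _ => isVertex_raising hh _ _ _) (fun i _ => isVertex_raising hh _ _ _) h0
      (fun i _ j _ => hσ i j) h1 h2 (by norm_num)

theorem XMinus_con_self (hh : 0 < h) {μ : ℕ} (hμ : 1 ≤ μ) (hμN : μ < N) :
    ∃ σ : ℕ × Bool → ℕ × Bool → ℂ, (∀ i j, σ j i = -σ i j) ∧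
      ∀ i ∈ loweringSet N μ, ∀ j ∈ loweringSet N μ, ∀ u v s, 0 < s →
        con N (comm N h k) (lowering N h k μ i u) (lowering N h k μ j v) s
          = ker h u v s (-1) - ker h u v s (σ i j) := by
  refine ⟨fun i j => if i.1 < j.1 then (if i.1 ≤ μ then -1 else 1)
    else if j.1 < i.1 then (if j.1 ≤ μ then 1 else -1)
    else (if i.1 ≤ μ then 1 else -1) * ((sgn i.2 - sgn j.2) / 2),
    fun i j => ?_, fun i hi j hj u v s hs => ?_⟩
  · rcases lt_trichotomy i.1 j.1 with h1 | h1 | h1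
    · simp only [h1, h1.not_gt, if_true, if_false]
      split_ifs <;> ring
    · simp only [h1, lt_irrefl, if_false]
      ring
    · simp only [h1, h1.not_gt, if_true, if_false]
      split_ifs <;> ring
  · rw [mem_loweringSet] at hi hj
    obtain ⟨i1, i2, i3, i4⟩ := hi
    obtain ⟨j1, j2, j3, j4⟩ := hj
    simp only [lowering]
    by_cases hi : i.1 ≤ μ <;> by_cases hj : j.1 ≤ μ <;> simp only [hi, hj, if_true, if_false]
    · rw [con_loweringL_loweringL_self hh hs hμN i1 hi j1 hj i3 j3, one_mul]
    · rw [con_loweringL_loweringR_of_le hh hs le_rfl hμN i1 hi (by omega) j2 i3 j4,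
        if_pos (by omega), sub_self]
    · rw [con_loweringR_loweringL_self hh hs hμN (by omega) i2 j1 hj i4 j3,
        if_neg (by omega), if_pos (by omega)]
    · rw [con_loweringR_loweringR_self hh hs hμ (by omega) i2 (by omega) j2 i4 j4]
      congr 2
      rcases lt_trichotomy i.1 j.1 with h1 | h1 | h1
      · simp [h1, h1.not_gt]
      · simp only [h1, lt_irrefl, if_false]
        ring
      · simp [h1, h1.not_gt]

theorem XMinus_XMinus_self (hN : 0 < N) (hh : 0 < h) {μ : ℕ} (hμ : 1 ≤ μ) (hμN : μ < N) :
    Exchange (fockSpace N) (fockDual N h) (fun w => w + -1 * (I * h)) (fun w => w - -1 * (I * h))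
      (XMinus N h k μ) (XMinus N h k μ) := by
  obtain ⟨σ, hσ, h0⟩ := XMinus_con_self (k := k) hh hμ hμN
  simp only [XMinus_eq_current hμN.le]
  exact exchange_self_of_con hN hh (fun i _ => isVertex_lowering hh _ _) hσ h0

theorem sum_sum_ite_eq {ι κ : Type*} [DecidableEq ι] [DecidableEq κ] (S : Finset ι) (T : Finset κ)
    (i₀ : ι) (j₀ : κ) (g : ι → κ → ℂ) :
    ∑ i ∈ S, ∑ j ∈ T, (if i = i₀ ∧ j = j₀ then g i j else 0)
      = if i₀ ∈ S ∧ j₀ ∈ T then g i₀ j₀ else 0 := by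
  simp only [ite_and]
  by_cases hi : i₀ ∈ S
  · rw [Finset.sum_eq_single_of_mem i₀ hi fun i _ hne => by simp [hne]]
    simp [hi]
  · simp only [hi, if_false]
    refine Finset.sum_eq_zero fun i h1 => ?_
    have : i ≠ i₀ := fun h2 => hi (h2 ▸ h1)
    simp [this]

/-- The residues of the products of the terms of `X_μ^-` and `X_ν^-`. -/
def lowRes (μ ν : ℕ) (i j : ℕ × Bool) : ℂ :=
  (if i = (ν, true) ∧ j = (μ, true) then -1 else 0)
  + (if i = (ν, true) ∧ j = (μ, false) then -1 else 0)
  + (if i = (ν + 1, true) ∧ j = (μ, true) then 1 else 0)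
  + (if i = (ν + 1, false) ∧ j = (μ, false) then -1 else 0)
  + (if i = (ν + 1, true) ∧ j = (μ + 1, false) then 1 else 0)
  + if i = (ν + 1, false) ∧ j = (μ + 1, false) then 1 else 0

theorem lowRes_eq {μ ν : ℕ} (i j : ℕ × Bool) : lowRes μ ν i j
    = if i.1 = ν ∧ j.1 = μ ∧ i.2 = true then -1
      else if i.1 = ν + 1 ∧ j.1 = μ ∧ i.2 = j.2 then sgn i.2
      else if i.1 = ν + 1 ∧ j.1 = μ + 1 ∧ j.2 = false then 1 else 0 := by
  obtain ⟨m, ε⟩ := i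
  obtain ⟨m', ε'⟩ := j
  simp only [lowRes, Prod.mk.injEq]
  cases ε <;> cases ε' <;>
    simp only [reduceCtorEq, and_true, and_false, false_and, if_false, add_zero, zero_add, sgn] <;>
    split_ifs <;> first | omega | norm_num

theorem XMinus_con_succ (hh : 0 < h) {ν : ℕ} (hν : 1 ≤ ν) (hνN : ν + 1 < N) :
    ∃ τ : ℕ × Bool → ℕ × Bool → ℂ, (∀ i j, lowRes (ν + 1) ν i j ≠ 0 → τ i j = 1) ∧
      (∀ i ∈ loweringSet N (ν + 1), ∀ j ∈ loweringSet N ν, ∀ u v s, 0 < s →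
        con N (comm N h k) (lowering N h k (ν + 1) i u) (lowering N h k ν j v) s
          = ker h u v s 1 - ker h u v s (τ i j)
            + (ker h u v s (k + (ν + 1)) - ker h u v s (k + (ν + 1) + lowRes (ν + 1) ν i j))) ∧
      ∀ i ∈ loweringSet N (ν + 1), ∀ j ∈ loweringSet N ν, ∀ u v s, 0 < s →
        con N (comm N h k) (lowering N h k ν j u) (lowering N h k (ν + 1) i v) s
          = ker h u v s 0 - ker h u v s (-τ i j)
            + (ker h u v s (-(k + (ν + 1)))
              - ker h u v s (-(k + (ν + 1)) - lowRes (ν + 1) ν i j)) := by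
  refine ⟨fun i j => if i.1 ≤ ν + 1 then
      (if j.1 ≤ ν then (if j.1 < i.1 ∨ j.1 = i.1 ∧ i.2 = true then 0 else 1) else 1)
    else (if j.1 ≤ ν then 0 else if i.1 < j.1 ∨ i.1 = j.1 ∧ j.2 = true then 0 else 1),
    fun i j hr => ?_, fun i hi j hj u v s hs => ?_, fun i hi j hj u v s hs => ?_⟩
  · rw [lowRes_eq] at hr
    have h1 : i.1 ≤ ν + 1 ∧ ¬ j.1 ≤ ν := by
      split_ifs at hr <;> first | omega | exact absurd rfl hr
    simp only [h1, if_true, if_false]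
  · rw [mem_loweringSet] at hi hj
    obtain ⟨i1, i2, i3, i4⟩ := hi
    obtain ⟨j1, j2, j3, j4⟩ := hj
    simp only [lowering]
    by_cases hi : i.1 ≤ ν + 1 <;> by_cases hj : j.1 ≤ ν <;> simp only [hi, hj, if_true, if_false]
    · have h0 : lowRes (ν + 1) ν i j = 0 := by
        rw [lowRes_eq, if_neg (by omega), if_neg (by omega), if_neg (by omega)]
      rw [con_loweringL_succ_loweringL hh hs hνN i1 hi j1 hj i3 j3, h0, add_zero, sub_self, add_zero]
    · rw [con_loweringL_loweringR_of_lt hh hs hν (by omega) hνN i1 hi (by omega) j2 i3 j4, sub_self,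
        zero_add, lowRes_eq]
      push_cast
      rfl
    · have h0 : lowRes (ν + 1) ν i j = 0 := by
        rw [lowRes_eq, if_neg (by omega), if_neg (by omega), if_neg (by omega)]
      rw [con_loweringR_succ_loweringL hh hs hνN (by omega) i2 j1 hj i4 j3, h0, add_zero, sub_self,
        add_zero]
    · have h0 : lowRes (ν + 1) ν i j = 0 := by
        rw [lowRes_eq, if_neg (by omega), if_neg (by omega), if_neg (by omega)]
      rw [con_loweringR_succ_loweringR hh hs hν (by omega) i2 (by omega) j2 i4 j4, h0, add_zero,
        sub_self, add_zero]
  · rw [mem_loweringSet] at hi hj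
    obtain ⟨i1, i2, i3, i4⟩ := hi
    obtain ⟨j1, j2, j3, j4⟩ := hj
    simp only [lowering]
    by_cases hi : i.1 ≤ ν + 1 <;> by_cases hj : j.1 ≤ ν <;> simp only [hi, hj, if_true, if_false]
    · have h0 : lowRes (ν + 1) ν i j = 0 := by
        rw [lowRes_eq, if_neg (by omega), if_neg (by omega), if_neg (by omega)]
      rw [con_loweringL_loweringL_succ hh hs hνN j1 hj i1 hi j3 i3, h0, sub_zero, sub_self, add_zero]
      congr 2
      split_ifs <;> ring
    · rw [con_loweringR_loweringL_succ hh hs hν hνN (by omega) j2 i1 hi j4 i3, lowRes_eq]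
    · have h0 : lowRes (ν + 1) ν i j = 0 := by
        rw [lowRes_eq, if_neg (by omega), if_neg (by omega), if_neg (by omega)]
      rw [con_loweringL_loweringR_of_le hh hs (by omega) hνN j1 hj (by omega) i2 j3 i4, h0, neg_zero,
        sub_zero, sub_self, sub_self, add_zero]
    · have h0 : lowRes (ν + 1) ν i j = 0 := by
        rw [lowRes_eq, if_neg (by omega), if_neg (by omega), if_neg (by omega)]
      rw [con_loweringR_loweringR_succ hh hs hν (by omega) j2 (by omega) i2 j4 i4, h0, sub_zero,
        sub_self, add_zero]
      congr 2
      split_ifs <;> ring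

end relations

section residues

variable {N : ℕ} {h : ℝ} {k : ℂ}

theorem lowering_of_le {μ m : ℕ} (hm : m ≤ μ) (ε : Bool) :
    lowering N h k μ (m, ε) = loweringL N h k μ m ε := if_pos hm

theorem lowering_of_lt {μ m : ℕ} (hm : μ < m) (ε : Bool) :
    lowering N h k μ (m, ε) = loweringR N h k μ m ε := if_neg hm.not_ge

/-- The residues of the products of the terms of `X_μ^-` and `X_ν^-` cancel. -/
theorem sum_lowRes_eq_zero {μ ν : ℕ} (hν : 1 ≤ ν) (hμν : ν < μ) (hμN : μ < N) (Φ : State)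
    (ξ : Profile) (v : ℂ) :
    ∑ i ∈ loweringSet N μ, ∑ j ∈ loweringSet N ν, -sgn i.2 * -sgn j.2 * lowRes μ ν i j
      * normalExp N (comm N h k)
        (lowering N h k μ i (v - (k + μ) * (I * h)) + lowering N h k ν j v) Φ ξ = 0 := by
  have e1 : lowering N h k μ (ν, true) (v - (k + μ) * (I * h)) + lowering N h k ν (μ, true) v
      = lowering N h k μ (ν + 1, false) (v - (k + μ) * (I * h))
        + lowering N h k ν (μ + 1, false) v := by
    rw [lowering_of_le hμν.le, lowering_of_lt hμν, lowering_of_le (show ν + 1 ≤ μ from hμν), lowering_of_lt (by omega)]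
    simp only [loweringL, loweringR, lower_eq (show ν + 1 ≤ μ from hμν), upper_eq hμN.le, bSgn, sgn]
    push_cast
    ring_nf
  have e2 : lowering N h k μ (ν, true) (v - (k + μ) * (I * h)) + lowering N h k ν (μ, false) v
      = lowering N h k μ (ν + 1, true) (v - (k + μ) * (I * h))
        + lowering N h k ν (μ + 1, false) v := by
    rw [lowering_of_le hμν.le, lowering_of_lt hμν, lowering_of_le (show ν + 1 ≤ μ from hμν), lowering_of_lt (by omega)]
    simp only [loweringL, loweringR, lower_eq (show ν + 1 ≤ μ from hμν), upper_eq hμN.le, bSgn, sgn]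
    push_cast
    ring_nf
  have e3 : lowering N h k μ (ν + 1, true) (v - (k + μ) * (I * h)) + lowering N h k ν (μ, true) v
      = lowering N h k μ (ν + 1, false) (v - (k + μ) * (I * h))
        + lowering N h k ν (μ, false) v := by
    rw [lowering_of_le (show ν + 1 ≤ μ from hμν), lowering_of_lt hμν, lowering_of_le (show ν + 1 ≤ μ from hμν), lowering_of_lt hμν]
    simp only [loweringL, loweringR, lower_eq (show ν + 1 ≤ μ from hμν), upper_eq hμN.le, bSgn, sgn]
    push_cast
    ring_nf
  have key : ∀ f : ℕ × Bool → ℕ × Bool → ℂ, ∑ i ∈ loweringSet N μ, ∑ j ∈ loweringSet N ν,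
      -sgn i.2 * -sgn j.2 * lowRes μ ν i j * f i j
      = f (ν + 1, false) (μ + 1, false) - f (ν, true) (μ, true)
        + if ν + 1 < μ then f (ν, true) (μ, false) + f (ν + 1, true) (μ, true)
          - f (ν + 1, false) (μ, false) - f (ν + 1, true) (μ + 1, false) else 0 := by
    intro f
    simp only [lowRes, mul_add, add_mul, mul_ite, ite_mul, mul_zero, zero_mul,
      Finset.sum_add_distrib, sum_sum_ite_eq, mem_loweringSet, sgn]
    rcases Nat.lt_or_ge (ν + 1) μ with h1 | h1
    · rw [if_pos h1]
      simp (disch := omega) only [if_pos]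
      ring
    · obtain rfl : μ = ν + 1 := by omega
      simp (disch := omega) only [if_pos, if_neg, true_and, and_true, not_true_eq_false, and_false,
        if_false, reduceCtorEq, not_false_eq_true, false_and, lt_irrefl]
      ring
  rw [key, e1, e2, e3, sub_self, zero_add]
  split_ifs
  · ring
  · rfl

theorem succ_polar {ν : ℕ} (hν : 1 ≤ ν) (hνN : ν + 1 < N) {τ : ℕ × Bool → ℕ × Bool → ℂ}
    (hτ : ∀ i j, lowRes (ν + 1) ν i j ≠ 0 → τ i j = 1) (Φ : State) (ξ : Profile) (v : ℂ) :
    ∑ i ∈ loweringSet N (ν + 1), ∑ j ∈ loweringSet N ν, -sgn i.2 * -sgn j.2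
      * (lowRes (ν + 1) ν i j * (τ i j - (k + (ν + 1))))
      * normalExp N (comm N h k) (lowering N h k (ν + 1) i (v - (k + (ν + 1)) * (I * h))
        + lowering N h k ν j v) Φ ξ = 0 := by
  have h3 := sum_lowRes_eq_zero (k := k) (h := h) hν (Nat.lt_succ_self ν) hνN Φ ξ v
  rw [← zero_mul (1 - (k + (ν + 1 : ℂ))), ← h3, Finset.sum_mul]
  refine Finset.sum_congr rfl fun i _ => ?_
  rw [Finset.sum_mul]
  refine Finset.sum_congr rfl fun j _ => ?_
  by_cases h4 : lowRes (ν + 1) ν i j = 0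
  · rw [h4]
    ring
  · rw [hτ i j h4]
    push_cast
    ring

theorem XMinus_con_far (hh : 0 < h) {μ ν : ℕ} (hν : 1 ≤ ν) (hμN : μ < N) (hμν : ν + 1 < μ) :
    (∀ i ∈ loweringSet N μ, ∀ j ∈ loweringSet N ν, ∀ u v s, 0 < s →
        con N (comm N h k) (lowering N h k μ i u) (lowering N h k ν j v) s
          = ker h u v s (k + μ) - ker h u v s (k + μ + lowRes μ ν i j)) ∧
      ∀ i ∈ loweringSet N μ, ∀ j ∈ loweringSet N ν, ∀ u v s, 0 < s →
        con N (comm N h k) (lowering N h k ν j u) (lowering N h k μ i v) s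
          = ker h u v s (-(k + μ)) - ker h u v s (-(k + μ) - lowRes μ ν i j) := by
  refine ⟨fun i hi j hj u v s hs => ?_, fun i hi j hj u v s hs => ?_⟩ <;>
  · rw [mem_loweringSet] at hi hj
    obtain ⟨i1, i2, i3, i4⟩ := hi
    obtain ⟨j1, j2, j3, j4⟩ := hj
    simp only [lowering]
    have h0 : ¬(i.1 ≤ μ ∧ ¬ j.1 ≤ ν) → lowRes μ ν i j = 0 := fun hij => by
      rw [lowRes_eq, if_neg (by omega), if_neg (by omega), if_neg (by omega)]
    by_cases hi : i.1 ≤ μ <;> by_cases hj : j.1 ≤ ν <;>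
      simp only [hi, hj, if_true, if_false, not_true_eq_false, not_false_eq_true, and_false, and_true,
        forall_const] at h0 ⊢
    · first
      | rw [con_loweringL_loweringL_far hh hs (.inr hμν) hμN (by omega) i1 hi j1 hj i3 j3, h0,
          add_zero, sub_self]
      | rw [con_loweringL_loweringL_far hh hs (.inl hμν) (by omega) hμN j1 hj i1 hi j3 i3, h0,
          sub_zero, sub_self]
    · first
      | rw [con_loweringL_loweringR_of_lt hh hs hν (by omega) hμN i1 hi (by omega) j2 i3 j4,
          lowRes_eq]
      | rw [con_loweringR_loweringL_of_lt hh hs hν (by omega) hμN (by omega) j2 i1 hi j4 i3,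
          lowRes_eq]
    · first
      | rw [con_loweringR_loweringL_far hh hs hμν hμN (by omega) i2 j1 hj i4 j3, h0, add_zero,
          sub_self]
      | rw [con_loweringL_loweringR_of_le hh hs (by omega) hμN j1 hj (by omega) i2 j3 i4, h0,
          sub_zero, sub_self]
    · first
      | rw [con_loweringR_loweringR_far hh hs (.inr hμν) (by omega) hν (by omega) i2 (by omega) j2
          i4 j4, h0, add_zero, sub_self]
      | rw [con_loweringR_loweringR_far hh hs (.inl hμν) hν (by omega) (by omega) j2 (by omega) i2
          j4 i4, h0, sub_zero, sub_self]

theorem far_polar {μ ν : ℕ} (hν : 1 ≤ ν) (hμN : μ < N) (hμν : ν + 1 < μ) (Φ : State) (ξ : Profile)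
    (v w : ℂ) :
    ∑ i ∈ loweringSet N μ, ∑ j ∈ loweringSet N ν, -sgn i.2 * -sgn j.2
      * (lowRes μ ν i j / (w + (k + μ) * (I * h)))
      * normalExp N (comm N h k) (lowering N h k μ i (v - (k + μ) * (I * h))
        + lowering N h k ν j v) Φ ξ = 0 := by
  rw [← zero_div (w + (k + μ) * (I * (h : ℂ))), ← sum_lowRes_eq_zero hν (by omega) hμN Φ ξ v,
    Finset.sum_div]
  refine Finset.sum_congr rfl fun i _ => ?_
  rw [Finset.sum_div]
  refine Finset.sum_congr rfl fun j _ => ?_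
  ring

theorem XMinus_succ_XMinus (hh : 0 < h) {ν : ℕ} (hν : 1 ≤ ν) (hνN : ν + 1 < N) :
    Exchange (fockSpace N) (fockDual N h) (fun w => w + 1 * (I * h)) (fun w => w - 0 * (I * h))
      (XMinus N h k (ν + 1)) (XMinus N h k ν) := by
  rw [XMinus_eq_current hνN.le, XMinus_eq_current (by omega)]
  obtain ⟨τ, h0, h1, h2⟩ := XMinus_con_succ (k := k) hh hν hνN
  refine exchange_of_con (comm_regular (by omega) hh) (fun ξ hξ => hξ.1)
    (fun i _ => isVertex_lowering hh _ _) (fun i _ => isVertex_lowering hh _ _) h1 h2 fun Φ ξ v => ?_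
  exact succ_polar hν hνN h0 Φ ξ v

theorem XMinus_XMinus_succ (hh : 0 < h) {ν : ℕ} (hν : 1 ≤ ν) (hνN : ν + 1 < N) :
    Exchange (fockSpace N) (fockDual N h) (fun w => w + 0 * (I * h)) (fun w => w - 1 * (I * h))
      (XMinus N h k ν) (XMinus N h k (ν + 1)) := by
  rw [XMinus_eq_current hνN.le, XMinus_eq_current (by omega)]
  obtain ⟨τ, h0, h1, h2⟩ := XMinus_con_succ (k := k) hh hν hνN
  refine exchange_swap_of_con (comm_regular (by omega) hh) (fun ξ hξ => hξ.1)
    (fun i _ => isVertex_lowering hh _ _) (fun i _ => isVertex_lowering hh _ _) h1 h2 fun Φ ξ v => ?_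
  exact succ_polar hν hνN h0 Φ ξ v

theorem XMinus_XMinus_of_lt (hh : 0 < h) {μ ν : ℕ} (hν : 1 ≤ ν) (hμN : μ < N) (hμν : ν + 1 < μ) :
    Exchange (fockSpace N) (fockDual N h) (fun _ => 1) (fun _ => 1)
      (XMinus N h k μ) (XMinus N h k ν) := by
  rw [XMinus_eq_current hμN.le, XMinus_eq_current (by omega)]
  obtain ⟨h1, h2⟩ := XMinus_con_far (k := k) hh hν hμN hμν
  refine exchange_one_of_con (comm_regular (by omega) hh) (fun ξ hξ => hξ.1)
    (fun i _ => isVertex_lowering hh _ _) (fun i _ => isVertex_lowering hh _ _) h1 h2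
    fun Φ ξ v w => ?_
  exact far_polar hν hμN hμν Φ ξ v w

theorem XMinus_XMinus_of_gt (hh : 0 < h) {μ ν : ℕ} (hν : 1 ≤ ν) (hμN : μ < N) (hμν : ν + 1 < μ) :
    Exchange (fockSpace N) (fockDual N h) (fun _ => 1) (fun _ => 1)
      (XMinus N h k ν) (XMinus N h k μ) := by
  rw [XMinus_eq_current hμN.le, XMinus_eq_current (by omega)]
  obtain ⟨h1, h2⟩ := XMinus_con_far (k := k) hh hν hμN hμν
  refine exchange_one_of_con (comm_regular (by omega) hh) (fun ξ hξ => hξ.1)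
    (fun i _ => isVertex_lowering hh _ _) (fun i _ => isVertex_lowering hh _ _)
    (π := fun _ _ => -(k + μ)) (δ := fun i j => -lowRes μ ν j i)
    (fun i hi j hj u v s hs => by rw [h2 j hj i hi u v s hs, ← sub_eq_add_neg])
    (fun i hi j hj u v s hs => by rw [h1 j hj i hi u v s hs, neg_neg, sub_neg_eq_add])
    fun Φ ξ v w => ?_
  rw [← neg_zero, ← zero_div (w - (k + μ) * (I * (h : ℂ))),
    ← sum_lowRes_eq_zero (ξ := ξ) (Φ := Φ) (v := v + (k + μ) * (I * h)) hν (by omega) hμN,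
    Finset.sum_div, ← Finset.sum_neg_distrib, Finset.sum_comm]
  refine Finset.sum_congr rfl fun i _ => ?_
  rw [Finset.sum_div, ← Finset.sum_neg_distrib]
  refine Finset.sum_congr rfl fun j _ => ?_
  have h3 : v - -(k + μ) * (I * h) = v + (k + μ) * (I * h) := by ring
  rw [h3, add_sub_cancel_right, add_comm (lowering N h k ν j _)]
  ring

theorem XMinus_serre (hh : 0 < h) {μ ν : ℕ} (hμ : 1 ≤ μ) (hν : 1 ≤ ν) (hμN : μ < N) (hνN : ν < N)
    (hμν : μ = ν + 1 ∨ ν = μ + 1) :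
    Serre (fockSpace N) (fockDual N h) (XMinus N h k μ) (XMinus N h k ν) := by
  rw [XMinus_eq_current hμN.le, XMinus_eq_current hνN.le]
  obtain ⟨σ, hσ, h0⟩ := XMinus_con_self (k := k) hh hμ hμN
  rcases hμν with rfl | rfl
  · obtain ⟨τ, -, h1, h2⟩ := XMinus_con_succ (k := k) hh hν hμN
    exact serre_of_con (comm_regular (by omega) hh) (fun ξ hξ => hξ.1)
      (fun i _ => isVertex_lowering hh _ _) (fun i _ => isVertex_lowering hh _ _) h0
      (fun i _ j _ => hσ i j) h1 h2 (by norm_num)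
  · obtain ⟨τ, -, h1, h2⟩ := XMinus_con_succ (k := k) hh hμ hνN
    exact serre_of_con (comm_regular (by omega) hh) (fun ξ hξ => hξ.1)
      (fun i _ => isVertex_lowering hh _ _) (fun i _ => isVertex_lowering hh _ _) h0
      (fun i _ j _ => hσ i j) (τ := fun i j => -τ j i) (δ := fun i j => -lowRes (μ + 1) μ j i)
      (π := -(k + (μ + 1)))
      (fun i hi j hj u v s hs => by rw [h2 j hj i hi u v s hs, ← sub_eq_add_neg])
      (fun i hi j hj u v s hs => by
        rw [h1 j hj i hi u v s hs, neg_neg, neg_neg, sub_neg_eq_add]) (by norm_num)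

end residues

/-! ### Relations between `X^+` and `X^-` -/

section mixed

variable {N : ℕ} {h : ℝ} {k : ℂ}

theorem deltaCommutator_of_con {ι κ : Type*} {S : Finset ι} {T : Finset κ} {a : ι → ℂ} {b : κ → ℂ}
    {Xs : ι → ℂ → Exponent} {Ys : κ → ℂ → Exponent} {Du : Set Profile} {H : Commutators}
    (hH : H.Regular) (hDu : ∀ ξ ∈ Du, ∀ m, IsSmearing (ξ m))
    (hX : ∀ i ∈ S, IsVertex (Xs i)) (hY : ∀ j ∈ T, IsVertex (Ys j)) {π δ : ι → κ → ℂ}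
    (hXY : ∀ i ∈ S, ∀ j ∈ T, ∀ u v s, 0 < s → con N H (Xs i u) (Ys j v) s
      = ker h u v s (π i j) - ker h u v s (π i j + δ i j))
    (hYX : ∀ i ∈ S, ∀ j ∈ T, ∀ u v s, 0 < s → con N H (Ys j u) (Xs i v) s
      = ker h u v s (-π i j) - ker h u v s (-π i j - δ i j))
    {Z W : ℂ → Exponent} (hZ : IsVertex Z) {r d : ℂ}
    (hpol : ∀ Φ ξ v w, ∑ i ∈ S, ∑ j ∈ T, a i * b j * (δ i j / (w + π i j * (I * h)))
      * normalExp N H (Xs i (v - π i j * (I * h)) + Ys j v) Φ ξ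
      = r * (normalExp N H (Z (v + d)) Φ ξ / (w - d) - normalExp N H (W v) Φ ξ / w)) :
    DeltaCommutator (fockSpace N) Du (r * (I * h)) d (current N H S a Xs) (current N H T b Ys)
      (fun u => normalExp N H (Z u)) (fun v => normalExp N H (W v)) := by
  refine deltaCommutator_of_polar_eq hH hDu hX hY
    (fun i hi j hj => hasContraction_of_ker (hXY i hi j hj))
    (fun i hi j hj => hasContraction_of_ker (hYX i hi j hj))
    (fun i j => δ i j * (I * h)) (fun i j => -π i j * (I * h)) ?_ ?_ hZ ?_
  · intro i _ j _
    filter_upwards [eventually_imBot_ne (π i j * (I * h))] with w h2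
    have h3 : w - -π i j * (I * h) = w + π i j * (I * h) := by ring
    rw [h3, add_div' _ _ _ h2]
    ring
  · intro i _ j _
    filter_upwards [eventually_imBot_ne (-π i j * (I * h))] with w h2
    have h3 : -w - -π i j * (I * h) = -(w + -π i j * (I * h)) := by ring
    rw [h3, div_neg, ← sub_eq_add_neg, sub_div' h2, one_mul]
    ring
  · intro Φ ξ v w
    rw [mul_assoc, mul_comm (I * (h : ℂ)), ← mul_assoc, ← hpol Φ ξ v w, Finset.sum_mul]
    refine Finset.sum_congr rfl fun i _ => ?_
    rw [Finset.sum_mul]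
    refine Finset.sum_congr rfl fun j _ => ?_
    have h3 : v + -π i j * (I * h) = v - π i j * (I * h) := by ring
    have h4 : w - -π i j * (I * h) = w + π i j * (I * h) := by ring
    rw [h3, h4]
    ring

theorem XPlus_XMinus_far (hh : 0 < h) {μ ν : ℕ} (hμ : 1 ≤ μ) (hνN : ν < N) (hμν : μ + 1 < ν) :
    Exchange (fockSpace N) (fockDual N h) (fun _ => 1) (fun _ => 1)
      (XPlus N h k μ) (XMinus N h k ν) := by
  rw [XPlus_eq_current, XMinus_eq_current hνN.le]
  refine exchange_one_of_con_zero (comm_regular (by omega) hh) (fun ξ hξ => hξ.1)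
    (fun i _ => isVertex_raising hh _ _ _) (fun i _ => isVertex_lowering hh _ _) ?_ ?_ <;>
  · intro i hi j hj u v s hs
    rw [mem_raisingSet] at hi
    rw [mem_loweringSet] at hj
    obtain ⟨i1, i2⟩ := hi
    obtain ⟨j1, j2, j3, j4⟩ := hj
    simp only [lowering]
    split_ifs with hj
    · first
      | rw [(con_raising_loweringL_far hh hs (.inr hμν) (by omega) hνN i1 i2 j1 hj j3).1]
      | rw [(con_raising_loweringL_far hh hs (.inr hμν) (by omega) hνN i1 i2 j1 hj j3).2]
    · first
      | rw [(con_raising_loweringR_of_le hh hs (by omega) (by omega) hνN i1 i2 (by omega) j2 j4).1,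
          if_neg (by omega)]
      | rw [(con_raising_loweringR_of_le hh hs (by omega) (by omega) hνN i1 i2 (by omega) j2 j4).2,
          if_neg (by omega)]

theorem sum_sum_diag_ite {ι : Type*} [DecidableEq ι] (S T : Finset ι) (g : ι → ι → ℂ) :
    ∑ i ∈ S, ∑ j ∈ T, (if i = j then g i j else 0) = ∑ i ∈ S, if i ∈ T then g i i else 0 :=
  Finset.sum_congr rfl fun i _ => by rw [Finset.sum_ite_eq]

theorem XPlus_XMinus_succ (hh : 0 < h) {μ : ℕ} (hμ : 1 ≤ μ) (hμN : μ + 1 < N) :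
    Exchange (fockSpace N) (fockDual N h) (fun _ => 1) (fun _ => 1)
      (XPlus N h k μ) (XMinus N h k (μ + 1)) := by
  rw [XPlus_eq_current, XMinus_eq_current hμN.le]
  refine exchange_one_of_con (h := h) (comm_regular (by omega) hh) (fun ξ hξ => hξ.1)
    (fun i _ => isVertex_raising hh _ _ _) (fun i _ => isVertex_lowering hh _ _)
    (π := fun i _ => -i.1) (δ := fun i j => if i = j then -sgn i.2 else 0) ?_ ?_ fun Φ ξ v w => ?_
  rotate_left 2
  · have e : ∀ m : ℕ, m ≤ μ → raising h μ m true (v - -m * (I * h)) + lowering N h k (μ + 1) (m, true) v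
        = raising h μ m false (v - -m * (I * h)) + lowering N h k (μ + 1) (m, false) v := by
      intro m hm
      rw [lowering_of_le (by omega), lowering_of_le (by omega)]
      simp only [raising, loweringL, bSgn, sgn]
      push_cast
      ring_nf
    simp only [ite_div, zero_div, mul_ite, ite_mul, mul_zero, zero_mul, sum_sum_diag_ite]
    rw [raisingSet, Finset.sum_product]
    refine Finset.sum_eq_zero fun m hm => ?_
    rw [Finset.mem_Icc] at hm
    rw [Fintype.sum_bool, if_pos (by simp [mem_loweringSet]; omega),
      if_pos (by simp [mem_loweringSet]; omega)]
    dsimp only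
    rw [e m hm.2]
    simp only [sgn]
    ring
  all_goals
    intro i hi j hj u v s hs
    rw [mem_raisingSet] at hi
    rw [mem_loweringSet] at hj
    obtain ⟨i1, i2⟩ := hi
    obtain ⟨j1, j2, j3, j4⟩ := hj
    simp only [lowering]
    by_cases hj : j.1 ≤ μ + 1
    · first
      | rw [if_pos hj, (con_raising_loweringL_succ hh hs hμN i1 i2 j1 hj).1]
      | rw [if_pos hj, (con_raising_loweringL_succ hh hs hμN i1 i2 j1 hj).2]
      split_ifs with h1 h2 h2
      · rfl
      · exact absurd (Prod.ext h1.1 h1.2) h2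
      · exact absurd (h2 ▸ ⟨rfl, rfl⟩) h1
      · simp
    · rw [if_neg hj, if_neg (by rintro rfl; omega)]
      first
      | rw [(con_raising_loweringR_of_le hh hs (by omega) (by omega) hμN i1 i2 (by omega) j2 j4).1,
          if_neg (by omega), add_zero, sub_self]
      | rw [(con_raising_loweringR_of_le hh hs (by omega) (by omega) hμN i1 i2 (by omega) j2 j4).2,
          if_neg (by omega), sub_zero, sub_self]

/-- The residues of the products of the terms of `X_μ^+` and `X_ν^-`, for `ν < μ`. -/
def mixedRes (μ ν : ℕ) (i j : ℕ × Bool) : ℂ :=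
  (if i = (ν, true) ∧ j = (μ + 1, true) then 1 else 0)
  + (if i = (ν, true) ∧ j = (μ + 1, false) then 1 else 0)
  + (if i = (ν + 1, true) ∧ j = (μ, true) then -1 else 0)
  + (if i = (ν + 1, false) ∧ j = (μ, true) then -1 else 0)
  + (if i = (ν + 1, true) ∧ j = (μ + 1, false) then -1 else 0)
  + if i = (ν + 1, false) ∧ j = (μ + 1, true) then 1 else 0

theorem mixedRes_eq {μ ν : ℕ} (i j : ℕ × Bool) : mixedRes μ ν i j
    = if i.1 = ν ∧ j.1 = μ + 1 ∧ i.2 = true then 1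
      else if i.1 = ν + 1 ∧ j.1 = μ ∧ j.2 = true then -1
      else if i.1 = ν + 1 ∧ j.1 = μ + 1 ∧ i.2 ≠ j.2 then -sgn i.2 else 0 := by
  obtain ⟨m, ε⟩ := i
  obtain ⟨m', ε'⟩ := j
  simp only [mixedRes, Prod.mk.injEq]
  cases ε <;> cases ε' <;>
    simp only [reduceCtorEq, and_true, and_false, false_and, if_false, add_zero, zero_add, sgn, ne_eq,
      not_true_eq_false, not_false_eq_true] <;>
    split_ifs <;> first | omega | norm_num

theorem sum_mixedRes_eq_zero {μ ν : ℕ} (hν : 1 ≤ ν) (hμν : ν < μ) (hμN : μ < N) (Φ : State)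
    (ξ : Profile) (v : ℂ) :
    ∑ i ∈ raisingSet μ, ∑ j ∈ loweringSet N ν, sgn i.2 * -sgn j.2 * mixedRes μ ν i j
      * normalExp N (comm N h k)
        (raising h μ i.1 i.2 (v - (k + (μ - ν)) * (I * h)) + lowering N h k ν j v) Φ ξ = 0 := by
  have e1 : raising h μ ν true (v - (k + (μ - ν)) * (I * h)) + lowering N h k ν (μ + 1, true) v
      = raising h μ (ν + 1) true (v - (k + (μ - ν)) * (I * h)) + lowering N h k ν (μ, true) v := by
    rw [lowering_of_lt (show ν < μ + 1 by omega), lowering_of_lt hμν]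
    simp only [raising, loweringR, ladder_succ hν, upper_eq hμN.le, bSgn, sgn]
    push_cast
    ring_nf
  have e2 : raising h μ ν true (v - (k + (μ - ν)) * (I * h)) + lowering N h k ν (μ + 1, false) v
      = raising h μ (ν + 1) false (v - (k + (μ - ν)) * (I * h)) + lowering N h k ν (μ, true) v := by
    rw [lowering_of_lt (show ν < μ + 1 by omega), lowering_of_lt hμν]
    simp only [raising, loweringR, ladder_succ hν, upper_eq hμN.le, bSgn, sgn]
    push_cast
    ring_nf
  have e3 : raising h μ (ν + 1) true (v - (k + (μ - ν)) * (I * h))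
        + lowering N h k ν (μ + 1, false) v
      = raising h μ (ν + 1) false (v - (k + (μ - ν)) * (I * h))
        + lowering N h k ν (μ + 1, true) v := by
    rw [lowering_of_lt (show ν < μ + 1 by omega), lowering_of_lt (show ν < μ + 1 by omega)]
    simp only [raising, loweringR, bSgn, sgn]
    push_cast
    ring_nf
  have key : ∀ f : ℕ × Bool → ℕ × Bool → ℂ, ∑ i ∈ raisingSet μ, ∑ j ∈ loweringSet N ν,
      sgn i.2 * -sgn j.2 * mixedRes μ ν i j * f i j
      = f (ν + 1, true) (μ, true) - f (ν, true) (μ + 1, true)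
        + (f (ν, true) (μ + 1, false) - f (ν + 1, false) (μ, true))
        + (f (ν + 1, false) (μ + 1, true) - f (ν + 1, true) (μ + 1, false)) := by
    intro f
    simp only [mixedRes, mul_add, add_mul, mul_ite, ite_mul, mul_zero, zero_mul,
      Finset.sum_add_distrib, sum_sum_ite_eq, mem_loweringSet, mem_raisingSet, sgn]
    simp (disch := omega) only [if_pos, reduceCtorEq, and_false, not_false_eq_true, and_true, true_and]
    ring
  rw [key, e1, e2, e3]
  ring

theorem XPlus_XMinus_of_lt (hh : 0 < h) {μ ν : ℕ} (hν : 1 ≤ ν) (hμN : μ < N) (hμν : ν < μ) :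
    Exchange (fockSpace N) (fockDual N h) (fun _ => 1) (fun _ => 1)
      (XPlus N h k μ) (XMinus N h k ν) := by
  rw [XPlus_eq_current, XMinus_eq_current (by omega)]
  refine exchange_one_of_con (h := h) (comm_regular (by omega) hh) (fun ξ hξ => hξ.1)
    (fun i _ => isVertex_raising hh _ _ _) (fun i _ => isVertex_lowering hh _ _)
    (π := fun i _ => k + (μ - ν)) (δ := mixedRes μ ν) ?_ ?_ fun Φ ξ v w => ?_
  rotate_left 2
  · rw [← zero_div (w + (k + (μ - ν)) * (I * (h : ℂ))), ← sum_mixedRes_eq_zero hν hμν hμN Φ ξ v,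
      Finset.sum_div]
    refine Finset.sum_congr rfl fun i _ => ?_
    rw [Finset.sum_div]
    refine Finset.sum_congr rfl fun j _ => ?_
    ring
  all_goals
    intro i hi j hj u v s hs
    rw [mem_raisingSet] at hi
    rw [mem_loweringSet] at hj
    obtain ⟨i1, i2⟩ := hi
    obtain ⟨j1, j2, j3, j4⟩ := hj
    rw [mixedRes_eq]
    simp only [lowering]
    by_cases hj : j.1 ≤ ν <;> simp only [hj, if_true, if_false]
    all_goals first
    | rw [(con_raising_loweringL_far hh hs (.inl hμν) hμN (by omega) i1 i2 j1 hj j3).1,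
        if_neg (by omega), if_neg (by omega), if_neg (by omega), add_zero, sub_self]
    | rw [(con_raising_loweringL_far hh hs (.inl hμν) hμN (by omega) i1 i2 j1 hj j3).2,
        if_neg (by omega), if_neg (by omega), if_neg (by omega), sub_zero, sub_self]
    | rw [(con_raising_loweringR_of_lt hh hs hν hμν hμN i1 i2 (by omega) j2 j4).1]
    | rw [(con_raising_loweringR_of_lt hh hs hν hμν hμN i1 i2 (by omega) j2 j4).2]

/-- The exponent of `H_μ^+`, in the normalization of `X_μ^±`. -/
def cartanPlus (N : ℕ) (h : ℝ) (k : ℂ) (μ : ℕ) (u : ℂ) : Exponent :=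
  upper N h k 0 μ (μ + 1) u + ladder h μ (μ + 1) u

/-- The exponent of `H_μ^-`, in the normalization of `X_μ^±`. -/
def cartanMinus (N : ℕ) (h : ℝ) (k : ℂ) (μ : ℕ) (v : ℂ) : Exponent := lower N h k μ 1 v

theorem isVertex_cartanPlus (μ : ℕ) : IsVertex (cartanPlus N h k μ) :=
  (isVertex_upper 0 μ (μ + 1)).add (isVertex_ladder μ (μ + 1))

theorem isVertex_cartanMinus (μ : ℕ) : IsVertex (cartanMinus N h k μ) :=
  isVertex_lower μ 1

theorem upper_neg (μ m : ℕ) (c u : ℂ) :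
    upper N h k (-c) μ m u = upper N h k 0 μ m (u - c * (I * h)) := by
  have e : ∀ a : ℂ, u + (-c + a) * (I * h) = u - c * (I * h) + (0 + a) * (I * h) := fun a => by ring
  simp only [upper, e]

theorem XPlus_XMinus_self (hh : 0 < h) {μ : ℕ} (hμ : 1 ≤ μ) (hμN : μ < N) :
    DeltaCommutator (fockSpace N) (fockDual N h) (-1 * (I * h)) (-k * (I * h))
      (XPlus N h k μ) (XMinus N h k μ)
      (fun u => normalExp N (comm N h k) (cartanPlus N h k μ u))
      (fun v => normalExp N (comm N h k) (cartanMinus N h k μ v)) := by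
  rw [XPlus_eq_current, XMinus_eq_current hμN.le]
  refine deltaCommutator_of_con (h := h) (comm_regular (by omega) hh) (fun ξ hξ => hξ.1)
    (fun i _ => isVertex_raising hh _ _ _) (fun i _ => isVertex_lowering hh _ _)
    (π := fun i j => if j.1 ≤ μ then -i.1 + (1 - sgn i.2) / 2 else k)
    (δ := fun i j => (if i = j then sgn i.2 else 0)
      + if i = (μ, true) ∧ j = (μ + 1, true) then 1 else 0)
    ?_ ?_ (isVertex_cartanPlus μ) fun Φ ξ v w => ?_
  rotate_left 2
  · have e1 : ∀ m : ℕ, 1 ≤ m → m < μ →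
        raising h μ m true (v + m * (I * h)) + lowering N h k μ (m, true) v
        = raising h μ (m + 1) false (v + m * (I * h)) + lowering N h k μ (m + 1, false) v := by
      intro m h1 h2
      rw [lowering_of_le (by omega), lowering_of_le (by omega)]
      simp only [raising, loweringL, ladder_succ h1, lower_eq (show m + 1 ≤ μ from h2), bSgn, sgn]
      push_cast
      ring_nf
    have e2 : raising h μ 1 false v + lowering N h k μ (1, false) v = cartanMinus N h k μ v := by
      rw [lowering_of_le hμ, cartanMinus, lower_eq hμ]
      simp only [raising, loweringL, bSgn, sgn, ladder, Finset.Ico_self, Finset.sum_empty]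
      push_cast
      ring_nf
    have e3 : raising h μ μ true (v - k * (I * h)) + lowering N h k μ (μ + 1, true) v
        = cartanPlus N h k μ (v + -k * (I * h)) := by
      have h1 : v + -k * (I * h) = v - k * (I * h) := by ring
      rw [lowering_of_lt (Nat.lt_succ_self μ), loweringR_self, cartanPlus, upper_neg, ladder_succ hμ, h1]
      simp only [raising, bSgn, sgn, bc_self, bP_self]
      push_cast
      ring_nf
    obtain ⟨g, hg⟩ : ∃ g : ℕ × Bool → ℕ × Bool → ℂ → ℂ, g = fun i j a => normalExp N (comm N h k)
      (raising h μ i.1 i.2 (v - a * (I * h)) + lowering N h k μ j v) Φ ξ := ⟨_, rfl⟩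
    have g1 : ∀ m : ℕ, 1 ≤ m → m < μ →
        g (m, true) (m, true) (-m) = g (m + 1, false) (m + 1, false) (-m) := by
      intro m h1 h2
      have e : v - -(m : ℂ) * (I * h) = v + m * (I * h) := by ring
      simp only [hg, e, e1 m h1 h2]
    have g2 : g (1, false) (1, false) 0 = normalExp N (comm N h k) (cartanMinus N h k μ v) Φ ξ := by
      simp only [hg, zero_mul, sub_zero, e2]
    have g3 : g (μ, true) (μ + 1, true) k
        = normalExp N (comm N h k) (cartanPlus N h k μ (v + -k * (I * h))) Φ ξ := by
      simp only [hg, e3]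
    rw [← g2, ← g3]
    have h0 : ∀ i j a, normalExp N (comm N h k)
      (raising h μ i.1 i.2 (v - a * (I * h)) + lowering N h k μ j v) Φ ξ = g i j a := by
      intro i j a
      rw [hg]
    have key : ∀ D F : ℕ × Bool → ℕ × Bool → ℂ, ∑ i ∈ raisingSet μ, ∑ j ∈ loweringSet N μ,
        sgn i.2 * -sgn j.2 * (((if i = j then sgn i.2 else 0)
          + if i = (μ, true) ∧ j = (μ + 1, true) then 1 else 0) / D i j) * F i j
        = ∑ m ∈ Finset.Icc 1 μ, (F (m, false) (m, false) / D (m, false) (m, false)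
            - if m < μ then F (m, true) (m, true) / D (m, true) (m, true) else 0)
          - F (μ, true) (μ + 1, true) / D (μ, true) (μ + 1, true) := by
      intro D F
      simp only [add_div, ite_div, zero_div, mul_add, add_mul, mul_ite, ite_mul, mul_zero, zero_mul,
        Finset.sum_add_distrib, sum_sum_ite_eq, sum_sum_diag_ite]
      rw [if_pos (by simp [mem_raisingSet, mem_loweringSet]; omega), raisingSet, Finset.sum_product,
        sub_eq_add_neg]
      congr 1
      · refine Finset.sum_congr rfl fun m hm => ?_
        rw [Finset.mem_Icc] at hm
        have h1 : (m, false) ∈ loweringSet N μ := by simp [mem_loweringSet]; omega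
        have h2 : (m, true) ∈ loweringSet N μ ↔ m < μ := by simp [mem_loweringSet]; omega
        rw [Fintype.sum_bool, if_pos h1]
        simp only [h2, sgn]
        split_ifs <;> ring
      · simp only [sgn]
        ring
    simp only [h0]
    rw [key (fun i j => w + (if j.1 ≤ μ then -(i.1 : ℂ) + (1 - sgn i.2) / 2 else k) * (I * h))
      fun i j => g i j (if j.1 ≤ μ then -(i.1 : ℂ) + (1 - sgn i.2) / 2 else k)]
    obtain ⟨G, hG⟩ : ∃ G : ℕ → ℂ, G = fun m => g (m, false) (m, false) (-(m : ℂ) + 1)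
      / (w + (-(m : ℂ) + 1) * (I * h)) := ⟨_, rfl⟩
    have h1 : ∀ m ∈ Finset.Icc 1 μ, (g (m, false) (m, false)
          (if m ≤ μ then -(m : ℂ) + (1 - sgn false) / 2 else k)
            / (w + (if m ≤ μ then -(m : ℂ) + (1 - sgn false) / 2 else k) * (I * h))
          - if m < μ then g (m, true) (m, true) (if m ≤ μ then -(m : ℂ) + (1 - sgn true) / 2 else k)
            / (w + (if m ≤ μ then -(m : ℂ) + (1 - sgn true) / 2 else k) * (I * h)) else 0)
        = (if m < μ then G m - G (m + 1) else 0) + if m = μ then G m else 0 := by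
      intro m hm
      rw [Finset.mem_Icc] at hm
      have s1 : -(m : ℂ) + (1 - sgn false) / 2 = -m + 1 := by simp only [sgn]; ring
      have s2 : -(m : ℂ) + (1 - sgn true) / 2 = -m := by simp only [sgn]; ring
      have s3 : -((m + 1 : ℕ) : ℂ) + 1 = -m := by push_cast; ring
      rw [if_pos hm.2, if_pos hm.2, s1, s2]
      rcases hm.2.lt_or_eq with h2 | h2
      · rw [if_pos h2, if_pos h2, if_neg h2.ne, add_zero, g1 m hm.1 h2, hG]
        simp only [s3]
      · rw [if_neg h2.not_lt, if_neg h2.not_lt, if_pos h2, zero_add, sub_zero, hG]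
    dsimp only
    rw [Finset.sum_congr rfl h1, Finset.sum_add_distrib, sum_Icc_ite_lt_telescope (Nat.le_succ μ),
      Finset.sum_ite_eq', if_pos hμ, if_pos (by simp [hμ]), if_neg (by omega), sub_add_cancel, hG]
    have s4 : -((1 : ℕ) : ℂ) + 1 = 0 := by norm_num
    have s5 : w - -k * (I * h) = w + k * (I * h) := by ring
    simp only [s4, s5, zero_mul, add_zero]
    ring
  all_goals
    intro i hi j hj u v s hs
    rw [mem_raisingSet] at hi
    rw [mem_loweringSet] at hj
    obtain ⟨i1, i2⟩ := hi
    obtain ⟨j1, j2, j3, j4⟩ := hj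
    obtain ⟨m, ε⟩ := i
    obtain ⟨m', ε'⟩ := j
    simp only [Prod.mk.injEq] at *
    rcases Nat.lt_or_ge μ m' with h1 | h1
    · rw [lowering_of_lt h1, if_neg h1.not_ge, if_neg (by omega)]
      first
      | rw [(con_raising_loweringR_of_le hh hs hμ le_rfl hμN i1 i2 h1 j2 j4).1]
      | rw [(con_raising_loweringR_of_le hh hs hμ le_rfl hμN i1 i2 h1 j2 j4).2]
      cases ε <;> cases ε' <;>
        simp only [and_true, and_false, false_and, reduceCtorEq, if_false, add_zero, sub_zero, sub_self,
          zero_add] at j4 ⊢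
      · rw [if_neg (by omega)]
      · split_ifs
        · rfl
        · simp
    · rw [lowering_of_le h1, if_pos h1, if_neg (c := (m = μ ∧ _) ∧ _) (by omega), add_zero]
      first
      | rw [(con_raising_loweringL_self hh hs hμN i1 i2 j1 h1 j3).1]
      | rw [(con_raising_loweringL_self hh hs hμN i1 i2 j1 h1 j3).2]
      split_ifs
      · rfl
      · simp

end mixed

/-! ### The fields `k^±` -/

section cartan

variable {N : ℕ} {h : ℝ} {k : ℂ} {s : ℝ} {u v a b c : ℂ}

/-- The exponent of `k_μ^+`. -/
def kP (N : ℕ) (h : ℝ) (k : ℂ) (μ : ℕ) (u : ℂ) : Exponent :=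
  -lamP h μ (u + (0 + (k - N) / 4) * (I * h))
    + ∑ α ∈ Finset.Ico 1 μ, bP h α μ (u + ((μ : ℂ) - α) / 2 * (I * h))
    - ∑ β ∈ Finset.Icc (μ + 1) N, bP h μ β (u + ((μ : ℂ) - β) / 2 * (I * h))

/-- The exponent of `k_μ^-`. -/
def kM (N : ℕ) (h : ℝ) (k : ℂ) (μ : ℕ) (u : ℂ) : Exponent :=
  -lamM h μ (u + (0 - (k - N) / 4) * (I * h))
    + ∑ ρ ∈ Finset.Ico 1 μ, ∑ γ ∈ Finset.Icc μ N, bM h ρ γ (u + ((ρ : ℂ) + γ) / 2 * (I * h))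
    - ∑ α ∈ Finset.Icc 1 μ, ∑ β ∈ Finset.Icc (μ + 1) N,
        bM h α β (u + ((α : ℂ) + β - 2) / 2 * (I * h))

theorem isVertex_kP (μ : ℕ) : IsVertex (kP N h k μ) :=
  ((((isVertex_lamP _ μ).comp_add _).neg).add (.sum _ fun α _ => (isVertex_bP _ α μ).comp_add _)).sub
    (.sum _ fun β _ => (isVertex_bP _ μ β).comp_add _)

theorem isVertex_kM (μ : ℕ) : IsVertex (kM N h k μ) :=
  ((((isVertex_lamM _ μ).comp_add _).neg).add
    (.sum _ fun α _ => .sum _ fun β _ => (isVertex_bM _ α β).comp_add _)).sub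
    (.sum _ fun α _ => .sum _ fun β _ => (isVertex_bM _ α β).comp_add _)

theorem kPlus_eq (μ : ℕ) (u : ℂ) : kPlus N h k μ u = normalExp N (comm N h k) (kP N h k μ u) := by
  simp only [kPlus, kP, zero_add]

theorem kMinus_eq (μ : ℕ) (u : ℂ) : kMinus N h k μ u = normalExp N (comm N h k) (kM N h k μ u) := by
  have e : u + (0 - (k - N) / 4) * (I * h) = u - (k - N) / 4 * (I * h) := by ring
  simp only [kMinus, kM, e]

theorem kP_fst (μ : ℕ) (u : ℂ) : (kP N h k μ u).1 = 0 := by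
  simp [kP, lamP, bP, Prod.fst_sum]

theorem kM_snd (μ : ℕ) (u : ℂ) : (kM N h k μ u).2 = 0 := by
  simp [kM, lamM, bM, Prod.snd_sum]

theorem con_kP_bc (hh : 0 < h) (hs : 0 < s) {μ α β : ℕ} (hμ : 1 ≤ μ) (hμN : μ ≤ N) (hα : 1 ≤ α)
    (hβ : β ≤ N) :
    con N (comm N h k) (kP N h k μ u) (bc h α β (v + b * (I * h))) s
      = (if β = μ ∧ α < β then firstDiff (ker h u v s) (((μ : ℂ) - α) / 2 - b) else 0)
        - if α = μ ∧ α < β then firstDiff (ker h u v s) (((μ : ℂ) - β) / 2 - b) else 0 := by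
  rw [kP, con_sub_left, con_add_left, con_neg_left, con_sum_left, con_sum_left]
  simp only [Pi.add_apply, Pi.sub_apply, Pi.neg_apply, Finset.sum_apply, con_lamP_bc, neg_zero,
    zero_add]
  rw [Finset.sum_congr rfl fun n hn => con_bP_bc_ker hh hs n μ α β (Finset.mem_Ico.1 hn).1 hμN,
    Finset.sum_congr (s₁ := Finset.Icc (μ + 1) N) rfl fun n hn =>
      con_bP_bc_ker hh hs μ n α β hμ (Finset.mem_Icc.1 hn).2, sum_ite_eq_left, sum_ite_eq_right]
  simp only [Finset.mem_Ico, Finset.mem_Icc]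
  congr 1
  all_goals exact if_congr (by omega) rfl rfl

theorem con_kP_bM (hh : 0 < h) (hs : 0 < s) {μ α β : ℕ} (hμ : 1 ≤ μ) (hμN : μ ≤ N) (hα : 1 ≤ α)
    (hβ : β ≤ N) :
    con N (comm N h k) (kP N h k μ u) (bM h α β (v + b * (I * h))) s
      = (if β = μ ∧ α < β then secondDiff (ker h u v s) (((μ : ℂ) - α) / 2 - b) else 0)
        - if α = μ ∧ α < β then secondDiff (ker h u v s) (((μ : ℂ) - β) / 2 - b) else 0 := by
  rw [kP, con_sub_left, con_add_left, con_neg_left, con_sum_left, con_sum_left]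
  simp only [Pi.add_apply, Pi.sub_apply, Pi.neg_apply, Finset.sum_apply, con_lamP_bM, neg_zero,
    zero_add]
  rw [Finset.sum_congr rfl fun n hn => con_bP_bM_ker hh hs n μ α β (Finset.mem_Ico.1 hn).1 hμN,
    Finset.sum_congr (s₁ := Finset.Icc (μ + 1) N) rfl fun n hn =>
      con_bP_bM_ker hh hs μ n α β hμ (Finset.mem_Icc.1 hn).2, sum_ite_eq_left, sum_ite_eq_right]
  simp only [Finset.mem_Ico, Finset.mem_Icc]
  congr 1
  all_goals exact if_congr (by omega) rfl rfl

theorem con_kM_of_con_bM {X : Exponent} {α β μ : ℕ} (hα : 1 ≤ α) (hβ : β ≤ N) {H : Commutators}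
    (hlam : ∀ y, con N H X (lamM h μ y) s = 0) {f : ℂ → ℂ}
    (hX : ∀ α' β' b, con N H X (bM h α' β' (v + b * (I * h))) s
      = if α = α' ∧ β = β' ∧ α < β then f b else 0) :
    con N H X (kM N h k μ v) s
      = (if α < μ ∧ μ ≤ β then f (((α : ℂ) + β) / 2) else 0)
        - if α ≤ μ ∧ μ < β then f (((α : ℂ) + β - 2) / 2) else 0 := by
  rw [kM, con_sub_right, con_add_right, con_neg_right, con_sum_right, con_sum_right]
  simp only [Pi.add_apply, Pi.sub_apply, Pi.neg_apply, Finset.sum_apply, con_sum_right, hlam, neg_zero,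
    zero_add, hX]
  simp only [sum_ite_eq_right', sum_ite_eq_left']
  simp only [Finset.mem_Ico, Finset.mem_Icc]
  congr 1
  all_goals exact if_congr (by omega) rfl rfl

theorem con_bc_kM (hh : 0 < h) (hs : 0 < s) {μ α β : ℕ} (hα : 1 ≤ α) (hβ : β ≤ N) :
    con N (comm N h k) (bc h α β (u + a * (I * h))) (kM N h k μ v) s
      = (if α < μ ∧ μ ≤ β then firstDiff (ker h u v s) (a - ((α : ℂ) + β) / 2) else 0)
        - if α ≤ μ ∧ μ < β then firstDiff (ker h u v s) (a - ((α : ℂ) + β - 2) / 2) else 0 :=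
  con_kM_of_con_bM hα hβ (fun y => con_bc_lamM _ _ _ _)
    fun α' β' b => con_bc_bM_ker hh hs α β α' β' hα hβ

theorem con_bP_kM (hh : 0 < h) (hs : 0 < s) {μ α β : ℕ} (hα : 1 ≤ α) (hβ : β ≤ N) :
    con N (comm N h k) (bP h α β (u + a * (I * h))) (kM N h k μ v) s
      = (if α < μ ∧ μ ≤ β then secondDiff (ker h u v s) (a - ((α : ℂ) + β) / 2) else 0)
        - if α ≤ μ ∧ μ < β then secondDiff (ker h u v s) (a - ((α : ℂ) + β - 2) / 2) else 0 :=
  con_kM_of_con_bM hα hβ (fun y => con_bP_lamM _ _ _ _)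
    fun α' β' b => con_bP_bM_ker hh hs α β α' β' hα hβ

theorem secondDiff_eq_stepDiff_sub (φ : ℂ → ℂ) (z : ℂ) :
    secondDiff φ (-z) = stepDiff φ z - stepDiff φ (z + 1) := by
  simp only [secondDiff, stepDiff]
  ring_nf

theorem secondDiff_comp_add (φ : ℂ → ℂ) (c z : ℂ) :
    secondDiff (fun z => φ (c + z)) z = secondDiff φ (c + z) := by
  simp only [secondDiff, add_assoc, add_sub_assoc]

theorem sum_Ico_stepDiff (φ : ℂ → ℂ) (c : ℂ) {m n : ℕ} (hmn : m ≤ n) :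
    ∑ j ∈ Finset.Ico m n, secondDiff φ (c - j) = stepDiff φ (m - c) - stepDiff φ (n - c) := by
  rw [← neg_sub (stepDiff φ (n - c)), ← Finset.sum_Ico_sub (fun j : ℕ => stepDiff φ (j - c)) hmn,
    ← Finset.sum_neg_distrib]
  refine Finset.sum_congr rfl fun j _ => ?_
  rw [← neg_sub (j : ℂ), secondDiff_eq_stepDiff_sub, neg_sub]
  push_cast
  ring_nf

theorem con_ladder_kM (hh : 0 < h) (hs : 0 < s) {μ ν m : ℕ} (hν : ν < N) (hm : 1 ≤ m)
    (hmν : m ≤ ν + 1) :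
    con N (comm N h k) (ladder h ν m u) (kM N h k μ v) s
      = (if μ = ν + 1 then stepDiff (ker h u v s) 1 - stepDiff (ker h u v s) m else 0)
        - if μ = ν then stepDiff (ker h u v s) 0 - stepDiff (ker h u v s) (m - 1) else 0 := by
  rw [ladder, con_sum_left, Finset.sum_apply]
  have h1 : ∀ n ∈ Finset.Ico 1 m, con N (comm N h k)
      (bP h n (ν + 1) (u + ((ν : ℂ) - n + 1) / 2 * (I * h)) - bP h n ν (u + ((ν : ℂ) - n) / 2 * (I * h)))
      (kM N h k μ v) s
      = (if μ = ν + 1 then secondDiff (ker h u v s) (0 - n) else 0)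
        - if μ = ν then secondDiff (ker h u v s) (1 - n) else 0 := by
    intro n hn
    rw [Finset.mem_Ico] at hn
    rw [con_sub_left, Pi.sub_apply, con_bP_kM hh hs hn.1 hν, con_bP_kM hh hs hn.1 hν.le]
    have e1 : ((ν : ℂ) - n + 1) / 2 - (n + (ν + 1 : ℕ)) / 2 = 0 - n := by push_cast; ring
    have e2 : ((ν : ℂ) - n + 1) / 2 - (n + (ν + 1 : ℕ) - 2) / 2 = 1 - n := by push_cast; ring
    have e3 : ((ν : ℂ) - n) / 2 - (n + ν) / 2 = 0 - n := by ring
    have e4 : ((ν : ℂ) - n) / 2 - (n + ν - 2) / 2 = 1 - n := by ring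
    rw [e1, e2, e3, e4]
    split_ifs <;> first | omega | ring
  rw [Finset.sum_congr rfl h1, Finset.sum_sub_distrib]
  congr 1
  · split_ifs
    · rw [sum_Ico_stepDiff _ _ hm, Nat.cast_one, sub_zero, sub_zero]
    · exact Finset.sum_const_zero
  · split_ifs
    · rw [sum_Ico_stepDiff _ _ hm, Nat.cast_one, sub_self]
    · exact Finset.sum_const_zero

theorem con_upper_kM (hh : 0 < h) (hs : 0 < s) {μ ν m : ℕ} (hν : 1 ≤ ν) (hνN : ν < N)
    (hμ : 1 ≤ μ) (hμN : μ ≤ N) (hm : ν < m) (hmN : m ≤ N) {ψ : ℂ → ℂ}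
    (hψ : ψ = fun z => ker h u v s (c + z)) :
    con N (comm N h k) (upper N h k c ν m u) (kM N h k μ v) s
      = (if μ = ν + 1 then ψ (k - 1) - ψ k + stepDiff ψ m else 0)
        + if μ = ν then ψ (k + 1) - ψ k - stepDiff ψ (m - 1) else 0 := by
  rw [upper, con_add_left, con_sum_left, Pi.add_apply, Finset.sum_apply]
  have h1 : ∀ n ∈ Finset.Icc m N, con N (comm N h k)
      (bP h ν n (u + (c + ((ν : ℂ) - n) / 2) * (I * h))
        - bP h (ν + 1) n (u + (c + ((ν : ℂ) - n + 1) / 2) * (I * h))) (kM N h k μ v) s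
      = (if μ = ν + 1 then secondDiff ψ (0 - n) else 0)
        - if μ = ν then secondDiff ψ (1 - n) else 0 := by
    intro n hn
    rw [Finset.mem_Icc] at hn
    rw [con_sub_left, Pi.sub_apply, con_bP_kM hh hs hν hn.2, con_bP_kM hh hs (by omega) hn.2, hψ,
      secondDiff_comp_add, secondDiff_comp_add]
    have e1 : c + ((ν : ℂ) - n) / 2 - (ν + n) / 2 = c + (0 - n) := by ring
    have e2 : c + ((ν : ℂ) - n) / 2 - (ν + n - 2) / 2 = c + (1 - n) := by ring
    have e3 : c + ((ν : ℂ) - n + 1) / 2 - ((ν + 1 : ℕ) + n) / 2 = c + (0 - n) := by push_cast; ring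
    have e4 : c + ((ν : ℂ) - n + 1) / 2 - ((ν + 1 : ℕ) + n - 2) / 2 = c + (1 - n) := by
      push_cast; ring
    rw [e1, e2, e3, e4]
    split_ifs <;> first | omega | ring
  have h2 : Finset.Icc m N = Finset.Ico m (N + 1) := rfl
  rw [Finset.sum_congr rfl h1, Finset.sum_sub_distrib, h2]
  rw [kM, con_sub_right, con_add_right, con_neg_right, con_sum_right, con_sum_right]
  simp only [Pi.add_apply, Pi.sub_apply, Pi.neg_apply, Finset.sum_apply, con_sum_right, con_lamRatio_bM,
    Finset.sum_const_zero, sub_zero, add_zero]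
  rw [con_lamRatio_lamM_ker hh hs hν hνN hμ hμN]
  rcases eq_or_ne μ ν with h3 | h3
  · rw [if_pos h3, if_neg (by omega), if_neg (by omega), if_pos h3]
    simp only [if_pos h3, if_neg (show ¬ μ = ν + 1 by omega), Finset.sum_const_zero, add_zero]
    rw [sum_Ico_stepDiff _ _ (by omega)]
    simp only [hψ, stepDiff]
    push_cast
    ring_nf
  · simp only [if_neg h3, Finset.sum_const_zero, sub_zero, add_zero]
    split_ifs
    · rw [sum_Ico_stepDiff _ _ (by omega)]
      simp only [hψ, stepDiff]
      push_cast
      ring_nf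
    · simp

theorem lam_neg (μ ν : ℕ) (s : ℝ) : (comm N h k).lam μ ν (-s) = -(comm N h k).lam ν μ s := by
  rcases lt_trichotomy μ ν with h1 | rfl | h1 <;>
  · simp (disch := omega) only [comm, if_pos, if_neg, if_true, ofReal_neg, mul_neg, sinh_neg, neg_mul,
      one_mul, neg_neg]
    ring

theorem lam_sub_lam_succ_right (hh : 0 < h) (hs : 0 < s) (hN : 0 < N) (μ ν : ℕ) :
    4 * h ^ 2 * s * ((comm N h k).lam μ ν s - (comm N h k).lam μ (ν + 1) s)
      = (exp ((k + N) / 2 * h * s) - exp (-((k + N) / 2 * h * s)))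
        * ((if μ = ν then 1 - exp (-(h * s)) else 0) + if μ = ν + 1 then 1 - exp (h * s) else 0) := by
  have e := lam_sub_lam_succ (k := k) hh (neg_ne_zero.2 hs.ne') hN ν μ
  simp only [lam_neg, ofReal_neg, mul_neg, neg_neg] at e
  rw [← neg_sub 1 (exp (-(h * s : ℂ))), ← neg_sub 1 (exp (h * s : ℂ))] at e
  split_ifs at e ⊢ <;> linear_combination e

theorem con_lamP_lamM_sub_ker (hh : 0 < h) (hs : 0 < s) {μ ν : ℕ} (hμ : 1 ≤ μ) (hμN : μ ≤ N)
    (hν : 1 ≤ ν) (hνN : ν < N) :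
    con N (comm N h k) (lamP h μ (u + (0 + (k - N) / 4) * (I * h)))
        (lamM h ν (v + (0 - (k - N) / 4) * (I * h)) - lamM h (ν + 1) (v + (0 - (k - N) / 4) * (I * h))) s
      = (if μ = ν then ker h u v s (k - 1) - ker h u v s k + ker h u v s (-N)
          - ker h u v s (-N - 1) else 0)
        + if μ = ν + 1 then ker h u v s (k + 1) - ker h u v s k + ker h u v s (-N)
          - ker h u v s (-N + 1) else 0 := by
  rw [con_sub_right, Pi.sub_apply, con_lamP_lamM _ hμ hμN hν hνN.le,
    con_lamP_lamM _ hμ hμN (by omega) hνN]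
  have h3 : (s : ℂ) ≠ 0 := by exact_mod_cast hs.ne'
  obtain ⟨x, hx⟩ : ∃ x, x = u + (0 + (k - N) / 4) * (I * h) := ⟨_, rfl⟩
  obtain ⟨y, hy⟩ : ∃ y, y = v + (0 - (k - N) / 4) * (I * h) := ⟨_, rfl⟩
  have key : ∀ a : ℂ, ker h u v s a = exp (-I * (x - y) * s)
      * exp ((a - (k - N) / 2) * h * s) / s := by
    intro a
    have e := expKernel_add_sub_add h (a - (k - N) / 2) u v (0 + (k - N) / 4) (0 - (k - N) / 4) s
    have e' : a - (k - N) / 2 + (0 + (k - N) / 4) - (0 - (k - N) / 4) = a := by ring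
    rw [e', ← hx, ← hy] at e
    rw [← e, expKernel, ← exp_add]
    ring_nf
  have h4 := lam_sub_lam_succ_right (k := k) hh hs (show 0 < N by omega) μ ν
  have e1 : (k - 1 - (k - N) / 2) * h * s = (k + N) / 2 * h * s + -(h * s) := by ring
  have e2 : (k + 1 - (k - N) / 2) * h * s = (k + N) / 2 * h * s + h * s := by ring
  have e3 : (k - (k - N) / 2) * h * s = (k + N) / 2 * h * s := by ring
  have e4 : (-N - (k - N) / 2) * h * s = -((k + N) / 2 * h * s) := by ring
  have e5 : (-N - 1 - (k - N) / 2) * h * s = -((k + N) / 2 * h * s) + -(h * s) := by ring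
  have e6 : (-N + 1 - (k - N) / 2) * h * s = -((k + N) / 2 * h * s) + h * s := by ring
  simp only [key, e1, e2, e3, e4, e5, e6, exp_add ((k + N) / 2 * h * s),
    exp_add (-((k + N) / 2 * h * s)), ← hx, ← hy]
  have h5 : ∀ a b c : ℂ, 4 * h ^ 2 * s * (a - b) = c → -(4 * h ^ 2 * a * exp (-I * (x - y) * s))
      - -(4 * h ^ 2 * b * exp (-I * (x - y) * s)) = -(exp (-I * (x - y) * s) * c / s) := by
    rintro a b c rfl
    field_simp
    ring
  rw [h5 _ _ _ h4]
  split_ifs <;> first | omega | ring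

theorem con_kP_lower (hh : 0 < h) (hs : 0 < s) {μ ν r : ℕ} (hμ : 1 ≤ μ) (hμN : μ ≤ N)
    (hν : 1 ≤ ν) (hνN : ν < N) (hr : 1 ≤ r) (hrν : r ≤ ν + 1) :
    con N (comm N h k) (kP N h k μ u) (lower N h k ν r v) s
      = (if μ = ν then ker h u v s k - ker h u v s (k - 1) - stepDiff (ker h u v s) r else 0)
        + if μ = ν + 1 then ker h u v s k - ker h u v s (k + 1) + stepDiff (ker h u v s) (r - 1)
          else 0 := by
  rw [lower, con_add_right, con_add_right, con_sum_right, con_sum_right]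
  simp only [Pi.add_apply, Finset.sum_apply]
  have h1 : ∀ n ∈ Finset.Icc r ν, con N (comm N h k) (kP N h k μ u)
      (bM h n (ν + 1) (v + ((n : ℂ) + ν - 1) / 2 * (I * h)) - bM h n ν (v + ((n : ℂ) + ν) / 2 * (I * h))) s
      = (if μ = ν + 1 then secondDiff (ker h u v s) (1 - n) else 0)
        - (if μ = ν then secondDiff (ker h u v s) (0 - n) else 0) := by
    intro n hn
    rw [Finset.mem_Icc] at hn
    rw [con_sub_right, Pi.sub_apply, con_kP_bM hh hs hμ hμN (by omega) hνN,
      con_kP_bM hh hs hμ hμN (by omega) hνN.le]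
    rcases (by omega : μ = ν ∨ μ = ν + 1 ∨ μ < ν ∨ ν + 1 < μ) with h1 | h1 | h1 | h1 <;>
    rcases lt_trichotomy n μ with h2 | h2 | h2
    all_goals subst_vars
    all_goals first
    | omega
    | simp (disch := omega) only [if_pos, if_neg, true_and, if_true]
      push_cast
      ring_nf
  have h2 : ∀ n ∈ Finset.Icc (ν + 1) N, con N (comm N h k) (kP N h k μ u)
      (bM h ν n (v + ((n : ℂ) + ν) / 2 * (I * h))
        - bM h (ν + 1) n (v + ((n : ℂ) + ν - 1) / 2 * (I * h))) s
      = (if μ = ν + 1 then secondDiff (ker h u v s) (1 - n) else 0)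
        - (if μ = ν then secondDiff (ker h u v s) (0 - n) else 0) := by
    intro n hn
    rw [Finset.mem_Icc] at hn
    rw [con_sub_right, Pi.sub_apply, con_kP_bM hh hs hμ hμN (by omega) hn.2,
      con_kP_bM hh hs hμ hμN (by omega) hn.2]
    rcases (by omega : μ = ν ∨ μ = ν + 1 ∨ μ < ν ∨ ν + 1 < μ) with h1 | h1 | h1 | h1 <;>
    rcases lt_trichotomy n μ with h2 | h2 | h2
    all_goals subst_vars
    all_goals first
    | omega
    | simp (disch := omega) only [if_pos, if_neg, true_and, if_true]
      push_cast
      ring_nf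
  have h3 : con N (comm N h k) (kP N h k μ u) (lamM h ν (v + (0 - (k - N) / 4) * (I * h))
      - lamM h (ν + 1) (v + (0 - (k - N) / 4) * (I * h))) s
      = -con N (comm N h k) (lamP h μ (u + (0 + (k - N) / 4) * (I * h)))
        (lamM h ν (v + (0 - (k - N) / 4) * (I * h))
          - lamM h (ν + 1) (v + (0 - (k - N) / 4) * (I * h))) s := by
    rw [kP, con_sub_left, con_add_left, con_neg_left, con_sum_left, con_sum_left]
    simp only [Pi.add_apply, Pi.sub_apply, Pi.neg_apply, Finset.sum_apply, con_sub_right, con_bP_lamM,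
      Finset.sum_const_zero, sub_zero, add_zero]
  have h4 : Finset.Icc r ν = Finset.Ico r (ν + 1) := rfl
  have h5 : Finset.Icc (ν + 1) N = Finset.Ico (ν + 1) (N + 1) := rfl
  rw [Finset.sum_congr rfl h1, Finset.sum_congr rfl h2, h3, con_lamP_lamM_sub_ker hh hs hμ hμN hν hνN,
    Finset.sum_sub_distrib, Finset.sum_sub_distrib, h4, h5]
  rcases eq_or_ne μ ν with h6 | h6
  · simp only [if_pos h6, if_neg (show ¬ μ = ν + 1 by omega), Finset.sum_const_zero, add_zero]
    rw [sum_Ico_stepDiff _ _ hrν, sum_Ico_stepDiff _ _ (by omega)]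
    simp only [stepDiff]
    push_cast
    ring_nf
  · rcases eq_or_ne μ (ν + 1) with h7 | h7
    · simp only [if_neg h6, if_pos h7, Finset.sum_const_zero, zero_add, sub_zero]
      rw [sum_Ico_stepDiff _ _ hrν, sum_Ico_stepDiff _ _ (by omega)]
      simp only [stepDiff]
      push_cast
      ring_nf
    · simp [h6, h7]

end cartan

section cartan_tables

variable {N : ℕ} {h : ℝ} {k : ℂ} {s : ℝ} {u v : ℂ}


theorem con_kP_raising (hh : 0 < h) (hs : 0 < s) {μ ν m : ℕ} {ε : Bool} (hμ : 1 ≤ μ) (hμN : μ ≤ N)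
    (hνN : ν < N) (hm : 1 ≤ m) (hmν : m ≤ ν) :
    con N (comm N h k) (kP N h k μ u) (raising h ν m ε v) s
      = (if μ = ν then ker h u v s (-1) - ker h u v s 0 else 0)
        + if μ = ν + 1 then ker h u v s 1 - ker h u v s 0 else 0 := by
  have i1 : ν ≤ N := by omega
  have i2 : ν + 1 ≤ N := by omega
  cases ε <;>
  · simp only [raising, bSgn, sgn, con_sub_right, con_add_right, Pi.add_apply, Pi.sub_apply,
      con_ladder_left, con_bP_right, con_kP_bc hh hs hμ hμN hm i1,
      con_kP_bc hh hs hμ hμN hm i2, con_kP_bM hh hs hμ hμN hm i2]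
    rcases (by omega : μ = ν ∨ μ = ν + 1 ∨ μ < ν ∨ ν + 1 < μ) with h1 | h1 | h1 | h1 <;>
    rcases lt_trichotomy m μ with h2 | h2 | h2
    all_goals subst_vars
    all_goals first
    | omega
    | simp (disch := omega) only [if_pos, if_neg, true_and, and_true, if_true]
      try simp only [firstDiff, secondDiff, stepDiff]
      push_cast
      ring_nf

theorem con_raising_kM (hh : 0 < h) (hs : 0 < s) {μ ν m : ℕ} {ε : Bool}
    (hνN : ν < N) (hm : 1 ≤ m) (hmν : m ≤ ν) :
    con N (comm N h k) (raising h ν m ε u) (kM N h k μ v) s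
      = (if μ = ν then ker h u v s 0 - ker h u v s 1 else 0)
        + if μ = ν + 1 then ker h u v s 0 - ker h u v s (-1) else 0 := by
  have i1 : ν ≤ N := by omega
  have i2 : ν + 1 ≤ N := by omega
  cases ε <;>
  · simp only [raising, bSgn, sgn, con_sub_left, con_add_left, Pi.add_apply, Pi.sub_apply,
      con_bM_left, con_bc_kM hh hs hm i1,
      con_bc_kM hh hs hm i2, con_bP_kM hh hs hm i2,
      con_ladder_kM hh hs hνN hm (hmν.trans (Nat.le_succ _))]
    rcases (by omega : μ = ν ∨ μ = ν + 1 ∨ μ < ν ∨ ν + 1 < μ) with h1 | h1 | h1 | h1 <;>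
    rcases lt_trichotomy m μ with h2 | h2 | h2
    all_goals subst_vars
    all_goals first
    | omega
    | simp (disch := omega) only [if_pos, if_neg, true_and, and_true, if_true]
      try simp only [firstDiff, secondDiff, stepDiff]
      push_cast
      ring_nf

theorem con_kP_loweringL (hh : 0 < h) (hs : 0 < s) {μ ν m : ℕ} {ε : Bool} (hμ : 1 ≤ μ) (hμN : μ ≤ N)
    (hνN : ν < N) (hm : 1 ≤ m) (hmν : m ≤ ν) (hε : ¬(m = ν ∧ ε = true)) :
    con N (comm N h k) (kP N h k μ u) (loweringL N h k ν m ε v) s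
      = (if μ = ν then ker h u v s k - ker h u v s (k - 1) else 0)
        + if μ = ν + 1 then ker h u v s k - ker h u v s (k + 1) else 0 := by
  have i1 : ν ≤ N := by omega
  have i2 : ν + 1 ≤ N := by omega
  have i3 : 1 ≤ ν := by omega
  cases ε <;>
  · simp only [loweringL, bSgn, sgn, con_sub_right, con_add_right, Pi.add_apply, Pi.sub_apply,
      con_bP_right, con_kP_bc hh hs hμ hμN hm i1,
      con_kP_bc hh hs hμ hμN hm i2, con_kP_bM hh hs hμ hμN hm i1,
      con_kP_lower hh hs hμ hμN i3 hνN (by omega : 1 ≤ m + 1) (by omega : m + 1 ≤ _ + 1)]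
    try simp at hε
    rcases (by omega : μ = ν ∨ μ = ν + 1 ∨ μ < ν ∨ ν + 1 < μ) with h1 | h1 | h1 | h1 <;>
    rcases lt_trichotomy m μ with h2 | h2 | h2
    all_goals subst_vars
    all_goals first
    | omega
    | simp (disch := omega) only [if_pos, if_neg, true_and, and_true, if_true]
      try simp only [firstDiff, secondDiff, stepDiff]
      push_cast
      ring_nf

theorem con_kP_loweringR (hh : 0 < h) (hs : 0 < s) {μ ν m : ℕ} {ε : Bool} (hμ : 1 ≤ μ) (hμN : μ ≤ N)
    (hν : 1 ≤ ν) (hm : ν < m) (hmN : m ≤ N) (hε : ¬(m = ν + 1 ∧ ε = false)) :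
    con N (comm N h k) (kP N h k μ u) (loweringR N h k ν m ε v) s
      = (if μ = ν then ker h u v s k - ker h u v s (k - 1) else 0)
        + if μ = ν + 1 then ker h u v s k - ker h u v s (k + 1) else 0 := by
  have i1 : 1 ≤ ν + 1 := by omega
  cases ε <;>
  · simp only [loweringR, bSgn, sgn, con_sub_right, con_add_right, Pi.add_apply, Pi.sub_apply,
      con_bP_right, con_upper_right, con_kP_bc hh hs hμ hμN hν hmN,
      con_kP_bc hh hs hμ hμN i1 hmN, con_kP_bM hh hs hμ hμN i1 hmN]
    try simp at hε
    rcases (by omega : μ = ν ∨ μ = ν + 1 ∨ μ < ν ∨ ν + 1 < μ) with h1 | h1 | h1 | h1 <;>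
    rcases lt_trichotomy m μ with h2 | h2 | h2
    all_goals subst_vars
    all_goals first
    | omega
    | simp (disch := omega) only [if_pos, if_neg, true_and, and_true, if_true]
      try simp only [firstDiff, secondDiff, stepDiff]
      push_cast
      ring_nf

theorem con_loweringL_kM (hh : 0 < h) (hs : 0 < s) {μ ν m : ℕ} {ε : Bool}
    (hνN : ν < N) (hm : 1 ≤ m) (hmν : m ≤ ν) (hε : ¬(m = ν ∧ ε = true)) :
    con N (comm N h k) (loweringL N h k ν m ε u) (kM N h k μ v) s
      = (if μ = ν then ker h u v s 1 - ker h u v s 0 else 0)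
        + if μ = ν + 1 then ker h u v s (-1) - ker h u v s 0 else 0 := by
  have i1 : ν ≤ N := by omega
  have i2 : ν + 1 ≤ N := by omega
  cases ε <;>
  · simp only [loweringL, bSgn, sgn, con_sub_left, con_add_left, Pi.add_apply, Pi.sub_apply,
      con_bM_left, con_lower_left, con_bc_kM hh hs hm i1,
      con_bc_kM hh hs hm i2, con_bP_kM hh hs hm i1]
    try simp at hε
    rcases (by omega : μ = ν ∨ μ = ν + 1 ∨ μ < ν ∨ ν + 1 < μ) with h1 | h1 | h1 | h1 <;>
    rcases lt_trichotomy m μ with h2 | h2 | h2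
    all_goals subst_vars
    all_goals first
    | omega
    | simp (disch := omega) only [if_pos, if_neg, true_and, and_true, if_true]
      try simp only [firstDiff, secondDiff, stepDiff]
      push_cast
      ring_nf

theorem con_loweringR_kM (hh : 0 < h) (hs : 0 < s) {μ ν m : ℕ} {ε : Bool} (hμ : 1 ≤ μ) (hμN : μ ≤ N)
    (hν : 1 ≤ ν) (hm : ν < m) (hmN : m ≤ N) (hε : ¬(m = ν + 1 ∧ ε = false)) :
    con N (comm N h k) (loweringR N h k ν m ε u) (kM N h k μ v) s
      = (if μ = ν then ker h u v s 1 - ker h u v s 0 else 0)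
        + if μ = ν + 1 then ker h u v s (-1) - ker h u v s 0 else 0 := by
  have i1 : 1 ≤ ν + 1 := by omega
  have i2 : ν < N := by omega
  cases ε <;>
  · simp only [loweringR, bSgn, sgn, con_sub_left, con_add_left, Pi.add_apply, Pi.sub_apply,
      con_bM_left, con_bc_kM hh hs hν hmN,
      con_bc_kM hh hs i1 hmN, con_bP_kM hh hs i1 hmN, con_upper_kM hh hs hν i2 hμ hμN hm hmN rfl]
    try simp at hε
    rcases (by omega : μ = ν ∨ μ = ν + 1 ∨ μ < ν ∨ ν + 1 < μ) with h1 | h1 | h1 | h1 <;>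
    rcases lt_trichotomy m μ with h2 | h2 | h2
    all_goals subst_vars
    all_goals first
    | omega
    | simp (disch := omega) only [if_pos, if_neg, true_and, and_true, if_true]
      try simp only [firstDiff, secondDiff, stepDiff]
      push_cast
      ring_nf

theorem con_cartanPlus_kM (hh : 0 < h) (hs : 0 < s) {μ ν : ℕ} (hμ : 1 ≤ μ) (hμN : μ ≤ N)
    (hν : 1 ≤ ν) (hνN : ν < N) :
    con N (comm N h k) (cartanPlus N h k ν u) (kM N h k μ v) s
      = (if μ = ν then ker h u v s (k + 1) - ker h u v s k - ker h u v s 1 + ker h u v s 0 else 0)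
        + if μ = ν + 1 then
            ker h u v s (k - 1) - ker h u v s k + ker h u v s 0 - ker h u v s (-1) else 0 := by
  simp only [cartanPlus, con_add_left, Pi.add_apply,
    con_upper_kM hh hs hν hνN hμ hμN (Nat.lt_succ_self ν) hνN rfl,
    con_ladder_kM hh hs hνN (by omega : 1 ≤ ν + 1) le_rfl, stepDiff]
  rcases (by omega : μ = ν ∨ μ = ν + 1 ∨ μ < ν ∨ ν + 1 < μ) with h1 | h1 | h1 | h1
  all_goals
    subst_vars
    simp (disch := omega) only [if_pos, if_neg, true_and, and_true, if_true]
    push_cast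
    ring_nf

end cartan_tables

/-! ### Relations of the Cartan currents with `X^±` -/

section cartan_exchange

variable {N : ℕ} {h : ℝ} {k : ℂ}

theorem con_eq_zero_of_fst {H : Commutators} {X Y : Exponent} (hY : Y.1 = 0) (s : ℝ) :
    con N H X Y s = 0 := by
  rw [con, hY, pairAt_zero_left, Pi.zero_apply]

theorem con_eq_zero_of_snd {H : Commutators} {X Y : Exponent} (hX : X.2 = 0) (s : ℝ) :
    con N H X Y s = 0 := by
  rw [con, hX, shift_zero, pairAt_zero_right, Pi.zero_apply]

theorem normalExp_eq_current {H : Commutators} (K : ℂ → Exponent) :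
    (fun u => normalExp N H (K u)) = current N H {()} (fun _ => 1) fun _ => K := by
  funext u
  simp [current]

variable {ι : Type*} {T : Finset ι} {c : ι → ℂ} {Y : ι → ℂ → Exponent} {K : ℂ → Exponent} {a b : ℂ}

theorem exchange_of_fst_eq_zero (hN : 0 < N) (hh : 0 < h) (hK : IsVertex K) (hK1 : ∀ u, (K u).1 = 0)
    (hY : ∀ j ∈ T, IsVertex (Y j)) (hc : ∀ j ∈ T, ∀ u v s, 0 < s →
      con N (comm N h k) (K u) (Y j v) s = ker h u v s a - ker h u v s b) :
    Exchange (fockSpace N) (fockDual N h) (fun w => w + a * (I * h)) (fun w => w + b * (I * h))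
      (fun u => normalExp N (comm N h k) (K u)) (current N (comm N h k) T c Y) := by
  have e : (fun w : ℂ => w + b * (I * h)) = fun w => w - -b * (I * h) := by
    funext w
    ring
  rw [normalExp_eq_current, e]
  refine exchange_of_con (comm_regular hN hh) (fun ξ hξ => hξ.1) (fun _ _ => hK) hY (π := 0)
    (δ := fun _ _ => 0) (τ := fun _ _ => b) (fun _ _ j hj u v s hs => ?_) (fun _ _ j hj u v s hs => ?_)
    (by simp)
  · rw [hc j hj u v s hs, add_zero, sub_self, add_zero]
  · rw [con_eq_zero_of_fst (hK1 v), sub_self, neg_zero, sub_zero, sub_self, add_zero]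

theorem exchange_of_snd_eq_zero (hN : 0 < N) (hh : 0 < h) (hK : IsVertex K) (hK2 : ∀ u, (K u).2 = 0)
    (hY : ∀ j ∈ T, IsVertex (Y j)) (hc : ∀ j ∈ T, ∀ u v s, 0 < s →
      con N (comm N h k) (Y j u) (K v) s = ker h u v s a - ker h u v s b) :
    Exchange (fockSpace N) (fockDual N h) (fun w => w - b * (I * h)) (fun w => w - a * (I * h))
      (fun u => normalExp N (comm N h k) (K u)) (current N (comm N h k) T c Y) := by
  have e : (fun w : ℂ => w - b * (I * h)) = fun w => w + -b * (I * h) := by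
    funext w
    ring
  rw [normalExp_eq_current, e]
  refine exchange_of_con (comm_regular hN hh) (fun ξ hξ => hξ.1) (fun _ _ => hK) hY (π := 0)
    (δ := fun _ _ => 0) (τ := fun _ _ => -b) (fun _ _ j hj u v s hs => ?_) (fun _ _ j hj u v s hs => ?_)
    (by simp)
  · rw [con_eq_zero_of_snd (hK2 u), sub_self, add_zero, sub_self, add_zero]
  · rw [hc j hj u v s hs, neg_zero, sub_zero, sub_self, add_zero, neg_neg]

theorem exchange_normalExp_of_con_zero {K' : ℂ → Exponent} (hN : 0 < N) (hh : 0 < h)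
    (hK : IsVertex K) (hK' : IsVertex K')
    (h1 : ∀ u v s, con N (comm N h k) (K u) (K' v) s = 0)
    (h2 : ∀ u v s, con N (comm N h k) (K' u) (K v) s = 0) :
    Exchange (fockSpace N) (fockDual N h) (fun _ => 1) (fun _ => 1)
      (fun u => normalExp N (comm N h k) (K u)) (fun u => normalExp N (comm N h k) (K' u)) := by
  rw [normalExp_eq_current, normalExp_eq_current]
  exact exchange_one_of_con_zero (comm_regular hN hh) (fun ξ hξ => hξ.1) (fun _ _ => hK)
    (fun _ _ => hK') (fun _ _ _ _ u v s _ => h1 u v s) (fun _ _ _ _ u v s _ => h2 u v s)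

/-- The case of an annihilation field and a creation field. -/
theorem exchange_normalExp_of_con {K L : ℂ → Exponent} {a b c d : ℂ} (hN : 0 < N) (hh : 0 < h)
    (hK : IsVertex K) (hL : IsVertex L) (hK1 : ∀ u, (K u).1 = 0)
    (hc : ∀ u v s, 0 < s → con N (comm N h k) (K u) (L v) s
      = ker h u v s a - ker h u v s b + (ker h u v s c - ker h u v s d)) :
    Exchange (fockSpace N) (fockDual N h)
        (fun w => (w + a * (I * h)) * (w + c * (I * h))) (fun w => (w + b * (I * h)) * (w + d * (I * h)))
        (fun u => normalExp N (comm N h k) (K u)) (fun u => normalExp N (comm N h k) (L u)) ∧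
      Exchange (fockSpace N) (fockDual N h)
        (fun w => (w - b * (I * h)) * (w - d * (I * h))) (fun w => (w - a * (I * h)) * (w - c * (I * h)))
        (fun u => normalExp N (comm N h k) (L u)) (fun u => normalExp N (comm N h k) (K u)) := by
  have h1 : HasContraction N (comm N h k) K L _ := hasContraction_of_ker_add hc
  have h2 : HasContraction N (comm N h k) L K _ :=
    hasContraction_of_zero fun u v s _ => con_eq_zero_of_fst (hK1 v) s
  have h3 : ∀ᶠ w in imBot, (w + a * (I * h)) * (w + c * (I * h))
      * ((w + b * (I * h)) / (w + a * (I * h)) * ((w + d * (I * h)) / (w + c * (I * h))))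
      = (w + b * (I * h)) * (w + d * (I * h)) := by
    filter_upwards [eventually_imBot_ne (a * (I * h)), eventually_imBot_ne (c * (I * h))] with w h3 h4
    rw [div_mul_div_comm, mul_div_cancel₀ _ (mul_ne_zero h3 h4)]
  rw [normalExp_eq_current, normalExp_eq_current]
  constructor
  · exact exchange_of_entire (comm_regular hN hh) (fun ξ hξ => hξ.1) (fun _ _ => hK) (fun _ _ => hL)
      (fun _ _ _ _ => h1) (fun _ _ _ _ => h2)
      (n := fun _ _ w => (w + b * (I * h)) * (w + d * (I * h))) (fun _ _ _ _ => by fun_prop)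
      (fun _ _ _ _ => h3) (fun _ _ _ _ => .of_forall fun w => mul_one _)
  · refine exchange_of_entire (comm_regular hN hh) (fun ξ hξ => hξ.1) (fun _ _ => hL) (fun _ _ => hK)
      (fun _ _ _ _ => h2) (fun _ _ _ _ => h1)
      (n := fun _ _ w => (w - b * (I * h)) * (w - d * (I * h))) (fun _ _ _ _ => by fun_prop)
      (fun _ _ _ _ => .of_forall fun w => mul_one _) (fun _ _ _ _ => ?_)
    filter_upwards [h3] with w h3
    linear_combination h3

theorem con_kP_lowering (hh : 0 < h) {s : ℝ} (hs : 0 < s) {μ ν : ℕ} (hμ : 1 ≤ μ) (hμN : μ ≤ N)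
    (hν : 1 ≤ ν) (hνN : ν < N) {i : ℕ × Bool} (hi : i ∈ loweringSet N ν) (u v : ℂ) :
    con N (comm N h k) (kP N h k μ u) (lowering N h k ν i v) s
      = (if μ = ν then ker h u v s k - ker h u v s (k - 1) else 0)
        + if μ = ν + 1 then ker h u v s k - ker h u v s (k + 1) else 0 := by
  rw [mem_loweringSet] at hi
  rw [lowering]
  rcases le_or_gt i.1 ν with h1 | h1
  · rw [if_pos h1]
    exact con_kP_loweringL hh hs hμ hμN hνN hi.1 h1 hi.2.2.1
  · rw [if_neg h1.not_ge]
    exact con_kP_loweringR hh hs hμ hμN hν h1 hi.2.1 hi.2.2.2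

theorem con_lowering_kM (hh : 0 < h) {s : ℝ} (hs : 0 < s) {μ ν : ℕ} (hμ : 1 ≤ μ) (hμN : μ ≤ N)
    (hν : 1 ≤ ν) (hνN : ν < N) {i : ℕ × Bool} (hi : i ∈ loweringSet N ν) (u v : ℂ) :
    con N (comm N h k) (lowering N h k ν i u) (kM N h k μ v) s
      = (if μ = ν then ker h u v s 1 - ker h u v s 0 else 0)
        + if μ = ν + 1 then ker h u v s (-1) - ker h u v s 0 else 0 := by
  rw [mem_loweringSet] at hi
  rw [lowering]
  rcases le_or_gt i.1 ν with h1 | h1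
  · rw [if_pos h1]
    exact con_loweringL_kM hh hs hνN hi.1 h1 hi.2.2.1
  · rw [if_neg h1.not_ge]
    exact con_loweringR_kM hh hs hμ hμN hν h1 hi.2.1 hi.2.2.2

theorem kP_succ_sub (μ : ℕ) (hμ : 1 ≤ μ) (hμN : μ < N) (u : ℂ) :
    kP N h k (μ + 1) u - kP N h k μ u = cartanPlus N h k μ u := by
  have e1 : upper N h k 0 μ (μ + 1) u = lamRatio h μ (u + (0 + (k - N) / 4) * (I * h))
      + ∑ n ∈ Finset.Icc (μ + 1) N, bP h μ n (u + ((μ : ℂ) - n) / 2 * (I * h))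
      - ∑ n ∈ Finset.Icc (μ + 2) N, bP h (μ + 1) n (u + ((μ : ℂ) - n + 1) / 2 * (I * h)) := by
    rw [upper, Finset.sum_sub_distrib, ← Finset.insert_Icc_add_one_left_eq_Icc (show μ + 1 ≤ N from hμN),
      Finset.sum_insert (by simp), Finset.sum_insert (by simp), Finset.sum_insert (by simp), bP_self]
    simp only [zero_add]
    abel
  have e2 : ladder h μ (μ + 1) u
      = ∑ n ∈ Finset.Ico 1 (μ + 1), bP h n (μ + 1) (u + ((μ : ℂ) - n + 1) / 2 * (I * h))
        - ∑ n ∈ Finset.Ico 1 μ, bP h n μ (u + ((μ : ℂ) - n) / 2 * (I * h)) := by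
    rw [ladder, Finset.sum_sub_distrib, Finset.sum_Ico_succ_top hμ (fun n => bP h n μ _), bP_self,
      add_zero]
  rw [cartanPlus, e1, e2, kP, kP, lamRatio]
  have e3 : ∀ n : ℕ, ((μ + 1 : ℕ) : ℂ) - n = μ - n + 1 := fun n => by push_cast; ring
  simp only [e3]
  abel

theorem kM_succ_sub (μ : ℕ) (hμ : 1 ≤ μ) (hμN : μ < N) (u : ℂ) :
    kM N h k (μ + 1) u - kM N h k μ u = cartanMinus N h k μ u := by
  obtain ⟨A, hA⟩ : ∃ A : ℕ → ℕ → Exponent, A = fun m n => bM h m n (u + ((m : ℂ) + n) / 2 * (I * h)) :=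
    ⟨_, rfl⟩
  obtain ⟨B, hB⟩ : ∃ B : ℕ → ℕ → Exponent,
    B = fun m n => bM h m n (u + ((m : ℂ) + n - 2) / 2 * (I * h)) := ⟨_, rfl⟩
  have hA0 : ∀ m, A m m = 0 := fun m => by rw [hA]; exact bM_self ..
  have hB0 : ∀ m, B m m = 0 := fun m => by rw [hB]; exact bM_self ..
  have e0 : cartanMinus N h k μ u = lamM h μ (u + (0 - (k - N) / 4) * (I * h))
      - lamM h (μ + 1) (u + (0 - (k - N) / 4) * (I * h))
      + ∑ n ∈ Finset.Icc 1 μ, (B n (μ + 1) - A n μ)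
      + ∑ n ∈ Finset.Icc (μ + 1) N, (A μ n - B (μ + 1) n) := by
    have e1 : ∀ n : ℕ, (n : ℂ) + (μ + 1 : ℕ) - 2 = n + μ - 1 := fun n => by push_cast; ring
    have e2 : ∀ n : ℕ, ((μ + 1 : ℕ) : ℂ) + n - 2 = n + μ - 1 := fun n => by push_cast; ring
    simp only [cartanMinus, lower, hA, hB, e1, e2, add_comm (μ : ℂ)]
  have e1 : ∀ ν, kM N h k ν u = -lamM h ν (u + (0 - (k - N) / 4) * (I * h))
      + ∑ m ∈ Finset.Ico 1 ν, ∑ n ∈ Finset.Icc ν N, A m n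
      - ∑ m ∈ Finset.Icc 1 ν, ∑ n ∈ Finset.Icc (ν + 1) N, B m n := by
    intro ν
    rw [kM, hA, hB]
  have e2 : ∀ f : ℕ → Exponent, ∑ n ∈ Finset.Icc μ N, f n = f μ + ∑ n ∈ Finset.Icc (μ + 1) N, f n :=
    fun f => by rw [← Finset.insert_Icc_add_one_left_eq_Icc hμN.le, Finset.sum_insert (by simp)]
  have e3 : ∀ f : ℕ → Exponent, ∑ n ∈ Finset.Icc (μ + 1) N, f n
      = f (μ + 1) + ∑ n ∈ Finset.Icc (μ + 1 + 1) N, f n :=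
    fun f => by
      rw [← Finset.insert_Icc_add_one_left_eq_Icc (show μ + 1 ≤ N from hμN), Finset.sum_insert (by simp)]
  have e4 : ∀ f : ℕ → Exponent, ∑ n ∈ Finset.Icc 1 (μ + 1), f n = ∑ n ∈ Finset.Icc 1 μ, f n + f (μ + 1) :=
    fun f => Finset.sum_Icc_succ_top (by omega) f
  have e5 : ∀ f : ℕ → Exponent, ∑ n ∈ Finset.Icc 1 μ, f n = ∑ n ∈ Finset.Ico 1 μ, f n + f μ :=
    fun f => Finset.sum_Ico_succ_top hμ f
  have e6 : Finset.Ico 1 (μ + 1) = Finset.Icc 1 μ := rfl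
  rw [e0, e1, e1, e6]
  simp only [e4, e2, Finset.sum_sub_distrib, Finset.sum_add_distrib]
  rw [e3 (fun n => B (μ + 1) n), hB0, zero_add, Finset.sum_congr (g := fun m =>
    B m (μ + 1) + ∑ n ∈ Finset.Icc (μ + 1 + 1) N, B m n) (s₁ := Finset.Icc 1 μ) rfl fun m _ => e3 (B m)]
  simp only [Finset.sum_add_distrib]
  rw [e5 fun m => ∑ n ∈ Finset.Icc (μ + 1) N, A m n, e5 fun m => A m μ, hA0]
  abel

end cartan_exchange

/-! ### The relations of `DY_η(gl_N)` -/

section gl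

variable {N : ℕ} {h : ℝ} {k : ℂ}

theorem Exchange.congr {Fo : Set State} {Du : Set Profile} {P Q P' Q' : ℂ → ℂ} {A B : ℂ → Op}
    (hAB : Exchange Fo Du P Q A B) (hP : ∀ w, P' w = P w) (hQ : ∀ w, Q' w = Q w) :
    Exchange Fo Du P' Q' A B := by
  rwa [funext hP, funext hQ]

theorem DeltaCommutator.congr {Fo : Set State} {Du : Set Profile} {κ a : ℂ} {A B Z W Z' W' : ℂ → Op}
    (hAB : DeltaCommutator Fo Du κ a A B Z W) (hZ : ∀ u, ∀ Φ, ∀ ξ ∈ Du, Z' u Φ ξ = Z u Φ ξ)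
    (hW : ∀ u, ∀ Φ, ∀ ξ ∈ Du, W' u Φ ξ = W u Φ ξ) : DeltaCommutator Fo Du κ a A B Z' W' := by
  obtain ⟨C, hC⟩ := hAB
  refine ⟨C, fun Φ hΦ ξ hξ v => ?_⟩
  obtain ⟨G, hG, h1, h2⟩ := hC Φ hΦ ξ hξ v
  exact ⟨G, hG, fun u hu => by rw [h1 u hu, hZ u Φ ξ hξ, hW v Φ ξ hξ],
    fun u hu => by rw [h2 u hu, hZ u Φ ξ hξ, hW v Φ ξ hξ]⟩

theorem kPlus_eq_normalExp (μ : ℕ) :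
    kPlus N h k μ = fun u => normalExp N (comm N h k) (kP N h k μ u) := funext (kPlus_eq μ)

theorem kMinus_eq_normalExp (μ : ℕ) :
    kMinus N h k μ = fun u => normalExp N (comm N h k) (kM N h k μ u) := funext (kMinus_eq μ)

theorem normalExp_mul_normalExp_neg {H : Commutators} {X : Exponent} (hX : X.1 = 0 ∨ X.2 = 0) :
    normalExp N H X * normalExp N H (-X) = 1 := by
  ext Φ ξ
  rw [Module.End.mul_apply, normalExp_apply, normalExp_apply, Prod.fst_neg, Prod.snd_neg, shift_neg,
    pairing_neg_left, add_neg_cancel_right, Module.End.one_apply, ← mul_assoc, ← exp_add]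
  rcases hX with hX | hX
  · rw [hX, pairing_zero_left, pairing_zero_left, neg_zero, add_zero, exp_zero, one_mul]
  · rw [hX, shift_zero, add_zero, add_neg_cancel, exp_zero, one_mul]

theorem inverse_normalExp {H : Commutators} {X : Exponent} (hX : X.1 = 0 ∨ X.2 = 0) :
    IsUnit (normalExp N H X) ∧ Ring.inverse (normalExp N H X) = normalExp N H (-X) := by
  have h2 : normalExp N H (-X) * normalExp N H X = 1 := by
    have := normalExp_mul_normalExp_neg (N := N) (H := H) (X := -X)
      (by rcases hX with hX | hX <;> simp [hX])
    rwa [neg_neg] at this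
  let U : Opˣ := ⟨_, _, normalExp_mul_normalExp_neg hX, h2⟩
  exact ⟨⟨U, rfl⟩, Ring.inverse_unit U⟩

theorem normalExp_mul_of_con_eq_zero {H : Commutators} (hH : H.Regular) {X Y : ℂ → Exponent}
    (hX : IsVertex X) (hY : IsVertex Y) {u v : ℂ} (hc : ∀ s, con N H (X u) (Y v) s = 0) (Φ : State)
    {ξ : Profile} (hξ : ∀ m, IsSmearing (ξ m)) :
    normalExp N H (X u) (normalExp N H (Y v) Φ) ξ = normalExp N H (X u + Y v) Φ ξ := by
  have h0 : con N H (X u) (Y v) = fun _ => 0 := funext hc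
  rw [normalExp_mul_of_integrable hH hX hY (by rw [h0]; exact integrableOn_zero) Φ hξ, h0]
  simp

theorem kPlus_mul_inverse (hN : 0 < N) (hh : 0 < h) {μ : ℕ} (hμ : 1 ≤ μ) (hμN : μ < N) (u : ℂ)
    (Φ : State) {ξ : Profile} (hξ : ∀ m, IsSmearing (ξ m)) :
    (kPlus N h k (μ + 1) u * Ring.inverse (kPlus N h k μ u)) Φ ξ
      = normalExp N (comm N h k) (cartanPlus N h k μ u) Φ ξ := by
  rw [kPlus_eq, kPlus_eq, (inverse_normalExp (.inl (kP_fst μ u))).2, Module.End.mul_apply,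
    normalExp_mul_of_con_eq_zero (Y := fun u => -kP N h k μ u) (comm_regular hN hh) (isVertex_kP _)
      (isVertex_kP μ).neg (con_eq_zero_of_fst (by rw [Prod.fst_neg, kP_fst, neg_zero])) Φ hξ,
    ← sub_eq_add_neg, kP_succ_sub μ hμ hμN]

theorem kMinus_mul_inverse (hN : 0 < N) (hh : 0 < h) {μ : ℕ} (hμ : 1 ≤ μ) (hμN : μ < N) (u : ℂ)
    (Φ : State) {ξ : Profile} (hξ : ∀ m, IsSmearing (ξ m)) :
    (kMinus N h k (μ + 1) u * Ring.inverse (kMinus N h k μ u)) Φ ξ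
      = normalExp N (comm N h k) (cartanMinus N h k μ u) Φ ξ := by
  rw [kMinus_eq, kMinus_eq, (inverse_normalExp (.inr (kM_snd μ u))).2, Module.End.mul_apply,
    normalExp_mul_of_con_eq_zero (Y := fun u => -kM N h k μ u) (comm_regular hN hh) (isVertex_kM _)
      (isVertex_kM μ).neg (con_eq_zero_of_snd (kM_snd _ _)) Φ hξ,
    ← sub_eq_add_neg, kM_succ_sub μ hμ hμN]

theorem XMinus_XMinus_far (hh : 0 < h) {μ ν : ℕ} (hμ : 1 ≤ μ) (hμN : μ < N) (hν : 1 ≤ ν) (hνN : ν < N)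
    (hμν : ν + 2 ≤ μ ∨ μ + 2 ≤ ν) :
    Exchange (fockSpace N) (fockDual N h) (fun _ => 1) (fun _ => 1)
      (XMinus N h k μ) (XMinus N h k ν) := by
  rcases hμν with h5 | h5
  · exact XMinus_XMinus_of_lt hh hν hμN h5
  · exact XMinus_XMinus_of_gt hh hμ hνN h5

theorem XPlus_XMinus_ne (hh : 0 < h) {μ ν : ℕ} (hμ : 1 ≤ μ) (hμN : μ < N) (hν : 1 ≤ ν) (hνN : ν < N)
    (hμν : μ ≠ ν) :
    Exchange (fockSpace N) (fockDual N h) (fun _ => 1) (fun _ => 1)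
      (XPlus N h k μ) (XMinus N h k ν) := by
  rcases lt_trichotomy (μ + 1) ν with h6 | h6 | h6
  · exact XPlus_XMinus_far hh hμ hνN h6
  · subst h6
    exact XPlus_XMinus_succ hh hμ hνN
  · exact XPlus_XMinus_of_lt hh hν hμN (by omega)

/-- The relations of `DY_η(gl_N)` other than the one between `k^+` and `k^-`. -/
theorem isYangianDoubleGL (hN : 2 ≤ N) (hh : 0 < h)
    (hkk : ∀ μ ν, 1 ≤ μ → μ ≤ N → 1 ≤ ν → ν ≤ N → ExchangeMero (fockSpace N) (fockDual N h)
      (fun w => rho N (-I * h) (w - k * (-I * h)) * ratFactor (-I * h) μ ν (w - k * (-I * h)))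
      (fun w => ratFactor (-I * h) μ ν w * rho N (-I * h) w) (kPlus N h k μ) (kMinus N h k ν)) :
    IsYangianDoubleGL N (-I * h) k (fockSpace N) (fockDual N h) (kPlus N h k) (kMinus N h k)
      (fun ν u => (1 / (-I * h)) • XPlus N h k ν u) (XMinus N h k) := by
  have hN' : 0 < N := by omega
  have hp : ∀ {K : ℂ → Op} {P Q : ℂ → ℂ} {μ : ℕ},
      Exchange (fockSpace N) (fockDual N h) P Q K (XPlus N h k μ) →
      Exchange (fockSpace N) (fockDual N h) P Q K (fun u => (1 / (-I * h)) • XPlus N h k μ u) :=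
    fun hK => by simpa only [one_smul] using hK.smul 1 (1 / (-I * h))
  refine ⟨fun μ u _ _ => ?_, fun μ u _ _ => ?_, fun μ ν _ _ _ _ => ?_, fun μ ν _ _ _ _ => ?_, hkk,
    fun μ h1 h2 => hp ?_, fun μ h1 h2 => hp ?_, fun μ h1 h2 => hp ?_, fun μ h1 h2 => hp ?_,
    fun μ h1 h2 => ?_, fun μ h1 h2 => ?_, fun μ h1 h2 => ?_, fun μ h1 h2 => ?_,
    fun μ ν h1 h2 h3 h4 h5 => ⟨hp ?_, hp ?_, ?_, ?_⟩, fun μ h1 h2 => ?_, fun μ h1 h2 => ?_,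
    fun μ h1 h2 => ?_, fun μ h1 h2 => ?_, fun μ ν h1 h2 h3 h4 h5 => ⟨?_, ?_⟩,
    fun μ ν h1 h2 h3 h4 h5 => ⟨?_, ?_⟩, fun μ ν h1 h2 h3 h4 h5 => ?_, fun μ h1 h2 => ?_⟩
  · rw [kPlus_eq]
    exact (inverse_normalExp (.inl (kP_fst μ u))).1
  · rw [kMinus_eq]
    exact (inverse_normalExp (.inr (kM_snd μ u))).1
  · rw [kPlus_eq_normalExp, kPlus_eq_normalExp]
    exact exchange_normalExp_of_con_zero hN' hh (isVertex_kP μ) (isVertex_kP ν)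
      (fun _ _ => con_eq_zero_of_fst (kP_fst _ _)) fun _ _ => con_eq_zero_of_fst (kP_fst _ _)
  · rw [kMinus_eq_normalExp, kMinus_eq_normalExp]
    exact exchange_normalExp_of_con_zero hN' hh (isVertex_kM μ) (isVertex_kM ν)
      (fun _ _ => con_eq_zero_of_snd (kM_snd _ _)) fun _ _ => con_eq_zero_of_snd (kM_snd _ _)
  · rw [kPlus_eq_normalExp, XPlus_eq_current]
    refine (exchange_of_fst_eq_zero (a := -1) (b := 0) hN' hh (isVertex_kP μ) (kP_fst μ)
      (fun j _ => isVertex_raising hh μ j.1 j.2) fun j hj u v s hs => ?_).congr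
      (fun w => by ring) fun w => by ring
    rw [mem_raisingSet] at hj
    rw [con_kP_raising hh hs h1 h2.le h2 hj.1 hj.2, if_pos rfl, if_neg (by omega), add_zero]
  · rw [kMinus_eq_normalExp, XPlus_eq_current]
    refine (exchange_of_snd_eq_zero (a := 0) (b := 1) hN' hh (isVertex_kM μ) (kM_snd μ)
      (fun j _ => isVertex_raising hh μ j.1 j.2) fun j hj u v s hs => ?_).congr
      (fun w => by ring) fun w => by ring
    rw [mem_raisingSet] at hj
    rw [con_raising_kM hh hs h2 hj.1 hj.2, if_pos rfl, if_neg (by omega), add_zero]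
  · rw [kPlus_eq_normalExp, XPlus_eq_current]
    refine (exchange_of_fst_eq_zero (a := 1) (b := 0) hN' hh (isVertex_kP _) (kP_fst _)
      (fun j _ => isVertex_raising hh μ j.1 j.2) fun j hj u v s hs => ?_).congr
      (fun w => by ring) fun w => by ring
    rw [mem_raisingSet] at hj
    rw [con_kP_raising hh hs (by omega) h2 h2 hj.1 hj.2, if_pos rfl, if_neg (by omega), zero_add]
  · rw [kMinus_eq_normalExp, XPlus_eq_current]
    refine (exchange_of_snd_eq_zero (a := 0) (b := -1) hN' hh (isVertex_kM _) (kM_snd _)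
      (fun j _ => isVertex_raising hh μ j.1 j.2) fun j hj u v s hs => ?_).congr
      (fun w => by ring) fun w => by ring
    rw [mem_raisingSet] at hj
    rw [con_raising_kM hh hs h2 hj.1 hj.2, if_pos rfl, if_neg (by omega), zero_add]
  · rw [kMinus_eq_normalExp, XMinus_eq_current h2.le]
    refine (exchange_of_snd_eq_zero (a := 1) (b := 0) hN' hh (isVertex_kM μ) (kM_snd μ)
      (fun j _ => isVertex_lowering hh μ j) fun j hj u v s hs => ?_).congr
      (fun w => by ring) fun w => by ring
    rw [con_lowering_kM hh hs h1 h2.le h1 h2 hj, if_pos rfl, if_neg (by omega), add_zero]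
  · rw [kMinus_eq_normalExp, XMinus_eq_current h2.le]
    refine (exchange_of_snd_eq_zero (a := -1) (b := 0) hN' hh (isVertex_kM _) (kM_snd _)
      (fun j _ => isVertex_lowering hh μ j) fun j hj u v s hs => ?_).congr
      (fun w => by ring) fun w => by ring
    rw [con_lowering_kM hh hs (by omega) h2 h1 h2 hj, if_pos rfl, if_neg (by omega), zero_add]
  · rw [kPlus_eq_normalExp, XMinus_eq_current h2.le]
    refine (exchange_of_fst_eq_zero (a := k) (b := k - 1) hN' hh (isVertex_kP μ) (kP_fst μ)
      (fun j _ => isVertex_lowering hh μ j) fun j hj u v s hs => ?_).congr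
      (fun w => by ring) fun w => by ring
    rw [con_kP_lowering hh hs h1 h2.le h1 h2 hj, if_pos rfl, if_neg (by omega), add_zero]
  · rw [kPlus_eq_normalExp, XMinus_eq_current h2.le]
    refine (exchange_of_fst_eq_zero (a := k) (b := k + 1) hN' hh (isVertex_kP _) (kP_fst _)
      (fun j _ => isVertex_lowering hh μ j) fun j hj u v s hs => ?_).congr
      (fun w => by ring) fun w => by ring
    rw [con_kP_lowering hh hs (by omega) h2 h1 h2 hj, if_pos rfl, if_neg (by omega), zero_add]
  · rw [kPlus_eq_normalExp, XPlus_eq_current, normalExp_eq_current]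
    refine exchange_one_of_con_zero (comm_regular hN' hh) (fun ξ hξ => hξ.1) (fun _ _ => isVertex_kP μ)
      (fun j _ => isVertex_raising hh ν j.1 j.2) (fun _ _ j hj u v s hs => ?_)
      fun _ _ j hj u v s hs => con_eq_zero_of_fst (kP_fst _ _) s
    rw [mem_raisingSet] at hj
    rw [con_kP_raising hh hs h1 h2 h4 hj.1 hj.2, if_neg (by omega), if_neg (by omega), zero_add]
  · rw [kMinus_eq_normalExp, XPlus_eq_current, normalExp_eq_current]
    refine exchange_one_of_con_zero (comm_regular hN' hh) (fun ξ hξ => hξ.1) (fun _ _ => isVertex_kM μ)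
      (fun j _ => isVertex_raising hh ν j.1 j.2)
      (fun _ _ j hj u v s hs => con_eq_zero_of_snd (kM_snd _ _) s) fun _ _ j hj u v s hs => ?_
    rw [mem_raisingSet] at hj
    rw [con_raising_kM hh hs h4 hj.1 hj.2, if_neg (by omega), if_neg (by omega), zero_add]
  · rw [kPlus_eq_normalExp, XMinus_eq_current h4.le, normalExp_eq_current]
    refine exchange_one_of_con_zero (comm_regular hN' hh) (fun ξ hξ => hξ.1) (fun _ _ => isVertex_kP μ)
      (fun j _ => isVertex_lowering hh ν j) (fun _ _ j hj u v s hs => ?_)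
      fun _ _ j hj u v s hs => con_eq_zero_of_fst (kP_fst _ _) s
    rw [con_kP_lowering hh hs h1 h2 h3 h4 hj, if_neg (by omega), if_neg (by omega), zero_add]
  · rw [kMinus_eq_normalExp, XMinus_eq_current h4.le, normalExp_eq_current]
    refine exchange_one_of_con_zero (comm_regular hN' hh) (fun ξ hξ => hξ.1) (fun _ _ => isVertex_kM μ)
      (fun j _ => isVertex_lowering hh ν j)
      (fun _ _ j hj u v s hs => con_eq_zero_of_snd (kM_snd _ _) s) fun _ _ j hj u v s hs => ?_
    rw [con_lowering_kM hh hs h1 h2 h3 h4 hj, if_neg (by omega), if_neg (by omega), zero_add]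
  · exact ((XPlus_XPlus_self hN' hh h2).smul _ _).congr (fun w => by ring) fun w => by ring
  · exact (XMinus_XMinus_self hN' hh h1 h2).congr (fun w => by ring) fun w => by ring
  · exact ((XPlus_XPlus_succ hN' hh h2).smul _ _).congr (fun w => by ring) fun w => by ring
  · exact (XMinus_XMinus_succ hh h1 h2).congr (fun w => by ring) fun w => by ring
  · simpa only [add_zero] using (XPlus_serre hN' hh h2 h4 h5).rescale _ _ 0 0
  · exact XMinus_serre hh h1 h3 h2 h4 h5
  · exact (XPlus_XPlus_far hN' hh h2 h4 (by omega)).smul _ _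
  · exact XMinus_XMinus_far hh h1 h2 h3 h4 h5
  · simpa only [one_smul] using (XPlus_XMinus_ne hh h1 h2 h3 h4 h5).smul (1 / (-I * h)) 1
  · have e : k * (-I * h) = -k * (I * h) := by ring
    have hI : I * (h : ℂ) ≠ 0 := mul_ne_zero I_ne_zero (ofReal_ne_zero.2 hh.ne')
    have h3 := (XPlus_XMinus_self (k := k) hh h1 h2).rescale (1 / (-I * h)) 1 0 1
      (by rw [neg_mul, mul_one, neg_one_mul, one_div_mul_cancel (neg_ne_zero.2 hI)]) (fun _ => rfl)
      fun _ => rfl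
    simp only [add_zero, one_smul] at h3
    rw [e]
    exact h3.congr (fun u Φ ξ hξ => kPlus_mul_inverse hN' hh h1 h2 u Φ hξ.1)
      fun u Φ ξ hξ => kMinus_mul_inverse hN' hh h1 h2 u Φ hξ.1

end gl

/-! ### The relations of `DY_η(sl_N)` -/

section sl

variable {N : ℕ} {h : ℝ} {k : ℂ} {s : ℝ} {u v : ℂ} {μ ν : ℕ}

theorem halfCartan_cases (μ ν : ℕ) : (μ = ν ∧ halfCartan μ ν = 1)
    ∨ (μ = ν + 1 ∧ halfCartan μ ν = -1 / 2) ∨ (ν = μ + 1 ∧ halfCartan μ ν = -1 / 2)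
    ∨ ((μ + 1 < ν ∨ ν + 1 < μ) ∧ halfCartan μ ν = 0) := by
  unfold halfCartan
  split_ifs <;> simp <;> omega

theorem con_cartanPlus_raising (hh : 0 < h) (hs : 0 < s) {m : ℕ} {ε : Bool} (hμ : 1 ≤ μ) (hμN : μ < N)
    (hνN : ν < N) (hm : 1 ≤ m) (hmν : m ≤ ν) :
    con N (comm N h k) (cartanPlus N h k μ u) (raising h ν m ε v) s
      = ker h u v s (halfCartan μ ν + ((μ : ℂ) - ν) / 2)
        - ker h u v s (-halfCartan μ ν + ((μ : ℂ) - ν) / 2) := by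
  rw [← kP_succ_sub μ hμ hμN, con_sub_left, Pi.sub_apply,
    con_kP_raising hh hs (by omega) (show μ + 1 ≤ N from hμN) hνN hm hmν,
    con_kP_raising hh hs hμ hμN.le hνN hm hmν]
  rcases halfCartan_cases μ ν with ⟨rfl, e⟩ | ⟨rfl, e⟩ | ⟨rfl, e⟩ | ⟨h, e⟩ <;>
  · simp (disch := omega) only [if_pos, if_neg, true_and, if_true, e]
    push_cast
    ring_nf

theorem con_cartanPlus_lowering (hh : 0 < h) (hs : 0 < s) (hμ : 1 ≤ μ) (hμN : μ < N)
    (hν : 1 ≤ ν) (hνN : ν < N) {i : ℕ × Bool} (hi : i ∈ loweringSet N ν) :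
    con N (comm N h k) (cartanPlus N h k μ u) (lowering N h k ν i v) s
      = ker h u v s (k - halfCartan μ ν + ((μ : ℂ) - ν) / 2)
        - ker h u v s (k + halfCartan μ ν + ((μ : ℂ) - ν) / 2) := by
  rw [← kP_succ_sub μ hμ hμN, con_sub_left, Pi.sub_apply,
    con_kP_lowering hh hs (by omega) (show μ + 1 ≤ N from hμN) hν hνN hi,
    con_kP_lowering hh hs hμ hμN.le hν hνN hi]
  rcases halfCartan_cases μ ν with ⟨rfl, e⟩ | ⟨rfl, e⟩ | ⟨rfl, e⟩ | ⟨h, e⟩ <;>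
  · simp (disch := omega) only [if_pos, if_neg, true_and, if_true, e]
    push_cast
    ring_nf

theorem con_raising_cartanMinus (hh : 0 < h) (hs : 0 < s) {m : ℕ} {ε : Bool} (hμ : 1 ≤ μ) (hμN : μ < N)
    (hνN : ν < N) (hm : 1 ≤ m) (hmν : m ≤ ν) :
    con N (comm N h k) (raising h ν m ε u) (cartanMinus N h k μ v) s
      = ker h u v s (halfCartan μ ν - ((μ : ℂ) - ν) / 2)
        - ker h u v s (-halfCartan μ ν - ((μ : ℂ) - ν) / 2) := by
  rw [← kM_succ_sub μ hμ hμN, con_sub_right, Pi.sub_apply, con_raising_kM hh hs hνN hm hmν,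
    con_raising_kM hh hs hνN hm hmν]
  rcases halfCartan_cases μ ν with ⟨rfl, e⟩ | ⟨rfl, e⟩ | ⟨rfl, e⟩ | ⟨h, e⟩ <;>
  · simp (disch := omega) only [if_pos, if_neg, true_and, if_true, e]
    push_cast
    ring_nf

theorem con_lowering_cartanMinus (hh : 0 < h) (hs : 0 < s) (hμ : 1 ≤ μ) (hμN : μ < N)
    (hν : 1 ≤ ν) (hνN : ν < N) {i : ℕ × Bool} (hi : i ∈ loweringSet N ν) :
    con N (comm N h k) (lowering N h k ν i u) (cartanMinus N h k μ v) s
      = ker h u v s (-halfCartan μ ν - ((μ : ℂ) - ν) / 2)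
        - ker h u v s (halfCartan μ ν - ((μ : ℂ) - ν) / 2) := by
  rw [← kM_succ_sub μ hμ hμN, con_sub_right, Pi.sub_apply,
    con_lowering_kM hh hs (by omega) (show μ + 1 ≤ N from hμN) hν hνN hi,
    con_lowering_kM hh hs hμ hμN.le hν hνN hi]
  rcases halfCartan_cases μ ν with ⟨rfl, e⟩ | ⟨rfl, e⟩ | ⟨rfl, e⟩ | ⟨h, e⟩ <;>
  · simp (disch := omega) only [if_pos, if_neg, true_and, if_true, e]
    push_cast
    ring_nf

theorem con_cartanPlus_cartanMinus (hh : 0 < h) (hs : 0 < s) (hμ : 1 ≤ μ) (hμN : μ < N)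
    (hν : 1 ≤ ν) (hνN : ν < N) :
    con N (comm N h k) (cartanPlus N h k μ u) (cartanMinus N h k ν v) s
      = ker h u v s (k - halfCartan μ ν + ((μ : ℂ) - ν) / 2)
          - ker h u v s (k + halfCartan μ ν + ((μ : ℂ) - ν) / 2)
        + (ker h u v s (halfCartan μ ν + ((μ : ℂ) - ν) / 2)
          - ker h u v s (-halfCartan μ ν + ((μ : ℂ) - ν) / 2)) := by
  rw [← kM_succ_sub ν hν hνN, con_sub_right, Pi.sub_apply,
    con_cartanPlus_kM hh hs (by omega) (show ν + 1 ≤ N from hνN) hμ hμN,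
    con_cartanPlus_kM hh hs hν hνN.le hμ hμN]
  rcases halfCartan_cases μ ν with ⟨rfl, e⟩ | ⟨rfl, e⟩ | ⟨rfl, e⟩ | ⟨h, e⟩ <;>
  · simp (disch := omega) only [if_pos, if_neg, true_and, if_true, e]
    push_cast
    ring_nf

theorem cartanPlus_fst (μ : ℕ) (u : ℂ) : (cartanPlus N h k μ u).1 = 0 := by
  simp [cartanPlus, upper, ladder, lamRatio, lamP, bP, Prod.fst_sum]

theorem cartanMinus_snd (μ : ℕ) (u : ℂ) : (cartanMinus N h k μ u).2 = 0 := by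
  simp [cartanMinus, lower, lamM, bM, Prod.snd_sum]

/-- The shift between the currents of the two presentations. -/
def slShift (h : ℝ) (μ : ℕ) : ℂ := -((μ : ℂ) / 2) * (I * h)

theorem HPlus_eq (μ : ℕ) :
    HPlus N h k μ = fun u => normalExp N (comm N h k) (cartanPlus N h k μ (u + slShift h μ)) := by
  funext u
  have e1 : u + slShift h μ + (0 + (k - N) / 4) * (I * h)
      = u + (k - N) / 4 * (I * h) - (μ : ℂ) / 2 * (I * h) := by rw [slShift]; ring
  have e2 : ∀ n : ℂ, u + slShift h μ + ((μ : ℂ) - n + 1) / 2 * (I * h) = u - (n - 1) / 2 * (I * h) :=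
    fun n => by rw [slShift]; ring
  have e3 : ∀ n : ℂ, u + slShift h μ + ((μ : ℂ) - n) / 2 * (I * h) = u - n / 2 * (I * h) :=
    fun n => by rw [slShift]; ring
  rw [HPlus, cartanPlus, upper, ladder, lamRatio]
  simp only [zero_add] at e1 ⊢
  simp only [e1, e2, e3]
  rw [add_right_comm]
  rfl

theorem HMinus_eq (μ : ℕ) :
    HMinus N h k μ = fun u => normalExp N (comm N h k) (cartanMinus N h k μ (u + slShift h μ)) := by
  funext u
  have e1 : u + slShift h μ + (0 - (k - N) / 4) * (I * h)
      = u - (k - N) / 4 * (I * h) - (μ : ℂ) / 2 * (I * h) := by rw [slShift]; ring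
  have e2 : ∀ n : ℂ, u + slShift h μ + (n + μ - 1) / 2 * (I * h) = u + (n - 1) / 2 * (I * h) :=
    fun n => by rw [slShift]; ring
  have e3 : ∀ n : ℂ, u + slShift h μ + (n + μ) / 2 * (I * h) = u + n / 2 * (I * h) :=
    fun n => by rw [slShift]; ring
  rw [HMinus, cartanMinus, lower]
  simp only [e1, e2, e3]

theorem ECur_eq (μ : ℕ) : (fun u => I • ECur N h k μ u)
    = fun u => (I * (1 / h)) • XPlus N h k μ (u + slShift h μ) := by
  funext u
  have e : u + -((μ : ℂ) / 2) * (I * h) + μ / 2 * (I * h) = u := by ring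
  rw [ECur, XPlus, slShift, e, smul_smul]

theorem FCur_eq (μ : ℕ) : (fun u => I • FCur N h k μ u)
    = fun u => (I * (1 / h)) • XMinus N h k μ (u + slShift h μ) := by
  funext u
  have e : u + -((μ : ℂ) / 2) * (I * h) + μ / 2 * (I * h) = u := by ring
  rw [FCur, XMinus, slShift, e, smul_smul]

theorem Exchange.slShift {Fo : Set State} {Du : Set Profile} {P Q P' Q' : ℂ → ℂ} {A B : ℂ → Op}
    (hAB : Exchange Fo Du P Q A B)
    (hP : ∀ w, P' w = P (w + -(((μ : ℂ) - ν) / 2) * (I * h)))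
    (hQ : ∀ w, Q' w = Q (w + -(((μ : ℂ) - ν) / 2) * (I * h))) :
    Exchange Fo Du P' Q' (fun u => A (u + BosonYangian.slShift h μ))
      fun v => B (v + BosonYangian.slShift h ν) := by
  have e : ∀ w, w + -(((μ : ℂ) - ν) / 2) * (I * h)
      = w + BosonYangian.slShift h μ - BosonYangian.slShift h ν := fun w => by
    simp only [BosonYangian.slShift]; ring
  simp only [e] at hP hQ
  exact hAB.comp_add _ _ hP hQ

/-- The relations of `DY_η(sl_N)` other than those of `K^±`. -/
theorem isYangianDoubleSL (hN : 2 ≤ N) (hh : 0 < h) {KP KM : ℂ → Op}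
    (hK : Exchange (fockSpace N) (fockDual N h) (fun _ => 1) (fun _ => 1) KP KP ∧
      Exchange (fockSpace N) (fockDual N h) (fun _ => 1) (fun _ => 1) KM KM ∧
      Exchange (fockSpace N) (fockDual N h) (fun _ => 1) (fun _ => 1) KP KM)
    (hK' : ∀ K : ℂ → Op, (K = KP ∨ K = KM) → ∀ μ, 1 ≤ μ → μ < N →
      Exchange (fockSpace N) (fockDual N h) (fun _ => 1) (fun _ => 1) K (HPlus N h k μ) ∧
      Exchange (fockSpace N) (fockDual N h) (fun _ => 1) (fun _ => 1) K (HMinus N h k μ) ∧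
      Exchange (fockSpace N) (fockDual N h) (fun _ => 1) (fun _ => 1) K
        (fun u => I • ECur N h k μ u) ∧
      Exchange (fockSpace N) (fockDual N h) (fun _ => 1) (fun _ => 1) K
        (fun u => I • FCur N h k μ u)) :
    IsYangianDoubleSL N (-I * h) k (fockSpace N) (fockDual N h) (HPlus N h k) (HMinus N h k)
      (fun μ u => I • ECur N h k μ u) (fun μ u => I • FCur N h k μ u) KP KM := by
  have hN' : 0 < N := by omega
  have hp : ∀ {K A : ℂ → Op} {P Q : ℂ → ℂ} (c : ℂ),
      Exchange (fockSpace N) (fockDual N h) P Q K A →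
      Exchange (fockSpace N) (fockDual N h) P Q K (fun u => c • A u) :=
    fun c hK => by simpa only [one_smul] using hK.smul 1 c
  refine ⟨fun μ ν h1 h2 h3 h4 => ?_, fun μ ν h1 h2 h3 h4 => ?_, fun μ ν h1 h2 h3 h4 => ?_,
    fun μ ν h1 h2 h3 h4 => ?_, fun μ ν h1 h2 h3 h4 => ?_, fun μ ν h1 h2 h3 h4 => ?_,
    fun μ ν h1 h2 h3 h4 => ?_, fun μ ν h1 h2 h3 h4 => ?_, fun μ ν h1 h2 h3 h4 => ?_,
    fun μ ν h1 h2 h3 h4 => ?_, fun μ ν h1 h2 h3 h4 h5 => ?_, fun μ h1 h2 => ?_,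
    fun μ ν h1 h2 h3 h4 h5 => ?_, fun μ ν h1 h2 h3 h4 h5 => ?_, hK, hK'⟩ <;>
    try simp only [ECur_eq, FCur_eq]
  · rw [HPlus_eq, HPlus_eq ν]
    exact (exchange_normalExp_of_con_zero hN' hh (isVertex_cartanPlus μ) (isVertex_cartanPlus ν)
      (fun _ _ => con_eq_zero_of_fst (cartanPlus_fst _ _))
      fun _ _ => con_eq_zero_of_fst (cartanPlus_fst _ _)).slShift (fun _ => rfl) fun _ => rfl
  · rw [HMinus_eq, HMinus_eq ν]
    exact (exchange_normalExp_of_con_zero hN' hh (isVertex_cartanMinus μ) (isVertex_cartanMinus ν)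
      (fun _ _ => con_eq_zero_of_snd (cartanMinus_snd _ _))
      fun _ _ => con_eq_zero_of_snd (cartanMinus_snd _ _)).slShift (fun _ => rfl) fun _ => rfl
  · rw [HPlus_eq, HMinus_eq]
    exact (exchange_normalExp_of_con hN' hh (isVertex_cartanPlus μ) (isVertex_cartanMinus ν)
      (cartanPlus_fst μ) fun u v s hs => con_cartanPlus_cartanMinus hh hs h1 h2 h3 h4).1.slShift
      (fun w => by ring) fun w => by ring
  · rw [HMinus_eq, HPlus_eq]
    have e : halfCartan ν μ = halfCartan μ ν := by
      simp only [halfCartan, eq_comm (a := ν) (b := μ), or_comm]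
    refine (exchange_normalExp_of_con hN' hh (isVertex_cartanPlus ν) (isVertex_cartanMinus μ)
      (cartanPlus_fst ν) fun u v s hs => con_cartanPlus_cartanMinus hh hs h3 h4 h1 h2).2.slShift
      (fun w => ?_) fun w => ?_ <;>
    · rw [e]
      ring
  · rw [HPlus_eq, XPlus_eq_current]
    exact hp _ ((exchange_of_fst_eq_zero hN' hh (isVertex_cartanPlus μ) (cartanPlus_fst μ)
      (fun j _ => isVertex_raising hh ν j.1 j.2) fun j hj u v s hs =>
        con_cartanPlus_raising hh hs h1 h2 h4 (mem_raisingSet.1 hj).1 (mem_raisingSet.1 hj).2).slShift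
      (fun w => by ring) fun w => by ring)
  · rw [HMinus_eq, XPlus_eq_current]
    exact hp _ ((exchange_of_snd_eq_zero hN' hh (isVertex_cartanMinus μ) (cartanMinus_snd μ)
      (fun j _ => isVertex_raising hh ν j.1 j.2) fun j hj u v s hs =>
        con_raising_cartanMinus hh hs h1 h2 h4 (mem_raisingSet.1 hj).1 (mem_raisingSet.1 hj).2).slShift
      (fun w => by ring) fun w => by ring)
  · rw [HPlus_eq, XMinus_eq_current h4.le]
    exact hp _ ((exchange_of_fst_eq_zero hN' hh (isVertex_cartanPlus μ) (cartanPlus_fst μ)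
      (fun j _ => isVertex_lowering hh ν j) fun j hj u v s hs =>
        con_cartanPlus_lowering hh hs h1 h2 h3 h4 hj).slShift (fun w => by ring) fun w => by ring)
  · rw [HMinus_eq, XMinus_eq_current h4.le]
    exact hp _ ((exchange_of_snd_eq_zero hN' hh (isVertex_cartanMinus μ) (cartanMinus_snd μ)
      (fun j _ => isVertex_lowering hh ν j) fun j hj u v s hs =>
        con_lowering_cartanMinus hh hs h1 h2 h3 h4 hj).slShift (fun w => by ring) fun w => by ring)
  · rcases halfCartan_cases μ ν with ⟨rfl, e⟩ | ⟨rfl, e⟩ | ⟨rfl, e⟩ | ⟨h5, e⟩ <;>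
      simp only [e]
    · exact ((XPlus_XPlus_self hN' hh h2).slShift (fun w => by ring) fun w => by ring).smul _ _
    · exact ((XPlus_succ_XPlus hN' hh h2).slShift (fun w => by push_cast; ring)
        fun w => by push_cast; ring).smul _ _
    · exact ((XPlus_XPlus_succ hN' hh h4).slShift (fun w => by push_cast; ring)
        fun w => by push_cast; ring).smul _ _
    · exact ((((XPlus_XPlus_far hN' hh h2 h4 h5).slShift (fun w => rfl) fun w => rfl).smul _ _
        ).mul_coeff (p := fun w => w) differentiable_id).congr (fun w => by ring) fun w => by ring
  · rcases halfCartan_cases μ ν with ⟨rfl, e⟩ | ⟨rfl, e⟩ | ⟨rfl, e⟩ | ⟨h5, e⟩ <;>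
      simp only [e]
    · exact ((XMinus_XMinus_self hN' hh h1 h2).slShift (fun w => by ring) fun w => by ring).smul _ _
    · exact ((XMinus_succ_XMinus hh h3 h2).slShift (fun w => by push_cast; ring)
        fun w => by push_cast; ring).smul _ _
    · exact ((XMinus_XMinus_succ hh h1 h4).slShift (fun w => by push_cast; ring)
        fun w => by push_cast; ring).smul _ _
    · exact ((((XMinus_XMinus_far hh h1 h2 h3 h4 (by omega)).slShift (fun w => rfl) fun w => rfl
        ).smul _ _).mul_coeff (p := fun w => w) differentiable_id).congr (fun w => by ring)
        fun w => by ring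
  · exact ((XPlus_XMinus_ne hh h1 h2 h3 h4 h5).slShift (fun _ => rfl) fun _ => rfl).smul _ _
  · have e : k * (-I * h) = -k * (I * h) := by ring
    rw [e, HPlus_eq, HMinus_eq]
    refine (XPlus_XMinus_self (k := k) hh h1 h2).rescale _ _ (slShift h μ) _ ?_ (fun _ => rfl)
      fun _ => rfl
    have hh' : (h : ℂ) ≠ 0 := ofReal_ne_zero.2 hh.ne'
    field_simp
    linear_combination (I ^ 2 - 1) * I_sq
  · exact ⟨(XPlus_serre hN' hh h2 h4 h5).rescale _ _ _ _, (XMinus_serre hh h1 h3 h2 h4 h5).rescale _ _ _ _⟩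
  · exact ⟨((XPlus_XPlus_far hN' hh h2 h4 (by omega)).slShift (fun _ => rfl) fun _ => rfl).smul _ _,
      ((XMinus_XMinus_far hh h1 h2 h3 h4 h5).slShift (fun _ => rfl) fun _ => rfl).smul _ _⟩

end sl

/-! ### The currents `K^±` -/

section determinant

variable {N : ℕ} {h : ℝ} {k : ℂ}

theorem sum_kP (N : ℕ) (h : ℝ) (k u : ℂ) :
    ∑ j ∈ Finset.range N, kP N h k (j + 1) (u + j * (-I * h))
      = -∑ j ∈ Finset.range N, lamP h (j + 1) (u + ((k - N) / 4 - j) * (I * h)) := by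
  obtain ⟨B, hB⟩ : ∃ B : ℕ → ℕ → Exponent,
    B = fun m n => bP h m n (u + (1 - ((m : ℂ) + n) / 2) * (I * h)) := ⟨_, rfl⟩
  have h1 : ∀ j ∈ Finset.range N, kP N h k (j + 1) (u + j * (-I * h))
      = -lamP h (j + 1) (u + ((k - N) / 4 - j) * (I * h))
        + (∑ α ∈ Finset.Ico 1 (j + 1), B α (j + 1) - ∑ β ∈ Finset.Icc (j + 1 + 1) N, B (j + 1) β) := by
    intro j _
    have e1 : u + j * (-I * h) + (0 + (k - N) / 4) * (I * h) = u + ((k - N) / 4 - j) * (I * h) := by ring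
    have e2 : ∀ n : ℂ, u + j * (-I * h) + (((j + 1 : ℕ) : ℂ) - n) / 2 * (I * h)
      = u + (1 - (((j + 1 : ℕ) : ℂ) + n) / 2) * (I * h) := fun n => by push_cast; ring
    rw [kP, e1, hB]
    simp only [e2]
    rw [add_sub_assoc]
    simp only [add_comm (((j + 1 : ℕ) : ℂ))]
  have h2 : ∑ j ∈ Finset.range N, ∑ α ∈ Finset.Ico 1 (j + 1), B α (j + 1)
      = ∑ j ∈ Finset.range N, ∑ β ∈ Finset.Icc (j + 1 + 1) N, B (j + 1) β := by
    have e : ∀ f : ℕ → Exponent, ∑ j ∈ Finset.range N, f (j + 1) = ∑ j ∈ Finset.Ico 1 (N + 1), f j := by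
      intro f
      rw [Finset.range_eq_Ico, Finset.sum_Ico_add' f 0 N 1, zero_add]
    rw [e fun m => ∑ α ∈ Finset.Ico 1 m, B α m, e fun m => ∑ β ∈ Finset.Icc (m + 1) N, B m β]
    refine Finset.sum_comm' fun m n => ?_
    simp only [Finset.mem_Ico, Finset.mem_Icc]
    omega
  rw [Finset.sum_congr rfl h1, Finset.sum_add_distrib, Finset.sum_sub_distrib, h2, sub_self, add_zero,
    Finset.sum_neg_distrib]

theorem sum_kM (N : ℕ) (h : ℝ) (k u : ℂ) :
    ∑ j ∈ Finset.range N, kM N h k (j + 1) (u + j * (-I * h))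
      = -∑ j ∈ Finset.range N, lamM h (j + 1) (u + (-((k - N) / 4) - j) * (I * h)) := by
  obtain ⟨T, hT⟩ : ∃ T : ℕ → Exponent, T = fun j => ∑ m ∈ Finset.Icc 1 j, ∑ n ∈ Finset.Icc (j + 1) N,
    bM h m n (u + (((m : ℂ) + n) / 2 - j) * (I * h)) := ⟨_, rfl⟩
  have h1 : ∀ j ∈ Finset.range N, kM N h k (j + 1) (u + j * (-I * h))
      = -lamM h (j + 1) (u + (-((k - N) / 4) - j) * (I * h)) + (T j - T (j + 1)) := by
    intro j _
    have e1 : u + j * (-I * h) + (0 - (k - N) / 4) * (I * h) = u + (-((k - N) / 4) - j) * (I * h) := by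
      ring
    have e2 : ∀ n : ℂ, u + j * (-I * h) + n / 2 * (I * h) = u + (n / 2 - j) * (I * h) :=
      fun n => by ring
    have e3 : ∀ n : ℂ, u + j * (-I * h) + (n - 2) / 2 * (I * h)
      = u + (n / 2 - ((j + 1 : ℕ) : ℂ)) * (I * h) := fun n => by push_cast; ring
    have e4 : Finset.Ico 1 (j + 1) = Finset.Icc 1 j := rfl
    rw [kM, e1, hT, e4]
    simp only [e3]
    simp only [e2]
    rw [add_sub_assoc]
  have h2 : T 0 - T N = 0 := by simp [hT]
  rw [Finset.sum_congr rfl h1, Finset.sum_add_distrib, Finset.sum_range_sub', h2, add_zero,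
    Finset.sum_neg_distrib]

/-- The commutators are compatible with the relation between the `λ_μ`. -/
theorem sum_exp_mul_lam (k : ℂ) (s : ℝ) {ν : ℕ} (hν : 1 ≤ ν) (hνN : ν ≤ N) :
    ∑ μ ∈ Finset.Icc 1 N, exp ((1 - (μ : ℂ)) * h * s) * (comm N h k).lam μ ν s = 0 := by
  obtain ⟨E, hE⟩ : ∃ E : ℂ → ℂ, E = fun a => exp (a * ((h : ℂ) * s / 2)) := ⟨_, rfl⟩
  have hmul : ∀ a b, E a * E b = E (a + b) := fun a b => by
    simp only [hE, ← exp_add, add_mul]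
  have e1 : sinh ((h : ℂ) / 2 * s) = (E 1 - E (-1)) / 2 := by rw [Complex.sinh, hE]; ring_nf
  have e2 : sinh (((N : ℂ) - 1) / 2 * h * s) = (E (N - 1) - E (1 - N)) / 2 := by
    rw [Complex.sinh, hE]; ring_nf
  have e3 : ∀ c : ℂ, exp (c * ((N : ℂ) / 2 * h * s)) = E (c * N) := fun c => by rw [hE]; ring_nf
  have e4 : ∀ μ : ℕ, exp ((1 - (μ : ℂ)) * h * s) = E (2 - 2 * μ) := fun c => by rw [hE]; ring_nf
  obtain ⟨f, hf⟩ : ∃ f : ℕ → ℂ,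
    f = fun μ => E ((if ν < μ then (N : ℂ) else -N) - 2 * μ + 3) / 2 := ⟨_, rfl⟩
  have key : ∀ μ ∈ Finset.Ico 1 (N + 1), exp ((1 - (μ : ℂ)) * h * s) * (comm N h k).lam μ ν s
      = sinh ((k + N) / 2 * h * s) * sinh ((h : ℂ) / 2 * s)
        / ((h : ℂ) ^ 2 * s * sinh ((N : ℂ) / 2 * h * s)) * (f (μ + 1) - f μ) := by
    intro μ _
    have h1 : E (2 - 2 * μ) * (if μ = ν then (E (N - 1) - E (1 - N)) / 2
        else -((E 1 - E (-1)) / 2) * E ((if ν < μ then 1 else -1) * N)) = f (μ + 1) - f μ := by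
      rw [hf]
      rcases lt_trichotomy μ ν with h1 | h1 | h1
      · simp (disch := omega) only [if_neg, neg_mul, sub_mul, mul_sub, div_mul_eq_mul_div,
          mul_div_assoc', hmul, mul_neg]
        push_cast
        ring_nf
      · subst h1
        simp (disch := omega) only [if_neg, if_pos, if_true]
        rw [mul_div_assoc', mul_sub, hmul, hmul]
        push_cast
        ring_nf
      · simp (disch := omega) only [if_neg, if_pos, neg_mul, sub_mul, mul_sub, div_mul_eq_mul_div,
          mul_div_assoc', hmul, mul_neg]
        push_cast
        ring_nf
    rw [← h1, e4]
    simp only [comm]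
    rcases eq_or_ne μ ν with h2 | h2
    · simp only [if_pos h2, ← e2]
      ring
    · simp only [if_neg h2, e3, ← e1]
      ring
  have e5 : Finset.Icc 1 N = Finset.Ico 1 (N + 1) := rfl
  have h2 : f (N + 1) - f 1 = 0 := by
    rw [hf]
    simp (disch := omega) only [if_pos, if_neg]
    push_cast
    ring_nf
  rw [e5, Finset.sum_congr rfl key, ← Finset.mul_sum, Finset.sum_Ico_sub f (by omega), h2, mul_zero]

theorem sum_exp_mul_lam_right (k : ℂ) (s : ℝ) {μ : ℕ} (hμ : 1 ≤ μ) (hμN : μ ≤ N) :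
    ∑ ν ∈ Finset.Icc 1 N, exp (((ν : ℂ) - 1) * h * s) * (comm N h k).lam μ ν s = 0 := by
  have e : ∀ ν ∈ Finset.Icc 1 N, exp (((ν : ℂ) - 1) * h * s) * (comm N h k).lam μ ν s
      = exp (((N : ℂ) - 1) * h * s) * (exp ((1 - ((N + 1 - ν : ℕ) : ℂ)) * h * s)
        * (comm N h k).lam (N + 1 - ν) (N + 1 - μ) s) := by
    intro ν hν
    rw [Finset.mem_Icc] at hν
    have h1 : (comm N h k).lam (N + 1 - ν) (N + 1 - μ) s = (comm N h k).lam μ ν s := by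
      simp only [comm]
      rw [if_congr (show N + 1 - ν = N + 1 - μ ↔ μ = ν by omega) rfl rfl,
        if_congr (show N + 1 - μ < N + 1 - ν ↔ ν < μ by omega) rfl rfl]
    rw [h1, ← mul_assoc, ← exp_add, Nat.cast_sub (by omega)]
    push_cast
    ring_nf
  rw [Finset.sum_congr rfl e, ← Finset.mul_sum]
  refine mul_eq_zero_of_right _ ?_
  rw [← sum_exp_mul_lam (N := N) (h := h) k s (ν := N + 1 - μ) (by omega) (by omega)]
  refine Finset.sum_nbij' (fun ν => N + 1 - ν) (fun ν => N + 1 - ν) ?_ ?_ ?_ ?_ ?_ <;> intro ν hν <;>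
    simp only [Finset.mem_Icc] at hν ⊢ <;> omega

/-- Two points at which all states of the Fock space have the same value. -/
def AgreeOn (N : ℕ) (ξ ζ : Profile) : Prop := ∀ m : Mode, m.InRange N → ∀ s : ℝ, 0 < s → ξ m s = ζ m s

theorem AgreeOn.pairing {ξ ζ : Profile} (hξ : AgreeOn N ξ ζ) (f : Profile) :
    pairing N f ξ = pairing N f ζ := by
  refine setIntegral_congr_fun measurableSet_Ioi fun s hs => ?_
  refine congrArg₂ _ (Finset.sum_congr rfl fun μ hμ => ?_)
    (Finset.sum_congr rfl fun μ hμ => Finset.sum_congr rfl fun ν hν => ?_)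
  · rw [hξ (.lam μ) (Finset.mem_Icc.1 hμ) s hs]
  · rw [Finset.mem_Icc] at hμ
    rw [Finset.mem_Ioc] at hν
    rw [hξ (.b μ ν) ⟨hμ.1, hν⟩ s hs, hξ (.c μ ν) ⟨hμ.1, hν⟩ s hs]

theorem AgreeOn.state {ξ ζ : Profile} (hξ : AgreeOn N ξ ζ) {Φ : State} (hΦ : Φ ∈ fockSpace N) :
    Φ ξ = Φ ζ := by
  induction hΦ using Algebra.adjoin_induction with
  | mem Φ hΦ =>
    obtain ⟨m, hm, η, hη, rfl⟩ := hΦ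
    refine setIntegral_congr_fun measurableSet_Ioi fun s hs => ?_
    beta_reduce
    rw [hξ m hm s hs]
  | algebraMap r => rfl
  | add Φ Ψ _ _ h1 h2 => rw [Pi.add_apply, Pi.add_apply, h1, h2]
  | mul Φ Ψ _ _ h1 h2 => rw [Pi.mul_apply, Pi.mul_apply, h1, h2]

theorem AgreeOn.add_right {ξ ζ : Profile} (hξ : AgreeOn N ξ ζ) (ζ' : Profile) :
    AgreeOn N (ξ + ζ') (ζ + ζ') := fun m hm s hs => by
  rw [Pi.add_apply, Pi.add_apply, Pi.add_apply, Pi.add_apply, hξ m hm s hs]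

theorem AgreeOn.normalExp {H : Commutators} {ξ ζ : Profile} (hξ : AgreeOn N ξ ζ) (Y : Exponent)
    {Φ : State} (hΦ : Φ ∈ fockSpace N) : normalExp N H Y Φ ξ = normalExp N H Y Φ ζ := by
  rw [normalExp_apply, normalExp_apply, hξ.pairing, (hξ.add_right _).state hΦ]

theorem quantumDet_kPlus (N : ℕ) (h : ℝ) (k u : ℂ) : quantumDet N (-I * h) (kPlus N h k) u
    = normalExp N (comm N h k)
      (-∑ j ∈ Finset.range N, lamP h (j + 1) (u + ((k - N) / 4 - j) * (I * h))) := by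
  have key : ∀ n : ℕ, ((List.range n).map fun j => kPlus N h k (j + 1) (u + j * (-I * h))).prod
      = normalExp N (comm N h k) (∑ j ∈ Finset.range n, kP N h k (j + 1) (u + j * (-I * h))) := by
    intro n
    induction n with
    | zero => simp [normalExp_zero]
    | succ n ih =>
      rw [List.range_succ, List.map_append, List.prod_append, ih, List.map_singleton,
        List.prod_singleton, Finset.sum_range_succ, kPlus_eq]
      ext Φ ξ
      rw [Module.End.mul_apply, normalExp_apply, normalExp_apply, normalExp_apply, kP_fst, Prod.fst_add,
        kP_fst, Prod.fst_sum, Finset.sum_eq_zero fun j _ => kP_fst _ _, add_zero, pairing_zero_left,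
        pairing_zero_left, Prod.snd_add, shift_add, add_assoc, exp_zero, one_mul, one_mul]
  rw [quantumDet, key, sum_kP]

theorem quantumDet_kMinus_apply (u : ℂ) (Φ : State) (ξ : Profile) :
    quantumDet N (-I * h) (kMinus N h k) u Φ ξ
      = exp (∑ j ∈ Finset.range N, pairing N (kM N h k (j + 1) (u + j * (-I * h))).1 ξ) * Φ ξ := by
  have key : ∀ n : ℕ, ((List.range n).map fun j => kMinus N h k (j + 1) (u + j * (-I * h))).prod Φ ξ
      = exp (∑ j ∈ Finset.range n, pairing N (kM N h k (j + 1) (u + j * (-I * h))).1 ξ) * Φ ξ := by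
    intro n
    induction n generalizing Φ with
    | zero => simp
    | succ n ih =>
      rw [List.range_succ, List.map_append, List.prod_append, List.map_singleton,
        List.prod_singleton, Finset.sum_range_succ, kMinus_eq, Module.End.mul_apply, ih,
        normalExp_apply, kM_snd, shift_zero, add_zero, exp_add, mul_assoc]
  exact key N

theorem sum_lamP_snd (w : ℕ → ℂ) {μ : ℕ} (hμ : 1 ≤ μ) (hμN : μ ≤ N) (s : ℝ) :
    (-∑ j ∈ Finset.range N, lamP h (j + 1) (w j)).2 (.lam μ) s
      = -(2 * h * exp (-I * w (μ - 1) * s)) := by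
  obtain ⟨j, rfl⟩ : ∃ j, μ = j + 1 := ⟨μ - 1, by omega⟩
  rw [Prod.snd_neg, Prod.snd_sum, Pi.neg_apply, Pi.neg_apply, Finset.sum_apply, Finset.sum_apply,
    Finset.sum_eq_single_of_mem j (Finset.mem_range.2 hμN)]
  · simp [lamP, onLam]
  · intro i _ hi
    simp [lamP, onLam, hi.symm]

theorem sum_lamM_fst (w : ℕ → ℂ) {μ : ℕ} (hμ : 1 ≤ μ) (hμN : μ ≤ N) (s : ℝ) :
    (-∑ j ∈ Finset.range N, lamM h (j + 1) (w j)).1 (.lam μ) s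
      = 2 * h * exp (I * w (μ - 1) * s) := by
  obtain ⟨j, rfl⟩ : ∃ j, μ = j + 1 := ⟨μ - 1, by omega⟩
  rw [Prod.fst_neg, Prod.fst_sum, Pi.neg_apply, Pi.neg_apply, Finset.sum_apply, Finset.sum_apply,
    Finset.sum_eq_single_of_mem j (Finset.mem_range.2 hμN)]
  · simp [lamM, onLam]
  · intro i _ hi
    simp [lamM, onLam, hi.symm]

theorem agreeOn_add_shift (ξ : Profile) (k u : ℂ) (c : ℂ) :
    AgreeOn N (ξ + shift N (comm N h k)
      (-∑ j ∈ Finset.range N, lamP h (j + 1) (u + (c - j) * (I * h))).2) ξ := by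
  intro m hm s hs
  rw [Pi.add_apply, Pi.add_apply, add_eq_left]
  cases m with
  | lam ν =>
    rw [← mul_zero (-(2 * h * exp ((-I * u + c * h) * s))), ← sum_exp_mul_lam (h := h) k s hm.1 hm.2,
      Finset.mul_sum]
    refine Finset.sum_congr rfl fun μ hμ => ?_
    rw [Finset.mem_Icc] at hμ
    have e : exp (-I * (u + (c - (μ - 1 : ℕ)) * (I * h)) * s)
        = exp ((-I * u + c * h) * s) * exp ((1 - (μ : ℂ)) * h * s) := by
      rw [← exp_add, Nat.cast_sub hμ.1]
      congr 1
      push_cast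
      linear_combination (-(c - (μ - 1)) * h * s) * I_sq
    rw [sum_lamP_snd _ hμ.1 hμ.2, e]
    ring
  | b μ ν => simp [shift, lamP, onLam, Prod.snd_sum, Finset.sum_apply]
  | c μ ν => simp [shift, lamP, onLam, Prod.snd_sum, Finset.sum_apply]

/-- Points that satisfy the relation between the `λ_μ`. -/
def IsBalanced (N : ℕ) (h : ℝ) (ζ : Profile) : Prop :=
  ∀ s : ℝ, 0 < s → ∑ μ ∈ Finset.Icc 1 N, exp (((μ : ℂ) - 1) * h * s) * ζ (.lam μ) s = 0

theorem IsBalanced.add_shift {ζ : Profile} (hζ : IsBalanced N h ζ) (k : ℂ) (g : Profile) :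
    IsBalanced N h (ζ + shift N (comm N h k) g) := by
  intro s hs
  simp only [Pi.add_apply, mul_add, Finset.sum_add_distrib, hζ s hs, zero_add, shift, Finset.mul_sum]
  rw [Finset.sum_comm]
  refine Finset.sum_eq_zero fun μ hμ => ?_
  rw [Finset.mem_Icc] at hμ
  rw [← mul_zero (g (.lam μ) s), ← sum_exp_mul_lam_right k s hμ.1 hμ.2, Finset.mul_sum]
  exact Finset.sum_congr rfl fun ν _ => by ring

theorem IsBalanced.pairAt_eq_zero {ζ : Profile} (hζ : IsBalanced N h ζ) (u c : ℂ) {s : ℝ} (hs : 0 < s) :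
    pairAt N (-∑ j ∈ Finset.range N, lamM h (j + 1) (u + (c - j) * (I * h))).1 ζ s = 0 := by
  have h1 : ∀ μ ν : ℕ, (-∑ j ∈ Finset.range N, lamM h (j + 1) (u + (c - j) * (I * h))).1 (.b μ ν) s = 0 ∧
      (-∑ j ∈ Finset.range N, lamM h (j + 1) (u + (c - j) * (I * h))).1 (.c μ ν) s = 0 := by
    simp [lamM, onLam, Prod.fst_sum, Finset.sum_apply]
  simp only [pairAt, h1, zero_mul, add_zero, Finset.sum_const_zero]
  rw [← mul_zero (2 * h * exp ((I * u - c * h) * s)), ← hζ s hs, Finset.mul_sum]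
  refine Finset.sum_congr rfl fun μ hμ => ?_
  rw [Finset.mem_Icc] at hμ
  have e : exp (I * (u + (c - (μ - 1 : ℕ)) * (I * h)) * s)
      = exp ((I * u - c * h) * s) * exp (((μ : ℂ) - 1) * h * s) := by
    rw [← exp_add, Nat.cast_sub hμ.1]
    congr 1
    push_cast
    linear_combination ((c - (μ - 1)) * h * s) * I_sq
  rw [sum_lamM_fst _ hμ.1 hμ.2, e]
  ring

end determinant

section determinant_exchange

variable {N : ℕ} {h : ℝ} {k : ℂ} {μ ν : ℕ}

theorem sum_lamP_fst (N : ℕ) (h : ℝ) (w : ℕ → ℂ) :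
    (-∑ j ∈ Finset.range N, lamP h (j + 1) (w j)).1 = 0 := by
  simp [lamP, Prod.fst_sum]

theorem quantumDet_kPlus_apply (u : ℂ) {Φ : State} (hΦ : Φ ∈ fockSpace N) :
    quantumDet N (-I * h) (kPlus N h k) u Φ = Φ := by
  funext ξ
  rw [quantumDet_kPlus, normalExp_apply, (agreeOn_add_shift ξ k u _).state hΦ, sum_lamP_fst,
    pairing_zero_left, exp_zero, one_mul]

theorem quantumDet_kPlus_normalExp (u : ℂ) {Φ : State} (hΦ : Φ ∈ fockSpace N) (Y : Exponent)
    (ξ : Profile) :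
    quantumDet N (-I * h) (kPlus N h k) u (normalExp N (comm N h k) Y Φ) ξ
      = normalExp N (comm N h k) Y Φ ξ := by
  rw [quantumDet_kPlus, normalExp_apply, (agreeOn_add_shift ξ k u _).normalExp Y hΦ, sum_lamP_fst,
    pairing_zero_left, exp_zero, one_mul]

theorem quantumDet_kMinus_of_integrable {ζ : Profile} (hζ : IsBalanced N h ζ) {u : ℂ}
    (hi : ∀ μ, 1 ≤ μ → μ ≤ N → IntegrableOn
      (pairAt N (kM N h k μ (u + ((μ - 1 : ℕ) : ℂ) * (-I * h))).1 ζ) (Set.Ioi 0)) (Φ : State) :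
    quantumDet N (-I * h) (kMinus N h k) u Φ ζ = Φ ζ := by
  have h1 : ∑ j ∈ Finset.range N, pairing N (kM N h k (j + 1) (u + j * (-I * h))).1 ζ = 0 := by
    simp only [pairing_eq]
    rw [← integral_finsetSum]
    · refine setIntegral_eq_zero_of_forall_eq_zero fun s hs => ?_
      rw [← hζ.pairAt_eq_zero u (-((k - N) / 4)) hs, ← sum_kM, Prod.fst_sum]
      induction Finset.range N using Finset.induction_on with
      | empty => simp [pairAt_zero_left]
      | insert i S hi ih =>
        rw [Finset.sum_insert hi, Finset.sum_insert hi, pairAt_add_left, Pi.add_apply, ih]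
    · intro j hj
      exact hi (j + 1) (by omega) (Finset.mem_range.1 hj)
  rw [quantumDet_kMinus_apply, h1, exp_zero, one_mul]

theorem quantumDet_kMinus_fockDual (hN : 0 < N) (hh : 0 < h) (u : ℂ) (Φ : State) {ξ : Profile}
    (hξ : ξ ∈ fockDual N h) : quantumDet N (-I * h) (kMinus N h k) u Φ ξ = Φ ξ :=
  quantumDet_kMinus_of_integrable hξ.2 (fun μ _ _ =>
    ((isVertex_kM (k := k) μ).isHolomorphic (comm_regular (k := k) hN hh)).integrable ξ hξ.1 _) Φ

/-- The contractions with all `k_μ^-` converge. -/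
def ContractsWithK (N : ℕ) (h : ℝ) (k : ℂ) (Y : ℂ → Exponent) : Prop :=
  ∀ μ, 1 ≤ μ → μ ≤ N → ∃ R, HasContraction N (comm N h k) Y (kM N h k μ) R

theorem normalExp_quantumDet_kMinus (hN : 0 < N) (hh : 0 < h) {Y : ℂ → Exponent}
    (hY : ContractsWithK N h k Y) : ∃ C : ℝ, ∀ u v : ℂ, v.im < u.im - C → ∀ Φ, ∀ ξ ∈ fockDual N h,
      normalExp N (comm N h k) (Y v) (quantumDet N (-I * h) (kMinus N h k) u Φ) ξ
        = normalExp N (comm N h k) (Y v) Φ ξ := by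
  have h1 : ∀ᶠ w in imBot, ∀ μ ∈ Finset.Icc 1 N, ∀ u v,
      u - v = w - ((μ - 1 : ℕ) : ℂ) * (-I * h) →
      IntegrableOn (con N (comm N h k) (Y u) (kM N h k μ v)) (Set.Ioi 0) := by
    rw [Finset.eventually_all]
    intro μ hμ
    rw [Finset.mem_Icc] at hμ
    obtain ⟨R, hR⟩ := hY μ hμ.1 hμ.2
    filter_upwards [eventually_imBot_add (-(((μ - 1 : ℕ) : ℂ) * (-I * h))) hR.exists_bound]
      with w h2 u v huv
    exact (h2 u v (by rw [huv, sub_eq_add_neg])).1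
  obtain ⟨C, hC⟩ := eventually_imBot.1 h1
  refine ⟨C, fun u v huv Φ ξ hξ => ?_⟩
  rw [normalExp_apply, normalExp_apply, quantumDet_kMinus_of_integrable
    (IsBalanced.add_shift hξ.2 k (Y v).2)]
  intro μ h2 h3
  rw [pairAt_add_right]
  exact (((isVertex_kM (k := k) μ).isHolomorphic (comm_regular (k := k) hN hh)).integrable ξ hξ.1 _).add
    (hC (v - u) (by rw [sub_im]; linarith) μ (Finset.mem_Icc.2 ⟨h2, h3⟩) v _ (by ring))

theorem exchange_quantumDet_kPlus {ι : Type*} {T : Finset ι} {c : ι → ℂ} {Y : ι → ℂ → Exponent} :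
    Exchange (fockSpace N) (fockDual N h) (fun _ => 1) (fun _ => 1)
      (quantumDet N (-I * h) (kPlus N h k)) (current N (comm N h k) T c Y) := by
  refine ⟨0, fun Φ hΦ ξ hξ v => ⟨fun _ => current N (comm N h k) T c Y v Φ ξ, differentiable_const _,
    fun u _ => ?_, fun u _ => ?_⟩⟩
  · rw [one_mul, current, LinearMap.sum_apply, map_sum, Finset.sum_apply, Finset.sum_apply]
    refine Finset.sum_congr rfl fun i _ => ?_
    rw [LinearMap.smul_apply, map_smul, Pi.smul_apply, Pi.smul_apply, quantumDet_kPlus_normalExp u hΦ]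
  · rw [one_mul, quantumDet_kPlus_apply u hΦ]

theorem exchange_quantumDet_kMinus (hN : 0 < N) (hh : 0 < h) {ι : Type*} {T : Finset ι} {c : ι → ℂ}
    {Y : ι → ℂ → Exponent} (hY : ∀ i ∈ T, ContractsWithK N h k (Y i)) :
    Exchange (fockSpace N) (fockDual N h) (fun _ => 1) (fun _ => 1)
      (quantumDet N (-I * h) (kMinus N h k)) (current N (comm N h k) T c Y) := by
  have h1 : ∃ C : ℝ, ∀ u v : ℂ, v.im < u.im - C → ∀ Φ, ∀ ξ ∈ fockDual N h, ∀ i ∈ T,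
      normalExp N (comm N h k) (Y i v) (quantumDet N (-I * h) (kMinus N h k) u Φ) ξ
        = normalExp N (comm N h k) (Y i v) Φ ξ := by
    choose! C hC using fun i hi => normalExp_quantumDet_kMinus hN hh (hY i hi)
    refine ⟨∑ i ∈ T, |C i|, fun u v huv Φ ξ hξ i hi => hC i hi u v ?_ Φ ξ hξ⟩
    have := Finset.single_le_sum (fun i _ => abs_nonneg (C i)) hi
    linarith [le_abs_self (C i)]
  obtain ⟨C, hC⟩ := h1
  refine ⟨C, fun Φ hΦ ξ hξ v => ⟨fun _ => current N (comm N h k) T c Y v Φ ξ, differentiable_const _,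
    fun u _ => ?_, fun u hu => ?_⟩⟩
  · rw [one_mul, quantumDet_kMinus_fockDual hN hh u _ hξ]
  · rw [one_mul, current_apply, current_apply]
    refine Finset.sum_congr rfl fun i hi => ?_
    rw [hC u v (by linarith) Φ ξ hξ i hi]

theorem exchange_quantumDet_quantumDet (hN : 0 < N) (hh : 0 < h) :
    Exchange (fockSpace N) (fockDual N h) (fun _ => 1) (fun _ => 1)
      (quantumDet N (-I * h) (kPlus N h k)) (quantumDet N (-I * h) (kPlus N h k)) ∧
    Exchange (fockSpace N) (fockDual N h) (fun _ => 1) (fun _ => 1)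
      (quantumDet N (-I * h) (kMinus N h k)) (quantumDet N (-I * h) (kMinus N h k)) ∧
    Exchange (fockSpace N) (fockDual N h) (fun _ => 1) (fun _ => 1)
      (quantumDet N (-I * h) (kPlus N h k)) (quantumDet N (-I * h) (kMinus N h k)) := by
  refine ⟨⟨0, fun Φ hΦ ξ hξ v => ⟨fun _ => Φ ξ, differentiable_const _, fun u _ => ?_, fun u _ => ?_⟩⟩,
    ⟨0, fun Φ hΦ ξ hξ v => ⟨fun _ => Φ ξ, differentiable_const _, fun u _ => ?_, fun u _ => ?_⟩⟩,
    ⟨0, fun Φ hΦ ξ hξ v => ⟨fun _ => Φ ξ, differentiable_const _, fun u _ => ?_, fun u _ => ?_⟩⟩⟩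
  · rw [one_mul, quantumDet_kPlus_apply v hΦ, quantumDet_kPlus_apply u hΦ]
  · rw [one_mul, quantumDet_kPlus_apply u hΦ, quantumDet_kPlus_apply v hΦ]
  · rw [one_mul, quantumDet_kMinus_fockDual hN hh u _ hξ, quantumDet_kMinus_fockDual hN hh v _ hξ]
  · rw [one_mul, quantumDet_kMinus_fockDual hN hh v _ hξ, quantumDet_kMinus_fockDual hN hh u _ hξ]
  · have h1 := agreeOn_add_shift (N := N) (h := h) ξ k u ((k - N) / 4)
    rw [one_mul, quantumDet_kPlus, normalExp_apply, quantumDet_kMinus_apply,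
      Finset.sum_congr rfl fun j _ => h1.pairing _, h1.state hΦ, ← quantumDet_kMinus_apply,
      quantumDet_kMinus_fockDual hN hh v _ hξ, sum_lamP_fst,
      pairing_zero_left, exp_zero, one_mul]
  · rw [one_mul, quantumDet_kMinus_fockDual hN hh v _ hξ, quantumDet_kPlus_apply u hΦ]

theorem exists_contraction_of_ite {X Y : ℂ → Exponent} {H : Commutators} {p q : Prop} [Decidable p]
    [Decidable q] {a b c d : ℂ} (hc : ∀ u v s, 0 < s → con N H (X u) (Y v) s
      = (if p then ker h u v s a - ker h u v s b else 0)
        + if q then ker h u v s c - ker h u v s d else 0) :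
    ∃ R, HasContraction N H X Y R := by
  refine ⟨_, hasContraction_of_ker_add (h := h) (a := if p then a else 0) (b := if p then b else 0)
    (c := if q then c else 0) (d := if q then d else 0) fun u v s hs => ?_⟩
  rw [hc u v s hs]
  split_ifs <;> simp

theorem contractsWithK_raising (hh : 0 < h) {i : ℕ × Bool} (hνN : ν < N) (hi : i ∈ raisingSet ν) :
    ContractsWithK N h k (raising h ν i.1 i.2) := fun μ _ _ => by
  rw [mem_raisingSet] at hi
  exact exists_contraction_of_ite fun u v s hs => con_raising_kM hh hs hνN hi.1 hi.2

theorem contractsWithK_lowering (hh : 0 < h) {i : ℕ × Bool} (hν : 1 ≤ ν) (hνN : ν < N)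
    (hi : i ∈ loweringSet N ν) : ContractsWithK N h k (lowering N h k ν i) := fun μ h1 h2 =>
  exists_contraction_of_ite fun u v s hs => con_lowering_kM hh hs h1 h2 hν hνN hi u v

theorem contractsWithK_cartanMinus : ContractsWithK N h k (cartanMinus N h k ν) := fun μ h1 h2 =>
  ⟨_, hasContraction_of_zero fun u v s _ => con_eq_zero_of_snd (cartanMinus_snd ν u) s⟩

theorem contractsWithK_cartanPlus (hh : 0 < h) (hν : 1 ≤ ν) (hνN : ν < N) :
    ContractsWithK N h k (cartanPlus N h k ν) := by
  intro μ h1 h2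
  rcases eq_or_ne μ ν with h3 | h3
  · refine ⟨_, hasContraction_of_ker_add (h := h) (a := k + 1) (b := k) (c := 0) (d := 1)
      fun u v s hs => ?_⟩
    rw [con_cartanPlus_kM hh hs h1 h2 hν hνN, if_pos h3, if_neg (by omega)]
    ring
  · rcases eq_or_ne μ (ν + 1) with h4 | h4
    · refine ⟨_, hasContraction_of_ker_add (h := h) (a := k - 1) (b := k) (c := 0) (d := -1)
        fun u v s hs => ?_⟩
      rw [con_cartanPlus_kM hh hs h1 h2 hν hνN, if_neg h3, if_pos h4]
      ring
    · refine ⟨_, hasContraction_of_zero fun u v s hs => ?_⟩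
      rw [con_cartanPlus_kM hh hs h1 h2 hν hνN, if_neg h3, if_neg h4, add_zero]

theorem quantumDet_central (hN : 0 < N) (hh : 0 < h) {K : ℂ → Op}
    (hK : K = quantumDet N (-I * h) (kPlus N h k) ∨ K = quantumDet N (-I * h) (kMinus N h k))
    (hμ : 1 ≤ μ) (hμN : μ < N) :
    Exchange (fockSpace N) (fockDual N h) (fun _ => 1) (fun _ => 1) K (HPlus N h k μ) ∧
    Exchange (fockSpace N) (fockDual N h) (fun _ => 1) (fun _ => 1) K (HMinus N h k μ) ∧
    Exchange (fockSpace N) (fockDual N h) (fun _ => 1) (fun _ => 1) K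
      (fun u => I • ECur N h k μ u) ∧
    Exchange (fockSpace N) (fockDual N h) (fun _ => 1) (fun _ => 1) K
      (fun u => I • FCur N h k μ u) := by
  have key : ∀ {A : ℂ → Op} (c : ℂ),
      Exchange (fockSpace N) (fockDual N h) (fun _ => 1) (fun _ => 1) K A →
      Exchange (fockSpace N) (fockDual N h) (fun _ => 1) (fun _ => 1) K
        (fun u => c • A (u + slShift h μ)) := by
    intro A c hA
    have := (hA.comp_add 0 (slShift h μ) (fun _ => rfl) fun _ => rfl).smul 1 c
    simpa only [one_smul, add_zero] using this
  rw [ECur_eq, FCur_eq, HPlus_eq, HMinus_eq]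
  refine ⟨?_, ?_, key _ ?_, key _ ?_⟩
  rotate_left 2
  · rw [XPlus_eq_current]
    rcases hK with rfl | rfl
    · exact exchange_quantumDet_kPlus
    · exact exchange_quantumDet_kMinus hN hh fun i hi => contractsWithK_raising hh hμN hi
  · rw [XMinus_eq_current hμN.le]
    rcases hK with rfl | rfl
    · exact exchange_quantumDet_kPlus
    · exact exchange_quantumDet_kMinus hN hh fun i hi => contractsWithK_lowering hh hμ hμN hi
  · have := key (A := fun u => normalExp N (comm N h k) (cartanPlus N h k μ u)) 1 <| by
      rw [normalExp_eq_current]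
      rcases hK with rfl | rfl
      · exact exchange_quantumDet_kPlus
      · exact exchange_quantumDet_kMinus hN hh fun i hi => contractsWithK_cartanPlus hh hμ hμN
    simpa only [one_smul] using this
  · have := key (A := fun u => normalExp N (comm N h k) (cartanMinus N h k μ u)) 1 <| by
      rw [normalExp_eq_current]
      rcases hK with rfl | rfl
      · exact exchange_quantumDet_kPlus
      · exact exchange_quantumDet_kMinus hN hh fun i hi => contractsWithK_cartanMinus
    simpa only [one_smul] using this

end determinant_exchange

section cross

variable {N : ℕ} {h : ℝ} {k : ℂ} {s : ℝ} {u v : ℂ}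

/-- The kernel whose integral is the logarithm of `rho`. -/
def theta (N : ℕ) (h s : ℝ) : ℂ :=
  (1 - exp (-(h * s))) * (1 - exp ((1 - N) * (h * s))) / (1 - exp (-N * (h * s)))

/-- The contraction of `k_μ^+` with `k_ν^-` at level one half of the difference of two shifts. -/
def crossKernel (N : ℕ) (h : ℝ) (μ ν : ℕ) (w : ℂ) (s : ℝ) : ℂ :=
  theta N h s * expKernel h 0 w s
    + (if μ < ν then expKernel h (-1) w s - expKernel h 0 w s else 0)
    + if ν < μ then expKernel h 0 w s - expKernel h 1 w s else 0

theorem con_kP_kM_eq_add (hh : 0 < h) (hs : 0 < s) {μ ν : ℕ} (hμ : 1 ≤ μ) (hμN : μ ≤ N) (hν : 1 ≤ ν)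
    (hνN : ν ≤ N) :
    con N (comm N h k) (kP N h k μ u) (kM N h k ν v) s
      = con N (comm N h k) (lamP h μ (u + (k - N) / 4 * (I * h)))
          (lamM h ν (v - (k - N) / 4 * (I * h))) s
        + if μ < ν then stepDiff (ker h u v s) (N + 1) - stepDiff (ker h u v s) N
          else if ν < μ then stepDiff (ker h u v s) 1 - stepDiff (ker h u v s) 0
          else stepDiff (ker h u v s) 1 - stepDiff (ker h u v s) N := by
  have key : ∀ {S : Finset ℕ} {p : ℕ → Prop} [DecidablePred p] (m n : ℕ) (x : ℂ), m ≤ n →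
      (∀ j, j ∈ S ∧ p j ↔ m ≤ j ∧ j < n) → ∑ j ∈ S, (if p j then secondDiff (ker h u v s) (x - j) else 0)
        = stepDiff (ker h u v s) (m - x) - stepDiff (ker h u v s) (n - x) := by
    intro S p _ m n x hmn hp
    rw [← sum_Ico_stepDiff _ _ hmn, ← Finset.sum_filter]
    congr 1
    ext j
    rw [Finset.mem_filter, hp, Finset.mem_Ico]
  have e1 : ∀ x y : ℂ, (x - y) / 2 - (y + x) / 2 = 0 - y := fun x y => by ring
  have e2 : ∀ x y : ℂ, (x - y) / 2 - (y + x - 2) / 2 = 1 - y := fun x y => by ring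
  have e3 : ∀ x y : ℂ, (x - y) / 2 - (x + y) / 2 = 0 - y := fun x y => by ring
  have e4 : ∀ x y : ℂ, (x - y) / 2 - (x + y - 2) / 2 = 1 - y := fun x y => by ring
  have h1 : con N (comm N h k) (lamP h μ (u + (0 + (k - N) / 4) * (I * h))) (kM N h k ν v) s
      = -con N (comm N h k) (lamP h μ (u + (k - N) / 4 * (I * h)))
          (lamM h ν (v - (k - N) / 4 * (I * h))) s := by
    rw [kM, con_sub_right, con_add_right, con_neg_right, con_sum_right, con_sum_right]
    simp only [Pi.add_apply, Pi.sub_apply, Pi.neg_apply, Finset.sum_apply, con_sum_right, con_lamP_bM,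
      Finset.sum_const_zero, add_zero, sub_zero, zero_add, zero_sub, neg_mul, ← sub_eq_add_neg]
  rw [kP, con_sub_left, con_add_left, con_neg_left, con_sum_left, con_sum_left]
  simp only [Pi.add_apply, Pi.sub_apply, Pi.neg_apply, Finset.sum_apply, h1, neg_neg]
  rw [Finset.sum_congr rfl fun n hn => con_bP_kM hh hs (Finset.mem_Ico.1 hn).1 hμN,
    Finset.sum_congr (s₁ := Finset.Icc (μ + 1) N) rfl fun n hn =>
      con_bP_kM hh hs hμ (Finset.mem_Icc.1 hn).2]
  simp only [Finset.sum_sub_distrib, e1, e2, e3, e4]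
  rcases lt_trichotomy μ ν with h4 | h4 | h4
  · rw [key 1 1 _ le_rfl, key 1 1 _ le_rfl, key ν (N + 1) _ (by omega), key (ν + 1) (N + 1) _ (by omega)]
    · simp (disch := omega) only [if_pos]
      push_cast
      ring_nf
    all_goals
      simp only [Finset.mem_Ico, Finset.mem_Icc]
      omega
  · subst h4
    rw [key 1 μ _ hμ, key 1 1 _ le_rfl, key 1 1 _ le_rfl, key (μ + 1) (N + 1) _ (by omega)]
    · simp (disch := omega) only [if_neg]
      push_cast
      ring_nf
    all_goals
      simp only [Finset.mem_Ico, Finset.mem_Icc]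
      omega
  · rw [key 1 ν _ hν, key 1 (ν + 1) _ (by omega), key 1 1 _ le_rfl, key 1 1 _ le_rfl]
    · simp (disch := omega) only [if_neg, if_pos]
      push_cast
      ring_nf
    all_goals
      simp only [Finset.mem_Ico, Finset.mem_Icc]
      omega

theorem con_kP_kM (hh : 0 < h) (hs : 0 < s) {μ ν : ℕ} (hμ : 1 ≤ μ) (hμN : μ ≤ N) (hν : 1 ≤ ν)
    (hνN : ν ≤ N) :
    con N (comm N h k) (kP N h k μ u) (kM N h k ν v) s
      = crossKernel N h μ ν (u - v) s - crossKernel N h μ ν (u - v + k * (I * h)) s := by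
  have h3 : (s : ℂ) ≠ 0 := by exact_mod_cast hs.ne'
  have h2 : (h : ℂ) ≠ 0 := by exact_mod_cast hh.ne'
  have h1 := sinh_mul_ne_zero (N := N) (by omega) hh hs
  rw [con_kP_kM_eq_add hh hs hμ hμN hν hνN, con_lamP_lamM _ hμ hμN hν hνN]
  obtain ⟨A, hA⟩ : ∃ A, A = exp (h * s / 2) := ⟨_, rfl⟩
  obtain ⟨B, hB⟩ : ∃ B, B = exp (N * (h * s) / 2) := ⟨_, rfl⟩
  obtain ⟨C, hC⟩ : ∃ C, C = exp ((k + N) * (h * s) / 2) := ⟨_, rfl⟩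
  obtain ⟨K, hK⟩ : ∃ K, K = exp (-I * (u - v) * s) := ⟨_, rfl⟩
  have hA0 : A ≠ 0 := hA ▸ exp_ne_zero _
  have hB0 : B ≠ 0 := hB ▸ exp_ne_zero _
  have hC0 : C ≠ 0 := hC ▸ exp_ne_zero _
  have ker0 : ∀ a : ℂ, ker h u v s a = K * exp (a * (h * s)) / s := fun a => by
    rw [ker, expKernel, hK, ← exp_add]; ring_nf
  have ker1 : ∀ a : ℂ, expKernel h a (u - v + k * (I * h)) s = K * exp ((k + a) * (h * s)) / s := by
    intro a
    rw [expKernel, hK, ← exp_add]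
    congr 2
    linear_combination (-(k * h * s)) * I_sq
  have x1 : exp (-(h * s)) = (A ^ 2)⁻¹ := by rw [hA, ← exp_nat_mul, ← exp_neg]; ring_nf
  have x2 : exp (h * s) = A ^ 2 := by rw [hA, ← exp_nat_mul]; ring_nf
  have x3 : exp (-N * (h * s)) = (B ^ 2)⁻¹ := by rw [hB, ← exp_nat_mul, ← exp_neg]; ring_nf
  have x4 : exp ((1 - N) * (h * s)) = A ^ 2 * (B ^ 2)⁻¹ := by rw [← x2, ← x3, ← exp_add]; ring_nf
  have x5 : exp ((-N - 1) * (h * s)) = (A ^ 2)⁻¹ * (B ^ 2)⁻¹ := by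
    rw [← x1, ← x3, ← exp_add]; ring_nf
  have x6 : exp (k * (h * s)) = C ^ 2 * (B ^ 2)⁻¹ := by
    rw [← x3, hC, ← exp_nat_mul, ← exp_add]; ring_nf
  have x7 : exp (-I * (u + (k - N) / 4 * (I * h) - (v - (k - N) / 4 * (I * h))) * s)
      = K * (C * (B ^ 2)⁻¹) := by
    rw [← x3, hC, hK, ← exp_add, ← exp_add]
    congr 1
    linear_combination (-((k - N) / 2 * h * s)) * I_sq
  have x8 : exp ((k + -1) * (h * s)) = C ^ 2 * (B ^ 2)⁻¹ * (A ^ 2)⁻¹ := by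
    rw [← x6, ← x1, ← exp_add]; ring_nf
  have x9 : exp ((k + 1) * (h * s)) = C ^ 2 * (B ^ 2)⁻¹ * A ^ 2 := by
    rw [← x6, ← x2, ← exp_add]; ring_nf
  have y1 : sinh ((k + N) / 2 * h * s) = (C - C⁻¹) / 2 := by
    rw [hC, ← exp_neg, sinh]; ring_nf
  have y2 : sinh ((N : ℂ) / 2 * h * s) = (B - B⁻¹) / 2 := by
    rw [hB, ← exp_neg, sinh]; ring_nf
  have y3 : sinh ((h : ℂ) / 2 * s) = (A - A⁻¹) / 2 := by
    rw [hA, ← exp_neg, sinh]; ring_nf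
  have y4 : sinh (((N : ℂ) - 1) / 2 * h * s) = (B * A⁻¹ - A * B⁻¹) / 2 := by
    rw [hA, hB, ← exp_neg, ← exp_neg, ← exp_add, ← exp_add, sinh]; ring_nf
  have hB1 : B ^ 2 - 1 ≠ 0 := fun hc => h1 (by
    rw [y2, show B - B⁻¹ = (B ^ 2 - 1) / B by field_simp, hc, zero_div, zero_div])
  have ker2 : ∀ a : ℂ, expKernel h a (u - v) s = K * exp (a * (h * s)) / s := ker0
  have y5 : exp (1 * ((N : ℂ) / 2 * h * s)) = B := by rw [hB]; ring_nf
  have y6 : exp (-1 * ((N : ℂ) / 2 * h * s)) = B⁻¹ := by rw [hB, ← exp_neg]; ring_nf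
  simp only [crossKernel, stepDiff, ker0, ker1, ker2, theta, comm]
  rcases lt_trichotomy μ ν with h4 | h4 | h4
  · simp (disch := omega) only [if_pos, if_neg]
    rw [show (1 : ℂ) - (N + 1) = -N by ring, show -((N : ℂ) + 1) = -N - 1 by ring,
      neg_one_mul (h * s : ℂ), x7, y1, y2, y3, y6, add_zero k, x1, x3, x4, x5, x6, x8, zero_mul, exp_zero]
    field_simp
    ring
  · subst h4
    simp only [lt_irrefl, if_true, if_false]
    rw [x7, y1, y2, y3, y4, sub_self, neg_one_mul, add_zero k, x1, x3, x4, x6, zero_mul, exp_zero]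
    field_simp
    ring
  · simp (disch := omega) only [if_pos, if_neg]
    rw [sub_self, sub_zero, neg_zero, neg_one_mul, one_mul (h * s : ℂ), x7, y1, y2, y3, y5, add_zero k, x1,
      x2, x3, x4, x6, x9, zero_mul, exp_zero]
    field_simp
    ring

end cross

section gamma_product

variable {N : ℕ} {h : ℝ} {w : ℂ}

theorem expKernel_eq_zero_mul (h : ℝ) (a w : ℂ) (s : ℝ) :
    expKernel h a w s = expKernel h 0 w s * exp (a * (h * s)) := by
  rw [expKernel, expKernel, div_mul_eq_mul_div, ← exp_add]
  ring_nf

/-- The summands of the expansion of `theta` in powers of `e^{-Nhs}`. -/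
def thetaTerm (N : ℕ) (h : ℝ) (w : ℂ) (j : ℕ) (s : ℝ) : ℂ :=
  (expKernel h (-(N * j)) w s - expKernel h (-(N * j + 1)) w s)
    + (expKernel h (-(N * j + N)) w s - expKernel h (-(N * j + (N - 1))) w s)

theorem sum_thetaTerm (hN : 0 < N) (hh : 0 < h) {s : ℝ} (hs : 0 < s) (n : ℕ) :
    ∑ j ∈ Finset.range n, thetaTerm N h w j s
      = theta N h s * expKernel h 0 w s * (1 - exp (-N * (h * s)) ^ n) := by
  have h1 : 1 - exp (-N * (h * s)) ≠ 0 := by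
    have h2 : (0 : ℝ) < N * (h * s) := by positivity
    have h3 : exp (-N * (h * s)) = (Real.exp (-(N * (h * s))) : ℝ) := by push_cast; ring_nf
    rw [h3, sub_ne_zero]
    exact_mod_cast (Real.exp_lt_one_iff.2 (neg_lt_zero.2 h2)).ne'
  have h2 : ∀ j : ℕ, thetaTerm N h w j s = (1 - exp (-(h * s))) * (1 - exp ((1 - N) * (h * s)))
      * expKernel h 0 w s * exp (-N * (h * s)) ^ j := by
    intro j
    have e1 : exp (-(h * s)) * exp ((1 - N) * (h * s)) = exp (-N * (h * s)) := by
      rw [← exp_add]; ring_nf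
    have e2 : exp (-(N * j + 1) * (h * s)) = exp (-N * (h * s)) ^ j * exp (-(h * s)) := by
      rw [← exp_nat_mul, ← exp_add]; ring_nf
    have e3 : exp (-(N * j + N) * (h * s)) = exp (-N * (h * s)) ^ j * exp (-N * (h * s)) := by
      rw [← exp_nat_mul, ← exp_add]; ring_nf
    have e4 : exp (-(N * j + (N - 1)) * (h * s))
        = exp (-N * (h * s)) ^ j * exp ((1 - N) * (h * s)) := by
      rw [← exp_nat_mul, ← exp_add]; ring_nf
    have e5 : exp (-(N * j) * (h * s)) = exp (-N * (h * s)) ^ j := by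
      rw [← exp_nat_mul]; ring_nf
    simp only [thetaTerm, expKernel_eq_zero_mul h (-(_)), e2, e3, e4, e5, ← e1]
    ring
  rw [Finset.sum_congr rfl fun j _ => h2 j, ← Finset.mul_sum, theta,
    ← geom_sum_mul_neg, div_mul_eq_mul_div, div_mul_eq_mul_div, eq_div_iff h1]
  ring

theorem norm_theta_le (hN : 0 < N) (hh : 0 < h) {s : ℝ} (hs : 0 < s) : ‖theta N h s‖ ≤ h * s := by
  have h0 : 0 < h * s := by positivity
  have hN1 : (1 : ℝ) ≤ N := by exact_mod_cast hN
  have e : theta N h s = ((1 - Real.exp (-(h * s))) * (1 - Real.exp ((1 - N) * (h * s)))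
      / (1 - Real.exp (-N * (h * s))) : ℝ) := by
    rw [theta]; push_cast; rfl
  have h1 : Real.exp (-N * (h * s)) < 1 := Real.exp_lt_one_iff.2 (by nlinarith)
  have h2 : Real.exp ((1 - N) * (h * s)) ≤ 1 := Real.exp_le_one_iff.2 (by nlinarith)
  have h3 : Real.exp (-N * (h * s)) ≤ Real.exp ((1 - N) * (h * s)) := Real.exp_le_exp.2 (by nlinarith)
  have h4 : Real.exp (-(h * s)) ≤ 1 := Real.exp_le_one_iff.2 (by linarith)
  have h5 := Real.add_one_le_exp (-(h * s))
  rw [e, norm_real, Real.norm_of_nonneg (div_nonneg (mul_nonneg (by linarith) (by linarith))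
    (by linarith)), div_le_iff₀ (by linarith)]
  exact mul_le_mul (by linarith) (by linarith) (by linarith) h0.le

theorem integral_thetaTerm (hN : 0 < N) (hh : 0 < h) (hw : w.im < 0) (j : ℕ) :
    IntegrableOn (thetaTerm N h w j) (Set.Ioi 0) ∧
      exp (∫ s in Set.Ioi 0, thetaTerm N h w j s)
        = (w / (N * (-I * h)) + j + 1 / N) * (w / (N * (-I * h)) + j + 1 - 1 / N)
          / ((w / (N * (-I * h)) + j) * (w / (N * (-I * h)) + j + 1)) := by
  have hN1 : (1 : ℝ) ≤ N := by exact_mod_cast hN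
  have hNC : (N : ℂ) ≠ 0 := by exact_mod_cast hN.ne'
  have hhC : (h : ℂ) ≠ 0 := by exact_mod_cast hh.ne'
  have hre : ∀ a : ℝ, 0 ≤ a → (-I * w + -(a : ℂ) * h).re < 0 := by
    intro a ha
    have : (-I * w + -(a : ℂ) * h).re = w.im - a * h := by simp [sub_eq_add_neg]
    rw [this]
    nlinarith [mul_nonneg ha hh.le]
  have e : ∀ a b : ℂ, (fun s => expKernel h a w s - expKernel h b w s)
      = fun s : ℝ => (exp ((-I * w + a * h) * s) - exp ((-I * w + b * h) * s)) / s := by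
    intro a b; funext s; simp only [expKernel, sub_div]
  have hj : (0 : ℝ) ≤ N * j := by positivity
  have key : ∀ a b : ℝ, 0 ≤ a → 0 ≤ b →
      IntegrableOn (fun s => expKernel h (-(a : ℂ)) w s - expKernel h (-(b : ℂ)) w s) (Set.Ioi 0) ∧
      exp (∫ s in Set.Ioi 0, (expKernel h (-(a : ℂ)) w s - expKernel h (-(b : ℂ)) w s))
        = (w / (N * (-I * h)) + b / N) / (w / (N * (-I * h)) + a / N) := by
    intro a b ha hb
    have e1 : ∀ a : ℂ, -I * w + -a * h = -(h * N) * (w / (N * (-I * h)) + a / N) := by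
      intro a
      field_simp
      linear_combination (-w) * I_sq
    rw [e]
    refine ⟨integrableOn_exp_sub_exp_div (hre a ha) (hre b hb), ?_⟩
    rw [exp_integral_exp_sub_exp_div (hre a ha) (hre b hb), e1, e1,
      mul_div_mul_left _ _ (neg_ne_zero.2 (mul_ne_zero hhC hNC))]
  have k1 := key (N * j) (N * j + 1) hj (by positivity)
  have k2 := key (N * j + N) (N * j + (N - 1)) (by positivity) (by linarith)
  push_cast at k1 k2
  refine ⟨k1.1.add k2.1, ?_⟩
  have e2 : (N * j + 1) / N = (j : ℂ) + 1 / N := by field_simp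
  have e3 : (N * j + N) / N = (j : ℂ) + 1 := by field_simp
  have e4 : (N * j + (N - 1)) / N = (j : ℂ) + 1 - 1 / N := by field_simp; ring
  simp only [thetaTerm]
  rw [integral_add k1.1 k2.1, exp_add, k1.2, k2.2, mul_div_cancel_left₀ _ hNC, e2, e3, e4,
    div_mul_div_comm]
  ring_nf

theorem prod_eq_GammaSeq {z a : ℂ} (hz : 0 < z.re) {n : ℕ} (hn : n ≠ 0) :
    ∏ j ∈ Finset.range (n + 1), ((z + j + a) * (z + j + 1 - a) / ((z + j) * (z + j + 1)))
      = GammaSeq z n * GammaSeq (1 + z) n / (GammaSeq (a + z) n * GammaSeq (1 - a + z) n) := by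
  have hn0 : (n : ℂ) ≠ 0 := by exact_mod_cast hn
  have hf : (n.factorial : ℂ) ≠ 0 := by exact_mod_cast n.factorial_ne_zero
  have e : (n : ℂ) ^ z * (n : ℂ) ^ (1 + z) = (n : ℂ) ^ (a + z) * (n : ℂ) ^ (1 - a + z) := by
    rw [← cpow_add _ _ hn0, ← cpow_add _ _ hn0]
    ring_nf
  have e1 : (n : ℂ) ^ (a + z) ≠ 0 := by simp [cpow_eq_zero_iff, hn0]
  have e2 : (n : ℂ) ^ (1 - a + z) ≠ 0 := by simp [cpow_eq_zero_iff, hn0]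
  rw [Finset.prod_div_distrib, Finset.prod_mul_distrib, Finset.prod_mul_distrib]
  simp only [GammaSeq]
  have c1 : ∀ j : ℕ, z + j + a = a + z + j := fun j => by ring
  have c2 : ∀ j : ℕ, 1 + z + j - a = 1 - a + z + j := fun j => by ring
  have c3 : ∀ j : ℕ, z + j + 1 = 1 + z + j := fun j => by ring
  simp only [c1, c2, c3]
  rw [div_mul_div_comm, div_mul_div_comm, div_div_div_eq,
    show (n : ℂ) ^ z * n.factorial * ((n : ℂ) ^ (1 + z) * n.factorial)
      = (n : ℂ) ^ (a + z) * n.factorial * ((n : ℂ) ^ (1 - a + z) * n.factorial) by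
        linear_combination (n.factorial : ℂ) ^ 2 * e,
    mul_comm (_ * _) (_ * _ * (_ * _)), mul_div_mul_left]
  exact mul_ne_zero (mul_ne_zero e1 hf) (mul_ne_zero e2 hf)

theorem integral_theta (hN : 2 ≤ N) (hh : 0 < h) (hw : w.im < 0) :
    IntegrableOn (fun s => theta N h s * expKernel h 0 w s) (Set.Ioi 0) ∧
      exp (∫ s in Set.Ioi 0, theta N h s * expKernel h 0 w s) = rho N (-I * h) w := by
  have hN0 : 0 < N := by omega
  have hN1 : (2 : ℝ) ≤ N := by exact_mod_cast hN
  set z := w / (N * (-I * h)) with hz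
  have hzre : 0 < z.re := by
    have : z = (-w.im / (N * h) : ℝ) + (w.re / (N * h) : ℝ) * I := by
      have hNC : (N : ℂ) ≠ 0 := by exact_mod_cast hN0.ne'
      have hhC : (h : ℂ) ≠ 0 := by exact_mod_cast hh.ne'
      rw [hz]
      conv_lhs => rw [← re_add_im w]
      push_cast
      field_simp
      linear_combination (-(w.re : ℂ)) * I_sq
    rw [this, add_re, ofReal_re, re_ofReal_mul, I_re, mul_zero, add_zero]
    exact div_pos (neg_pos.2 hw) (by positivity : (0 : ℝ) < N * h)
  have hb : IntegrableOn (fun s => h * Real.exp (w.im * s)) (Set.Ioi 0) := by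
    have := (integrableOn_exp_neg_mul_Ioi (neg_pos.2 hw)).const_mul h
    simp only [neg_neg] at this
    exact this
  have hnorm : ∀ s ∈ Set.Ioi (0 : ℝ), ‖theta N h s * expKernel h 0 w s‖ ≤ h * Real.exp (w.im * s) := by
    intro s hs
    have hs' : (0 : ℝ) < s := hs
    rw [norm_mul, expKernel, norm_div, norm_exp, norm_real, Real.norm_of_nonneg hs'.le,
      show ((-I * w + 0 * h) * s).re = w.im * s by simp, mul_div_assoc', div_le_iff₀ hs', mul_right_comm]
    exact mul_le_mul_of_nonneg_right (norm_theta_le hN0 hh hs) (Real.exp_pos _).le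
  have hint : ∀ n, IntegrableOn (fun s => ∑ j ∈ Finset.range n, thetaTerm N h w j s) (Set.Ioi 0) :=
    fun n => integrable_finsetSum _ fun j _ => (integral_thetaTerm hN0 hh hw j).1
  have hQ : ∀ s ∈ Set.Ioi (0 : ℝ), ‖exp (-N * (h * s))‖ < 1 := by
    intro s hs
    have hs' : (0 : ℝ) < s := hs
    rw [norm_exp, Real.exp_lt_one_iff, show (-N * (h * s) : ℂ) = ((-(N * (h * s)) : ℝ) : ℂ) by
      push_cast; ring, ofReal_re]
    exact neg_lt_zero.2 (by positivity)
  have hlim : ∀ᵐ s ∂volume.restrict (Set.Ioi (0 : ℝ)), Tendsto (fun n : ℕ =>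
      ∑ j ∈ Finset.range n, thetaTerm N h w j s) atTop (𝓝 (theta N h s * expKernel h 0 w s)) := by
    filter_upwards [ae_restrict_mem measurableSet_Ioi] with s hs
    simp only [sum_thetaTerm hN0 hh hs]
    have := ((tendsto_pow_atTop_nhds_zero_of_norm_lt_one (hQ s hs)).const_sub 1).const_mul
      (theta N h s * expKernel h 0 w s)
    simpa using this
  have hbound : ∀ n : ℕ, ∀ᵐ s ∂volume.restrict (Set.Ioi (0 : ℝ)),
      ‖∑ j ∈ Finset.range n, thetaTerm N h w j s‖ ≤ 2 * (h * Real.exp (w.im * s)) := by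
    intro n
    filter_upwards [ae_restrict_mem measurableSet_Ioi] with s hs
    rw [sum_thetaTerm hN0 hh hs, norm_mul, mul_comm]
    refine mul_le_mul ((norm_sub_le _ _).trans ?_) (hnorm s hs) (norm_nonneg _) zero_le_two
    rw [norm_one, norm_pow]
    linarith [pow_le_one₀ (n := n) (norm_nonneg _) (hQ s hs).le]
  refine ⟨(hb.mono' (aestronglyMeasurable_of_tendsto_ae atTop (fun n => (hint n).1) hlim)
    ((ae_restrict_mem measurableSet_Ioi).mono hnorm)), ?_⟩
  have t1 := (continuous_exp.tendsto _).comp (tendsto_integral_of_dominated_convergence _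
    (fun n => (hint n).1) (hb.const_mul 2) hbound hlim)
  have t2 : Tendsto (fun n => GammaSeq z n * GammaSeq (1 + z) n
      / (GammaSeq (1 / N + z) n * GammaSeq (1 - 1 / N + z) n)) atTop (𝓝 (rho N (-I * h) w)) := by
    refine ((GammaSeq_tendsto_Gamma _).mul (GammaSeq_tendsto_Gamma _)).div
      ((GammaSeq_tendsto_Gamma _).mul (GammaSeq_tendsto_Gamma _)) (mul_ne_zero ?_ ?_)
    · refine Gamma_ne_zero_of_re_pos ?_
      have : (1 / (N : ℂ)).re = 1 / N := by rw [← ofReal_natCast, ← ofReal_one, ← ofReal_div, ofReal_re]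
      rw [add_re, this]
      positivity
    · refine Gamma_ne_zero_of_re_pos ?_
      have : (1 / (N : ℂ)).re = 1 / N := by rw [← ofReal_natCast, ← ofReal_one, ← ofReal_div, ofReal_re]
      rw [add_re, sub_re, this, one_re]
      have : 1 / (N : ℝ) ≤ 1 := (div_le_one (by linarith)).2 (by linarith)
      linarith
  refine tendsto_nhds_unique (t1.comp (tendsto_add_atTop_nat 1)) (t2.congr' ?_)
  filter_upwards [eventually_ne_atTop 0] with n hn
  rw [← prod_eq_GammaSeq hzre hn]
  simp only [Function.comp]
  rw [integral_finsetSum _ fun j _ => (integral_thetaTerm hN0 hh hw j).1, exp_sum]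
  exact Finset.prod_congr rfl fun j _ => ((integral_thetaTerm hN0 hh hw j).2).symm

theorem integratesTo_crossKernel (hN : 2 ≤ N) (hh : 0 < h) (μ ν : ℕ) :
    IntegratesTo (crossKernel N h μ ν) fun w => rho N (-I * h) w * ratFactor (-I * h) μ ν w := by
  have h1 : IntegratesTo (fun w s => theta N h s * expKernel h 0 w s) fun w => rho N (-I * h) w := by
    filter_upwards [eventually_imBot_lt 0] with w hw
    exact integral_theta hN hh hw
  have h2 : IntegratesTo (fun w s => (if μ < ν then expKernel h (-1) w s - expKernel h 0 w s else 0)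
      + if ν < μ then expKernel h 0 w s - expKernel h 1 w s else 0)
      fun w => ratFactor (-I * h) μ ν w := by
    have e1 := integratesTo_expKernel h (-1) 0
    have e2 := integratesTo_expKernel h 0 1
    rcases lt_trichotomy μ ν with h4 | h4 | h4
    · simp (disch := omega) only [if_pos, if_neg, ratFactor, add_zero]
      convert e1 using 2
      ring
    · subst h4
      simp only [lt_irrefl, if_false, ratFactor, add_zero]
      exact IntegratesTo.zero
    · simp (disch := omega) only [if_pos, if_neg, ratFactor, zero_add]
      convert e2 using 2
      ring
  convert h1.add h2 using 3
  exact add_assoc _ _ _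

theorem exchangeMero_kPlus_kMinus {k : ℂ} (hN : 2 ≤ N) (hh : 0 < h) {μ ν : ℕ} (hμ : 1 ≤ μ) (hμN : μ ≤ N)
    (hν : 1 ≤ ν) (hνN : ν ≤ N) : ExchangeMero (fockSpace N) (fockDual N h)
      (fun w => rho N (-I * h) (w - k * (-I * h)) * ratFactor (-I * h) μ ν (w - k * (-I * h)))
      (fun w => ratFactor (-I * h) μ ν w * rho N (-I * h) w) (kPlus N h k μ) (kMinus N h k ν) := by
  have hH := comm_regular (k := k) (show 0 < N by omega) hh
  have hR := integratesTo_crossKernel hN hh μ ν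
  obtain ⟨C, hC⟩ := eventually_imBot.1 (hR.and (hR.comp_add (k * (I * h))))
  have hX := isVertex_kP (N := N) (h := h) (k := k) μ
  have hY := isVertex_kM (N := N) (h := h) (k := k) ν
  refine ⟨C, fun Φ hΦ ξ hξ v => ⟨fun u => ratFactor (-I * h) μ ν (u - v) * rho N (-I * h) (u - v)
    * normalExp N (comm N h k) (kP N h k μ u + kM N h k ν v) Φ ξ, ?_, fun u hu => ?_, fun u _ => ?_⟩⟩
  · have hA : ∀ a : ℂ, MeromorphicOn (fun u => Gamma (a + (u - v) / (N * (-I * h)))) Set.univ := by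
      intro a u _
      exact (Meromorphic.Gamma _).comp_analyticAt
        (Differentiable.analyticAt (f := fun u : ℂ => a + (u - v) / (N * (-I * h))) (by fun_prop) u)
    have hG : MeromorphicOn (fun u => normalExp N (comm N h k) (kP N h k μ u + kM N h k ν v) Φ ξ)
        Set.univ := fun u _ => ((((hX.isHolomorphic hH).add ((hY.isHolomorphic hH).comp
          (differentiable_const v))).normalExp hΦ hξ.1).analyticAt u).meromorphicAt
    have h0 := hA 0
    simp only [zero_add] at h0
    refine MeromorphicOn.mul (MeromorphicOn.mul ?_ ((h0.mul (hA _)).div ((hA _).mul (hA _)))) hG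
    unfold ratFactor
    split_ifs
    all_goals intro u _; fun_prop
  · obtain ⟨c1, c2⟩ := hC (u - v) (by rw [sub_im]; linarith)
    have e1 : Set.EqOn (con N (comm N h k) (kP N h k μ u) (kM N h k ν v))
        (fun s => crossKernel N h μ ν (u - v) s - crossKernel N h μ ν (u - v + k * (I * h)) s)
        (Set.Ioi 0) := fun s hs => con_kP_kM hh hs hμ hμN hν hνN
    have e2 : u - v - k * (-I * h) = u - v + k * (I * h) := by ring
    rw [kPlus_eq_normalExp, kMinus_eq_normalExp, normalExp_mul_of_integrable hH hX hY
      ((c1.1.sub c2.1).congr_fun e1.symm measurableSet_Ioi) Φ hξ.1]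
    dsimp only at c1 c2 ⊢
    rw [setIntegral_congr_fun measurableSet_Ioi e1, integral_sub c1.1 c2.1, exp_sub, c1.2, e2, ← c2.2,
      ← mul_assoc, mul_div_cancel₀ _ (exp_ne_zero _)]
    ring
  · have e1 : con N (comm N h k) (kM N h k ν v) (kP N h k μ u) = 0 :=
      funext fun s => con_eq_zero_of_fst (kP_fst _ _) s
    rw [kPlus_eq_normalExp, kMinus_eq_normalExp, normalExp_mul_of_integrable hH hY hX
      (e1 ▸ integrableOn_zero) Φ hξ.1, e1, add_comm (kM _ _ _ _ _)]
    simp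

end gamma_product

/-! ### Kernels depending on the deformation parameter -/

section kernel_limit

/-- The kernels `f h` converge, locally uniformly in the positive parameter, to `g` as `h → 0⁺`. -/
structure TendstoKernel (f : ℝ → ℝ → ℂ) (g : ℝ → ℂ) : Prop where
  continuousOn : ∀ h : ℝ, 0 < h → ContinuousOn (f h) (Set.Ioi 0)
  continuousOn_limit : ContinuousOn g (Set.Ioi 0)
  tendsto : ∀ s : ℝ, 0 < s → Tendsto (fun p : ℝ × ℝ => f p.1 p.2) (𝓝[>] 0 ×ˢ 𝓝 s) (𝓝 (g s))

variable {f f' : ℝ → ℝ → ℂ} {g g' : ℝ → ℂ}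

theorem eventually_pos_prod {s : ℝ} (hs : 0 < s) :
    ∀ᶠ p : ℝ × ℝ in 𝓝[>] 0 ×ˢ 𝓝 s, 0 < p.1 ∧ 0 < p.2 :=
  (eventually_mem_nhdsWithin (a := (0 : ℝ)) (s := Set.Ioi 0)).prod_mk (lt_mem_nhds hs)

theorem TendstoKernel.congr (hf : TendstoKernel f g)
    (h1 : ∀ h s : ℝ, 0 < h → 0 < s → f' h s = f h s) (h2 : ∀ s : ℝ, 0 < s → g' s = g s) :
    TendstoKernel f' g' where
  continuousOn h hh := (hf.1 h hh).congr fun s hs => h1 h s hh hs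
  continuousOn_limit := hf.2.congr h2
  tendsto s hs := by
    rw [h2 s hs]
    exact (hf.3 s hs).congr' ((eventually_pos_prod hs).mono fun p hp => (h1 _ _ hp.1 hp.2).symm)

theorem TendstoKernel.const (hg : ContinuousOn g (Set.Ioi 0)) : TendstoKernel (fun _ => g) g :=
  ⟨fun _ _ => hg, hg, fun s hs => (hg.continuousAt (Ioi_mem_nhds hs)).tendsto.comp tendsto_snd⟩

theorem TendstoKernel.add (hf : TendstoKernel f g) (hf' : TendstoKernel f' g') :
    TendstoKernel (fun h s => f h s + f' h s) fun s => g s + g' s :=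
  ⟨fun h hh => (hf.1 h hh).add (hf'.1 h hh), hf.2.add hf'.2, fun s hs => (hf.3 s hs).add (hf'.3 s hs)⟩

theorem TendstoKernel.mul (hf : TendstoKernel f g) (hf' : TendstoKernel f' g') :
    TendstoKernel (fun h s => f h s * f' h s) fun s => g s * g' s :=
  ⟨fun h hh => (hf.1 h hh).mul (hf'.1 h hh), hf.2.mul hf'.2, fun s hs => (hf.3 s hs).mul (hf'.3 s hs)⟩

theorem TendstoKernel.neg (hf : TendstoKernel f g) :
    TendstoKernel (fun h s => -f h s) fun s => -g s :=
  ⟨fun h hh => (hf.1 h hh).neg, hf.2.neg, fun s hs => (hf.3 s hs).neg⟩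

theorem TendstoKernel.inv (hf : TendstoKernel f g) (h1 : ∀ h s : ℝ, 0 < h → 0 < s → f h s ≠ 0)
    (h2 : ∀ s : ℝ, 0 < s → g s ≠ 0) : TendstoKernel (fun h s => (f h s)⁻¹) fun s => (g s)⁻¹ :=
  ⟨fun h hh => (hf.1 h hh).inv₀ fun s hs => h1 h s hh hs, hf.2.inv₀ h2,
    fun s hs => (hf.3 s hs).inv₀ (h2 s hs)⟩

theorem TendstoKernel.zero : TendstoKernel (fun _ _ => 0) fun _ => 0 := .const continuousOn_const

theorem TendstoKernel.sum {ι : Type*} (S : Finset ι) {f : ι → ℝ → ℝ → ℂ} {g : ι → ℝ → ℂ}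
    (hf : ∀ i, TendstoKernel (f i) (g i)) :
    TendstoKernel (fun h s => ∑ i ∈ S, f i h s) fun s => ∑ i ∈ S, g i s :=
  ⟨fun h hh => continuousOn_finsetSum _ fun i _ => (hf i).1 h hh,
    continuousOn_finsetSum _ fun i _ => (hf i).2, fun s hs => tendsto_finsetSum _ fun i _ => (hf i).3 s hs⟩

theorem tendsto_mul_mul_prod (c : ℂ) (s : ℝ) :
    Tendsto (fun p : ℝ × ℝ => c * p.1 * p.2) (𝓝[>] 0 ×ˢ 𝓝 s) (𝓝 0) := by
  have h1 : ContinuousAt (fun p : ℝ × ℝ => c * p.1 * p.2) (0, s) := by fun_prop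
  have h2 : 𝓝[>] (0 : ℝ) ×ˢ 𝓝 s ≤ 𝓝 (0, s) := by
    rw [nhds_prod_eq]
    exact Filter.prod_mono_left _ nhdsWithin_le_nhds
  simpa [ContinuousAt] using h1.tendsto.mono_left h2

theorem tendstoKernel_comp {φ : ℂ → ℂ} (hφ : Continuous φ) (c : ℂ) :
    TendstoKernel (fun h s => φ (c * h * s)) fun _ => φ 0 :=
  ⟨fun h _ => by fun_prop, continuousOn_const,
    fun s _ => (hφ.tendsto 0).comp (tendsto_mul_mul_prod c s)⟩

theorem tendstoKernel_div {φ : ℂ → ℂ} {d : ℂ} (hφ : HasDerivAt φ d 0) (h0 : φ 0 = 0) (c : ℂ)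
    (hc : ∀ h : ℝ, 0 < h → ContinuousOn (fun s : ℝ => φ (c * h * s)) (Set.Ioi 0)) :
    TendstoKernel (fun h s => φ (c * h * s) / h) fun s => c * s * d := by
  refine ⟨fun h hh => (hc h hh).div_const _, by fun_prop, fun s hs => ?_⟩
  have h1 := (continuousAt_dslope_same.2 hφ.differentiableAt).tendsto.comp (tendsto_mul_mul_prod c s)
  rw [dslope_same, hφ.deriv] at h1
  have h2 : Tendsto (fun p : ℝ × ℝ => c * p.2) (𝓝[>] 0 ×ˢ 𝓝 s) (𝓝 (c * s)) :=
    tendsto_const_nhds.mul ((continuous_ofReal.tendsto s).comp tendsto_snd)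
  refine (h2.mul h1).congr' ((eventually_pos_prod hs).mono fun p hp => ?_)
  have h3 := sub_smul_dslope φ 0 (c * p.1 * p.2)
  rw [sub_zero, h0, sub_zero, smul_eq_mul] at h3
  have h4 : (p.1 : ℂ) ≠ 0 := by exact_mod_cast hp.1.ne'
  dsimp only [Function.comp]
  rw [← h3]
  field_simp

theorem tendstoKernel_sinh (c : ℂ) : TendstoKernel (fun h s => sinh (c * h * s) / h) fun s => c * s := by
  have h1 := tendstoKernel_div (by simpa using Complex.hasDerivAt_sinh 0) Complex.sinh_zero c
    fun h _ => by fun_prop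
  exact h1.congr (fun _ _ _ _ => rfl) fun s _ => by rw [mul_one]

theorem tendstoKernel_sinh_inv {c : ℂ} (hc : c ≠ 0)
    (h1 : ∀ h s : ℝ, 0 < h → 0 < s → sinh (c * h * s) ≠ 0) :
    TendstoKernel (fun h s => (sinh (c * h * s) / h)⁻¹) fun s => (c * s)⁻¹ :=
  (tendstoKernel_sinh c).inv
    (fun h s hh hs => div_ne_zero (h1 h s hh hs) (by exact_mod_cast hh.ne'))
    fun s hs => mul_ne_zero hc (by exact_mod_cast hs.ne')

theorem tendstoKernel_lam {N : ℕ} (hN : 0 < N) (k : ℂ) (μ ν : ℕ) :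
    TendstoKernel (fun h => (comm N h k).lam μ ν) ((commClassical N k).lam μ ν) := by
  have hNC : (N : ℂ) ≠ 0 := by exact_mod_cast hN.ne'
  have hS := (tendstoKernel_sinh ((k + N) / 2)).mul
    (tendstoKernel_sinh_inv (c := (N : ℂ) / 2) (by simpa using hNC) fun h s => sinh_mul_ne_zero hN)
  have h2 : TendstoKernel (fun h s => sinh ((h : ℂ) / 2 * s) / h) fun s => (s : ℂ) / 2 :=
    (tendstoKernel_sinh (1 / 2)).congr (fun h s _ _ => by ring_nf) fun s _ => by ring
  have h3 : TendstoKernel (fun _ s => (s : ℂ)⁻¹) fun s => (s : ℂ)⁻¹ :=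
    .const fun s hs => (continuousAt_inv₀ (by exact_mod_cast (ne_of_gt hs))).comp_continuousWithinAt
      (by fun_prop)
  by_cases hμν : μ = ν
  · simp only [comm, commClassical, if_pos hμν]
    refine ((hS.mul (tendstoKernel_sinh (((N : ℂ) - 1) / 2))).mul (h2.mul h3)).congr
      (fun h s hh hs => ?_) fun s hs => ?_
    · have h4 := sinh_mul_ne_zero hN hh hs
      have h5 : (h : ℂ) ≠ 0 := by exact_mod_cast hh.ne'
      field_simp
    · have h6 : (s : ℂ) ≠ 0 := by exact_mod_cast hs.ne'
      field_simp
      norm_num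
  · simp only [comm, commClassical, if_neg hμν]
    refine (((hS.mul (h2.mul h2)).mul h3).neg.mul (tendstoKernel_comp continuous_exp
      ((if ν < μ then 1 else -1) * ((N : ℂ) / 2)))).congr (fun h s hh hs => ?_) fun s hs => ?_
    · have h4 := sinh_mul_ne_zero hN hh hs
      have h5 : (h : ℂ) ≠ 0 := by exact_mod_cast hh.ne'
      rw [show ∀ a : ℂ, a * ((N : ℂ) / 2) * h * s = a * (N / 2 * h * s) by intro a; ring]
      field_simp
    · have h6 : (s : ℂ) ≠ 0 := by exact_mod_cast hs.ne'
      rw [exp_zero]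
      field_simp
      norm_num

theorem tendstoKernel_ghost {N : ℕ} (k : ℂ) :
    TendstoKernel (fun h => (comm N h k).ghost) (commClassical N k).ghost := by
  have h3 : TendstoKernel (fun _ s => (s : ℂ)⁻¹) fun s => (s : ℂ)⁻¹ :=
    .const fun s hs => (continuousAt_inv₀ (by exact_mod_cast (ne_of_gt hs))).comp_continuousWithinAt
      (by fun_prop)
  refine (((tendstoKernel_sinh (1 / 2)).mul (tendstoKernel_sinh (1 / 2))).mul h3).congr
    (fun h s hh hs => ?_) fun s hs => ?_
  · rw [show (1 / 2 : ℂ) * h * s = h * s / 2 by ring, comm]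
    ring
  · have h6 : (s : ℂ) ≠ 0 := by exact_mod_cast hs.ne'
    simp only [commClassical]
    field_simp
    norm_num

theorem TendstoKernel.exists_bound (hf : TendstoKernel f g) {K : Set ℝ} (hK : IsCompact K)
    (hK0 : K ⊆ Set.Ioi 0) : ∃ C : ℝ, ∀ᶠ h in 𝓝[>] (0 : ℝ), ∀ s ∈ K, ‖f h s‖ ≤ C := by
  refine hK.induction_on (p := fun K => ∃ C : ℝ, ∀ᶠ h in 𝓝[>] (0 : ℝ), ∀ s ∈ K, ‖f h s‖ ≤ C)
    ⟨0, by simp⟩ (fun S T hST ⟨C, hC⟩ => ⟨C, hC.mono fun h hh s hs => hh s (hST hs)⟩)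
    (fun S T ⟨C, hC⟩ ⟨D, hD⟩ => ⟨max C D, ?_⟩) fun s hs => ?_
  · filter_upwards [hC, hD] with h h1 h2 s hs
    exact hs.elim (fun hs => (h1 s hs).trans (le_max_left _ _)) fun hs => (h2 s hs).trans (le_max_right _ _)
  · have h1 := (hf.3 s (hK0 hs)).norm.eventually (ge_mem_nhds (lt_add_one _))
    obtain ⟨p, hp, q, hq, hpq⟩ := eventually_prod_iff.1 h1
    exact ⟨{s | q s}, mem_nhdsWithin_of_mem_nhds hq, _, hp.mono fun h hh s hs => hpq hh hs⟩

theorem TendstoKernel.tendsto_integral (hf : TendstoKernel f g) {η : ℝ → ℂ} (hη : IsSmearing η) :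
    Tendsto (fun h => ∫ s in Set.Ioi (0 : ℝ), f h s * η s) (𝓝[>] 0)
      (𝓝 (∫ s in Set.Ioi (0 : ℝ), g s * η s)) := by
  obtain ⟨C, hC⟩ := hf.exists_bound hη.2.1 hη.2.2
  refine tendsto_integral_filter_of_dominated_convergence (fun s => C * ‖η s‖) ?_ ?_
    (hη.integrable.norm.const_mul C) ?_
  · filter_upwards [eventually_mem_nhdsWithin] with h hh
    exact (hη.continuousOn_mul (hf.1 h hh)).integrable.1
  · filter_upwards [hC] with h hh
    refine Eventually.of_forall fun s => ?_
    by_cases hs : s ∈ tsupport η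
    · rw [norm_mul]
      exact mul_le_mul_of_nonneg_right (hh s hs) (norm_nonneg _)
    · simp [image_eq_zero_of_notMem_tsupport hs]
  · filter_upwards [ae_restrict_mem measurableSet_Ioi] with s hs
    exact ((hf.3 s hs).comp (tendsto_id.prodMk tendsto_const_nhds)).mul_const _

end kernel_limit

section exponent_limit

variable {N : ℕ} {k : ℂ}

/-- Convergence of all components of a profile. -/
def TendstoProfile (ζ : ℝ → Profile) (ζ₀ : Profile) : Prop :=
  ∀ m, TendstoKernel (fun h => ζ h m) (ζ₀ m)

theorem TendstoProfile.twist {ξ : Profile} (hξ : ∀ m, IsSmearing (ξ m)) :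
    TendstoProfile (fun h => twist h ξ) ξ := by
  have h1 : ∀ m, TendstoKernel (fun _ => ξ m) (ξ m) := fun m => .const (hξ m).1.continuousOn
  rintro (μ | ⟨μ, ν⟩ | ⟨μ, ν⟩)
  · exact ((tendstoKernel_comp continuous_exp (1 - (μ : ℂ))).mul (h1 _)).congr (fun _ _ _ _ => rfl)
      fun s _ => by rw [exp_zero, one_mul]
  · exact h1 _
  · exact h1 _

theorem TendstoProfile.shift (hN : 0 < N) {ζ : ℝ → Profile} {ζ₀ : Profile} (hζ : TendstoProfile ζ ζ₀) :
    TendstoProfile (fun h => shift N (comm N h k) (ζ h)) (shift N (commClassical N k) ζ₀) := by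
  rintro (ν | ⟨μ, ν⟩ | ⟨μ, ν⟩)
  · exact .sum _ fun μ => (hζ _).mul (tendstoKernel_lam hN k μ ν)
  · exact ((hζ _).mul (tendstoKernel_ghost k)).neg
  · exact (hζ _).mul (tendstoKernel_ghost k)

theorem pairing_eq_sum {f ξ : Profile} (hf : ∀ m, ContinuousOn (f m) (Set.Ioi 0))
    (hξ : ∀ m, IsSmearing (ξ m)) : pairing N f ξ
      = (∑ μ ∈ Finset.Icc 1 N, ∫ s in Set.Ioi (0 : ℝ), f (.lam μ) s * ξ (.lam μ) s)
        + ∑ μ ∈ Finset.Icc 1 N, ∑ ν ∈ Finset.Ioc μ N,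
          ((∫ s in Set.Ioi (0 : ℝ), f (.b μ ν) s * ξ (.b μ ν) s)
            + ∫ s in Set.Ioi (0 : ℝ), f (.c μ ν) s * ξ (.c μ ν) s) := by
  have h1 : ∀ m, IntegrableOn (fun s => f m s * ξ m s) (Set.Ioi 0) :=
    fun m => ((hξ m).continuousOn_mul (hf m)).integrable
  have h2 : ∀ μ, IntegrableOn (fun s => ∑ ν ∈ Finset.Ioc μ N,
      (f (.b μ ν) s * ξ (.b μ ν) s + f (.c μ ν) s * ξ (.c μ ν) s)) (Set.Ioi 0) :=
    fun μ => integrable_finsetSum _ fun ν _ => (h1 _).add (h1 _)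
  rw [pairing, integral_add (integrable_finsetSum _ fun μ _ => h1 _) (integrable_finsetSum _ fun μ _ => h2 μ),
    integral_finsetSum _ fun μ _ => h1 _, integral_finsetSum _ fun μ _ => h2 μ]
  congr 1
  refine Finset.sum_congr rfl fun μ _ => ?_
  exact (integral_finsetSum _ fun ν _ => (h1 _).add (h1 _)).trans
    (Finset.sum_congr rfl fun ν _ => integral_add (h1 _) (h1 _))

theorem isSmearing_twist {ξ : Profile} (hξ : ∀ m, IsSmearing (ξ m)) (h : ℝ) (m : Mode) :
    IsSmearing (twist h ξ m) := by
  rcases m with μ | ⟨μ, ν⟩ | ⟨μ, ν⟩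
  · exact (hξ _).continuousOn_mul (by fun_prop)
  · exact hξ _
  · exact hξ _

theorem TendstoProfile.tendsto_pairing {ζ : ℝ → Profile} {ζ₀ ξ : Profile} (hζ : TendstoProfile ζ ζ₀)
    (hξ : ∀ m, IsSmearing (ξ m)) :
    Tendsto (fun h => pairing N (ζ h) (BosonYangian.twist h ξ)) (𝓝[>] 0) (𝓝 (pairing N ζ₀ ξ)) := by
  have h1 : Tendsto (fun h => pairing N (fun m => (BosonYangian.twist h fun m s => ζ h m s) m) ξ) (𝓝[>] 0)
      (𝓝 (pairing N ζ₀ ξ)) := by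
    have h2 : TendstoProfile (fun h => BosonYangian.twist h (ζ h)) ζ₀ := by
      rintro (μ | ⟨μ, ν⟩ | ⟨μ, ν⟩)
      · exact ((tendstoKernel_comp continuous_exp (1 - (μ : ℂ))).mul (hζ _)).congr (fun _ _ _ _ => rfl)
          fun s _ => by rw [exp_zero, one_mul]
      · exact hζ _
      · exact hζ _
    rw [pairing_eq_sum (fun m => (h2 m).2) hξ]
    refine Tendsto.congr' ((eventually_mem_nhdsWithin).mono fun h hh =>
      (pairing_eq_sum (fun m => (h2 m).1 h hh) hξ).symm) ?_
    exact (tendsto_finsetSum _ fun μ _ => (h2 _).tendsto_integral (hξ _)).add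
      (tendsto_finsetSum _ fun μ _ => tendsto_finsetSum _ fun ν _ =>
        ((h2 _).tendsto_integral (hξ _)).add ((h2 _).tendsto_integral (hξ _)))
  refine h1.congr fun h => ?_
  simp only [pairing, BosonYangian.twist, mul_assoc, mul_left_comm]

/-- A difference of states at two nearby points, divided by the distance, tends to the derivative. -/
theorem tendsto_state {Φ : State} (hΦ : Φ ∈ fockSpace N) {ζ ω : ℝ → Profile} {ζ₀ κ : Profile}
    (hζ : TendstoProfile ζ ζ₀) (hω : TendstoProfile ω ζ₀)
    (hκ : TendstoProfile (fun h => (1 / (h : ℂ)) • (ζ h - ω h)) κ) :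
    Tendsto (fun h => Φ (ζ h)) (𝓝[>] 0) (𝓝 (Φ ζ₀)) ∧ Tendsto (fun h => Φ (ω h)) (𝓝[>] 0) (𝓝 (Φ ζ₀)) ∧
      ∃ d, HasDerivAt (fun ε : ℂ => Φ (ζ₀ + ε • κ)) d 0 ∧
        Tendsto (fun h : ℝ => (1 / (h : ℂ)) * (Φ (ζ h) - Φ (ω h))) (𝓝[>] 0) (𝓝 d) := by
  induction hΦ using Algebra.adjoin_induction with
  | mem Φ hΦ =>
    obtain ⟨m, -, η, hη, rfl⟩ := hΦ
    have hi : ∀ {f : ℝ → ℂ}, ContinuousOn f (Set.Ioi 0) →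
        IntegrableOn (fun s => η s * f s) (Set.Ioi 0) := fun hf => by
      simp only [mul_comm (η _)]
      exact (hη.continuousOn_mul hf).integrable
    have ht : ∀ {f : ℝ → ℝ → ℂ} {g}, TendstoKernel f g → Tendsto (fun h => ∫ s in Set.Ioi (0 : ℝ), η s * f h s)
        (𝓝[>] 0) (𝓝 (∫ s in Set.Ioi (0 : ℝ), η s * g s)) := fun hf => by
      simp only [mul_comm (η _)]
      exact hf.tendsto_integral hη
    refine ⟨ht (hζ m), ht (hω m), ∫ s in Set.Ioi (0 : ℝ), η s * κ m s, ?_, (ht (hκ m)).congr' ?_⟩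
    · have e : (fun ε : ℂ => ∫ s in Set.Ioi (0 : ℝ), η s * (ζ₀ + ε • κ) m s) = fun ε =>
          (∫ s in Set.Ioi (0 : ℝ), η s * ζ₀ m s) + ε * ∫ s in Set.Ioi (0 : ℝ), η s * κ m s := by
        funext ε
        rw [← integral_const_mul, ← integral_add (hi (hζ m).2) ((hi (hκ m).2).const_mul ε)]
        congr 1
        funext s
        simp only [Pi.add_apply, Pi.smul_apply, smul_eq_mul]
        ring
      simp only [e]
      simpa using ((hasDerivAt_id (0 : ℂ)).mul_const (∫ s in Set.Ioi (0 : ℝ), η s * κ m s)).const_add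
        (∫ s in Set.Ioi (0 : ℝ), η s * ζ₀ m s)
    · filter_upwards [eventually_mem_nhdsWithin] with h hh
      rw [← integral_sub (hi ((hζ m).1 h hh)) (hi ((hω m).1 h hh)), ← integral_const_mul]
      congr 1
      funext s
      simp only [Pi.smul_apply, Pi.sub_apply, smul_eq_mul]
      ring
  | algebraMap r =>
    refine ⟨tendsto_const_nhds, tendsto_const_nhds, 0, hasDerivAt_const _ _, ?_⟩
    simpa [Pi.algebraMap_apply] using tendsto_const_nhds
  | add Φ Ψ _ _ h1 h2 =>
    obtain ⟨a1, b1, d1, e1, f1⟩ := h1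
    obtain ⟨a2, b2, d2, e2, f2⟩ := h2
    refine ⟨a1.add a2, b1.add b2, d1 + d2, e1.add e2, (f1.add f2).congr fun h => ?_⟩
    simp only [Pi.add_apply]
    ring
  | mul Φ Ψ _ _ h1 h2 =>
    obtain ⟨a1, b1, d1, e1, f1⟩ := h1
    obtain ⟨a2, b2, d2, e2, f2⟩ := h2
    refine ⟨a1.mul a2, b1.mul b2, _, e1.mul e2, ?_⟩
    simp only [zero_smul, add_zero]
    refine ((f1.mul a2).add (b1.mul f2)).congr fun h => ?_
    simp only [Pi.mul_apply]
    ring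

theorem tendsto_exp_sub_exp_div {A B : ℝ → ℂ} {A₀ a : ℂ} (hB : Tendsto B (𝓝[>] 0) (𝓝 A₀))
    (ha : Tendsto (fun h : ℝ => (1 / (h : ℂ)) * (A h - B h)) (𝓝[>] 0) (𝓝 a)) :
    Tendsto (fun h : ℝ => (1 / (h : ℂ)) * (exp (A h) - exp (B h))) (𝓝[>] 0) (𝓝 (exp A₀ * a)) := by
  have h0 : Tendsto (fun h : ℝ => (h : ℂ) * ((1 / (h : ℂ)) * (A h - B h))) (𝓝[>] 0) (𝓝 0) := by
    have := ((continuous_ofReal.tendsto 0).mono_left nhdsWithin_le_nhds).mul ha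
    rwa [ofReal_zero, zero_mul] at this
  have h1 := (continuousAt_dslope_same.2 (differentiable_exp 0)).tendsto.comp h0
  rw [dslope_same, (hasDerivAt_exp 0).deriv, exp_zero] at h1
  have h2 := ((continuous_exp.tendsto _).comp hB).mul (ha.mul h1)
  rw [mul_one] at h2
  refine h2.congr' (eventually_mem_nhdsWithin.mono fun h hh => ?_)
  have hh0 : (h : ℂ) ≠ 0 := by exact_mod_cast (ne_of_gt hh)
  have h3 := sub_smul_dslope exp 0 (A h - B h)
  rw [sub_zero, exp_zero, smul_eq_mul] at h3
  have h4 : exp (A h) = exp (B h) * exp (A h - B h) := by rw [← exp_add, add_sub_cancel]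
  have h5 : (h : ℂ) * ((1 / (h : ℂ)) * (A h - B h)) = A h - B h := by field_simp
  simp only [Function.comp, h5]
  rw [h4]
  linear_combination exp (B h) * (1 / (h : ℂ)) * h3

/-- Componentwise convergence of exponents. -/
def TendstoExponent (Z : ℝ → Exponent) (L : Exponent) : Prop :=
  TendstoProfile (fun h => (Z h).1) L.1 ∧ TendstoProfile (fun h => (Z h).2) L.2

/-- `Z h = L + h J + o(h)`. -/
structure HasExpansion (Z : ℝ → Exponent) (L J : Exponent) : Prop where
  const : TendstoExponent (fun _ => L) L
  tendsto : TendstoExponent (fun h => (1 / (h : ℂ)) • (Z h - L)) J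

variable {Z W : ℝ → Exponent} {L L' M J J' K : Exponent}

theorem TendstoExponent.add (hZ : TendstoExponent Z L) (hW : TendstoExponent W M) :
    TendstoExponent (fun h => Z h + W h) (L + M) :=
  ⟨fun m => (hZ.1 m).add (hW.1 m), fun m => (hZ.2 m).add (hW.2 m)⟩

theorem TendstoExponent.neg (hZ : TendstoExponent Z L) : TendstoExponent (fun h => -Z h) (-L) :=
  ⟨fun m => (hZ.1 m).neg, fun m => (hZ.2 m).neg⟩

theorem HasExpansion.add (hZ : HasExpansion Z L J) (hW : HasExpansion W M J') :
    HasExpansion (fun h => Z h + W h) (L + M) (J + J') := by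
  refine ⟨hZ.1.add hW.1, ?_⟩
  simpa only [add_sub_add_comm, smul_add] using hZ.2.add hW.2

theorem HasExpansion.neg (hZ : HasExpansion Z L J) : HasExpansion (fun h => -Z h) (-L) (-J) := by
  refine ⟨hZ.1.neg, ?_⟩
  simpa only [← neg_sub', smul_neg] using hZ.2.neg

theorem HasExpansion.sub (hZ : HasExpansion Z L J) (hW : HasExpansion W M J') :
    HasExpansion (fun h => Z h - W h) (L - M) (J - J') := by
  simpa only [sub_eq_add_neg] using hZ.add hW.neg

theorem HasExpansion.zero : HasExpansion (fun _ => 0) 0 0 := by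
  have h1 : TendstoExponent (fun _ => 0) 0 := ⟨fun _ => .zero, fun _ => .zero⟩
  refine ⟨h1, ?_⟩
  simpa only [sub_zero, smul_zero] using h1

theorem HasExpansion.sum {ι : Type*} (S : Finset ι) {Z : ι → ℝ → Exponent} {L J : ι → Exponent}
    (hZ : ∀ i, HasExpansion (Z i) (L i) (J i)) :
    HasExpansion (fun h => ∑ i ∈ S, Z i h) (∑ i ∈ S, L i) (∑ i ∈ S, J i) := by
  classical
  induction S using Finset.induction_on with
  | empty => simpa only [Finset.sum_empty] using HasExpansion.zero
  | insert i S hi h1 => simpa only [Finset.sum_insert hi] using (hZ i).add h1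

theorem HasExpansion.tendstoExponent (hZ : HasExpansion Z L J) : TendstoExponent Z L := by
  have h1 : TendstoKernel (fun h s => (h : ℂ)) fun _ => 0 :=
    ⟨fun _ _ => continuousOn_const, continuousOn_const, fun s _ =>
      ((continuous_ofReal.tendsto 0).mono_left nhdsWithin_le_nhds).comp tendsto_fst⟩
  have h2 : ∀ h : ℝ, 0 < h → ∀ a b : ℂ, b = a + h * ((1 / (h : ℂ)) * (b - a)) := fun h hh a b => by
    have : (h : ℂ) ≠ 0 := by exact_mod_cast hh.ne'
    field_simp
    ring
  exact ⟨fun m => ((hZ.1.1 m).add (h1.mul (hZ.2.1 m))).congr (fun h s hh _ => h2 h hh _ _)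
      fun s _ => by rw [zero_mul, add_zero],
    fun m => ((hZ.1.2 m).add (h1.mul (hZ.2.2 m))).congr (fun h s hh _ => h2 h hh _ _)
      fun s _ => by rw [zero_mul, add_zero]⟩

theorem HasExpansion.tendsto_normalExp (hN : 0 < N) {Φ : State} (hΦ : Φ ∈ fockSpace N) {ξ : Profile}
    (hξ : ∀ m, IsSmearing (ξ m)) (hZ : HasExpansion Z L J) (hW : HasExpansion W L' J')
    (hL : L = M) (hL' : L' = M) (hK : J - J' = K) :
    Tendsto (fun h : ℝ => (1 / (h : ℂ)) * (normalExp N (comm N h k) (Z h) Φ (twist h ξ)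
      - normalExp N (comm N h k) (W h) Φ (twist h ξ))) (𝓝[>] 0)
      (𝓝 (normalLinExp N (commClassical N k) K M Φ ξ)) := by
  subst hL hK hL'
  have h1 := hZ.tendstoExponent
  have h2 := hW.tendstoExponent
  have h3 : TendstoExponent (fun h => (1 / (h : ℂ)) • (Z h - W h)) (J - J') := by
    have := hZ.2.add hW.2.neg
    simpa only [← sub_eq_add_neg, ← smul_sub, sub_sub_sub_cancel_right] using this
  have h4 : ∀ {Z : ℝ → Exponent}, TendstoExponent Z L' → TendstoProfile (fun h => twist h ξ
      + shift N (comm N h k) (Z h).2) (ξ + shift N (commClassical N k) L'.2) :=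
    fun hZ m => (TendstoProfile.twist hξ m).add (hZ.2.shift hN m)
  obtain ⟨a, b, d, e, f⟩ := tendsto_state hΦ (h4 h1) (h4 h2) (κ := shift N (commClassical N k) (J - J').2) (by
    have := h3.2.shift (k := k) hN
    simp only [Prod.smul_snd, Prod.snd_sub, shift_smul] at this
    simp only [add_sub_add_left_eq_sub, ← sub_eq_add_neg, Prod.snd_sub]
    refine fun m => (this m).congr (fun h s _ _ => ?_) fun _ _ => rfl
    simp only [sub_eq_add_neg, shift_add, shift_neg])
  have p1 := h2.1.tendsto_pairing (N := N) hξ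
  have p2 : Tendsto (fun h : ℝ => (1 / (h : ℂ)) * (pairing N (Z h).1 (twist h ξ)
      - pairing N (W h).1 (twist h ξ))) (𝓝[>] 0) (𝓝 (pairing N (J - J').1 ξ)) := by
    refine (h3.1.tendsto_pairing hξ).congr' (eventually_mem_nhdsWithin.mono fun h hh => ?_)
    have i1 : ∀ {Z : ℝ → Exponent}, TendstoExponent Z L' →
        IntegrableOn (pairAt N (Z h).1 (twist h ξ)) (Set.Ioi 0) := fun hZ =>
      (isSmearing_pairAt (fun m => (hZ.1 m).1 h hh) (isSmearing_twist hξ h)).integrable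
    simp only [pairing_eq]
    rw [← integral_sub (i1 h1) (i1 h2), ← integral_const_mul, Prod.smul_fst, Prod.fst_sub, pairAt_smul_left,
      sub_eq_add_neg, pairAt_add_left, pairAt_neg_left]
    rfl
  have p3 := tendsto_exp_sub_exp_div p1 p2
  have p4 := (continuous_exp.tendsto _).comp p1
  simp only [normalLinExp, e.deriv]
  refine (((p3.mul a).add (p4.mul f)).congr fun h => ?_).trans_eq ?_
  · simp only [normalExp_apply, Function.comp]
    ring
  · congr 1
    ring

end exponent_limit

section field_expansions

/-- `sinh z / z`, extended continuously to `0`. -/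
def sinhc : ℂ → ℂ := dslope sinh 0

theorem sinhc_zero : sinhc 0 = 1 := by
  rw [sinhc, dslope_same, (Complex.hasDerivAt_sinh 0).deriv, cosh_zero]

theorem mul_sinhc (z : ℂ) : z * sinhc z = sinh z := by
  simpa [sinhc] using sub_smul_dslope sinh 0 z

theorem differentiable_sinhc : Differentiable ℂ sinhc := by
  rw [← differentiableOn_univ]
  exact (differentiableOn_dslope univ_mem).2 differentiable_sinh.differentiableOn

theorem hasDerivAt_sinhc_zero : HasDerivAt sinhc 0 0 := by
  have h1 : HasDerivAt sinhc (deriv sinhc 0) 0 := (differentiable_sinhc 0).hasDerivAt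
  have h2 : (fun z => sinhc (-z)) = sinhc := by
    funext z
    rcases eq_or_ne z 0 with rfl | hz
    · rw [neg_zero]
    · refine mul_left_cancel₀ (neg_ne_zero.2 hz) ?_
      rw [mul_sinhc, sinh_neg, neg_mul, mul_sinhc]
  have h3 : HasDerivAt (fun z => sinhc (-z)) (deriv sinhc 0 * -1) 0 :=
    HasDerivAt.comp (0 : ℂ) (by rwa [neg_zero]) (hasDerivAt_neg 0)
  rw [h2] at h3
  have h4 := h3.unique h1
  rw [show deriv sinhc 0 = 0 by linear_combination (-1 / 2) * h4] at h1
  exact h1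

theorem tendstoKernel_div_sinh (a x : ℂ) :
    TendstoKernel (fun h s => (1 / (h : ℂ)) * (h / sinh ((h : ℂ) * s / 2) * exp (x * s + a * h * s)
      - 2 / s * exp (x * s))) fun s => 2 * a * exp (x * s) := by
  have h1 : HasDerivAt (fun z => (sinhc (1 / 2 * z))⁻¹ * exp (a * z) - 1) a 0 := by
    have h2 : HasDerivAt (fun z => sinhc (1 / 2 * z)) (0 * (1 / 2 * 1)) 0 :=
      HasDerivAt.comp (0 : ℂ) (by rw [mul_zero]; exact hasDerivAt_sinhc_zero)
        ((hasDerivAt_id (0 : ℂ)).const_mul _)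
    have h3 : HasDerivAt (fun z => exp (a * z)) (exp (a * 0) * (a * 1)) 0 :=
      ((hasDerivAt_id (0 : ℂ)).const_mul a).cexp
    simpa [sinhc_zero] using ((h2.inv (by simp [sinhc_zero])).mul h3).sub_const 1
  have hne : ∀ h s : ℝ, 0 < h → 0 < s → sinhc (1 / 2 * (1 * h * s)) ≠ 0 := by
    intro h s hh hs h0
    refine sinh_half_ne_zero hh hs ?_
    rw [← mul_sinhc, show (h : ℂ) * s / 2 = 1 / 2 * (1 * h * s) by ring, h0, mul_zero]
  have h2 := tendstoKernel_div h1 (by simp [sinhc_zero]) 1 fun h hh => by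
    refine ((ContinuousOn.inv₀ ?_ fun s hs => hne h s hh hs).mul (by fun_prop)).sub continuousOn_const
    exact (differentiable_sinhc.continuous.comp (by fun_prop)).continuousOn
  have h3 : TendstoKernel (fun _ s => 2 / (s : ℂ) * exp (x * s)) fun s => 2 / (s : ℂ) * exp (x * s) :=
    .const (ContinuousOn.mul (continuousOn_const.div (by fun_prop) fun s hs => by
      exact_mod_cast (ne_of_gt hs)) (by fun_prop))
  refine (h3.mul h2).congr (fun h s hh hs => ?_) fun s hs => ?_
  · have h5 : (h : ℂ) ≠ 0 := by exact_mod_cast hh.ne'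
    have h6 : (s : ℂ) ≠ 0 := by exact_mod_cast hs.ne'
    have h7 := hne h s hh hs
    rw [← mul_sinhc, show (h : ℂ) * s / 2 = 1 / 2 * (1 * h * s) by ring, exp_add,
      show a * (1 * (h : ℂ) * s) = a * h * s by ring]
    field_simp
  · have h6 : (s : ℂ) ≠ 0 := by exact_mod_cast hs.ne'
    field_simp

/-- The creation part of `λ̂_μ(u)`. -/
def lamCre (μ : ℕ) (u : ℂ) : Exponent := (onLam μ fun s => exp (I * u * s), 0)

/-- The annihilation part of `λ̂_μ(u)`. -/
def lamAnn (μ : ℕ) (u : ℂ) : Exponent := (0, onLam μ fun s => exp (-I * u * s))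

/-- The creation part of `b̂_{μν}(u)`. -/
def bCre (μ ν : ℕ) (u : ℂ) : Exponent := (onB μ ν fun s => exp (I * u * s), 0)

/-- The annihilation part of `b̂_{μν}(u)`. -/
def bAnn (μ ν : ℕ) (u : ℂ) : Exponent := (0, onB μ ν fun s => exp (-I * u * s))

theorem lamCl_eq (μ : ℕ) (u : ℂ) : lamCl μ u = lamCre μ u + lamAnn μ u := by
  simp [lamCl, lamCre, lamAnn]

theorem bCl_eq (μ ν : ℕ) (u : ℂ) : bCl μ ν u = bCre μ ν u + bAnn μ ν u := by
  simp [bCl, bCre, bAnn]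

variable {f : ℝ → ℝ → ℂ} {g : ℝ → ℂ}

theorem tendstoKernel_ite {p : Prop} [Decidable p] (hf : TendstoKernel f g) :
    TendstoKernel (fun h => if p then f h else 0) (if p then g else 0) := by
  split_ifs
  exacts [hf, .zero]

theorem tendstoProfile_zero : TendstoProfile (fun _ => 0) 0 := fun _ => .zero

theorem TendstoKernel.onLam (hf : TendstoKernel f g) (μ : ℕ) :
    TendstoProfile (fun h => onLam μ (f h)) (onLam μ g) := by
  rintro (_ | _ | _)
  exacts [tendstoKernel_ite hf, .zero, .zero]

theorem TendstoKernel.onB (hf : TendstoKernel f g) (μ ν : ℕ) :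
    TendstoProfile (fun h => onB μ ν (f h)) (onB μ ν g) := by
  rintro (_ | _ | _)
  exacts [.zero, tendstoKernel_ite hf, .zero]

theorem TendstoKernel.onC (hf : TendstoKernel f g) (μ ν : ℕ) :
    TendstoProfile (fun h => onC μ ν (f h)) (onC μ ν g) := by
  rintro (_ | _ | _)
  exacts [.zero, .zero, tendstoKernel_ite hf]

/-- Spectral parameters `x h = u + a i h`. -/
def IsAffine (x : ℝ → ℂ) (u a : ℂ) : Prop := ∀ h : ℝ, x h = u + a * (I * h)

variable {x : ℝ → ℂ} {u a : ℂ}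

theorem hasExpansion_of_tendsto {Z : ℝ → Exponent} {J : Exponent}
    (h1 : TendstoProfile (fun h => (1 / (h : ℂ)) • (Z h).1) J.1)
    (h2 : TendstoProfile (fun h => (1 / (h : ℂ)) • (Z h).2) J.2) : HasExpansion Z 0 J :=
  ⟨HasExpansion.zero.1, by simpa only [sub_zero] using ⟨h1, h2⟩⟩

theorem tendstoKernel_exp (hx : IsAffine x u a) (c e : ℂ) :
    TendstoKernel (fun h s => (1 / (h : ℂ)) * (c * h * exp (e * x h * s))) fun s => c * exp (e * u * s) := by
  have h1 : TendstoKernel (fun _ s => c * exp (e * u * s)) fun s => c * exp (e * u * s) :=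
    .const (by fun_prop)
  refine (h1.mul (tendstoKernel_comp continuous_exp (e * a * I))).congr (fun h s hh _ => ?_)
    fun s _ => by rw [exp_zero, mul_one]
  have h5 : (h : ℂ) ≠ 0 := by exact_mod_cast hh.ne'
  rw [hx, show e * (u + a * (I * h)) * s = e * u * s + e * a * I * h * s by ring, exp_add]
  field_simp

theorem IsAffine.const (u : ℂ) : IsAffine (fun _ => u) u 0 := fun h => by ring

theorem IsAffine.add (hx : IsAffine x u a) (b : ℂ) : IsAffine (fun h => x h + b * (I * h)) u (a + b) :=
  fun h => by linear_combination hx h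

theorem IsAffine.sub (hx : IsAffine x u a) (b : ℂ) : IsAffine (fun h => x h - b * (I * h)) u (a - b) :=
  fun h => by linear_combination hx h

theorem hasExpansion_lamP (hx : IsAffine x u a) (μ : ℕ) :
    HasExpansion (fun h => lamP h μ (x h)) 0 ((2 : ℂ) • lamAnn μ u) := by
  refine hasExpansion_of_tendsto (by simpa [lamP, lamAnn] using tendstoProfile_zero) fun m => ?_
  exact ((tendstoKernel_exp hx 2 (-I)).onLam μ m).congr (fun h s _ _ => (onLam_scale rfl m).symm)
    fun s _ => (onLam_scale rfl m).symm

theorem hasExpansion_lamM (hx : IsAffine x u a) (μ : ℕ) :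
    HasExpansion (fun h => lamM h μ (x h)) 0 ((-2 : ℂ) • lamCre μ u) := by
  refine hasExpansion_of_tendsto (fun m => ?_) (by simpa [lamM, lamCre] using tendstoProfile_zero)
  exact ((tendstoKernel_exp hx (-2) I).onLam μ m).congr (fun h s _ _ => (onLam_scale (by ring) m).symm)
    fun s _ => (onLam_scale rfl m).symm

theorem hasExpansion_bP (hx : IsAffine x u a) (μ ν : ℕ) :
    HasExpansion (fun h => bP h μ ν (x h)) 0 ((2 : ℂ) • bAnn μ ν u) := by
  refine hasExpansion_of_tendsto (by simpa [bP, bAnn] using tendstoProfile_zero) fun m => ?_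
  exact ((tendstoKernel_exp hx 2 (-I)).onB μ ν m).congr (fun h s _ _ => (onB_scale rfl m).symm)
    fun s _ => (onB_scale rfl m).symm

theorem hasExpansion_bM (hx : IsAffine x u a) (μ ν : ℕ) :
    HasExpansion (fun h => bM h μ ν (x h)) 0 ((-2 : ℂ) • bCre μ ν u) := by
  refine hasExpansion_of_tendsto (fun m => ?_) (by simpa [bM, bCre] using tendstoProfile_zero)
  exact ((tendstoKernel_exp hx (-2) I).onB μ ν m).congr (fun h s _ _ => (onB_scale (by ring) m).symm)
    fun s _ => (onB_scale rfl m).symm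

theorem onB_add_onC_sub {μ ν : ℕ} {f f' g : ℝ → ℂ} {e : ℂ} {s : ℝ} (hf : g s = e * (f s - f' s)) (m : Mode) :
    e * ((onB μ ν f + onC μ ν f) m s - (onB μ ν f' + onC μ ν f') m s) = onB μ ν g m s + onC μ ν g m s := by
  rcases m with _ | _ | _ <;> simp only [onB, onC, Pi.add_apply, Pi.zero_apply] <;> (try split_ifs) <;>
    simp [hf]

theorem hasExpansion_bc (hx : IsAffine x u a) (μ ν : ℕ) :
    HasExpansion (fun h => bc h μ ν (x h)) (chiCl μ ν u) ((-2 * a) • (bCl μ ν u + cCl μ ν u)) := by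
  have h1 : ∀ x : ℂ, TendstoKernel (fun _ s => 2 / (s : ℂ) * exp (x * s)) fun s => 2 / (s : ℂ) * exp (x * s) :=
    fun x => .const (ContinuousOn.mul (continuousOn_const.div (by fun_prop) fun s hs => by
      exact_mod_cast (ne_of_gt hs)) (by fun_prop))
  refine ⟨⟨fun m => ((h1 (I * u)).onB μ ν m).add ((h1 (I * u)).onC μ ν m),
    fun m => ((h1 (-I * u)).neg.onB μ ν m).add ((h1 (-I * u)).neg.onC μ ν m)⟩, fun m => ?_, fun m => ?_⟩
  · have h2 := tendstoKernel_div_sinh (-a) (I * u)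
    refine ((h2.onB μ ν m).add (h2.onC μ ν m)).congr (fun h s _ _ => onB_add_onC_sub ?_ m) fun s _ => ?_
    · rw [hx, show I * (u + a * (I * h)) * s = I * u * s + -a * h * s by linear_combination (a * h * s) * I_sq]
    · rcases m with _ | _ | _ <;> simp [bCl, cCl, onB, onC] <;> (try split_ifs) <;> simp
  · have h2 := (tendstoKernel_div_sinh a (-I * u)).neg
    refine ((h2.onB μ ν m).add (h2.onC μ ν m)).congr (fun h s _ _ => onB_add_onC_sub ?_ m) fun s _ => ?_
    · rw [hx, show -I * (u + a * (I * h)) * s = -I * u * s + a * h * s by linear_combination -(a * h * s) * I_sq]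
      ring
    · rcases m with _ | _ | _ <;> simp [bCl, cCl, onB, onC] <;> (try split_ifs) <;> simp

end field_expansions

section wakimoto_limit

variable {N : ℕ} {k : ℂ} {Φ : State} {ξ : Profile} {x : ℝ → ℂ} {u a : ℂ}

theorem tendsto_kPlus_sub_kMinus (hN : 0 < N) (hΦ : Φ ∈ fockSpace N) (hξ : ∀ m, IsSmearing (ξ m)) {μ : ℕ}
    (hμ : 1 ≤ μ) (hμN : μ ≤ N) :
    Tendsto (fun h : ℝ => (1 / (h : ℂ)) * (kPlus N h k μ u Φ (twist h ξ)
      - kMinus N h k μ u Φ (twist h ξ))) (𝓝[>] 0) (𝓝 (wakimotoK N k μ u Φ ξ)) := by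
  have hu := IsAffine.const u
  simp only [kPlus, kMinus, wakimotoK]
  refine HasExpansion.tendsto_normalExp hN hΦ hξ
    (((hasExpansion_lamP (hu.add _) μ).neg.add (.sum _ fun α => hasExpansion_bP (hu.add _) α μ)).sub
      (.sum _ fun β => hasExpansion_bP (hu.add _) μ β))
    (((hasExpansion_lamM (hu.sub _) μ).neg.add (.sum _ fun ρ => .sum _ fun γ =>
      hasExpansion_bM (hu.add _) ρ γ)).sub (.sum _ fun α => .sum _ fun β =>
      hasExpansion_bM (hu.add _) α β)) (by simp) (by simp) ?_
  simp only [lamCl_eq, bCl_eq, ← Finset.smul_sum, Finset.sum_add_distrib]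
  rw [Finset.sum_congr rfl fun ρ _ => (Finset.add_sum_Ioc_eq_sum_Icc (f := fun γ => bCre ρ γ u) hμN).symm,
    Finset.sum_add_distrib, ← Finset.sum_Ico_add_eq_sum_Icc (f := fun α =>
      ∑ β ∈ Finset.Icc (μ + 1) N, bCre α β u) hμ]
  have e : Finset.Ioc μ N = Finset.Icc (μ + 1) N := by
    ext j
    simp only [Finset.mem_Ioc, Finset.mem_Icc]
    omega
  rw [e]
  module

theorem tendsto_HPlus_sub_HMinus (hN : 0 < N) (hΦ : Φ ∈ fockSpace N) (hξ : ∀ m, IsSmearing (ξ m)) (μ : ℕ) :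
    Tendsto (fun h : ℝ => (1 / (h : ℂ)) * (HPlus N h k μ u Φ (twist h ξ)
      - HMinus N h k μ u Φ (twist h ξ))) (𝓝[>] 0) (𝓝 (wakimotoH N k μ u Φ ξ)) := by
  have hu := IsAffine.const u
  simp only [HPlus, HMinus, wakimotoH]
  refine HasExpansion.tendsto_normalExp hN hΦ hξ
    ((((hasExpansion_lamP ((hu.add _).sub _) μ).sub (hasExpansion_lamP ((hu.add _).sub _) (μ + 1))).add
      (.sum _ fun m => (hasExpansion_bP (hu.sub _) m (μ + 1)).sub (hasExpansion_bP (hu.sub _) m μ))).add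
      (.sum _ fun n => (hasExpansion_bP (hu.sub _) μ n).sub (hasExpansion_bP (hu.sub _) (μ + 1) n)))
    ((((hasExpansion_lamM ((hu.sub _).sub _) μ).sub (hasExpansion_lamM ((hu.sub _).sub _) (μ + 1))).add
      (.sum _ fun m => (hasExpansion_bM (hu.add _) m (μ + 1)).sub (hasExpansion_bM (hu.add _) m μ))).add
      (.sum _ fun n => (hasExpansion_bM (hu.add _) μ n).sub (hasExpansion_bM (hu.add _) (μ + 1) n)))
    (by simp) (by simp) ?_
  simp only [lamCl_eq, bCl_eq, ← Finset.smul_sum, Finset.sum_add_distrib, Finset.sum_sub_distrib]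
  module

theorem tendsto_eCore (hN : 0 < N) (hΦ : Φ ∈ fockSpace N) (hξ : ∀ m, IsSmearing (ξ m))
    (hx : IsAffine x u a) (μ : ℕ) :
    Tendsto (fun h : ℝ => (1 / (h : ℂ)) * eCore N h k μ (x h) Φ (twist h ξ)) (𝓝[>] 0)
      (𝓝 (wakimotoE N k μ u Φ ξ)) := by
  simp only [eCore, wakimotoE, LinearMap.sum_apply, LinearMap.sub_apply, Finset.sum_apply, Pi.sub_apply,
    Finset.mul_sum]
  refine tendsto_finsetSum _ fun m _ => ?_
  have hb := (hasExpansion_bc (hx.sub (((m : ℂ) - 1) / 2)) m μ).add (.sum (Finset.Ico 1 m) fun n =>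
    (hasExpansion_bP (hx.sub (((n : ℂ) - 1) / 2)) n (μ + 1)).sub
      (hasExpansion_bP (hx.sub ((n : ℂ) / 2)) n μ))
  refine HasExpansion.tendsto_normalExp hN hΦ hξ
    ((hb.add (hasExpansion_bP (hx.sub _) m (μ + 1))).sub (hasExpansion_bc (hx.sub _) m (μ + 1)))
    ((hb.add (hasExpansion_bM (hx.sub _) m (μ + 1))).sub (hasExpansion_bc (hx.sub _) m (μ + 1)))
    (by simp) (by simp) ?_
  rw [bCl_eq m (μ + 1)]
  module

theorem tendsto_fCore (hN : 0 < N) (hΦ : Φ ∈ fockSpace N) (hξ : ∀ m, IsSmearing (ξ m))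
    (hx : IsAffine x u a) {μ : ℕ} (hμ : 1 ≤ μ) (hμN : μ < N) :
    Tendsto (fun h : ℝ => (1 / (h : ℂ)) * fCore N h k μ (x h) Φ (twist h ξ)) (𝓝[>] 0)
      (𝓝 (wakimotoF N k μ u Φ ξ)) := by
  have hL := fun m : ℕ => ((((hasExpansion_bc (hx.add ((m : ℂ) / 2)) m (μ + 1)).add
    (hasExpansion_lamM ((hx.sub ((k - N) / 4)).sub ((μ : ℂ) / 2)) μ)).sub
    (hasExpansion_lamM ((hx.sub ((k - N) / 4)).sub ((μ : ℂ) / 2)) (μ + 1))).add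
    (.sum (Finset.Icc (m + 1) μ) fun n => (hasExpansion_bM (hx.add (((n : ℂ) - 1) / 2)) n (μ + 1)).sub
      (hasExpansion_bM (hx.add ((n : ℂ) / 2)) n μ))).add
    (.sum (Finset.Icc (μ + 1) N) fun s => (hasExpansion_bM (hx.add ((s : ℂ) / 2)) μ s).sub
      (hasExpansion_bM (hx.add (((s : ℂ) - 1) / 2)) (μ + 1) s))
  have hR := fun m : ℕ => (((hasExpansion_bc (hx.sub ((2 * k + m - 1) / 2)) μ m).add
    (hasExpansion_lamP ((hx.sub ((3 * k + N) / 4)).sub ((μ : ℂ) / 2)) μ)).sub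
    (hasExpansion_lamP ((hx.sub ((3 * k + N) / 4)).sub ((μ : ℂ) / 2)) (μ + 1))).add
    (.sum (Finset.Icc m N) fun n => (hasExpansion_bP (hx.sub ((2 * k + n) / 2)) μ n).sub
      (hasExpansion_bP (hx.sub ((2 * k + n - 1) / 2)) (μ + 1) n))
  have t1 : ∀ m, _ := fun m : ℕ => HasExpansion.tendsto_normalExp (k := k) (M := chiCl m (μ + 1) u - chiCl m μ u)
    (K := (-2 : ℂ) • cCl m μ u) hN hΦ hξ
    (((hL m).sub (hasExpansion_bM (hx.add ((m : ℂ) / 2)) m μ)).sub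
      (hasExpansion_bc (hx.add (((m : ℂ) - 1) / 2)) m μ))
    (((hL m).sub (hasExpansion_bP (hx.add ((m : ℂ) / 2)) m μ)).sub
      (hasExpansion_bc (hx.add (((m : ℂ) + 1) / 2)) m μ)) (by simp) (by simp) (by rw [bCl_eq m μ]; module)
  have t2 : ∀ m, _ := fun m : ℕ => HasExpansion.tendsto_normalExp (k := k) (M := chiCl μ m u - chiCl (μ + 1) m u)
    (K := (-2 : ℂ) • cCl (μ + 1) m u) hN hΦ hξ
    (((hR m).add (hasExpansion_bP (hx.sub ((2 * k + m - 1) / 2)) (μ + 1) m)).sub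
      (hasExpansion_bc (hx.sub ((2 * k + m) / 2)) (μ + 1) m))
    (((hR m).add (hasExpansion_bM (hx.sub ((2 * k + m - 1) / 2)) (μ + 1) m)).sub
      (hasExpansion_bc (hx.sub ((2 * k + m - 2) / 2)) (μ + 1) m)) (by simp) (by simp)
      (by rw [bCl_eq (μ + 1) m]; module)
  have t3 := HasExpansion.tendsto_normalExp (k := k) (M := chiCl μ (μ + 1) u)
    (K := ((-2 * (k + μ)) • (bCl μ (μ + 1) u + cCl μ (μ + 1) u)
        - (2 : ℂ) • (lamCl μ u - lamCl (μ + 1) u)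
        - (2 : ℂ) • ∑ n ∈ Finset.Icc (μ + 1) N, (bCl μ n u - bCl (μ + 1) n u))) hN hΦ hξ
    (hL μ) (hR (μ + 1)) (by simp) (by simp) (by
      rw [Finset.Icc_eq_empty (by omega : ¬μ + 1 ≤ μ)]
      simp only [lamCl_eq, bCl_eq _ _ u, ← Finset.smul_sum, Finset.sum_add_distrib, Finset.sum_sub_distrib,
        Finset.sum_empty]
      push_cast
      module)
  have t4 := ((tendsto_finsetSum (Finset.Ico 1 μ) fun m _ => t1 m).add t3).sub
    (tendsto_finsetSum (Finset.Icc (μ + 2) N) fun m _ => t2 m)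
  simp only [wakimotoF, gammaBeta, Pi.add_apply, Pi.sub_apply, Finset.sum_apply]
  refine t4.congr fun h => ?_
  have s1 : ∀ A B : ℕ → Op, ∑ m ∈ Finset.Icc 1 μ, ((1 + if m = μ then (1 : ℂ) else 0) • A m - B m)
      = ∑ m ∈ Finset.Ico 1 μ, (A m - B m) + ((2 : ℂ) • A μ - B μ) := by
    intro A B
    rw [← Finset.sum_Ico_add_eq_sum_Icc hμ, if_pos rfl, one_add_one_eq_two]
    congr 1
    refine Finset.sum_congr rfl fun m hm => ?_
    rw [if_neg (Finset.mem_Ico.1 hm).2.ne, add_zero, one_smul]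
  have s2 : ∀ A B : ℕ → Op,
      ∑ m ∈ Finset.Icc (μ + 1) N, ((1 + if m = μ + 1 then (1 : ℂ) else 0) • A m - B m)
      = ((2 : ℂ) • A (μ + 1) - B (μ + 1)) + ∑ m ∈ Finset.Icc (μ + 2) N, (A m - B m) := by
    intro A B
    have e : Finset.Icc (μ + 1) N = insert (μ + 1) (Finset.Icc (μ + 2) N) := by
      ext j
      simp only [Finset.mem_insert, Finset.mem_Icc]
      omega
    rw [e, Finset.sum_insert (by simp), if_pos rfl, one_add_one_eq_two]
    congr 1
    refine Finset.sum_congr rfl fun m hm => ?_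
    rw [Finset.mem_Icc] at hm
    rw [if_neg (by omega), add_zero, one_smul]
  simp only [fCore]
  rw [s1, s2]
  simp only [bP_self, bM_self, bc_self, sub_zero, add_zero, if_true, LinearMap.sub_apply,
    LinearMap.add_apply, LinearMap.sum_apply, LinearMap.smul_apply, Pi.sub_apply, Pi.add_apply,
    Finset.sum_apply, Pi.smul_apply, smul_eq_mul, ← Finset.mul_sum, Nat.cast_add, Nat.cast_one]
  ring

end wakimoto_limit

end BosonYangian

end

theorem proposition2 (N : ℕ) (hN : 2 ≤ N) (k : ℂ) :
    (∀ h : ℝ, 0 < h →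
      BosonYangian.IsYangianDoubleGL N (-Complex.I * h) k
        (BosonYangian.fockSpace N) (BosonYangian.fockDual N h)
        (BosonYangian.kPlus N h k) (BosonYangian.kMinus N h k)
        (fun ν u => (1 / (-Complex.I * h)) • BosonYangian.XPlus N h k ν u)
        (BosonYangian.XMinus N h k) ∧
      BosonYangian.IsYangianDoubleSL N (-Complex.I * h) k
        (BosonYangian.fockSpace N) (BosonYangian.fockDual N h)
        (BosonYangian.HPlus N h k) (BosonYangian.HMinus N h k)
        (fun μ u => Complex.I • BosonYangian.ECur N h k μ u)
        (fun μ u => Complex.I • BosonYangian.FCur N h k μ u)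
        (BosonYangian.quantumDet N (-Complex.I * h) (BosonYangian.kPlus N h k))
        (BosonYangian.quantumDet N (-Complex.I * h) (BosonYangian.kMinus N h k))) ∧
    (∀ Φ ∈ BosonYangian.fockSpace N, ∀ ξ ∈ BosonYangian.fockDual N 0, ∀ u : ℂ,
      (∀ μ : ℕ, 1 ≤ μ → μ ≤ N →
        Tendsto (fun h : ℝ => (1 / (h : ℂ)) *
            (BosonYangian.kPlus N h k μ u Φ (BosonYangian.twist h ξ)
              - BosonYangian.kMinus N h k μ u Φ (BosonYangian.twist h ξ)))
          (𝓝[>] 0) (𝓝 (BosonYangian.wakimotoK N k μ u Φ ξ))) ∧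
      (∀ μ : ℕ, 1 ≤ μ → μ < N →
        Tendsto (fun h : ℝ => (1 / (h : ℂ)) *
            BosonYangian.XPlus N h k μ u Φ (BosonYangian.twist h ξ))
          (𝓝[>] 0) (𝓝 (BosonYangian.wakimotoE N k μ u Φ ξ)) ∧
        Tendsto (fun h : ℝ => (1 / (h : ℂ)) *
            BosonYangian.XMinus N h k μ u Φ (BosonYangian.twist h ξ))
          (𝓝[>] 0) (𝓝 (BosonYangian.wakimotoF N k μ u Φ ξ)) ∧
        Tendsto (fun h : ℝ => (1 / (h : ℂ)) *
            (BosonYangian.HPlus N h k μ u Φ (BosonYangian.twist h ξ)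
              - BosonYangian.HMinus N h k μ u Φ (BosonYangian.twist h ξ)))
          (𝓝[>] 0) (𝓝 (BosonYangian.wakimotoH N k μ u Φ ξ)) ∧
        Tendsto (fun h : ℝ => BosonYangian.ECur N h k μ u Φ (BosonYangian.twist h ξ))
          (𝓝[>] 0) (𝓝 (BosonYangian.wakimotoE N k μ u Φ ξ)) ∧
        Tendsto (fun h : ℝ => BosonYangian.FCur N h k μ u Φ (BosonYangian.twist h ξ))
          (𝓝[>] 0) (𝓝 (BosonYangian.wakimotoF N k μ u Φ ξ)))) := by
  have hN0 : 0 < N := by omega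
  refine ⟨fun h hh => ⟨?_, ?_⟩, fun Φ hΦ ξ hξ u => ?_⟩
  · exact BosonYangian.isYangianDoubleGL hN hh fun μ ν hμ hμN hν hνN =>
      BosonYangian.exchangeMero_kPlus_kMinus hN hh hμ hμN hν hνN
  · exact BosonYangian.isYangianDoubleSL hN hh (BosonYangian.exchange_quantumDet_quantumDet hN0 hh)
      fun K hK μ hμ hμN => BosonYangian.quantumDet_central hN0 hh hK hμ hμN
  · have hu := BosonYangian.IsAffine.const u
    refine ⟨fun μ hμ hμN => BosonYangian.tendsto_kPlus_sub_kMinus hN0 hΦ hξ.1 hμ hμN,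
      fun μ hμ hμN => ⟨?_, ?_, BosonYangian.tendsto_HPlus_sub_HMinus hN0 hΦ hξ.1 μ, ?_, ?_⟩⟩
    · exact BosonYangian.tendsto_eCore hN0 hΦ hξ.1 (hu.add _) μ
    · exact BosonYangian.tendsto_fCore hN0 hΦ hξ.1 (hu.add _) hμ hμN
    · exact BosonYangian.tendsto_eCore hN0 hΦ hξ.1 hu μ
    · exact BosonYangian.tendsto_fCore hN0 hΦ hξ.1 hu hμ hμN
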